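/- **Theorem 4.3 (Upper Bound on Condition Number).** *Surface.* Let $\Omega$ be a connected closed surface immersed in $\mathbb{R}^d$, given by finitely many patches $\Omega_i$, $i\in\mathcal I_\Omega$. Each patch is $\Omega_i=F_i(\widehat\Omega_i)$, where $\widehat\Omega_i\subset[0,1]^2$ is open and connected and $F_i$ is a smooth injective immersion of the closure of $\widehat\Omega_i$ into $\mathbb{R}^d$, smooth up to the boundary. The boundary of $\widehat\Omega_i$ consists of finitely many disjoint simple closed curves, each composed of finitely many smooth regular arcs, and $\widehat\Omega_i$ lies on exactly one side of each arc. Each arc is identified with exactly one other such arc, the two having the same image in $\mathbb{R}^d$ under the patch maps; these common images are the interface curves $\Gamma_{ij}$, with $(i,j)\in\mathcal I_\Gamma$ (a pair of patches may share several curves). Any two patches are linked by a chain of patches in which consecutive ones share an interface curve. Let $G_i=DF_i^TDF_i$ be the metric tensor. Integrals, gradients and the exterior unit conormal $n_i\in T(\Omega_i)$ on $\partial\Omega_i$ are those of this metric. Write $[\![v]\!]=v_i-v_j$ and $\{n\cdot\nabla v\}=\tfrac12(n_i\cdot\nabla v_i-n_j\cdot\nabla v_j)$ on $\Gamma_{ij}$,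 with traces taken from inside the respective patches. *Meshes and spaces.* For $h>0$ and origins $o_i\in\mathbb{R}^2$, let $\widehat{\mathcal K}_{h,i}$ be the set of closed squares of the uniform grid with vertices $o_i+h\mathbb{Z}^2$ that meet $\widehat\Omega_i$ (the active elements; $o_i=0$, $h=1/n$ is the uniform mesh of the unit square). Fix $p\ge1$. Let $\widehat V_{h,i}$ be the space of restrictions to the active elements of continuous functions that are tensor product polynomials of degree at most $p$ in each variable on every square of the grid, and $V_h=\bigoplus_i\widehat V_{h,i}\circ F_i^{-1}$, with standard nodal Lagrange basis $\varphi_1,\dots,\varphi_N$ (one function for each patch and each Lagrange node of an active element of that patch). Let $\widehat{\mathcal F}_{h,i}$ be the set of faces shared by two active elements at least one of which meets $\partial\widehat\Omega_i$. *Method.* For $\beta>0$ and $\gamma_1,\dots,\gamma_p>0$ let $$A_h(v,w)=\sum_{i}(\nabla v,\nabla w)_{\Omega_i}-\sum_{(i,j)\in\mathcal I_\Gamma}\Big((\{n\cdot\nabla v\},[\![w]\!])_{\Gamma_{ij}}+([\![v]\!],\{n\cdot\nabla w\})_{\Gamma_{ij}}\Big)+\sum_{(i,j)\in\mathcal I_\Gamma}\beta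 h^{-1}([\![v]\!],[\![w]\!])_{\Gamma_{ij}}+\sum_i\sum_{k=1}^p\gamma_kh^{2k-1}([\![\widehat D_n^k\widehat v]\!],[\![\widehat D_n^k\widehat w]\!])_{\widehat{\mathcal F}_{h,i}},$$ where $\widehat D_n^k$ is the $k$-th derivative in the direction of the face normal in the reference plane. The stiffness matrix is $\mathcal A_{mn}=A_h(\varphi_n,\varphi_m)$. Let $\widetilde{\mathbb{R}}^N=\{V\in\mathbb{R}^N:\int_\Omega\sum_nV_n\varphi_n=0\}$ be the space of coefficient vectors of mean-zero functions. *Patch geometry condition.* For an integer $l\ge0$ and $c>0$, a choice of $(h,(o_i)_i)$ satisfies the condition $(l,c)$ if, for every $i$ and every active element $\widehat K\in\widehat{\mathcal K}_{h,i}$ that meets $\partial\widehat\Omega_i$, there is a grid square $\widehat K'$ at distance at most $l$ from $\widehat K$ (that is, obtained from it by a shift of at most $l$ squares in each coordinate direction) with $|\widehat K'\cap\widehat\Omega_i|\ge c\,h^2$. *Claim.* Fix the surface with its patches, $p$, $(\gamma_k)$, $l$ and $c$. There are $\beta_0>0$ and $h_0>0$ such that for every $\beta\ge\beta_0$ there is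 a constant $C>0$ with the following property: for all $h\in(0,h_0]$ and all origins $(o_i)_i$ such that $(h,(o_i)_i)$ satisfies the patch geometry condition $(l,c)$, the restriction of $\mathcal A$ to $\widetilde{\mathbb{R}}^N$ is injective, and $$\kappa(\mathcal A)=|\mathcal A|\,|\mathcal A^{-1}|\le C\,h^{-2}.$$ Here $|\mathcal A|$ is the Euclidean operator norm of $\mathcal A:\widetilde{\mathbb{R}}^N\to\mathcal A\widetilde{\mathbb{R}}^N$, and $|\mathcal A^{-1}|$ that of its inverse. In particular, $C$ does not depend on $h$ or on how the trim curves cut the mesh, except through $l$ and $c$. -/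

import Mathlib

open scoped ContDiff

/-- A closed (boundaryless) connected patchwise parametric surface immersed in `ℝᵈ`.

The reference plane is written `Fin 2 → ℝ`; only its topology, its Lebesgue measure and its
coordinates are used, never its sup norm.  `ι` indexes the patches and `ε` the interface curves.
Each interface curve `e` has two sides `(e, false)` and `(e, true)`, and each side is a smooth
regular curve in the boundary of a reference patch.  Since every piece of patch boundary is a side
of exactly one interface curve, the surface has no boundary; as only abutting sides are identified,
the surface may intersect itself in `ℝᵈ` and need not be orientable. -/
structure MultipatchSurface (ι ε : Type*) (d : ℕ) where
  /-- the trimmed reference patches -/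
  dom : ι → Set (Fin 2 → ℝ)
  dom_open : ∀ i, IsOpen (dom i)
  dom_connected : ∀ i, IsConnected (dom i)
  dom_subset : ∀ i, dom i ⊆ Set.Icc 0 1
  /-- The patch maps; their values away from the closed reference patches are irrelevant. -/
  F : ι → (Fin 2 → ℝ) → EuclideanSpace ℝ (Fin d)
  F_smooth : ∀ i, ContDiff ℝ ∞ (F i)
  F_inj : ∀ i, Set.InjOn (F i) (closure (dom i))
  F_immersion : ∀ i, ∀ x ∈ closure (dom i), Function.Injective (fderiv ℝ (F i) x)
  /-- the patch on which a side lies -/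
  patch : ε × Bool → ι
  /-- the trim curves, parametrized over `[0, 1]` -/
  curve : ε × Bool → ℝ → Fin 2 → ℝ
  curve_smooth : ∀ s, ContDiff ℝ ∞ (curve s)
  curve_regular : ∀ s, ∀ t ∈ Set.Icc (0 : ℝ) 1, deriv (curve s) t ≠ 0
  frontier_eq : ∀ i, frontier (dom i) = ⋃ s ∈ {s | patch s = i}, curve s '' Set.Icc 0 1
  /-- The sides of each patch are joined end to end by `next` into finitely many closed curves. -/
  next : Equiv.Perm (ε × Bool)
  next_patch : ∀ s, patch (next s) = patch s
  next_start : ∀ s, curve (next s) 0 = curve s 1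
  /-- The closed curves are simple and pairwise disjoint. -/
  curve_inj : ∀ s s' t t', patch s = patch s' → t ∈ Set.Ico (0 : ℝ) 1 → t' ∈ Set.Ico (0 : ℝ) 1 →
    curve s t = curve s' t' → s = s' ∧ t = t'
  /-- The reference patch lies to the left of its boundary curves, and only there. -/
  curve_left : ∀ s, ∀ t ∈ Set.Ioo (0 : ℝ) 1, ∃ δ > 0, ∀ r ∈ Set.Ioo (0 : ℝ) δ,
    curve s t + r • ![-(deriv (curve s) t 1), deriv (curve s) t 0] ∈ dom (patch s) ∧
    curve s t - r • ![-(deriv (curve s) t 1), deriv (curve s) t 0] ∉ dom (patch s)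
  /-- whether the two sides of an interface are traversed in opposite directions -/
  reversed : ε → Bool
  /-- The two sides of an interface are mapped onto the same curve in space. -/
  glue : ∀ e, ∀ t ∈ Set.Icc (0 : ℝ) 1,
    F (patch (e, false)) (curve (e, false) t) =
      F (patch (e, true)) (curve (e, true) (if reversed e then 1 - t else t))
  /-- The surface is connected: any two patches are linked by a chain of patches
  in which consecutive ones share an interface curve. -/
  connected : ∀ i j, Relation.ReflTransGen
    (fun a b => ∃ e r, patch (e, r) = a ∧ patch (e, !r) = b) i j

/-- A broken polynomial on the surface: for each patch and each element (an element is given by its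
position in the grid of the patch) a polynomial in the reference coordinates. -/
abbrev BrokenPoly (ι : Type*) := ι → (Fin 2 → ℤ) → MvPolynomial (Fin 2) ℝ

/-- The closed element at position `K` of the uniform grid of mesh size `h` and origin `o`. -/
def gridElement (h : ℝ) (o : Fin 2 → ℝ) (K : Fin 2 → ℤ) : Set (Fin 2 → ℝ) :=
  Set.Icc (fun k => o k + h * K k) (fun k => o k + h * (K k + 1))

/-- The position of the element that contains `x + r • u` for all small `r > 0`
(if `u k = 0`, the element to the upper side is taken in the coordinate `k`). -/
noncomputable def elementTowards (h : ℝ) (o u x : Fin 2 → ℝ) : Fin 2 → ℤ :=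
  fun k => if u k < 0 then ⌈(x k - o k) / h⌉ - 1 else ⌊(x k - o k) / h⌋

/-- The tensor product Lagrange basis polynomial of order `p` on the element `K` that belongs to the
node `o + (h / p) • m`; it is zero if that node is not a node of `K`. -/
noncomputable def localLagrange (p : ℕ) (h : ℝ) (o : Fin 2 → ℝ) (m K : Fin 2 → ℤ) :
    MvPolynomial (Fin 2) ℝ :=
  if ∀ k, (p : ℤ) * K k ≤ m k ∧ m k ≤ p * (K k + 1) then
    ∏ k, Polynomial.aeval
      (MvPolynomial.C h⁻¹ * (MvPolynomial.X k - MvPolynomial.C (o k)) - MvPolynomial.C (K k : ℝ))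
      (Lagrange.basis (Finset.range (p + 1)) (fun j : ℕ => (j : ℝ) / p) (m k - p * K k).toNat)
  else 0

namespace MultipatchSurface

variable {ι ε : Type*} {d : ℕ} (S : MultipatchSurface ι ε d)

/-! ### Riemannian structure in reference coordinates -/

/-- The metric tensor, with entries `∂ₖF · ∂ₗF`. -/
noncomputable def metric (i : ι) (x : Fin 2 → ℝ) : Matrix (Fin 2) (Fin 2) ℝ :=
  Matrix.of fun k l =>
    inner ℝ (fderiv ℝ (S.F i) x (Pi.single k 1)) (fderiv ℝ (S.F i) x (Pi.single l 1))

/-- The integral over the patch `i` of a function given in reference coordinates. -/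
noncomputable def patchIntegral (i : ι) (f : (Fin 2 → ℝ) → ℝ) : ℝ :=
  ∫ x in S.dom i, f x * √(S.metric i x).det

/-- The integral over the interface curve `e` of a function of the parameter of its first side. -/
noncomputable def interfaceIntegral (e : ε) (f : ℝ → ℝ) : ℝ :=
  ∫ t in (0 : ℝ)..1, f t *
    ‖fderiv ℝ (S.F (S.patch (e, false))) (S.curve (e, false) t) (deriv (S.curve (e, false)) t)‖

/-- The inward Euclidean normal (of length `|γ'|`) to the reference patch along a side. -/
noncomputable def inward (s : ε × Bool) (t : ℝ) : Fin 2 → ℝ :=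
  ![-(deriv (S.curve s) t 1), deriv (S.curve s) t 0]

/-- The exterior unit conormal to the patch along a side, in reference coordinates: the vector
`G⁻¹ν / ‖G⁻¹ν‖_G`, where `ν` is the outward Euclidean normal. -/
noncomputable def conormal (s : ε × Bool) (t : ℝ) : Fin 2 → ℝ :=
  let G := S.metric (S.patch s) (S.curve s t)
  let a := G⁻¹.mulVec (-(S.inward s t))
  (√(a ⬝ᵥ G.mulVec a))⁻¹ • a

/-! ### The mesh -/

open Classical in
/-- The active elements of patch `i`: those elements of the background grid over the unit square
that meet the reference patch.  The grid of patch `i` has mesh size `h` and origin `o i`. -/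
noncomputable def activeElements (h : ℝ) (o : ι → Fin 2 → ℝ) (i : ι) : Finset (Fin 2 → ℤ) :=
  (Fintype.piFinset fun k => Finset.Icc ⌊(0 - o i k) / h⌋ ⌊(1 - o i k) / h⌋).filter
    fun K => (gridElement h (o i) K ∩ S.dom i).Nonempty

/-- The element `K` is met by the boundary of the reference patch `i`. -/
def IsCut (h : ℝ) (o : ι → Fin 2 → ℝ) (i : ι) (K : Fin 2 → ℤ) : Prop :=
  (gridElement h (o i) K ∩ frontier (S.dom i)).Nonempty

open Classical in
/-- The stabilized faces of patch `i`: faces between two active elements `K` and `K + eₖ`,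
encoded as `(K, k)`, such that at least one of the two elements is cut. -/
noncomputable def stabFaces (h : ℝ) (o : ι → Fin 2 → ℝ) (i : ι) :
    Finset ((Fin 2 → ℤ) × Fin 2) :=
  (S.activeElements h o i ×ˢ Finset.univ).filter fun f =>
    f.1 + Pi.single f.2 1 ∈ S.activeElements h o i ∧
      (S.IsCut h o i f.1 ∨ S.IsCut h o i (f.1 + Pi.single f.2 1))

/-- The patch geometry condition with constants `l` and `c` on a mesh: every cut active element has,
within distance `l` in the grid, an element whose intersection with the reference patch
has area at least `c` times the area of an element. -/
def PatchGeometry (l : ℕ) (c h : ℝ) (o : ι → Fin 2 → ℝ) : Prop :=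
  ∀ i, ∀ K ∈ S.activeElements h o i, S.IsCut h o i K →
    ∃ K' : Fin 2 → ℤ, (∀ k, |K' k - K k| ≤ l) ∧
      c * h ^ 2 ≤ (MeasureTheory.volume (gridElement h (o i) K' ∩ S.dom i)).toReal

/-! ### The finite element basis -/

/-- The active nodes of patch `i`: the nodes of its active elements.  The position `m` stands for
the point `o i + (h / p) • m`. -/
noncomputable def activeNodes (p : ℕ) (h : ℝ) (o : ι → Fin 2 → ℝ) (i : ι) :
    Finset (Fin 2 → ℤ) :=
  (S.activeElements h o i).biUnion fun K =>
    Fintype.piFinset fun k => Finset.Icc ((p : ℤ) * K k) (p * (K k + 1))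

/-- The degrees of freedom: pairs of a patch and an active node of that patch. -/
abbrev Dof (p : ℕ) (h : ℝ) (o : ι → Fin 2 → ℝ) :=
  (i : ι) × {m : Fin 2 → ℤ // m ∈ S.activeNodes p h o i}

open Classical in
/-- The Lagrange basis function of a degree of freedom; it vanishes on all other patches. -/
noncomputable def basisFun (p : ℕ) (h : ℝ) (o : ι → Fin 2 → ℝ) (n : S.Dof p h o) : BrokenPoly ι :=
  fun i K => if i = n.1 then localLagrange p h (o i) n.2 K else 0

/-! ### The bilinear form -/

/-- The value on patch `i` of a broken polynomial at `x`. -/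
noncomputable def val (h : ℝ) (o : ι → Fin 2 → ℝ) (v : BrokenPoly ι) (i : ι) (x : Fin 2 → ℝ) : ℝ :=
  MvPolynomial.eval x (v i (elementTowards h (o i) 0 x))

/-- The elementwise reference gradient on patch `i` of a broken polynomial at `x`. -/
noncomputable def grad (h : ℝ) (o : ι → Fin 2 → ℝ) (v : BrokenPoly ι) (i : ι) (x : Fin 2 → ℝ) :
    Fin 2 → ℝ :=
  fun k => MvPolynomial.eval x (MvPolynomial.pderiv k (v i (elementTowards h (o i) 0 x)))

/-- The trace on a side, taken from inside the patch. -/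
noncomputable def trace (h : ℝ) (o : ι → Fin 2 → ℝ) (v : BrokenPoly ι) (s : ε × Bool) (t : ℝ) : ℝ :=
  MvPolynomial.eval (S.curve s t)
    (v (S.patch s) (elementTowards h (o (S.patch s)) (S.inward s t) (S.curve s t)))

/-- The conormal derivative `n · ∇v` on a side, taken from inside the patch.  In reference
coordinates it is the reference gradient applied to the conormal. -/
noncomputable def flux (h : ℝ) (o : ι → Fin 2 → ℝ) (v : BrokenPoly ι) (s : ε × Bool) (t : ℝ) : ℝ :=
  ∑ k, S.conormal s t k * MvPolynomial.eval (S.curve s t) (MvPolynomial.pderiv k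
    (v (S.patch s) (elementTowards h (o (S.patch s)) (S.inward s t) (S.curve s t))))

/-- The parameter on the second side of the interface `e` that corresponds to `t` on the first. -/
def opposite (e : ε) (t : ℝ) : ℝ := if S.reversed e then 1 - t else t

/-- The jump `v₁ - v₂` over an interface. -/
noncomputable def jump (h : ℝ) (o : ι → Fin 2 → ℝ) (v : BrokenPoly ι) (e : ε) (t : ℝ) : ℝ :=
  S.trace h o v (e, false) t - S.trace h o v (e, true) (S.opposite e t)

/-- The average flux `(n₁ · ∇v₁ - n₂ · ∇v₂) / 2` over an interface. -/
noncomputable def avgFlux (h : ℝ) (o : ι → Fin 2 → ℝ) (v : BrokenPoly ι) (e : ε) (t : ℝ) : ℝ :=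
  (S.flux h o v (e, false) t - S.flux h o v (e, true) (S.opposite e t)) / 2

/-- The integral `∫_Ω v`. -/
noncomputable def integral [Fintype ι] (h : ℝ) (o : ι → Fin 2 → ℝ) (v : BrokenPoly ι) : ℝ :=
  ∑ i, S.patchIntegral i (val h o v i)

/-- The symmetric Nitsche form. -/
noncomputable def nitscheForm [Fintype ι] [Fintype ε] (β h : ℝ) (o : ι → Fin 2 → ℝ)
    (v w : BrokenPoly ι) : ℝ :=
  (∑ i, S.patchIntegral i fun x => grad h o v i x ⬝ᵥ (S.metric i x)⁻¹.mulVec (grad h o w i x))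
  - (∑ e, (S.interfaceIntegral e (fun t => S.avgFlux h o v e t * S.jump h o w e t)
      + S.interfaceIntegral e (fun t => S.jump h o v e t * S.avgFlux h o w e t)))
  + ∑ e, β * h⁻¹ * S.interfaceIntegral e (fun t => S.jump h o v e t * S.jump h o w e t)

/-- The jump over the face `(K, k)` of the `q`-th derivative in the direction of the face normal
`eₖ`, at the point of the face whose other coordinate is `t`. -/
noncomputable def faceJump (h : ℝ) (o : ι → Fin 2 → ℝ) (v : BrokenPoly ι) (i : ι)
    (f : (Fin 2 → ℤ) × Fin 2) (q : ℕ) (t : ℝ) : ℝ :=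
  MvPolynomial.eval (Function.update (fun _ => t) f.2 (o i f.2 + h * (f.1 f.2 + 1)))
    ((MvPolynomial.pderiv f.2)^[q] (v i (f.1 + Pi.single f.2 1) - v i f.1))

/-- The stabilization form. -/
noncomputable def stabForm [Fintype ι] (p : ℕ) (γ : ℕ → ℝ) (h : ℝ) (o : ι → Fin 2 → ℝ)
    (v w : BrokenPoly ι) : ℝ :=
  ∑ i, ∑ f ∈ S.stabFaces h o i, ∑ q ∈ Finset.Icc 1 p, γ q * h ^ (2 * q - 1) *
    ∫ t in (o i f.2.rev + h * f.1 f.2.rev)..(o i f.2.rev + h * (f.1 f.2.rev + 1)),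
      faceJump h o v i f q t * faceJump h o w i f q t

/-- The bilinear form of the stabilized method. -/
noncomputable def discreteForm [Fintype ι] [Fintype ε] (p : ℕ) (β : ℝ) (γ : ℕ → ℝ) (h : ℝ)
    (o : ι → Fin 2 → ℝ) (v w : BrokenPoly ι) : ℝ :=
  S.nitscheForm β h o v w + S.stabForm p γ h o v w

/-! ### The stiffness matrix on mean-zero functions -/

/-- The stiffness matrix in the Lagrange basis. -/
noncomputable def stiffness [Fintype ι] [Fintype ε] (p : ℕ) (β : ℝ) (γ : ℕ → ℝ) (h : ℝ)
    (o : ι → Fin 2 → ℝ) : Matrix (S.Dof p h o) (S.Dof p h o) ℝ :=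
  Matrix.of fun m n =>
    S.discreteForm p β γ h o (S.basisFun p h o n) (S.basisFun p h o m)

/-- The coefficient vectors of the functions with mean zero on the surface, that is, the vectors
`V` with `∑ₙ Vₙ ∫_Ω φₙ = 0`. -/
noncomputable def meanZero [Fintype ι] (p : ℕ) (h : ℝ) (o : ι → Fin 2 → ℝ) :
    Submodule ℝ (EuclideanSpace ℝ (S.Dof p h o)) :=
  (Submodule.span ℝ {WithLp.toLp 2 fun n => S.integral h o (S.basisFun p h o n)})ᗮ

open Classical in
/-- The stiffness matrix as an operator on the mean-zero coefficient vectors, onto its range.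
All norms are operator norms for the Euclidean norm on coefficient vectors. -/
noncomputable def stiffnessOp [Fintype ι] [Fintype ε] (p : ℕ) (β : ℝ) (γ : ℕ → ℝ) (h : ℝ)
    (o : ι → Fin 2 → ℝ) :=
  ((Matrix.toEuclideanCLM (𝕜 := ℝ) (S.stiffness p β γ h o)).domRestrict
    (S.meanZero p h o)).rangeRestrict

/-- The condition number `|𝒜| |𝒜⁻¹|` of the stiffness matrix on mean-zero functions. -/
noncomputable def condNumber [Fintype ι] [Fintype ε] (p : ℕ) (β : ℝ) (γ : ℕ → ℝ) (h : ℝ)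
    (o : ι → Fin 2 → ℝ) : ℝ :=
  ‖S.stiffnessOp p β γ h o‖ * ‖(S.stiffnessOp p β γ h o).inverse‖

end MultipatchSurface

/-! The stiffness matrix is symmetric, and its quadratic form is the discrete form evaluated on the
diagonal. The bound therefore follows from two estimates in terms of the coefficient vector `V`: the
form is at most `C |V|²` for all `V`, and at least `c h² |V|²` if the function has mean zero. Their
quotient is of order `h⁻²`.

All norms are expressed by nodal values. On an element, the nodal energy (squared differences of
nodal values) is equivalent to the squared `L²` norm of the gradient, and the nodal mass (squared
nodal values) to `h⁻²` times the squared `L²` norm. These equivalences hold on full elements, with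
constants from finite-dimensional algebra on the reference square. Upper bounds are then routine:
the number of elements per node is bounded, a side spends a parameter time of order `h` in each
element, and the stabilization is scale invariant. This gives `exists_discreteForm_le`.

The lower bound has to reach elements of which only a sliver lies in the patch. If two neighbours
have matching normal derivatives of all orders on their common edge, their polynomials coincide;
hence the energy of one is bounded by the energy of the other plus the jumps
(`exists_nodalEnergy_le_neighbour`). A cut element is joined to an element inside the patch by a
chain of boundedly many active elements, which exists if every point of the patch is the vertex of a
cone in the patch of uniform size (`UniformCone.exists_sum_le`). So the gradients on the patches and
the stabilization control the energy of all active elements. The consistency terms of Nitsche's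
method are absorbed by this energy and by the penalty once `β` is large (`exists_coercive`).

The uniform cone condition is a property of the patches alone. At a boundary point two arcs meet.
Unless their tangents are antiparallel, some sector of directions crosses both arcs inwards and
yields cones. If they are antiparallel, either the complement has a cusp, and cones still exist, or
the patch itself has a cusp (`isThinAt_or_hasLocalCone`). In a cusp of the patch the available area
within a bounded number of elements is `o(h²)`, so that the patch geometry condition fails on all
fine meshes and the claim is vacuous (`uniformCone_or_not_patchGeometry`). This is the only use of
that condition.

What remains is a Poincaré inequality for functions of mean zero. A connected patch with the cone
condition satisfies one (`exists_poincare`), proved for functions whose increments along segments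
are dominated by a square-integrable density, since the finite element functions are only piecewise
smooth. Constants on adjacent patches are compared through traces on the middle of a common
interface and the jump there, and then along chains of patches (`exists_broken_poincare`). Passing
from `L²` norms to nodal values costs the factor `h²` (`MultipatchSurface.exists_sum_sq_le`). -/

section

open Set Metric Filter Topology

/-! ### Plane vectors -/

/-- The determinant of two plane vectors. -/
def det2 (a b : Fin 2 → ℝ) : ℝ := a 0 * b 1 - a 1 * b 0

lemma det2_add (a b c : Fin 2 → ℝ) : det2 a (b + c) = det2 a b + det2 a c := by
  simp [det2]; ring

lemma det2_sub (a b c : Fin 2 → ℝ) : det2 a (b - c) = det2 a b - det2 a c := by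
  simp [det2]; ring

lemma det2_smul (a b : Fin 2 → ℝ) (r : ℝ) : det2 a (r • b) = r * det2 a b := by
  simp [det2]; ring

lemma det2_neg (a b : Fin 2 → ℝ) : det2 a (-b) = -det2 a b := by
  simp [det2]; ring

lemma det2_self (a : Fin 2 → ℝ) : det2 a a = 0 := by
  simp [det2]; ring

lemma det2_swap (a b : Fin 2 → ℝ) : det2 a b = -det2 b a := by
  simp [det2]; ring

lemma det2_sub_left (a b c : Fin 2 → ℝ) : det2 (a - b) c = det2 a c - det2 b c := by
  simp [det2]; ring

lemma abs_det2_le (a b : Fin 2 → ℝ) : |det2 a b| ≤ 2 * ‖a‖ * ‖b‖ := by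
  have h0 := norm_le_pi_norm a 0
  have h1 := norm_le_pi_norm a 1
  have g0 := norm_le_pi_norm b 0
  have g1 := norm_le_pi_norm b 1
  calc |det2 a b| ≤ |a 0 * b 1| + |a 1 * b 0| := abs_sub _ _
    _ = ‖a 0‖ * ‖b 1‖ + ‖a 1‖ * ‖b 0‖ := by simp [abs_mul]
    _ ≤ ‖a‖ * ‖b‖ + ‖a‖ * ‖b‖ := by gcongr
    _ = _ := by ring

lemma continuous_det2 (a : Fin 2 → ℝ) : Continuous (det2 a) := by
  unfold det2; fun_prop

/-- The rotation by a right angle. -/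
def rot (b : Fin 2 → ℝ) : Fin 2 → ℝ := ![-(b 1), b 0]

lemma norm_rot (b : Fin 2 → ℝ) : ‖rot b‖ = ‖b‖ := by
  apply le_antisymm
  · rw [pi_norm_le_iff_of_nonneg (norm_nonneg _)]
    intro k; fin_cases k
    · simpa [rot] using norm_le_pi_norm b 1
    · simpa [rot] using norm_le_pi_norm b 0
  · rw [pi_norm_le_iff_of_nonneg (norm_nonneg _)]
    intro k; fin_cases k
    · simpa [rot] using norm_le_pi_norm (rot b) 1
    · simpa [rot] using norm_le_pi_norm (rot b) 0

/-- The norm of `Fin 2 → ℝ` is the sup norm, whereas the right side is the Euclidean square; hence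
an inequality. -/
lemma sq_norm_le_det2_rot (b : Fin 2 → ℝ) : ‖b‖ ^ 2 ≤ det2 b (rot b) := by
  have hd : det2 b (rot b) = b 0 ^ 2 + b 1 ^ 2 := by simp [det2, rot]; ring
  have : ‖b‖ ≤ √(b 0 ^ 2 + b 1 ^ 2) := by
    rw [pi_norm_le_iff_of_nonneg (Real.sqrt_nonneg _)]
    intro k
    rw [Real.norm_eq_abs]
    apply Real.abs_le_sqrt
    fin_cases k <;> simp <;> positivity
  rw [hd, ← Real.sq_sqrt (show 0 ≤ b 0 ^ 2 + b 1 ^ 2 by positivity)]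
  gcongr

lemma det2_rot_pos {b : Fin 2 → ℝ} (hb : b ≠ 0) : 0 < det2 b (rot b) :=
  lt_of_lt_of_le (by positivity) (sq_norm_le_det2_rot b)

/-- Two vectors that are not antiparallel lie on the same side of a line. -/
lemma exists_det2_pos_or_antiparallel {a b : Fin 2 → ℝ} (ha : a ≠ 0) (hb : b ≠ 0) :
    (∃ u, 0 < det2 a u ∧ 0 < det2 b u) ∨ ∃ r : ℝ, 0 < r ∧ a = (-r) • b := by
  rcases lt_trichotomy (det2 a b) 0 with h | h | h
  · left
    refine ⟨a - b, ?_, ?_⟩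
    · rw [det2_sub, det2_self]; linarith
    · rw [det2_sub, det2_self, det2_swap]; linarith
  · have hpos := det2_rot_pos hb
    have hd : det2 b (rot b) = b 0 ^ 2 + b 1 ^ 2 := by simp [det2, rot]; ring
    -- As `a` and `b` are parallel, `a` equals its orthogonal projection onto `b`; the denominator
    -- is the Euclidean square of `b`.
    have key : a = ((a 0 * b 0 + a 1 * b 1) / det2 b (rot b)) • b := by
      have h' : a 0 * b 1 - a 1 * b 0 = 0 := h
      ext k
      simp only [Pi.smul_apply, smul_eq_mul]
      rw [div_mul_eq_mul_div, eq_div_iff hpos.ne', hd]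
      fin_cases k
      · simp; linear_combination b 1 * h'
      · simp; linear_combination -b 0 * h'
    generalize (a 0 * b 0 + a 1 * b 1) / det2 b (rot b) = r at key
    rcases lt_trichotomy r 0 with hr | hr | hr
    · right; exact ⟨-r, by linarith, by rw [neg_neg]; exact key⟩
    · exact absurd (by rw [key, hr, zero_smul]) ha
    · left
      refine ⟨rot b, ?_, hpos⟩
      rw [det2_swap, key, det2_smul, det2_swap (rot b) b]
      nlinarith
  · left
    refine ⟨b - a, ?_, ?_⟩
    · rw [det2_sub, det2_self]; linarith
    · rw [det2_sub, det2_self, det2_swap]; linarith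

/-! ### Crossing the frontier along segments -/

section Crossing

variable {E : Type*} [NormedAddCommGroup E] [NormedSpace ℝ E] {Ω : Set E}

/-- A preconnected set that meets an open set but not its frontier is contained in it. -/
lemma IsPreconnected.subset_of_disjoint_frontier' {X : Type*} [TopologicalSpace X] {T Ω : Set X}
    (hT : IsPreconnected T) (hΩ : IsOpen Ω) (hdisj : ∀ x ∈ T, x ∉ frontier Ω)
    (hne : (T ∩ Ω).Nonempty) : T ⊆ Ω := by
  intro x hx
  by_contra hxΩ
  have hcov : T ⊆ Ω ∪ (closure Ω)ᶜ := by
    intro y hy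
    by_cases h : y ∈ Ω
    · exact Or.inl h
    · refine Or.inr fun hc => hdisj y hy ?_
      rw [hΩ.frontier_eq]; exact ⟨hc, h⟩
  have hx' : x ∈ (closure Ω)ᶜ := (hcov hx).resolve_left hxΩ
  obtain ⟨y, -, hy1, hy2⟩ := hT Ω (closure Ω)ᶜ hΩ isClosed_closure.isOpen_compl hcov hne ⟨x, hx, hx'⟩
  exact hy2 (subset_closure hy1)

/-- The first exit point of a segment that starts in an open set and leaves it. -/
lemma exists_first_exit (hΩ : IsOpen Ω) {x u : E} (hx : x ∈ Ω) {R : ℝ} (hR : 0 ≤ R)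
    (hxR : x + R • u ∉ Ω) :
    ∃ r, 0 < r ∧ r ≤ R ∧ x + r • u ∈ frontier Ω ∧ ∀ s, 0 ≤ s → s < r → x + s • u ∈ Ω := by
  have hcont : Continuous fun r : ℝ => x + r • u := by fun_prop
  have hcl : IsClosed {r : ℝ | x + r • u ∉ Ω} := hΩ.isClosed_compl.preimage hcont
  have hcpt : IsCompact (Icc 0 R ∩ {r : ℝ | x + r • u ∉ Ω}) := isCompact_Icc.inter_right hcl
  obtain ⟨r, ⟨⟨hr0, hrR⟩, hr⟩, hmin⟩ := hcpt.exists_isLeast ⟨R, ⟨hR, le_rfl⟩, hxR⟩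
  have hlt : ∀ s, 0 ≤ s → s < r → x + s • u ∈ Ω := by
    intro s hs hsr
    by_contra h
    exact absurd (hmin ⟨⟨hs, by linarith⟩, h⟩) (not_le.2 hsr)
  have hrpos : 0 < r := by
    rcases hr0.lt_or_eq with h | h
    · exact h
    · subst h; exact absurd (by simpa using hx) hr
  refine ⟨r, hrpos, hrR, ?_, hlt⟩
  rw [hΩ.frontier_eq]
  refine ⟨?_, hr⟩
  have : Tendsto (fun r : ℝ => x + r • u) (𝓝[<] r) (𝓝 (x + r • u)) :=
    hcont.continuousAt.tendsto.mono_left nhdsWithin_le_nhds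
  apply mem_closure_of_tendsto this
  filter_upwards [Ioo_mem_nhdsLT hrpos] with s hs using hlt s hs.1.le hs.2

/-- The last entrance point of a segment that ends in an open set. -/
lemma exists_last_entrance (hΩ : IsOpen Ω) {x u : E} {r R : ℝ} (hrR : r ≤ R)
    (hr : x + r • u ∉ Ω) (hR : x + R • u ∈ Ω) :
    ∃ s, r ≤ s ∧ s < R ∧ x + s • u ∈ frontier Ω := by
  obtain ⟨q, hq0, hqR, hq, -⟩ := exists_first_exit (u := -u) hΩ hR (sub_nonneg.2 hrR)
    (by rwa [show x + R • u + (R - r) • -u = x + r • u by module])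
  refine ⟨R - q, by linarith, by linarith, ?_⟩
  convert hq using 1; module

/-- Segments near a frontier point stay inside in one of two opposite cones of directions, if the
frontier consists of two antichains for the cone, one of which is crossed outwards and the other
inwards. -/
lemma cone_segments (hΩ : IsOpen Ω) {x₀ : E} {ρ ρ' : ℝ} (hρ : ρ ≤ ρ')
    {A B C : Set E} (hCs : ∀ u ∈ C, ∀ r : ℝ, 0 < r → r • u ∈ C) (hCa : ∀ u ∈ C, ∀ v ∈ C, u + v ∈ C)
    (hfr : ∀ z ∈ frontier Ω, ‖z - x₀‖ < ρ' → z ∈ A ∨ z ∈ B ∨ z = x₀)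
    (hA : ∀ y ∈ insert x₀ A, ∀ z ∈ insert x₀ A, y - z ∉ C)
    (hB : ∀ y ∈ insert x₀ B, ∀ z ∈ insert x₀ B, y - z ∉ C)
    (hcA : ∀ z ∈ A, z ≠ x₀ → ∀ u ∈ C, ∀ᶠ r in 𝓝[>] (0 : ℝ), z + r • u ∉ Ω)
    (hcB : ∀ z ∈ B, z ≠ x₀ → ∀ u ∈ C, ∀ᶠ r in 𝓝[>] (0 : ℝ), z - r • u ∉ Ω)
    (htop : ∀ z ∈ A, ‖z - x₀‖ < ρ → ∀ u ∈ C, ∃ R : ℝ, 0 < R ∧ z + R • u ∈ Ω ∧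
      ∀ r, 0 ≤ r → r ≤ R → ‖z + r • u - x₀‖ < ρ')
    {x : E} (hx : x ∈ Ω) (hxρ : ‖x - x₀‖ < ρ / 2) :
    (∀ u ∈ C, ‖u‖ ≤ ρ / 2 → x + u ∈ Ω) ∨ (∀ u ∈ C, ‖u‖ ≤ ρ / 2 → x - u ∈ Ω) := by
  -- Suppose that a segment from `x` in a direction of `C` leaves `Ω` at `y`, and one in an opposite
  -- direction leaves it at `z`. Since `A` is crossed outwards and `B` inwards, `y` lies in `A` and
  -- `z` in `B`, up to the point `x₀`, and `y - z` lies in `C`. If one of them is `x₀`, the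
  -- antichain property of the other set is violated.
  by_contra! hcon
  obtain ⟨⟨u, huC, hun, hu⟩, ⟨v, hvC, hvn, hv⟩⟩ := hcon
  have hball : ∀ (w : E) (r : ℝ), ‖w‖ ≤ ρ / 2 → 0 ≤ r → r ≤ 1 → ‖x + r • w - x₀‖ < ρ := by
    intro w r hw h0 h1
    calc ‖x + r • w - x₀‖ = ‖(x - x₀) + r • w‖ := by congr 1; abel
      _ ≤ ‖x - x₀‖ + ‖r • w‖ := norm_add_le _ _
      _ ≤ ‖x - x₀‖ + 1 * ‖w‖ := by rw [norm_smul, Real.norm_of_nonneg h0]; gcongr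
      _ < ρ := by linarith
  obtain ⟨r, hr0, hr1, hrf, hrΩ⟩ := exists_first_exit (u := u) (R := 1) hΩ hx zero_le_one (by simpa)
  obtain ⟨s, hs0, hs1, hsf, hsΩ⟩ := exists_first_exit (u := -v) (R := 1) hΩ hx zero_le_one
    (by simpa [sub_eq_add_neg] using hv)
  have hyn := hball u r hun hr0.le hr1
  have hzn := hball (-v) s (by simpa using hvn) hs0.le hs1
  have hyΩ : x + r • u ∉ Ω := by
    rw [hΩ.frontier_eq] at hrf; exact hrf.2
  have hyA : x + r • u ∈ insert x₀ A := by
    rcases hfr _ hrf (by linarith) with h | h | h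
    · exact Or.inr h
    · by_contra hne
      have hne' : x + r • u ≠ x₀ := fun h => hne (Or.inl h)
      obtain ⟨t, ht, ht'⟩ := ((hcB _ h hne' u huC).and (Ioo_mem_nhdsGT hr0)).exists
      apply ht
      have := hrΩ (r - t) (by linarith [ht'.2]) (by linarith [ht'.1])
      convert this using 1; module
    · exact Or.inl h
  have hzB : x + s • (-v) ∈ insert x₀ B := by
    rcases hfr _ hsf (by linarith) with h | h | h
    · by_contra hne
      have hne' : x + s • (-v) ≠ x₀ := fun h => hne (Or.inl h)
      obtain ⟨t, ht, ht'⟩ := ((hcA _ h hne' v hvC).and (Ioo_mem_nhdsGT hs0)).exists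
      apply ht
      have := hsΩ (s - t) (by linarith [ht'.2]) (by linarith [ht'.1])
      convert this using 1; module
    · exact Or.inr h
    · exact Or.inl h
  have hdiff : (x + r • u) - (x + s • (-v)) ∈ C := by
    have := hCa _ (hCs u huC r hr0) _ (hCs v hvC s hs0)
    convert this using 1; module
  rcases hyA with h | hyA
  · exact hB _ (Or.inl h) _ hzB hdiff
  rcases hzB with h | hzB
  · exact hA _ (Or.inr hyA) _ (Or.inl h) hdiff
  by_cases hy0 : x + r • u = x₀
  · exact hB _ (Or.inl hy0) _ (Or.inr hzB) hdiff
  -- Beyond `y` the segment is outside `Ω` at first, but it returns by `htop`. Its last entrance is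
  -- a frontier point that differs from `y` by an element of `C`, hence is not in `A`; it differs
  -- from `z` by an element of `C` as well, hence is not in `B`.
  obtain ⟨R, hR0, hRΩ, hRn⟩ := htop _ hyA hyn u huC
  obtain ⟨t, ht, ht'⟩ := ((hcA _ hyA hy0 u huC).and (Ioo_mem_nhdsGT hR0)).exists
  obtain ⟨q, hq1, hq2, hqf⟩ := exists_last_entrance hΩ ht'.2.le ht hRΩ
  have hq0 : 0 < q := by linarith [ht'.1]
  have hqC : x + r • u + q • u - (x + r • u) ∈ C := by
    convert hCs u huC q hq0 using 1; module
  have hqA : x + r • u + q • u ∉ insert x₀ A := fun h => hA _ h _ (Or.inr hyA) hqC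
  rcases hfr _ hqf (hRn q hq0.le hq2.le) with h | h | h
  · exact hqA (Or.inr h)
  · refine hB _ (Or.inr h) _ (Or.inr hzB) ?_
    have := hCa _ hqC _ hdiff
    convert this using 1; module
  · exact hqA (Or.inl h)

end Crossing

end

section

open Set Metric Filter Topology

namespace MultipatchSurface

variable {ι ε : Type*} {d : ℕ} (S : MultipatchSurface ι ε d)

/-! ### Local structure of the patch boundary -/

lemma curve_hasStrictDerivAt (s : ε × Bool) (t : ℝ) :
    HasStrictDerivAt (S.curve s) (deriv (S.curve s) t) t :=
  (S.curve_smooth s).contDiffAt.hasStrictDerivAt (by simp)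

lemma continuous_deriv_curve (s : ε × Bool) : Continuous (deriv (S.curve s)) :=
  (S.curve_smooth s).continuous_deriv (by simp)

lemma continuous_curve (s : ε × Bool) : Continuous (S.curve s) := (S.curve_smooth s).continuous

lemma curve_mem_frontier (s : ε × Bool) {t : ℝ} (ht : t ∈ Icc (0 : ℝ) 1) :
    S.curve s t ∈ frontier (S.dom (S.patch s)) := by
  rw [S.frontier_eq]
  exact mem_biUnion (show s ∈ {s' | S.patch s' = S.patch s} from rfl) (mem_image_of_mem _ ht)

/-- Near a parameter, a curve is nearly a segment and its tangent is nearly constant. -/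
lemma exists_curve_flat (s : ε × Bool) (t₀ : ℝ) {δ : ℝ} (hδ : 0 < δ) :
    ∃ η > 0, (∀ t t', |t - t₀| < η → |t' - t₀| < η →
      ‖S.curve s t - S.curve s t' - (t - t') • deriv (S.curve s) t₀‖ ≤ δ * |t - t'|) ∧
      ∀ t, |t - t₀| < η → ‖deriv (S.curve s) t - deriv (S.curve s) t₀‖ ≤ δ := by
  have h1 := (S.curve_hasStrictDerivAt s t₀).hasStrictFDerivAt.isLittleO.def hδ
  rw [nhds_prod_eq, Metric.nhds_basis_ball.prod_self.eventually_iff] at h1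
  obtain ⟨η₁, hη₁, h1⟩ := h1
  obtain ⟨η₂, hη₂, h2⟩ := Metric.continuousAt_iff.1
    ((S.continuous_deriv_curve s).continuousAt (x := t₀)) δ hδ
  refine ⟨min η₁ η₂, lt_min hη₁ hη₂, fun t t' ht ht' => ?_, fun t ht => ?_⟩
  · have := h1 (x := (t, t')) ⟨by simpa [Real.dist_eq] using ht.trans_le (min_le_left _ _),
      by simpa [Real.dist_eq] using ht'.trans_le (min_le_left _ _)⟩
    simpa using this
  · have := @h2 t (by simpa [Real.dist_eq] using ht.trans_le (min_le_right _ _))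
    rw [dist_eq_norm] at this; exact this.le

/-- Near a point, the patch boundary consists of the arcs through this point. -/
lemma exists_frontier_near [Finite ε] (i : ι) (y : Fin 2 → ℝ) {η : ℝ} :
    0 < η → ∃ ρ > 0, ∀ z ∈ frontier (S.dom i), ‖z - y‖ < ρ → ∃ s, S.patch s = i ∧
      ∃ t₀ ∈ Icc (0 : ℝ) 1, S.curve s t₀ = y ∧ ∃ t ∈ Icc (0 : ℝ) 1, |t - t₀| < η ∧
        z = S.curve s t := by
  intro hη
  -- The curve points whose parameter keeps distance `η` from every parameter of `y` form a finite
  -- union of compact sets that does not contain `y`. Some ball about `y` misses it.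
  have hcl : IsClosed (⋃ s : ε × Bool, S.curve s ''
      {t ∈ Icc (0 : ℝ) 1 | ∀ t₀ ∈ Icc (0 : ℝ) 1, S.curve s t₀ = y → η ≤ |t - t₀|}) := by
    apply isClosed_iUnion_of_finite
    intro s
    apply IsCompact.isClosed
    apply IsCompact.image _ (S.continuous_curve s)
    have hset : {t ∈ Icc (0 : ℝ) 1 | ∀ t₀ ∈ Icc (0 : ℝ) 1, S.curve s t₀ = y → η ≤ |t - t₀|} =
        Icc (0 : ℝ) 1 ∩ ⋂ t₀ ∈ {t₀ ∈ Icc (0 : ℝ) 1 | S.curve s t₀ = y}, {t | η ≤ |t - t₀|} := by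
      ext t; simp
    rw [hset]
    apply isCompact_Icc.inter_right
    refine isClosed_biInter fun t₀ _ => ?_
    exact isClosed_le continuous_const (by fun_prop)
  have hy : y ∉ ⋃ s : ε × Bool, S.curve s ''
      {t ∈ Icc (0 : ℝ) 1 | ∀ t₀ ∈ Icc (0 : ℝ) 1, S.curve s t₀ = y → η ≤ |t - t₀|} := by
    simp only [mem_iUnion, not_exists]
    rintro s ⟨t, ⟨ht, ht'⟩, hty⟩
    have := ht' t ht hty
    simp at this; linarith
  obtain ⟨ρ, hρ, hb⟩ := Metric.isOpen_iff.1 hcl.isOpen_compl y hy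
  refine ⟨ρ, hρ, fun z hz hzy => ?_⟩
  rw [S.frontier_eq] at hz
  simp only [mem_iUnion, exists_prop] at hz
  obtain ⟨s, hs, t, ht, rfl⟩ := hz
  have hn := hb (show S.curve s t ∈ ball y ρ by rwa [mem_ball, dist_eq_norm])
  rw [mem_compl_iff, mem_iUnion, not_exists] at hn
  by_contra hcon
  refine hn s ⟨t, ⟨ht, fun t₀ ht₀ hty => ?_⟩, rfl⟩
  by_contra hlt
  exact hcon ⟨s, hs, t₀, ht₀, hty, t, ht, not_le.1 hlt, rfl⟩

/-- The patch lies locally to the left of its boundary curves. -/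
lemma eventually_left [Finite ε] (s : ε × Bool) {t : ℝ} (ht : t ∈ Ioo (0 : ℝ) 1)
    {w : Fin 2 → ℝ} (hw : 0 < det2 (deriv (S.curve s) t) w) :
    ∀ᶠ r in 𝓝[>] (0 : ℝ), S.curve s t + r • w ∈ S.dom (S.patch s) ∧
      S.curve s t - r • w ∉ S.dom (S.patch s) := by
  set b := deriv (S.curve s) t with hbdef
  have hb : b ≠ 0 := S.curve_regular s t ⟨ht.1.le, ht.2.le⟩
  have hbn : 0 < ‖b‖ := norm_pos_iff.2 hb
  -- The definition of the surface speaks only of the normal direction. It is joined to `w` by a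
  -- segment on which the determinant with `b` is at least `κ` and the norm at most `M`; by `4 * δ *
  -- M < κ` the scaled segment is nowhere as tangential as the frontier and thus stays on one side
  -- of it.
  set κ := min (det2 b w) (det2 b (rot b)) with hκ
  have hκ0 : 0 < κ := lt_min hw (det2_rot_pos hb)
  set M := ‖w‖ + ‖rot b‖ + 1 with hM
  have hM0 : 0 < M := by positivity
  obtain ⟨δ, hδ0, hδ1, hδ2⟩ : ∃ δ > 0, δ ≤ ‖b‖ / 2 ∧ 4 * δ * M < κ := by
    refine ⟨min (‖b‖ / 2) (κ / (8 * M)), by positivity, min_le_left _ _, ?_⟩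
    calc 4 * min (‖b‖ / 2) (κ / (8 * M)) * M ≤ 4 * (κ / (8 * M)) * M := by
          gcongr; exact min_le_right _ _
      _ = κ / 2 := by field_simp; norm_num
      _ < κ := by linarith
  obtain ⟨η, hη, hflat, -⟩ := S.exists_curve_flat s t hδ0
  obtain ⟨ρ, hρ, hnear⟩ := S.exists_frontier_near (S.patch s) (S.curve s t)
    (show 0 < min η (min t (1 - t)) from lt_min hη (lt_min ht.1 (by linarith [ht.2])))
  -- the frontier near the point is nearly tangential
  have hfree : ∀ v, ‖v‖ < ρ → S.curve s t + v ∈ frontier (S.dom (S.patch s)) →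
      |det2 b v| ≤ 4 * δ * ‖v‖ := by
    intro v hv hvf
    obtain ⟨s', hs', t₀, ht₀, hst, t', ht', htt, hz⟩ := hnear _ hvf (by simpa using hv)
    have hs : s = s' ∧ t = t₀ := by
      rcases ht₀.2.lt_or_eq with h | h
      · exact S.curve_inj s s' t t₀ hs'.symm ⟨ht.1.le, ht.2⟩ ⟨ht₀.1, h⟩ hst.symm
      -- A side of this patch that ends at the point has a successor that starts there, so the point
      -- would have the parameter `0` instead of `t > 0`.
      · exfalso
        subst h
        have := S.curve_inj s (S.next s') t 0 (by rw [S.next_patch]; exact hs'.symm)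
          ⟨ht.1.le, ht.2⟩ (by simp) (by rw [S.next_start, hst])
        linarith [ht.1, this.2]
    obtain ⟨rfl, rfl⟩ := hs
    have hf := hflat t' t (htt.trans_le (min_le_left _ _)) (by simpa using hη)
    have hv' : v = S.curve s t' - S.curve s t := by rw [← hz]; abel
    rw [← hv'] at hf
    set e := v - (t' - t) • b with he
    have hve : v = (t' - t) • b + e := by rw [he]; abel
    have h1 : det2 b v = det2 b e := by
      rw [hve, det2_add, det2_smul, det2_self]; ring
    have h2 : |t' - t| * ‖b‖ ≤ ‖v‖ + δ * |t' - t| := by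
      calc |t' - t| * ‖b‖ = ‖v - e‖ := by rw [he, sub_sub_cancel, norm_smul, Real.norm_eq_abs]
        _ ≤ ‖v‖ + ‖e‖ := norm_sub_le _ _
        _ ≤ _ := by gcongr
    have h3 : |t' - t| * ‖b‖ ≤ 2 * ‖v‖ := by nlinarith [abs_nonneg (t' - t)]
    calc |det2 b v| = |det2 b e| := by rw [h1]
      _ ≤ 2 * ‖b‖ * ‖e‖ := abs_det2_le _ _
      _ ≤ 2 * ‖b‖ * (δ * |t' - t|) := by gcongr
      _ = 2 * δ * (|t' - t| * ‖b‖) := by ring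
      _ ≤ 2 * δ * (2 * ‖v‖) := by gcongr
      _ = _ := by ring
  -- the segment from the normal to the given direction
  have hseg : ∀ r : ℝ, r ≠ 0 → |r| < ρ / M → ∀ x ∈ segment ℝ (S.curve s t + r • rot b)
      (S.curve s t + r • w), x ∉ frontier (S.dom (S.patch s)) := by
    rintro r hr0 hr x ⟨α, α', hα, hα', hαα, rfl⟩ hx
    have hrw : α • (S.curve s t + r • rot b) + α' • (S.curve s t + r • w) =
        S.curve s t + r • (α • rot b + α' • w) := by
      rw [show α' = 1 - α by linarith]; module
    rw [hrw] at hx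
    set u := α • rot b + α' • w with hu
    have hun : ‖u‖ ≤ M := by
      calc ‖u‖ ≤ ‖α • rot b‖ + ‖α' • w‖ := norm_add_le _ _
        _ = α * ‖rot b‖ + α' * ‖w‖ := by
          rw [norm_smul, norm_smul, Real.norm_of_nonneg hα, Real.norm_of_nonneg hα']
        _ ≤ 1 * ‖rot b‖ + 1 * ‖w‖ := by gcongr <;> linarith
        _ ≤ M := by rw [hM]; linarith
    have hrn : ‖r • u‖ < ρ := by
      rw [norm_smul, Real.norm_eq_abs]
      calc |r| * ‖u‖ ≤ |r| * M := by gcongr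
        _ < ρ / M * M := by gcongr
        _ = ρ := by field_simp
    have hd : κ ≤ det2 b u := by
      rw [hu, det2_add, det2_smul, det2_smul]
      have e1 : α * κ ≤ α * det2 b (rot b) := by gcongr; exact min_le_right _ _
      have e2 : α' * κ ≤ α' * det2 b w := by gcongr; exact min_le_left _ _
      calc κ = α * κ + α' * κ := by rw [← add_mul, hαα, one_mul]
        _ ≤ _ := by linarith
    have h := hfree _ hrn hx
    rw [det2_smul, abs_mul, norm_smul, Real.norm_eq_abs] at h
    have hr' : 0 < |r| := abs_pos.2 hr0
    have : |det2 b u| ≤ 4 * δ * ‖u‖ := by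
      have : |r| * |det2 b u| ≤ |r| * (4 * δ * ‖u‖) := by linarith
      exact le_of_mul_le_mul_left this hr'
    have h5 : 4 * δ * ‖u‖ ≤ 4 * δ * M := by gcongr
    linarith [le_abs_self (det2 b u)]
  obtain ⟨δ', hδ', hleft⟩ := S.curve_left s t ht
  filter_upwards [Ioo_mem_nhdsGT (show 0 < min δ' (ρ / M) by positivity)] with r hr
  obtain ⟨hl1, hl2⟩ := hleft r ⟨hr.1, hr.2.trans_le (min_le_left _ _)⟩
  have hrρ : r < ρ / M := hr.2.trans_le (min_le_right _ _)
  change S.curve s t + r • rot b ∈ _ at hl1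
  change S.curve s t - r • rot b ∉ _ at hl2
  constructor
  · exact IsPreconnected.subset_of_disjoint_frontier' (convex_segment _ _).isPreconnected
      (S.dom_open _) (hseg r hr.1.ne' (by rwa [abs_of_pos hr.1])) ⟨_, left_mem_segment _ _ _, hl1⟩
      (right_mem_segment _ _ _)
  · intro hcon
    apply hl2
    have := IsPreconnected.subset_of_disjoint_frontier' (convex_segment _ _).isPreconnected
      (S.dom_open _) (hseg (-r) (neg_ne_zero.2 hr.1.ne') (by rwa [abs_neg, abs_of_pos hr.1]))
      ⟨_, right_mem_segment _ _ _, by simpa [neg_smul, ← sub_eq_add_neg] using hcon⟩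
      (left_mem_segment _ _ _)
    simpa [neg_smul, ← sub_eq_add_neg] using this

end MultipatchSurface

end

section

open Set Metric Filter Topology

/-! ### Cones at boundary points -/

/-- Near `x₀` the set `Ω` lies in an arbitrarily narrow double cone about a line. -/
def IsThinAt (Ω : Set (Fin 2 → ℝ)) (x₀ : Fin 2 → ℝ) : Prop :=
  ∃ b : Fin 2 → ℝ, b ≠ 0 ∧ ∀ κ > 0, ∃ ρ > 0, ∀ x ∈ Ω, ‖x - x₀‖ < ρ →
    |det2 b (x - x₀)| ≤ κ * ‖x - x₀‖

/-- Each point of `Ω` near `x₀` is the vertex of one of two opposite truncated cones of fixed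
directions that is contained in `Ω`. -/
def HasLocalCone (Ω : Set (Fin 2 → ℝ)) (x₀ : Fin 2 → ℝ) : Prop :=
  ∃ ρ > 0, ∃ e : Fin 2 → ℝ, ∃ η > 0, ∀ x ∈ Ω, ‖x - x₀‖ < ρ →
    (∀ y, ‖y - e‖ < η → ∀ r ∈ Icc (0 : ℝ) 1, x + r • y ∈ Ω) ∨
    (∀ y, ‖y + e‖ < η → ∀ r ∈ Icc (0 : ℝ) 1, x + r • y ∈ Ω)

/-- A small multiple of the interior direction `n` has a ball around it that lies in the cone `C`
within radius `ρ / 2`. This ball generates the required truncated cones; the vertex `r = 0` is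
treated apart because `C` need not contain `0`. -/
lemma HasLocalCone.of_cone {Ω : Set (Fin 2 → ℝ)} {x₀ n : Fin 2 → ℝ} {C : Set (Fin 2 → ℝ)}
    (hC : IsOpen C) (hn : n ∈ C) (hCs : ∀ u ∈ C, ∀ r : ℝ, 0 < r → r • u ∈ C) {ρ : ℝ} (hρ : 0 < ρ)
    (h : ∀ x ∈ Ω, ‖x - x₀‖ < ρ / 2 → (∀ u ∈ C, ‖u‖ ≤ ρ / 2 → x + u ∈ Ω) ∨
      (∀ u ∈ C, ‖u‖ ≤ ρ / 2 → x - u ∈ Ω)) : HasLocalCone Ω x₀ := by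
  obtain ⟨η, hη, hb⟩ := Metric.isOpen_iff.1 hC n hn
  set s := ρ / (2 * (‖n‖ + η)) with hs
  have hs0 : 0 < s := by positivity
  have key : ∀ y, ‖y - s • n‖ < s * η → ∀ r ∈ Icc (0 : ℝ) 1, 0 < r → r • y ∈ C ∧ ‖r • y‖ ≤ ρ / 2 := by
    intro y hy r hr hr0
    have hyC : y ∈ C := by
      have h1 : s⁻¹ • y ∈ C := by
        apply hb
        rw [mem_ball, dist_eq_norm]
        have : s⁻¹ • y - n = s⁻¹ • (y - s • n) := by
          rw [smul_sub, smul_smul, inv_mul_cancel₀ hs0.ne', one_smul]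
        rw [this, norm_smul, norm_inv, Real.norm_of_nonneg hs0.le, inv_mul_lt_iff₀ hs0]
        exact hy
      have := hCs _ h1 s hs0
      rwa [smul_smul, mul_inv_cancel₀ hs0.ne', one_smul] at this
    refine ⟨hCs y hyC r hr0, ?_⟩
    have hyn : ‖y‖ ≤ ρ / 2 := by
      calc ‖y‖ = ‖(y - s • n) + s • n‖ := by rw [sub_add_cancel]
        _ ≤ ‖y - s • n‖ + ‖s • n‖ := norm_add_le _ _
        _ ≤ s * η + s * ‖n‖ := by
          rw [norm_smul, Real.norm_of_nonneg hs0.le]; gcongr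
        _ = ρ / 2 := by
          have : ‖n‖ + η ≠ 0 := by positivity
          rw [hs]; field_simp; ring
    calc ‖r • y‖ = r * ‖y‖ := by rw [norm_smul, Real.norm_of_nonneg hr.1]
      _ ≤ 1 * ‖y‖ := by gcongr; exact hr.2
      _ ≤ ρ / 2 := by linarith
  refine ⟨ρ / 2, by positivity, s • n, s * η, by positivity, fun x hx hxρ => ?_⟩
  refine (h x hx hxρ).imp (fun H y hy r hr => ?_) (fun H y hy r hr => ?_)
  · rcases hr.1.eq_or_lt with h0 | h0
    · rw [← h0]; simpa using hx
    · obtain ⟨h1, h2⟩ := key y hy r hr h0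
      exact H _ h1 h2
  · rcases hr.1.eq_or_lt with h0 | h0
    · rw [← h0]; simpa using hx
    · obtain ⟨h1, h2⟩ := key (-y) (by rwa [← norm_neg, neg_sub, sub_neg_eq_add, add_comm]) r hr h0
      have := H _ h1 h2
      rwa [smul_neg, sub_neg_eq_add] at this

/-- The determinant with `b` sees only the deviation of `v` from `τ • b`, and `δ ≤ ‖b‖ / 2` makes
`|τ| ‖b‖` at most `2 ‖v‖`. -/
lemma abs_det2_le_of_flat {b v : Fin 2 → ℝ} {τ δ : ℝ} (hδ : 0 ≤ δ) (hb : δ ≤ ‖b‖ / 2)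
    (h : ‖v - τ • b‖ ≤ δ * |τ|) : |det2 b v| ≤ 4 * δ * ‖v‖ := by
  set e := v - τ • b with he
  have hve : v = τ • b + e := by rw [he]; abel
  have h1 : det2 b v = det2 b e := by
    rw [hve, det2_add, det2_smul, det2_self]; ring
  have h2 : |τ| * ‖b‖ ≤ ‖v‖ + δ * |τ| := by
    calc |τ| * ‖b‖ = ‖v - e‖ := by rw [he, sub_sub_cancel, norm_smul, Real.norm_eq_abs]
      _ ≤ ‖v‖ + ‖e‖ := norm_sub_le _ _
      _ ≤ _ := by gcongr
  have h3 : |τ| * ‖b‖ ≤ 2 * ‖v‖ := by nlinarith [abs_nonneg τ]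
  calc |det2 b v| = |det2 b e| := by rw [h1]
    _ ≤ 2 * ‖b‖ * ‖e‖ := abs_det2_le _ _
    _ ≤ 2 * ‖b‖ * (δ * |τ|) := by gcongr
    _ = 2 * δ * (|τ| * ‖b‖) := by ring
    _ ≤ 2 * δ * (2 * ‖v‖) := by gcongr
    _ = _ := by ring

lemma isOpen_det2_cone (b : Fin 2 → ℝ) (κ : ℝ) : IsOpen {u | κ * ‖u‖ < det2 b u} :=
  isOpen_lt (by fun_prop) (continuous_det2 b)

lemma smul_mem_det2_cone {b u : Fin 2 → ℝ} {κ : ℝ} (hu : κ * ‖u‖ < det2 b u) {r : ℝ} (hr : 0 < r) :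
    κ * ‖r • u‖ < det2 b (r • u) := by
  rw [norm_smul, det2_smul, Real.norm_of_nonneg hr.le]; nlinarith

lemma add_mem_det2_cone {b u v : Fin 2 → ℝ} {κ : ℝ} (hκ : 0 ≤ κ) (hu : κ * ‖u‖ < det2 b u)
    (hv : κ * ‖v‖ < det2 b v) : κ * ‖u + v‖ < det2 b (u + v) := by
  rw [det2_add]
  have := mul_le_mul_of_nonneg_left (norm_add_le u v) hκ
  linarith

lemma convex_det2_cone_ball (b : Fin 2 → ℝ) {κ : ℝ} (hκ : 0 ≤ κ) (ρ : ℝ) :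
    Convex ℝ {v | ‖v‖ < ρ ∧ κ * ‖v‖ < det2 b v} := by
  rintro u ⟨hu1, hu⟩ v ⟨hv1, hv⟩ α β hα hβ hαβ
  refine ⟨?_, ?_⟩
  · have := convex_ball (0 : Fin 2 → ℝ) ρ (mem_ball_zero_iff.2 hu1) (mem_ball_zero_iff.2 hv1) hα hβ hαβ
    simpa using this
  · rcases hα.eq_or_lt with h | h
    · subst h; rw [zero_add] at hαβ; subst hαβ; simpa using hv
    rcases hβ.eq_or_lt with h' | h'
    · subst h'; rw [add_zero] at hαβ; subst hαβ; simpa using hu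
    exact add_mem_det2_cone hκ (smul_mem_det2_cone hu h) (smul_mem_det2_cone hv h')

/-- An outward cusp between two arcs admits local cones. -/
lemma HasLocalCone.of_cusp {Ω : Set (Fin 2 → ℝ)} (hΩ : IsOpen Ω) {x₀ b : Fin 2 → ℝ}
    {A B : Set (Fin 2 → ℝ)} {κ ρ' : ℝ} (hκ : 0 < κ) (hκb : κ < ‖b‖) (hρ' : 0 < ρ')
    (hfr : ∀ z ∈ frontier Ω, ‖z - x₀‖ < ρ' → z ∈ A ∨ z ∈ B ∨ z = x₀)
    (hA : ∀ y ∈ insert x₀ A, ∀ z ∈ insert x₀ A, |det2 b (y - z)| ≤ κ * ‖y - z‖)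
    (hB : ∀ y ∈ insert x₀ B, ∀ z ∈ insert x₀ B, |det2 b (y - z)| ≤ κ * ‖y - z‖)
    (hcA : ∀ z ∈ A, z ≠ x₀ → ∀ u, κ * ‖u‖ < det2 b u → ∀ᶠ r in 𝓝[>] (0 : ℝ), z + r • u ∉ Ω)
    (hcB : ∀ z ∈ B, z ≠ x₀ → ∀ u, κ * ‖u‖ < det2 b u → ∀ᶠ r in 𝓝[>] (0 : ℝ), z - r • u ∉ Ω)
    (hup : ∀ v, ‖v‖ < ρ' → κ / 2 * ‖v‖ < det2 b v → x₀ + v ∈ Ω) : HasLocalCone Ω x₀ := by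
  have hb0 : 0 < ‖b‖ := hκ.trans hκb
  -- From a point of `A` within `ρ` of `x₀`, a move of length `ρ' / 2` in the cone ends in the
  -- sector of `hup`: the starting point changes the determinant by at most `2 ‖b‖ ρ`, and the slope
  -- `κ / 2` in `hup` leaves room for this.
  set ρ := min (ρ' / 2) (κ * ρ' / (8 * (2 * ‖b‖ + κ))) with hρdef
  have hρ : 0 < ρ := by positivity
  have hρ1 : ρ ≤ ρ' / 2 := min_le_left _ _
  have hρ2 : (2 * ‖b‖ + κ) * ρ ≤ κ * ρ' / 8 := by
    calc (2 * ‖b‖ + κ) * ρ ≤ (2 * ‖b‖ + κ) * (κ * ρ' / (8 * (2 * ‖b‖ + κ))) := by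
          gcongr; exact min_le_right _ _
      _ = κ * ρ' / 8 := by field_simp
  have hn : rot b ∈ {u | κ * ‖u‖ < det2 b u} := by
    show κ * ‖rot b‖ < det2 b (rot b)
    refine lt_of_lt_of_le ?_ (sq_norm_le_det2_rot b)
    rw [norm_rot]; nlinarith
  refine HasLocalCone.of_cone (isOpen_det2_cone b κ) hn
    (fun u hu r hr => smul_mem_det2_cone (b := b) (u := u) (κ := κ) hu hr) hρ fun x hx hxρ => ?_
  refine cone_segments (ρ' := ρ') hΩ (by linarith) (A := A) (B := B)
    (C := {u | κ * ‖u‖ < det2 b u})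
    (fun u hu r hr => smul_mem_det2_cone (b := b) (u := u) (κ := κ) hu hr)
    (fun u hu v hv => add_mem_det2_cone (b := b) (u := u) (v := v) (κ := κ) hκ.le hu hv)
    hfr ?_ ?_ hcA hcB ?_ hx hxρ
  · exact fun y hy z hz h => absurd (show κ * ‖y - z‖ < det2 b (y - z) from h)
      (not_lt.2 ((le_abs_self _).trans (hA y hy z hz)))
  · exact fun y hy z hz h => absurd (show κ * ‖y - z‖ < det2 b (y - z) from h)
      (not_lt.2 ((le_abs_self _).trans (hB y hy z hz)))
  · intro z hz hzρ u hu
    have hu' : κ * ‖u‖ < det2 b u := hu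
    have hu0 : 0 < ‖u‖ := by
      rw [norm_pos_iff]; rintro rfl
      simp [det2] at hu'
    set R := ρ' / (2 * ‖u‖) with hR
    have hRu : R * ‖u‖ = ρ' / 2 := by rw [hR]; field_simp
    have hR0 : 0 < R := by positivity
    have hnorm : ∀ r, 0 ≤ r → r ≤ R → ‖z + r • u - x₀‖ ≤ ‖z - x₀‖ + ρ' / 2 := by
      intro r h0 h1
      calc ‖z + r • u - x₀‖ = ‖(z - x₀) + r • u‖ := by congr 1; abel
        _ ≤ ‖z - x₀‖ + ‖r • u‖ := norm_add_le _ _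
        _ ≤ ‖z - x₀‖ + R * ‖u‖ := by rw [norm_smul, Real.norm_of_nonneg h0]; gcongr
        _ = _ := by rw [hRu]
    refine ⟨R, hR0, ?_, fun r h0 h1 => by linarith [hnorm r h0 h1]⟩
    have := hup (z + R • u - x₀) (by linarith [hnorm R hR0.le le_rfl]) ?_
    · rwa [add_sub_cancel] at this
    · have h1 : det2 b (z + R • u - x₀) = det2 b (z - x₀) + R * det2 b u := by
        rw [← det2_smul, ← det2_add]; congr 1; abel
      have h2 := (abs_le.1 (abs_det2_le b (z - x₀))).1
      have h3 : κ * (ρ' / 2) < R * det2 b u := by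
        rw [← hRu]; nlinarith
      have h4 : 2 * ‖b‖ * ‖z - x₀‖ ≤ 2 * ‖b‖ * ρ := by gcongr
      have h5 : κ / 2 * ‖z + R • u - x₀‖ ≤ κ / 2 * (ρ + ρ' / 2) := by
        gcongr; linarith [hnorm R hR0.le le_rfl]
      rw [h1]
      nlinarith

end

/-! ### Corners and cusps of the patch boundary. -/

section

open Set Metric Filter Topology

/-- The difference of points of two arcs that meet at a corner is not in the cone of directions
that cross both arcs. -/
lemma not_mem_cone_of_flat {a b u₀ w v : Fin 2 → ℝ} {m κ δ τ τ' : ℝ} (hm0 : 0 < m)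
    (hma : m ≤ det2 a u₀) (hmb : m ≤ det2 b u₀) (hκ0 : 0 < κ)
    (hδm : 4 * ‖u₀‖ * δ ≤ m) (hδN : 16 * ‖u₀‖ * (‖a‖ + ‖b‖) * δ ≤ κ * m) (hτ : 0 < τ) (hτ' : 0 < τ')
    (hen : ‖w - (τ • b + τ' • a)‖ ≤ δ * (τ + τ')) {w' : Fin 2 → ℝ} (hww : w' = -w)
    (hw : v = w ∨ v = w') (hv1 : κ * ‖v‖ < det2 a v) (hv2 : κ * ‖v‖ < det2 b v) : False := by
  set e := w - (τ • b + τ' • a) with he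
  set N := ‖a‖ + ‖b‖ with hN
  have hp : 0 < τ + τ' := by linarith
  have hzy : w = τ • b + τ' • a + e := by rw [he]; abel
  have hvn : ‖v‖ = ‖w‖ := by
    rcases hw with rfl | rfl
    · rfl
    · rw [hww, norm_neg]
  have hbe : |det2 b e| ≤ 2 * N * (δ * (τ + τ')) := (abs_det2_le b e).trans (by
    gcongr; rw [hN]; linarith [norm_nonneg a])
  have hae : |det2 a e| ≤ 2 * N * (δ * (τ + τ')) := (abs_det2_le a e).trans (by
    gcongr; rw [hN]; linarith [norm_nonneg b])
  have hda : det2 a w = τ * det2 a b + det2 a e := by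
    rw [hzy, det2_add, det2_add, det2_smul, det2_smul, det2_self]; ring
  have hdb : det2 b w = -(τ' * det2 a b) + det2 b e := by
    rw [hzy, det2_add, det2_add, det2_smul, det2_smul, det2_self, det2_swap b a]; ring
  -- Both arcs leave the corner on definite sides of the line along `u₀`, so their contributions to
  -- `det2 u₀ w` do not cancel. This bounds `‖w‖` from below by a multiple of `τ + τ'`.
  have hlow : m / 2 * (τ + τ') ≤ 2 * ‖u₀‖ * ‖v‖ := by
    have h1 := abs_det2_le u₀ w
    have h2 : det2 u₀ w = -(τ * det2 b u₀ + τ' * det2 a u₀) + det2 u₀ e := by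
      rw [hzy, det2_add, det2_add, det2_smul, det2_smul, det2_swap b, det2_swap a]; ring
    have h3 : |det2 u₀ e| ≤ 2 * ‖u₀‖ * (δ * (τ + τ')) := (abs_det2_le u₀ e).trans (by gcongr)
    have h4 : m * (τ + τ') ≤ τ * det2 b u₀ + τ' * det2 a u₀ := by
      have e1 : τ * m ≤ τ * det2 b u₀ := by gcongr
      have e2 : τ' * m ≤ τ' * det2 a u₀ := by gcongr
      linarith
    have h5 : 2 * ‖u₀‖ * (δ * (τ + τ')) ≤ m / 2 * (τ + τ') := by
      have : 4 * ‖u₀‖ * δ * (τ + τ') ≤ m * (τ + τ') := by gcongr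
      linarith
    rw [hvn]
    linarith [(abs_le.1 h1).1, (abs_le.1 h3).2]
  -- Since `det2 a b` enters `det2 a w` and `det2 b w` with opposite signs, one of the two is at
  -- most the error term, whatever the sign of `det2 a b`; likewise for `-w`.
  have hup : κ * ‖v‖ < 2 * N * (δ * (τ + τ')) := by
    rcases hw with rfl | rfl
    · rcases le_total (det2 a b) 0 with h | h
      · linarith [(abs_le.1 hae).2, mul_nonpos_of_nonneg_of_nonpos hτ.le h]
      · linarith [(abs_le.1 hbe).2, mul_nonneg hτ'.le h]
    · rw [hww, det2_neg, norm_neg] at hv1 hv2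
      rw [hww, norm_neg]
      rcases le_total (det2 a b) 0 with h | h
      · linarith [(abs_le.1 hbe).1, mul_nonpos_of_nonneg_of_nonpos hτ'.le h]
      · linarith [(abs_le.1 hae).1, mul_nonneg hτ.le h]
  have h6 : κ * (m / 2 * (τ + τ')) ≤ κ * (2 * ‖u₀‖ * ‖v‖) := by gcongr
  have h7 : 2 * ‖u₀‖ * (κ * ‖v‖) ≤ 2 * ‖u₀‖ * (2 * N * (δ * (τ + τ'))) := by gcongr
  have h8 : 16 * ‖u₀‖ * N * δ * (τ + τ') ≤ κ * m * (τ + τ') := by gcongr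
  have h9 : 0 < κ * m * (τ + τ') := by positivity
  linarith

namespace MultipatchSurface

variable {ι ε : Type*} {d : ℕ} (S : MultipatchSurface ι ε d)

/-- On the boundary of one patch the parameters in `[0, 1)` are unique, and the only further
parameter of a point is the end `1` of the preceding side. -/
lemma curve_eq_cases {s s' : ε × Bool} {t t' : ℝ} (hp : S.patch s' = S.patch s)
    (ht : t ∈ Ico (0 : ℝ) 1) (ht' : t' ∈ Icc (0 : ℝ) 1) (h : S.curve s' t' = S.curve s t) :
    (s' = s ∧ t' = t) ∨ (t' = 1 ∧ S.next s' = s ∧ t = 0) := by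
  rcases ht'.2.lt_or_eq with h1 | h1
  · exact Or.inl (S.curve_inj s' s t' t hp ⟨ht'.1, h1⟩ ht h)
  · subst h1
    obtain ⟨h2, h3⟩ := S.curve_inj (S.next s') s 0 t (by rw [S.next_patch, hp]) (by simp) ht
      (by rw [S.next_start, h])
    exact Or.inr ⟨rfl, h2, h3.symm⟩

/-- At each boundary point one arc arrives and one arc leaves. -/
lemma exists_arcs [Finite ε] {i : ι} {x₀ : Fin 2 → ℝ} (hx₀ : x₀ ∈ frontier (S.dom i)) :
    ∃ sA tA sB tB, S.patch sA = i ∧ S.patch sB = i ∧ tA ∈ Icc (0 : ℝ) 1 ∧ tB ∈ Icc (0 : ℝ) 1 ∧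
      S.curve sA tA = x₀ ∧ S.curve sB tB = x₀ ∧ ∀ η > 0, ∃ ρ > 0, ∀ z ∈ frontier (S.dom i),
        ‖z - x₀‖ < ρ → (∃ t ∈ Ioo (0 : ℝ) 1, tA - η < t ∧ t < tA ∧ z = S.curve sA t) ∨
          (∃ t ∈ Ioo (0 : ℝ) 1, tB < t ∧ t < tB + η ∧ z = S.curve sB t) ∨ z = x₀ := by
  have hcorner : ∀ s, S.patch s = i → S.curve s 0 = x₀ →
    ∃ sA tA sB tB, S.patch sA = i ∧ S.patch sB = i ∧ tA ∈ Icc (0 : ℝ) 1 ∧ tB ∈ Icc (0 : ℝ) 1 ∧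
      S.curve sA tA = x₀ ∧ S.curve sB tB = x₀ ∧ ∀ η > 0, ∃ ρ > 0, ∀ z ∈ frontier (S.dom i),
        ‖z - x₀‖ < ρ → (∃ t ∈ Ioo (0 : ℝ) 1, tA - η < t ∧ t < tA ∧ z = S.curve sA t) ∨
          (∃ t ∈ Ioo (0 : ℝ) 1, tB < t ∧ t < tB + η ∧ z = S.curve sB t) ∨ z = x₀ := by
    intro s hs hsx
    have hend : S.curve (S.next.symm s) 1 = x₀ := by
      rw [← S.next_start, Equiv.apply_symm_apply, hsx]
    refine ⟨S.next.symm s, 1, s, 0, ?_, hs, by simp, by simp, hend, hsx, fun η hη => ?_⟩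
    · rw [← S.next_patch, Equiv.apply_symm_apply, hs]
    obtain ⟨ρ, hρ, h⟩ := S.exists_frontier_near i x₀ (show 0 < min η 1 by positivity)
    refine ⟨ρ, hρ, fun z hz hzx => ?_⟩
    obtain ⟨s', hs', t₀, ht₀, hst, t, ht, htt, hzt⟩ := h z hz hzx
    have h1 := htt.trans_le (min_le_left _ _)
    have h2 := htt.trans_le (min_le_right _ _)
    rcases S.curve_eq_cases (hs'.trans hs.symm) (show (0 : ℝ) ∈ Ico (0 : ℝ) 1 by simp) ht₀
      (hst.trans hsx.symm) with ⟨rfl, rfl⟩ | ⟨rfl, h3, -⟩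
    · rcases ht.1.lt_or_eq with h0 | h0
      · right; left
        rw [sub_zero, abs_of_pos h0] at h1 h2
        exact ⟨t, ⟨h0, h2⟩, h0, by linarith, hzt⟩
      · right; right; rw [hzt, ← h0, hsx]
    · have hs'' : s' = S.next.symm s := by rw [← h3, Equiv.symm_apply_apply]
      subst hs''
      rcases ht.2.lt_or_eq with h0 | h0
      · left
        rw [abs_sub_comm, abs_of_pos (by linarith)] at h1 h2
        exact ⟨t, ⟨by linarith, h0⟩, by linarith, h0, hzt⟩
      · right; right; rw [hzt, h0, hend]
  have hx := hx₀
  rw [S.frontier_eq] at hx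
  simp only [mem_iUnion, exists_prop] at hx
  obtain ⟨s, hs, t, ht, hst⟩ := hx
  rcases ht.1.eq_or_lt with h0 | h0
  · subst h0; exact hcorner s hs hst
  rcases ht.2.eq_or_lt with h1 | h1
  · subst h1
    exact hcorner (S.next s) ((S.next_patch s).trans hs) (by rw [S.next_start, hst])
  -- At an interior parameter the arriving and the leaving arc belong to the same side.
  refine ⟨s, t, s, t, hs, hs, ht, ht, hst, hst, fun η hη => ?_⟩
  obtain ⟨ρ, hρ, h⟩ := S.exists_frontier_near i x₀
    (show 0 < min η (min t (1 - t)) from lt_min hη (lt_min h0 (by linarith)))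
  refine ⟨ρ, hρ, fun z hz hzx => ?_⟩
  obtain ⟨s', hs', t₀, ht₀, hst', t', ht', htt, hzt⟩ := h z hz hzx
  have g1 := abs_lt.1 (htt.trans_le (min_le_left _ _))
  have g2 := abs_lt.1 (htt.trans_le ((min_le_right _ _).trans (min_le_left _ _)))
  have g3 := abs_lt.1 (htt.trans_le ((min_le_right _ _).trans (min_le_right _ _)))
  rcases S.curve_eq_cases (hs'.trans (Eq.symm hs)) ⟨ht.1, h1⟩ ht₀
      (hst'.trans hst.symm) with ⟨rfl, rfl⟩ | ⟨-, -, h3⟩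
  · rcases lt_trichotomy t' t₀ with h4 | h4 | h4
    · left; exact ⟨t', ⟨by linarith, by linarith⟩, by linarith, h4, hzt⟩
    · right; right; rw [hzt, h4, hst']
    · right; left; exact ⟨t', ⟨by linarith, by linarith⟩, h4, by linarith, hzt⟩
  · linarith

/-- At a boundary point the patch is either a cusp or contains cones. -/
lemma isThinAt_or_hasLocalCone [Finite ε] {i : ι} {x₀ : Fin 2 → ℝ}
    (hx₀ : x₀ ∈ frontier (S.dom i)) : IsThinAt (S.dom i) x₀ ∨ HasLocalCone (S.dom i) x₀ := by
  obtain ⟨sA, tA, sB, tB, hsA, hsB, htA, htB, hxA, hxB, hnear⟩ := S.exists_arcs hx₀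
  set a := deriv (S.curve sA) tA with ha
  set b := deriv (S.curve sB) tB with hb
  have ha0 : a ≠ 0 := S.curve_regular sA tA htA
  have hb0 : b ≠ 0 := S.curve_regular sB tB htB
  have han : 0 < ‖a‖ := norm_pos_iff.2 ha0
  have hbn : 0 < ‖b‖ := norm_pos_iff.2 hb0
  -- flat arcs
  have hflat : ∀ δ > 0, ∃ ρ > 0, ∃ A B : Set (Fin 2 → ℝ),
      (∀ z ∈ frontier (S.dom i), ‖z - x₀‖ < ρ → z ∈ A ∨ z ∈ B ∨ z = x₀) ∧
      (∀ y ∈ insert x₀ A, ∀ z ∈ insert x₀ A, ∃ τ : ℝ, ‖(y - z) - τ • a‖ ≤ δ * |τ|) ∧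
      (∀ y ∈ insert x₀ B, ∀ z ∈ insert x₀ B, ∃ τ : ℝ, ‖(y - z) - τ • b‖ ≤ δ * |τ|) ∧
      (∀ y ∈ A, ∃ τ : ℝ, 0 < τ ∧ ‖(y - x₀) + τ • a‖ ≤ δ * τ) ∧
      (∀ y ∈ B, ∃ τ : ℝ, 0 < τ ∧ ‖(y - x₀) - τ • b‖ ≤ δ * τ) ∧
      (∀ z ∈ A, ∀ u, 2 * δ * ‖u‖ < det2 a u → ∀ᶠ r in 𝓝[>] (0 : ℝ), z - r • u ∉ S.dom i) ∧
      (∀ z ∈ B, ∀ u, 2 * δ * ‖u‖ < det2 b u → ∀ᶠ r in 𝓝[>] (0 : ℝ), z - r • u ∉ S.dom i) := by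
    intro δ hδ
    obtain ⟨ηA, hηA, hA1, hA2⟩ := S.exists_curve_flat sA tA hδ
    obtain ⟨ηB, hηB, hB1, hB2⟩ := S.exists_curve_flat sB tB hδ
    obtain ⟨ρ, hρ, hn⟩ := hnear (min ηA ηB) (lt_min hηA hηB)
    have hmA : ∀ y ∈ insert x₀ {z | ∃ t ∈ Ioo (0 : ℝ) 1, tA - min ηA ηB < t ∧ t < tA ∧
        z = S.curve sA t}, ∃ t, |t - tA| < ηA ∧ y = S.curve sA t := by
      rintro y (rfl | ⟨t, -, h1, h2, rfl⟩)
      · exact ⟨tA, by simpa using hηA, hxA.symm⟩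
      · refine ⟨t, ?_, rfl⟩
        rw [abs_sub_comm, abs_of_pos (by linarith)]
        linarith [min_le_left ηA ηB]
    have hmB : ∀ y ∈ insert x₀ {z | ∃ t ∈ Ioo (0 : ℝ) 1, tB < t ∧ t < tB + min ηA ηB ∧
        z = S.curve sB t}, ∃ t, |t - tB| < ηB ∧ y = S.curve sB t := by
      rintro y (rfl | ⟨t, -, h1, h2, rfl⟩)
      · exact ⟨tB, by simpa using hηB, hxB.symm⟩
      · refine ⟨t, ?_, rfl⟩
        rw [abs_of_pos (by linarith)]
        linarith [min_le_right ηA ηB]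
    have hcross : ∀ (s : ε × Bool) (t t₀ : ℝ), S.patch s = i → t ∈ Ioo (0 : ℝ) 1 →
        ‖deriv (S.curve s) t - deriv (S.curve s) t₀‖ ≤ δ →
        ∀ u, 2 * δ * ‖u‖ < det2 (deriv (S.curve s) t₀) u →
        ∀ᶠ r in 𝓝[>] (0 : ℝ), S.curve s t - r • u ∉ S.dom i := by
      intro s t t₀ hs ht hd u hu
      have hpos : 0 < det2 (deriv (S.curve s) t) u := by
        have h1 := abs_det2_le (deriv (S.curve s) t - deriv (S.curve s) t₀) u
        rw [det2_sub_left] at h1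
        have h2 : 2 * ‖deriv (S.curve s) t - deriv (S.curve s) t₀‖ * ‖u‖ ≤ 2 * δ * ‖u‖ := by gcongr
        linarith [(abs_le.1 h1).1]
      filter_upwards [S.eventually_left s ht hpos] with r hr
      rw [hs] at hr; exact hr.2
    refine ⟨ρ, hρ, _, _, hn, ?_, ?_, ?_, ?_, ?_, ?_⟩
    · intro y hy z hz
      obtain ⟨t, ht, rfl⟩ := hmA y hy
      obtain ⟨t', ht', rfl⟩ := hmA z hz
      exact ⟨t - t', hA1 t t' ht ht'⟩
    · intro y hy z hz
      obtain ⟨t, ht, rfl⟩ := hmB y hy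
      obtain ⟨t', ht', rfl⟩ := hmB z hz
      exact ⟨t - t', hB1 t t' ht ht'⟩
    · rintro y ⟨t, h0, h1, h2, rfl⟩
      have h3 := hA1 t tA (by rw [abs_sub_comm, abs_of_pos (by linarith)]
                              linarith [min_le_left ηA ηB]) (by simpa using hηA)
      refine ⟨tA - t, by linarith, ?_⟩
      rw [hxA, abs_sub_comm, abs_of_pos (by linarith)] at h3
      convert h3 using 2; module
    · rintro y ⟨t, h0, h1, h2, rfl⟩
      have h3 := hB1 t tB (by rw [abs_of_pos (by linarith)]
                              linarith [min_le_right ηA ηB]) (by simpa using hηB)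
      refine ⟨t - tB, by linarith, ?_⟩
      rw [hxB, abs_of_pos (by linarith)] at h3
      exact h3
    · rintro z ⟨t, h0, h1, h2, rfl⟩ u hu
      exact hcross sA t tA hsA h0 (hA2 t (by rw [abs_sub_comm, abs_of_pos (by linarith)]
                                             linarith [min_le_left ηA ηB])) u hu
    · rintro z ⟨t, h0, h1, h2, rfl⟩ u hu
      exact hcross sB t tB hsB h0 (hB2 t (by rw [abs_of_pos (by linarith)]
                                             linarith [min_le_right ηA ηB])) u hu
  clear hnear
  rcases exists_det2_pos_or_antiparallel ha0 hb0 with ⟨u₀, hau, hbu⟩ | ⟨r, hr, hab⟩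
  -- Directions near `u₀` point to the left of both tangents, so they cross both arcs into the
  -- patch. With respect to the cone `C` of such directions the two arcs together form an antichain.
  · right
    set m := min (det2 a u₀) (det2 b u₀) with hm
    have hm0 : 0 < m := lt_min hau hbu
    have hu0 : 0 < ‖u₀‖ := by
      rw [norm_pos_iff]; rintro rfl; simp [det2] at hau
    set N := ‖a‖ + ‖b‖ with hN
    set κ := m / (2 * ‖u₀‖) with hκ
    have hκ0 : 0 < κ := by positivity
    have hκu : κ * ‖u₀‖ = m / 2 := by rw [hκ]; field_simp
    obtain ⟨δ, hδ0, hδa, hδb, hδκ, hδm, hδN⟩ : ∃ δ > 0, δ ≤ ‖a‖ / 2 ∧ δ ≤ ‖b‖ / 2 ∧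
        4 * δ ≤ κ ∧ 4 * ‖u₀‖ * δ ≤ m ∧ 16 * ‖u₀‖ * N * δ ≤ κ * m := by
      refine ⟨min (min (‖a‖ / 2) (‖b‖ / 2)) (min (κ / 4) (min (m / (4 * ‖u₀‖))
        (κ * m / (16 * ‖u₀‖ * N)))), by positivity, ?_, ?_, ?_, ?_, ?_⟩
      · exact (min_le_left _ _).trans (min_le_left _ _)
      · exact (min_le_left _ _).trans (min_le_right _ _)
      · have := (min_le_right (min (‖a‖ / 2) (‖b‖ / 2)) (min (κ / 4) (min (m / (4 * ‖u₀‖))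
          (κ * m / (16 * ‖u₀‖ * N))))).trans (min_le_left _ _)
        linarith
      · rw [mul_comm, ← le_div_iff₀ (by positivity)]
        exact (min_le_right _ _).trans ((min_le_right _ _).trans (min_le_left _ _))
      · rw [mul_comm, ← le_div_iff₀ (by positivity)]
        exact (min_le_right _ _).trans ((min_le_right _ _).trans (min_le_right _ _))
    obtain ⟨ρ, hρ, A, B, hfr, hA, hB, hA', hB', hcA, hcB⟩ := hflat δ hδ0
    set C : Set (Fin 2 → ℝ) := {u | κ * ‖u‖ < det2 a u} ∩ {u | κ * ‖u‖ < det2 b u} with hC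
    have hanti : ∀ c v : Fin 2 → ℝ, (∃ τ : ℝ, ‖v - τ • c‖ ≤ δ * |τ|) → δ ≤ ‖c‖ / 2 →
        ¬ κ * ‖v‖ < det2 c v := by
      rintro c v ⟨τ, hτ⟩ hc hv
      have h1 := abs_det2_le_of_flat hδ0.le hc hτ
      have h2 : 4 * δ * ‖v‖ ≤ κ * ‖v‖ := by gcongr
      linarith [le_abs_self (det2 c v)]
    have hmix : ∀ y ∈ A, ∀ z ∈ B, ∀ v, (v = z - y ∨ v = y - z) → v ∉ C := by
      rintro y hy z hz v hv ⟨hv1, hv2⟩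
      obtain ⟨τ', hτ', hy'⟩ := hA' y hy
      obtain ⟨τ, hτ, hz'⟩ := hB' z hz
      have hp : 0 < τ + τ' := by linarith
      refine not_mem_cone_of_flat (a := a) (b := b) (u₀ := u₀) (m := m) (κ := κ) (δ := δ) hm0
        (min_le_left _ _) (min_le_right _ _) hκ0 hδm hδN hτ hτ' ?_ (neg_sub z y).symm hv hv1 hv2
      calc ‖(z - y) - (τ • b + τ' • a)‖ = ‖(z - x₀ - τ • b) - (y - x₀ + τ' • a)‖ := by
            congr 1; abel
        _ ≤ ‖z - x₀ - τ • b‖ + ‖y - x₀ + τ' • a‖ := norm_sub_le _ _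
        _ ≤ _ := by linarith
    refine HasLocalCone.of_cone (C := C) ((isOpen_det2_cone a κ).inter (isOpen_det2_cone b κ))
      (n := u₀) ⟨?_, ?_⟩ (fun u hu r hr => ⟨smul_mem_det2_cone hu.1 hr, smul_mem_det2_cone hu.2 hr⟩)
      hρ fun x hx hxρ => ?_
    · show κ * ‖u₀‖ < det2 a u₀
      linarith [min_le_left (det2 a u₀) (det2 b u₀)]
    · show κ * ‖u₀‖ < det2 b u₀
      linarith [min_le_right (det2 a u₀) (det2 b u₀)]
    have hκC : ∀ u, ∀ c, κ * ‖u‖ < det2 c u → 2 * δ * ‖u‖ < det2 c u := by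
      intro u c hu
      have : 2 * δ * ‖u‖ ≤ κ * ‖u‖ := by gcongr; linarith
      linarith
    -- Both arcs are crossed inwards. Hence the family crossed outwards is empty, and the condition
    -- on returning segments is vacuous.
    refine cone_segments (S.dom_open i) le_rfl (A := ∅) (B := A ∪ B) (C := C)
      (fun u hu r hr => ⟨smul_mem_det2_cone hu.1 hr, smul_mem_det2_cone hu.2 hr⟩)
      (fun u hu v hv => ⟨add_mem_det2_cone hκ0.le hu.1 hv.1, add_mem_det2_cone hκ0.le hu.2 hv.2⟩)
      (fun z hz hzρ => ?_) ?_ ?_ (by simp) ?_ (by simp) hx hxρ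
    · rcases hfr z hz hzρ with h | h | h <;> simp [h]
    · rintro y hy z hz ⟨h, -⟩
      simp only [insert_empty_eq, mem_singleton_iff] at hy hz
      subst hy; subst hz
      simp [det2] at h
    · have hin : ∀ y ∈ insert x₀ (A ∪ B), y ∈ insert x₀ A ∨ y ∈ B := by
        rintro y (h | h | h)
        · exact Or.inl (Or.inl h)
        · exact Or.inl (Or.inr h)
        · exact Or.inr h
      intro y hy z hz hyz
      rcases hin y hy with hy | hy <;> rcases hin z hz with hz | hz
      · exact hanti a _ (hA y hy z hz) hδa hyz.1
      · rcases hy with hy | hy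
        · exact hanti b _ (hB y (Or.inl hy) z (Or.inr hz)) hδb hyz.2
        · exact hmix y hy z hz _ (Or.inr rfl) hyz
      · rcases hz with hz | hz
        · exact hanti b _ (hB y (Or.inr hy) z (Or.inl hz)) hδb hyz.2
        · exact hmix z hz y hy _ (Or.inl rfl) hyz
      · exact hanti b _ (hB y (Or.inr hy) z (Or.inr hz)) hδb hyz.2
    · rintro z (hz | hz) - u hu
      · exact hcA z hz u (hκC u a hu.1)
      · exact hcB z hz u (hκC u b hu.2)
  · -- antiparallel tangents
    -- Here both arcs issue from `x₀` along the same ray, and the frontier lies in a narrow double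
    -- cone about it. If the patch is not thin, it has a point outside of the double cone and
    -- therefore contains a whole complementary sector: the cusp belongs to the complement.
    by_cases hthin : IsThinAt (S.dom i) x₀
    · exact Or.inl hthin
    right
    rw [IsThinAt] at hthin
    push Not at hthin
    obtain ⟨κ₀, hκ₀, hnot⟩ := hthin b hb0
    set κ := min κ₀ (‖b‖ / 4) with hκdef
    have hκ0 : 0 < κ := by positivity
    have hκb : 4 * κ ≤ ‖b‖ := by linarith [min_le_right κ₀ (‖b‖ / 4)]
    have hdab : ∀ v, det2 a v = -(r * det2 b v) := by
      intro v; rw [hab, det2_swap, det2_smul, det2_swap v b]; ring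
    obtain ⟨δ, hδ0, hδa, hδb, hδκ, hδr⟩ : ∃ δ > 0, δ ≤ ‖a‖ / 2 ∧ δ ≤ ‖b‖ / 2 ∧
        4 * δ ≤ κ ∧ 4 * δ ≤ κ * r := by
      refine ⟨min (min (‖a‖ / 2) (‖b‖ / 2)) (min (κ / 4) (κ * r / 4)), by positivity, ?_, ?_, ?_, ?_⟩
      · exact (min_le_left _ _).trans (min_le_left _ _)
      · exact (min_le_left _ _).trans (min_le_right _ _)
      · have := (min_le_right (min (‖a‖ / 2) (‖b‖ / 2)) (min (κ / 4) (κ * r / 4))).trans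
          (min_le_left _ _)
        linarith
      · have := (min_le_right (min (‖a‖ / 2) (‖b‖ / 2)) (min (κ / 4) (κ * r / 4))).trans
          (min_le_right _ _)
        linarith
    obtain ⟨ρ, hρ, A, B, hfr, hA, hB, -, -, hcA, hcB⟩ := hflat δ hδ0
    have hAκ : ∀ y ∈ insert x₀ A, ∀ z ∈ insert x₀ A, |det2 b (y - z)| ≤ κ * ‖y - z‖ := by
      intro y hy z hz
      obtain ⟨τ, hτ⟩ := hA y hy z hz
      have h1 := abs_det2_le_of_flat hδ0.le hδa hτ
      rw [hdab, abs_neg, abs_mul, abs_of_pos hr] at h1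
      have h2 : 4 * δ * ‖y - z‖ ≤ κ * r * ‖y - z‖ := by gcongr
      have h3 : r * |det2 b (y - z)| ≤ r * (κ * ‖y - z‖) := by linarith
      exact le_of_mul_le_mul_left h3 hr
    have hBκ : ∀ y ∈ insert x₀ B, ∀ z ∈ insert x₀ B, |det2 b (y - z)| ≤ κ * ‖y - z‖ := by
      intro y hy z hz
      obtain ⟨τ, hτ⟩ := hB y hy z hz
      have h1 := abs_det2_le_of_flat hδ0.le hδb hτ
      have h2 : 4 * δ * ‖y - z‖ ≤ κ * ‖y - z‖ := by gcongr
      linarith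
    have hfree : ∀ z ∈ frontier (S.dom i), ‖z - x₀‖ < ρ → |det2 b (z - x₀)| ≤ κ * ‖z - x₀‖ := by
      intro z hz hzρ
      rcases hfr z hz hzρ with h | h | h
      · exact hAκ z (Or.inr h) x₀ (Or.inl rfl)
      · exact hBκ z (Or.inr h) x₀ (Or.inl rfl)
      · subst h; simp [det2]
    -- a cone that meets the patch is contained in it
    have hcone : ∀ c : Fin 2 → ℝ, (∀ v, |det2 c v| = |det2 b v|) →
        (∃ x ∈ S.dom i, ‖x - x₀‖ < ρ ∧ κ * ‖x - x₀‖ < det2 c (x - x₀)) →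
        ∀ v, ‖v‖ < ρ → κ * ‖v‖ < det2 c v → x₀ + v ∈ S.dom i := by
      rintro c hc ⟨x, hx, hxρ, hxκ⟩ v hv hvκ
      have hconv := (convex_det2_cone_ball c hκ0.le ρ).isPreconnected.image (fun v => x₀ + v)
        (by fun_prop)
      refine IsPreconnected.subset_of_disjoint_frontier' hconv (S.dom_open i) ?_
        ⟨x, ⟨x - x₀, ⟨hxρ, hxκ⟩, by simp⟩, hx⟩ ⟨v, ⟨hv, hvκ⟩, rfl⟩
      rintro _ ⟨w, ⟨hw, hwκ⟩, rfl⟩ hwf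
      have := hfree _ hwf (by simpa using hw)
      rw [add_sub_cancel_left, ← hc] at this
      linarith [le_abs_self (det2 c w)]
    obtain ⟨x, hx, hxρ, hxκ⟩ := hnot ρ hρ
    have hxκ' : κ * ‖x - x₀‖ < |det2 b (x - x₀)| :=
      lt_of_le_of_lt (by gcongr; exact min_le_left _ _) hxκ
    have hwide : ∀ v : Fin 2 → ℝ, 2 * κ * ‖v‖ = κ * ‖v‖ + κ * ‖v‖ := fun v => by ring
    have hnn : ∀ v : Fin 2 → ℝ, 0 ≤ κ * ‖v‖ := fun v => by positivity
    have hδu : ∀ v : Fin 2 → ℝ, 2 * δ * ‖v‖ ≤ κ * ‖v‖ := fun v => by gcongr; linarith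
    have hδr' : ∀ v : Fin 2 → ℝ, 2 * δ * ‖v‖ ≤ r * (κ * ‖v‖) := fun v => by
      have : 2 * δ * ‖v‖ ≤ κ * r * ‖v‖ :=
        mul_le_mul_of_nonneg_right (by linarith) (norm_nonneg _)
      linarith
    rcases le_total 0 (det2 b (x - x₀)) with h | h
    · rw [abs_of_nonneg h] at hxκ'
      -- The width is doubled so that the half width at which the sector has to lie in the patch is
      -- `κ`.
      refine HasLocalCone.of_cusp (S.dom_open i) (b := b) (A := A) (B := B) (κ := 2 * κ)
        (by positivity) (by linarith) hρ hfr ?_ ?_ ?_ ?_ ?_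
      · intro y hy z hz; linarith [hAκ y hy z hz, hwide (y - z), hnn (y - z)]
      · intro y hy z hz; linarith [hBκ y hy z hz, hwide (y - z), hnn (y - z)]
      · rintro z hz - u hu
        have := hcA z hz (-u) (by
          rw [norm_neg, hdab, det2_neg]
          nlinarith [hδr' u, hwide u, hnn u])
        simpa using this
      · rintro z hz - u hu
        exact hcB z hz u (by linarith [hδu u, hwide u, hnn u])
      · intro v hv hvκ
        exact hcone b (fun _ => rfl) ⟨x, hx, hxρ, hxκ'⟩ v hv (by linarith)
    · have hneg : ∀ v, det2 (-b) v = -det2 b v := fun v => by rw [det2_swap, det2_neg, det2_swap v]; ring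
      rw [abs_of_nonpos h] at hxκ'
      -- In the opposite sector the tangent changes its sign and the two arcs exchange their roles.
      refine HasLocalCone.of_cusp (S.dom_open i) (b := -b) (A := B) (B := A) (κ := 2 * κ)
        (by positivity) (by rw [norm_neg]; linarith) hρ (fun z hz hzρ => ?_) ?_ ?_ ?_ ?_ ?_
      · rcases hfr z hz hzρ with h | h | h <;> simp [h]
      · intro y hy z hz
        rw [hneg, abs_neg]; linarith [hBκ y hy z hz, hwide (y - z), hnn (y - z)]
      · intro y hy z hz
        rw [hneg, abs_neg]; linarith [hAκ y hy z hz, hwide (y - z), hnn (y - z)]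
      · rintro z hz - u hu
        rw [hneg] at hu
        have := hcB z hz (-u) (by
          rw [norm_neg, det2_neg]
          linarith [hδu u, hwide u, hnn u])
        simpa using this
      · rintro z hz - u hu
        rw [hneg] at hu
        exact hcA z hz u (by rw [hdab]; nlinarith [hδr' u, hwide u, hnn u])
      · intro v hv hvκ
        exact hcone (-b) (fun v => by rw [hneg, abs_neg]) ⟨x, hx, hxρ, by rwa [hneg]⟩ v hv
          (by linarith)

end MultipatchSurface

end

section

open Set Metric Filter Topology MeasureTheory

/-! ### The uniform cone condition -/

/-- Each point of `Ω` is the vertex of a truncated cone in `Ω`, with finitely many cones up to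
translation. -/
def UniformCone (Ω : Set (Fin 2 → ℝ)) : Prop :=
  ∃ D : Finset (Fin 2 → ℝ), ∃ η > 0, ∀ x ∈ Ω, ∃ e ∈ D, ∀ y, ‖y - e‖ < η →
    ∀ r ∈ Icc (0 : ℝ) 1, x + r • y ∈ Ω

lemma Finset.exists_pos_le {α : Type*} (t : Finset α) (f : α → ℝ) (hf : ∀ x ∈ t, 0 < f x) :
    ∃ η > 0, ∀ x ∈ t, η ≤ f x := by
  classical
  induction t using Finset.induction_on with
  | empty => exact ⟨1, one_pos, by simp⟩
  | insert a t ha ih =>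
    obtain ⟨η, hη, h⟩ := ih fun x hx => hf x (Finset.mem_insert_of_mem hx)
    refine ⟨min η (f a), lt_min hη (hf a (Finset.mem_insert_self a t)), fun x hx => ?_⟩
    rcases Finset.mem_insert.1 hx with rfl | hx
    · exact min_le_right _ _
    · exact (min_le_left _ _).trans (h x hx)

/-- By compactness finitely many local cones serve all points near the frontier. The rest of the
closure is compact in `Ω`, so a ball of fixed radius about each of its points lies in `Ω`; this is
the cone with axis `0`. -/
lemma UniformCone.of_local {Ω : Set (Fin 2 → ℝ)} (hΩ : IsOpen Ω) (hb : Bornology.IsBounded Ω)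
    (h : ∀ x ∈ frontier Ω, HasLocalCone Ω x) : UniformCone Ω := by
  classical
  have hcl : IsCompact (closure Ω) := hb.isCompact_closure
  have hfr : IsCompact (frontier Ω) := hcl.of_isClosed_subset isClosed_frontier frontier_subset_closure
  choose! ρ hρ e η hη hcone using h
  obtain ⟨t, htf, hcov⟩ := hfr.elim_nhds_subcover (fun x => ball x (ρ x))
    fun x hx => ball_mem_nhds x (hρ x hx)
  set K := closure Ω \ ⋃ x ∈ t, ball x (ρ x) with hK
  have hKc : IsCompact K := hcl.diff (isOpen_biUnion fun x _ => isOpen_ball)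
  have hKΩ : K ⊆ Ω := by
    rintro x ⟨hx, hx'⟩
    by_contra hn
    exact hx' (hcov (by rw [hΩ.frontier_eq]; exact ⟨hx, hn⟩))
  obtain ⟨δ, hδ, hthick⟩ := hKc.exists_thickening_subset_open hΩ hKΩ
  obtain ⟨η₀, hη₀, hle⟩ := t.exists_pos_le η fun x hx => hη x (htf x hx)
  refine ⟨insert 0 (t.image e ∪ t.image fun x => -e x), min η₀ δ, lt_min hη₀ hδ, fun x hx => ?_⟩
  by_cases hxt : x ∈ ⋃ x ∈ t, ball x (ρ x)
  · simp only [mem_iUnion, exists_prop] at hxt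
    obtain ⟨z, hz, hxz⟩ := hxt
    rw [mem_ball, dist_eq_norm] at hxz
    rcases hcone z (htf z hz) x hx hxz with H | H
    · refine ⟨e z, ?_, fun y hy => H y (hy.trans_le ((min_le_left _ _).trans (hle z hz)))⟩
      exact Finset.mem_insert_of_mem (Finset.mem_union_left _ (Finset.mem_image_of_mem _ hz))
    · refine ⟨-e z, ?_, fun y hy => H y ?_⟩
      · exact Finset.mem_insert_of_mem (Finset.mem_union_right _ (Finset.mem_image.2 ⟨z, hz, rfl⟩))
      · rw [sub_neg_eq_add] at hy
        exact hy.trans_le ((min_le_left _ _).trans (hle z hz))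
  · refine ⟨0, Finset.mem_insert_self _ _, fun y hy r hr => hthick ?_⟩
    rw [mem_thickening_iff]
    refine ⟨x, ⟨subset_closure hx, hxt⟩, ?_⟩
    rw [dist_eq_norm, add_sub_cancel_left, norm_smul, Real.norm_of_nonneg hr.1]
    rw [sub_zero] at hy
    calc r * ‖y‖ ≤ 1 * ‖y‖ := by gcongr; exact hr.2
      _ < δ := by rw [one_mul]; exact hy.trans_le (min_le_right _ _)

/-! ### The grid -/

lemma mem_gridElement_iff {h : ℝ} {o : Fin 2 → ℝ} {K : Fin 2 → ℤ} {x : Fin 2 → ℝ} :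
    x ∈ gridElement h o K ↔ ∀ k, o k + h * K k ≤ x k ∧ x k ≤ o k + h * (K k + 1) := by
  simp only [gridElement, mem_Icc, Pi.le_def]
  exact ⟨fun H k => ⟨H.1 k, H.2 k⟩, fun H => ⟨fun k => (H k).1, fun k => (H k).2⟩⟩

lemma mem_gridElement_floor {h : ℝ} (hh : 0 < h) (o x : Fin 2 → ℝ) :
    x ∈ gridElement h o (fun k => ⌊(x k - o k) / h⌋) := by
  rw [mem_gridElement_iff]
  intro k
  have h1 := Int.floor_le ((x k - o k) / h)
  have h2 := (Int.lt_floor_add_one ((x k - o k) / h)).le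
  rw [le_div_iff₀ hh] at h1
  rw [div_le_iff₀ hh] at h2
  constructor <;> nlinarith

lemma isClosed_gridElement (h : ℝ) (o : Fin 2 → ℝ) (K : Fin 2 → ℤ) : IsClosed (gridElement h o K) :=
  isClosed_Icc

/-- The linear map with rows `rot b` and `b` takes the set to a translated rectangle of area `4 * α
* β`, and its determinant is, up to sign, the Euclidean square of `b`. -/
lemma volume_thin_le (b x₀ : Fin 2 → ℝ) (hb : b ≠ 0) {α β : ℝ} (hα : 0 ≤ α) (hβ : 0 ≤ β) :
    volume {x : Fin 2 → ℝ | |det2 b (x - x₀)| ≤ α ∧ |b 0 * (x - x₀) 0 + b 1 * (x - x₀) 1| ≤ β} ≤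
      ENNReal.ofReal (4 * α * β / ‖b‖ ^ 2) := by
  set M : Matrix (Fin 2) (Fin 2) ℝ := !![-(b 1), b 0; b 0, b 1] with hM
  have hdet : LinearMap.det (Matrix.toLin' M) = -det2 b (rot b) := by
    rw [LinearMap.det_toLin', hM, Matrix.det_fin_two_of]
    simp [det2, rot]; ring
  have hpos := det2_rot_pos hb
  have hset : {x : Fin 2 → ℝ | |det2 b (x - x₀)| ≤ α ∧
      |b 0 * (x - x₀) 0 + b 1 * (x - x₀) 1| ≤ β} =
      (fun x => x + -x₀) ⁻¹' (Matrix.toLin' M ⁻¹' Icc ![-α, -β] ![α, β]) := by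
    ext x
    simp only [mem_ofPred_eq, mem_preimage, mem_Icc, Pi.le_def, Fin.forall_fin_two, Matrix.toLin'_apply,
      abs_le, det2, hM, ← sub_eq_add_neg]
    simp [Matrix.mulVec, dotProduct, Fin.sum_univ_two]
    constructor
    · rintro ⟨⟨h1, h2⟩, h3, h4⟩; refine ⟨⟨?_, ?_⟩, ?_, ?_⟩ <;> linarith
    · rintro ⟨⟨h1, h2⟩, h3, h4⟩; refine ⟨⟨?_, ?_⟩, ?_, ?_⟩ <;> linarith
  rw [hset, measure_preimage_add_right, Measure.addHaar_preimage_linearMap _ (by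
    rw [hdet]; linarith), hdet, Real.volume_Icc_pi, Fin.prod_univ_two]
  simp only [Matrix.cons_val_zero, Matrix.cons_val_one, sub_neg_eq_add]
  rw [← ENNReal.ofReal_mul (by linarith), ← ENNReal.ofReal_mul (abs_nonneg _)]
  apply ENNReal.ofReal_le_ofReal
  rw [abs_inv, abs_neg, abs_of_pos hpos, inv_mul_eq_div]
  have hb' : 0 < ‖b‖ := norm_pos_iff.2 hb
  have := sq_norm_le_det2_rot b
  rw [show (α + α) * (β + β) = 4 * α * β by ring]
  gcongr

namespace MultipatchSurface

variable {ι ε : Type*} {d : ℕ} (S : MultipatchSurface ι ε d)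

lemma isBounded_dom (i : ι) : Bornology.IsBounded (S.dom i) :=
  (isBounded_Icc 0 1).subset (S.dom_subset i)

/-- An open subset of the closed unit square avoids the lower and left edges. Therefore
`activeElements`, whose index range leaves out elements that touch the square only there, misses no
element that meets the patch. -/
lemma dom_pos {i : ι} {x : Fin 2 → ℝ} (hx : x ∈ S.dom i) (k : Fin 2) : 0 < x k := by
  have hc : Tendsto (fun r : ℝ => x - r • (1 : Fin 2 → ℝ)) (𝓝[>] 0) (𝓝 x) := by
    have : Continuous fun r : ℝ => x - r • (1 : Fin 2 → ℝ) := by fun_prop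
    have := this.tendsto 0
    simp only [zero_smul, sub_zero] at this
    exact this.mono_left nhdsWithin_le_nhds
  obtain ⟨r, hr, hr0⟩ := ((hc.eventually ((S.dom_open i).mem_nhds hx)).and
    self_mem_nhdsWithin).exists
  have := (S.dom_subset i hr).1 k
  have hr0 : 0 < r := hr0
  simp at this
  linarith

lemma mem_activeElements {h : ℝ} (hh : 0 < h) {o : ι → Fin 2 → ℝ} {i : ι} {K : Fin 2 → ℤ} :
    K ∈ S.activeElements h o i ↔ (gridElement h (o i) K ∩ S.dom i).Nonempty := by
  classical
  rw [activeElements, Finset.mem_filter, and_iff_right_iff_imp]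
  rintro ⟨x, hxK, hx⟩
  rw [Fintype.mem_piFinset]
  intro k
  rw [mem_gridElement_iff] at hxK
  have h1 := (S.dom_subset i hx).2 k
  have h0 := S.dom_pos hx k
  simp only [Pi.one_apply] at h1
  obtain ⟨h2, h3⟩ := hxK k
  rw [Finset.mem_Icc]
  constructor
  · rw [← Int.lt_add_one_iff, Int.floor_lt, div_lt_iff₀ hh]
    push_cast; nlinarith
  · rw [Int.le_floor, le_div_iff₀ hh]
    nlinarith

lemma exists_active_of_mem_closure {h : ℝ} (hh : 0 < h) {o : ι → Fin 2 → ℝ} {i : ι}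
    {x : Fin 2 → ℝ} (hx : x ∈ closure (S.dom i)) :
    ∃ K ∈ S.activeElements h o i, x ∈ gridElement h (o i) K := by
  have hcl : IsClosed (⋃ K ∈ S.activeElements h o i, gridElement h (o i) K) :=
    (S.activeElements h o i).finite_toSet.isClosed_biUnion fun K _ => isClosed_gridElement _ _ _
  have hsub : S.dom i ⊆ ⋃ K ∈ S.activeElements h o i, gridElement h (o i) K := by
    intro y hy
    refine mem_biUnion (x := fun k => ⌊(y k - o i k) / h⌋) ?_ (mem_gridElement_floor hh _ _)
    exact (S.mem_activeElements hh).2 ⟨y, mem_gridElement_floor hh _ _, hy⟩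
  have := closure_minimal hsub hcl hx
  simpa using this

/-- The patch geometry condition excludes cusps on fine meshes. -/
lemma not_patchGeometry_of_isThinAt {i : ι} {x₀ : Fin 2 → ℝ} (hx₀ : x₀ ∈ frontier (S.dom i))
    (hthin : IsThinAt (S.dom i) x₀) (l : ℕ) {c : ℝ} (hc : 0 < c) :
    ∃ h₀ > 0, ∀ h, 0 < h → h ≤ h₀ → ∀ o, ¬ S.PatchGeometry l c h o := by
  obtain ⟨b, hb, hthin⟩ := hthin
  have hbn : 0 < ‖b‖ := norm_pos_iff.2 hb
  set m : ℝ := l + 1 with hm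
  have hm0 : 0 < m := by positivity
  -- Elements within grid distance `l` of one that contains `x₀` lie within `m * h` of `x₀`. With
  -- this slope the part of the patch there is contained in a rectangle of area `c * h ^ 2 / 2`,
  -- which is too small.
  obtain ⟨ρ, hρ, hthin⟩ := hthin (c * ‖b‖ / (16 * m ^ 2)) (by positivity)
  refine ⟨ρ / (2 * m), by positivity, fun h hh hhρ o hpg => ?_⟩
  rw [le_div_iff₀ (by positivity)] at hhρ
  obtain ⟨K, hK, hxK⟩ := S.exists_active_of_mem_closure hh (o := o) (frontier_subset_closure hx₀)
  obtain ⟨K', hKK, harea⟩ := hpg i K hK ⟨x₀, hxK, hx₀⟩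
  have hsub : gridElement h (o i) K' ∩ S.dom i ⊆ {x | |det2 b (x - x₀)| ≤
      c * ‖b‖ / (16 * m ^ 2) * (m * h) ∧
      |b 0 * (x - x₀) 0 + b 1 * (x - x₀) 1| ≤ 2 * ‖b‖ * (m * h)} := by
    rintro x ⟨hx, hxd⟩
    rw [mem_gridElement_iff] at hx hxK
    have hn : ‖x - x₀‖ ≤ m * h := by
      rw [pi_norm_le_iff_of_nonneg (by positivity)]
      intro k
      obtain ⟨h1, h2⟩ := hx k
      obtain ⟨h3, h4⟩ := hxK k
      have h5 : |(K' k : ℝ) - K k| ≤ l := by exact_mod_cast hKK k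
      obtain ⟨h6, h7⟩ := abs_le.1 h5
      rw [Real.norm_eq_abs, Pi.sub_apply, abs_le, hm]
      constructor <;> nlinarith
    refine ⟨(hthin x hxd (by nlinarith)).trans (by gcongr), ?_⟩
    have h1 := abs_det2_le (rot b) (x - x₀)
    rw [norm_rot] at h1
    calc |b 0 * (x - x₀) 0 + b 1 * (x - x₀) 1| = |det2 (rot b) (x - x₀)| := by
          rw [← abs_neg]; congr 1; simp [det2, rot]; ring
      _ ≤ 2 * ‖b‖ * ‖x - x₀‖ := h1
      _ ≤ _ := by gcongr
  have hle := (measure_mono hsub).trans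
    (volume_thin_le b x₀ hb (by positivity) (by positivity))
  have := ENNReal.toReal_mono ENNReal.ofReal_ne_top hle
  rw [ENNReal.toReal_ofReal (by positivity)] at this
  have heq : 4 * (c * ‖b‖ / (16 * m ^ 2) * (m * h)) * (2 * ‖b‖ * (m * h)) / ‖b‖ ^ 2 =
      c * h ^ 2 / 2 := by field_simp; norm_num
  rw [heq] at this
  have : 0 < c * h ^ 2 := by positivity
  linarith

/-- Either all patches satisfy the uniform cone condition, or the patch geometry condition fails on
all fine meshes. -/
lemma uniformCone_or_not_patchGeometry [Finite ε] (l : ℕ) {c : ℝ} (hc : 0 < c) :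
    (∀ i, UniformCone (S.dom i)) ∨ ∃ h₀ > 0, ∀ h, 0 < h → h ≤ h₀ → ∀ o, ¬ S.PatchGeometry l c h o := by
  by_cases H : ∃ i, ∃ x ∈ frontier (S.dom i), IsThinAt (S.dom i) x
  · obtain ⟨i, x, hx, hthin⟩ := H
    exact Or.inr (S.not_patchGeometry_of_isThinAt hx hthin l hc)
  · push Not at H
    exact Or.inl fun i => UniformCone.of_local (S.dom_open i) (S.isBounded_dom i) fun x hx =>
      (S.isThinAt_or_hasLocalCone hx).resolve_left (H i x hx)

/-- Near its midpoint, each side is the edge of a strip in the patch. -/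
lemma exists_strip [Finite ε] (s : ε × Bool) : ∃ u : Fin 2 → ℝ, ∃ κ > 0, ∃ τ > 0, τ < 1 / 2 ∧
    ∀ t, |t - 1 / 2| ≤ τ → κ ≤ det2 (deriv (S.curve s) t) u ∧
      ∀ r : ℝ, 0 < r → r ≤ 1 → S.curve s t + r • u ∈ S.dom (S.patch s) := by
  set b := deriv (S.curve s) (1 / 2) with hb
  have hb0 : b ≠ 0 := S.curve_regular s (1 / 2) (by norm_num)
  set n := rot b with hn
  have hκ := det2_rot_pos hb0
  have hnn : 0 < ‖n‖ := by rw [hn, norm_rot]; exact norm_pos_iff.2 hb0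
  have hcont : Continuous fun t => det2 (deriv (S.curve s) t) n := by
    have := S.continuous_deriv_curve s
    unfold det2; fun_prop
  obtain ⟨η, hη, hη'⟩ := Metric.continuousAt_iff.1 (hcont.continuousAt (x := 1 / 2))
    (det2 b n / 2) (by rw [hn]; positivity)
  have hdet : ∀ t, |t - 1 / 2| < η → det2 b n / 2 ≤ det2 (deriv (S.curve s) t) n := by
    intro t ht
    have := @hη' t (by rwa [Real.dist_eq])
    rw [Real.dist_eq] at this
    have := (abs_lt.1 this).1
    linarith
  obtain ⟨ρ, hρ, hnear⟩ := S.exists_frontier_near (S.patch s) (S.curve s (1 / 2))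
    (show 0 < min η (1 / 4) by positivity)
  obtain ⟨τ, hτ, hτ'⟩ := Metric.continuousAt_iff.1 ((S.continuous_curve s).continuousAt (x := 1 / 2))
    (ρ / 2) (by positivity)
  set q := ρ / (4 * ‖n‖) with hq
  have hq0 : 0 < q := by positivity
  have hqn : q * ‖n‖ = ρ / 4 := by rw [hq]; field_simp
  refine ⟨q • n, q * (det2 b n / 2), by rw [hn]; positivity,
    min (τ / 2) (min (η / 2) (1 / 4)), by positivity, ?_, fun t ht => ?_⟩
  · have := (min_le_right (τ / 2) (min (η / 2) (1 / 4))).trans (min_le_right _ _)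
    linarith
  have ht1 : |t - 1 / 2| < τ := by linarith [ht.trans (min_le_left _ _)]
  have ht2 : |t - 1 / 2| < η := by
    linarith [ht.trans ((min_le_right _ _).trans (min_le_left _ _))]
  have ht3 := abs_le.1 (ht.trans ((min_le_right _ _).trans (min_le_right _ _)))
  have htI : t ∈ Ioo (0 : ℝ) 1 := ⟨by linarith, by linarith⟩
  have hd : ∀ t, |t - 1 / 2| < η → q * (det2 b n / 2) ≤ det2 (deriv (S.curve s) t) (q • n) := by
    intro t ht
    rw [det2_smul]; exact mul_le_mul_of_nonneg_left (hdet t ht) hq0.le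
  have hκ' : 0 < q * (det2 b n / 2) := by rw [hn]; positivity
  refine ⟨hd t ht2, fun r hr0 hr1 => ?_⟩
  -- The segment starts inside. Its first exit would be a point of the same side with a parameter
  -- near `1 / 2`, where `u` points into the patch; so the segment would have been outside just
  -- before the exit.
  by_contra hout
  obtain ⟨r₀, ⟨hr₀, -⟩, hr₀'⟩ := ((S.eventually_left s htI (hκ'.trans_le (hd t ht2))).and
    (Ioo_mem_nhdsGT hr0)).exists
  obtain ⟨r₁, h0, h1, hfr, hins⟩ := exists_first_exit (u := q • n) (R := r - r₀) (S.dom_open _) hr₀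
    (by linarith [hr₀'.2]) (by rwa [show S.curve s t + r₀ • q • n + (r - r₀) • q • n =
      S.curve s t + r • q • n by module])
  have hdist : ‖S.curve s t + r₀ • q • n + r₁ • q • n - S.curve s (1 / 2)‖ < ρ := by
    have e1 := @hτ' t (by rwa [Real.dist_eq])
    rw [dist_eq_norm] at e1
    calc ‖S.curve s t + r₀ • q • n + r₁ • q • n - S.curve s (1 / 2)‖
        = ‖(S.curve s t - S.curve s (1 / 2)) + (r₀ + r₁) • q • n‖ := by congr 1; module
      _ ≤ ‖S.curve s t - S.curve s (1 / 2)‖ + ‖(r₀ + r₁) • q • n‖ := norm_add_le _ _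
      _ = ‖S.curve s t - S.curve s (1 / 2)‖ + (r₀ + r₁) * (ρ / 4) := by
          rw [norm_smul, norm_smul, Real.norm_of_nonneg hq0.le, hqn,
            Real.norm_of_nonneg (by linarith [hr₀'.1])]
      _ < ρ := by nlinarith
  obtain ⟨s', hs', t₀, ht₀, hst, t', ht', htt, hz⟩ := hnear _ hfr hdist
  rcases S.curve_eq_cases hs' (t := 1 / 2) (by norm_num) ht₀ hst with ⟨rfl, rfl⟩ | ⟨-, -, h⟩
  · have g1 := htt.trans_le (min_le_left _ _)
    have g2 := abs_lt.1 (htt.trans_le (min_le_right _ _))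
    obtain ⟨w, ⟨-, hw⟩, hw'⟩ := ((S.eventually_left s' (t := t') ⟨by linarith, by linarith⟩
      (hκ'.trans_le (hd t' g1))).and (Ioo_mem_nhdsGT h0)).exists
    apply hw
    rw [← hz]
    have := hins (r₁ - w) (by linarith [hw'.2]) (by linarith [hw'.1])
    rwa [show S.curve s' t + r₀ • q • n + r₁ • q • n - w • q • n =
      S.curve s' t + r₀ • q • n + (r₁ - w) • q • n by module]
  · norm_num at h

end MultipatchSurface

end

section

open Set Metric Filter Topology MeasureTheory ENNReal

/-! ### A Poincaré inequality for functions with square-integrable gradient -/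

/-- `g` dominates the squared gradient of `w` along all segments in `Ω`. -/
def SqGrad (Ω : Set (Fin 2 → ℝ)) (w : (Fin 2 → ℝ) → ℝ) (g : (Fin 2 → ℝ) → ℝ≥0∞) : Prop :=
  ∀ x u, (∀ r ∈ Ioo (0 : ℝ) 1, x + r • u ∈ Ω) →
    ENNReal.ofReal ((w (x + u) - w x) ^ 2) ≤
      ENNReal.ofReal (‖u‖ ^ 2) * ∫⁻ r in Icc (0 : ℝ) 1, g (x + r • u)

lemma ofReal_sq_sub_le (a b c : ℝ) : ENNReal.ofReal ((a - c) ^ 2) ≤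
    2 * ENNReal.ofReal ((b - c) ^ 2) + 2 * ENNReal.ofReal ((b - a) ^ 2) := by
  rw [← ENNReal.ofReal_ofNat 2, ← ENNReal.ofReal_mul (by norm_num), ← ENNReal.ofReal_mul (by norm_num),
    ← ENNReal.ofReal_add (by positivity) (by positivity)]
  apply ENNReal.ofReal_le_ofReal
  nlinarith [sq_nonneg ((b - c) + (b - a))]

section

variable {Ω : Set (Fin 2 → ℝ)} {w : (Fin 2 → ℝ) → ℝ} {g : (Fin 2 → ℝ) → ℝ≥0∞}

/-- Tonelli's theorem and translation invariance. For this `g` is integrated over the whole plane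
and not only over `Ω`. -/
lemma lintegral_segment (hg : Measurable g) (u : Fin 2 → ℝ) :
    ∫⁻ x, ∫⁻ r in Icc (0 : ℝ) 1, g (x + r • u) = ∫⁻ x, g x := by
  rw [lintegral_lintegral_swap]
  · have : ∀ r : ℝ, ∫⁻ x, g (x + r • u) = ∫⁻ x, g x := fun r => lintegral_add_right_eq_self g _
    simp [this]
  · apply Measurable.aemeasurable
    exact hg.comp (by fun_prop)

lemma measurable_segment (hg : Measurable g) (u : Fin 2 → ℝ) :
    Measurable fun x => ∫⁻ r in Icc (0 : ℝ) 1, g (x + r • u) :=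
  Measurable.lintegral_prod_right' (f := fun q : (Fin 2 → ℝ) × ℝ => g (q.1 + q.2 • u))
    (hg.comp (by fun_prop))

/-- Transport of a mean square along a translation inside `Ω`. -/
lemma SqGrad.transport (h : SqGrad Ω w g) (hw : Measurable w) (hg : Measurable g) (m : ℝ)
    (u : Fin 2 → ℝ) {A B : Set (Fin 2 → ℝ)} (hB : MeasurableSet B)
    (hAB : ∀ x ∈ A, x + u ∈ B) (hseg : ∀ x ∈ A, ∀ r ∈ Ioo (0 : ℝ) 1, x + r • u ∈ Ω) :
    ∫⁻ x in A, ENNReal.ofReal ((w x - m) ^ 2) ≤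
      2 * (∫⁻ x in B, ENNReal.ofReal ((w x - m) ^ 2)) +
        2 * ENNReal.ofReal (‖u‖ ^ 2) * ∫⁻ x, g x := by
  have hf : Measurable fun x => ENNReal.ofReal ((w x - m) ^ 2) :=
    ((hw.sub_const m).pow_const 2).ennreal_ofReal
  have hfB : Measurable (B.indicator fun x => ENNReal.ofReal ((w x - m) ^ 2)) := hf.indicator hB
  have h1 : Measurable fun x => B.indicator (fun x => ENNReal.ofReal ((w x - m) ^ 2)) (x + u) :=
    hfB.comp (measurable_add_const u)
  have h2 := measurable_segment hg u
  calc ∫⁻ x in A, ENNReal.ofReal ((w x - m) ^ 2)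
      ≤ ∫⁻ x in A, (2 * B.indicator (fun x => ENNReal.ofReal ((w x - m) ^ 2)) (x + u) +
        2 * (ENNReal.ofReal (‖u‖ ^ 2) * ∫⁻ r in Icc (0 : ℝ) 1, g (x + r • u))) := by
        apply setLIntegral_mono ((h1.const_mul _).add ((h2.const_mul _).const_mul _))
        intro x hx
        show _ ≤ 2 * B.indicator (fun x => ENNReal.ofReal ((w x - m) ^ 2)) (x + u) +
          2 * (ENNReal.ofReal (‖u‖ ^ 2) * ∫⁻ r in Icc (0 : ℝ) 1, g (x + r • u))
        rw [indicator_of_mem (hAB x hx)]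
        refine (ofReal_sq_sub_le (w x) (w (x + u)) m).trans ?_
        gcongr
        exact h x u (hseg x hx)
    _ ≤ ∫⁻ x, (2 * B.indicator (fun x => ENNReal.ofReal ((w x - m) ^ 2)) (x + u) +
        2 * (ENNReal.ofReal (‖u‖ ^ 2) * ∫⁻ r in Icc (0 : ℝ) 1, g (x + r • u))) :=
        setLIntegral_le_lintegral _ _
    _ = _ := by
        rw [lintegral_add_left (h1.const_mul _), lintegral_const_mul _ h1,
          lintegral_add_right_eq_self (B.indicator fun x => ENNReal.ofReal ((w x - m) ^ 2)) u,
          lintegral_indicator hB, lintegral_const_mul _ (h2.const_mul _), lintegral_const_mul _ h2,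
          lintegral_segment hg, mul_assoc]

/-- Poincaré's inequality on a ball. -/
lemma SqGrad.ball (h : SqGrad Ω w g) (hw : Measurable w) (hg : Measurable g) {z : Fin 2 → ℝ} {r : ℝ}
    (hr : 0 < r) (hball : Metric.ball z r ⊆ Ω) :
    ∃ m, ∫⁻ x in Metric.ball z r, ENNReal.ofReal ((w x - m) ^ 2) ≤
      ENNReal.ofReal (4 * r ^ 2) * volume (Metric.ball (0 : Fin 2 → ℝ) (2 * r)) *
        (volume (Metric.ball z r))⁻¹ * ∫⁻ x, g x := by
  set B := Metric.ball z r
  set D := Metric.ball (0 : Fin 2 → ℝ) (2 * r)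
  have hBm : MeasurableSet B := measurableSet_ball
  have hDm : MeasurableSet D := measurableSet_ball
  have hB0 : volume B ≠ 0 := (measure_ball_pos volume z hr).ne'
  have hBt : volume B ≠ ⊤ := measure_ball_lt_top.ne
  -- The double integral of `(w y - w x) ^ 2` over the ball is bounded by the energy. The constant
  -- will be the value of `w` at a suitable point `x` rather than a mean value.
  set F : (Fin 2 → ℝ) → ℝ≥0∞ := fun x => ∫⁻ y in B, ENNReal.ofReal ((w y - w x) ^ 2) with hF
  have hsegm : Measurable fun q : (Fin 2 → ℝ) × (Fin 2 → ℝ) =>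
      ∫⁻ t in Icc (0 : ℝ) 1, g (q.1 + t • q.2) :=
    Measurable.lintegral_prod_right'
      (f := fun q : ((Fin 2 → ℝ) × (Fin 2 → ℝ)) × ℝ => g (q.1.1 + q.2 • q.1.2))
      (hg.comp (by fun_prop))
  have hpt : ∀ x ∈ B, F x ≤ ENNReal.ofReal (4 * r ^ 2) *
      ∫⁻ u in D, ∫⁻ t in Icc (0 : ℝ) 1, g (x + t • u) := by
    intro x hx
    have hme : Measurable (B.indicator fun y => ENNReal.ofReal ((w y - w x) ^ 2)) :=
      (((hw.sub_const _).pow_const 2).ennreal_ofReal).indicator hBm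
    have hm1 : Measurable fun u => ∫⁻ t in Icc (0 : ℝ) 1, g (x + t • u) :=
      hsegm.comp (measurable_const.prodMk measurable_id)
    calc F x = ∫⁻ y, B.indicator (fun y => ENNReal.ofReal ((w y - w x) ^ 2)) y := by
          rw [hF, lintegral_indicator hBm]
      _ = ∫⁻ u, B.indicator (fun y => ENNReal.ofReal ((w y - w x) ^ 2)) (x + u) :=
          (lintegral_add_left_eq_self _ x).symm
      _ ≤ ∫⁻ u, D.indicator (fun u => ENNReal.ofReal (4 * r ^ 2) *
            ∫⁻ t in Icc (0 : ℝ) 1, g (x + t • u)) u := by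
          apply lintegral_mono
          intro u
          by_cases hu : x + u ∈ B
          · have hn : ‖u‖ < 2 * r := by
              have e1 : ‖x + u - z‖ < r := by rw [← dist_eq_norm]; exact hu
              have e2 : ‖x - z‖ < r := by rw [← dist_eq_norm]; exact hx
              calc ‖u‖ = ‖(x + u - z) - (x - z)‖ := by congr 1; abel
                _ ≤ _ := norm_sub_le _ _
                _ < 2 * r := by linarith
            have huD : u ∈ D := mem_ball_zero_iff.2 hn
            simp only [indicator_of_mem hu, indicator_of_mem huD]
            refine (h x u fun t ht => hball ?_).trans ?_
            · have := convex_ball z r hx hu (show 0 ≤ 1 - t by linarith [ht.2]) ht.1.le (by ring)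
              convert this using 1; module
            · gcongr
              nlinarith [norm_nonneg u]
          · simp [indicator_of_notMem hu]
      _ = ∫⁻ u in D, ENNReal.ofReal (4 * r ^ 2) * ∫⁻ t in Icc (0 : ℝ) 1, g (x + t • u) :=
          lintegral_indicator hDm _
      _ = _ := lintegral_const_mul _ hm1
  have hmD : Measurable fun x => ∫⁻ u in D, ∫⁻ t in Icc (0 : ℝ) 1, g (x + t • u) :=
    Measurable.lintegral_prod_right' hsegm
  have htot : ∫⁻ x in B, F x ≤ ENNReal.ofReal (4 * r ^ 2) * (volume D * ∫⁻ x, g x) := by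
    calc ∫⁻ x in B, F x ≤ ∫⁻ x in B, ENNReal.ofReal (4 * r ^ 2) *
          ∫⁻ u in D, ∫⁻ t in Icc (0 : ℝ) 1, g (x + t • u) :=
          setLIntegral_mono (hmD.const_mul _) hpt
      _ ≤ ∫⁻ x, ENNReal.ofReal (4 * r ^ 2) *
          ∫⁻ u in D, ∫⁻ t in Icc (0 : ℝ) 1, g (x + t • u) := setLIntegral_le_lintegral _ _
      _ = ENNReal.ofReal (4 * r ^ 2) * ∫⁻ x, ∫⁻ u in D, ∫⁻ t in Icc (0 : ℝ) 1, g (x + t • u) :=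
          lintegral_const_mul _ hmD
      _ = ENNReal.ofReal (4 * r ^ 2) * ∫⁻ u in D, ∫⁻ x, ∫⁻ t in Icc (0 : ℝ) 1, g (x + t • u) := by
          rw [lintegral_lintegral_swap]; exact hsegm.aemeasurable
      _ = _ := by simp_rw [lintegral_segment hg]; simp [mul_comm]
  by_cases htop : ∫⁻ x, g x = ⊤
  · refine ⟨0, ?_⟩
    rw [htop, ENNReal.mul_top]
    · exact le_top
    · refine mul_ne_zero (mul_ne_zero ?_ ?_) (ENNReal.inv_ne_zero.2 hBt)
      · rw [Ne, ENNReal.ofReal_eq_zero, not_le]; positivity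
      · exact (measure_ball_pos volume _ (by positivity)).ne'
  have hfin : ∫⁻ x in B, F x ≠ ⊤ := by
    refine ne_top_of_le_ne_top ?_ htot
    exact ENNReal.mul_ne_top ENNReal.ofReal_ne_top (ENNReal.mul_ne_top measure_ball_lt_top.ne htop)
  -- At some point `F` does not exceed its average.
  obtain ⟨x, hx, hle⟩ := exists_le_setLAverage hB0 hBt (f := F) (by
    apply Measurable.aemeasurable
    exact Measurable.lintegral_prod_right' (f := fun q : (Fin 2 → ℝ) × (Fin 2 → ℝ) =>
      ENNReal.ofReal ((w q.2 - w q.1) ^ 2)) (by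
        exact (((hw.comp measurable_snd).sub (hw.comp measurable_fst)).pow_const 2).ennreal_ofReal))
  refine ⟨w x, hle.trans ?_⟩
  rw [setLAverage_eq, ENNReal.div_eq_inv_mul]
  calc (volume B)⁻¹ * ∫⁻ x in B, F x ≤
        (volume B)⁻¹ * (ENNReal.ofReal (4 * r ^ 2) * (volume D * ∫⁻ x, g x)) := by gcongr
    _ = _ := by ring

/-- Mean squares on compact subsets of a connected open set are controlled by those on a ball. -/
lemma SqGrad.compact (hΩ : IsOpen Ω) (hc : IsPreconnected Ω) {z₀ : Fin 2 → ℝ} {r₀ : ℝ} (hr₀ : 0 < r₀)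
    (hz₀ : z₀ ∈ Ω) {K : Set (Fin 2 → ℝ)} (hK : IsCompact K) (hKΩ : K ⊆ Ω) :
    ∃ C : ℝ≥0∞, C ≠ ⊤ ∧ ∀ w g, SqGrad Ω w g → Measurable w → Measurable g → ∀ m : ℝ,
      ∫⁻ x in K, ENNReal.ofReal ((w x - m) ^ 2) ≤
        C * ((∫⁻ x in Metric.ball z₀ r₀, ENNReal.ofReal ((w x - m) ^ 2)) + ∫⁻ x, g x) := by
  set P : Set (Fin 2 → ℝ) → Prop := fun A => ∃ C : ℝ≥0∞, C ≠ ⊤ ∧ ∀ w g, SqGrad Ω w g →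
    Measurable w → Measurable g → ∀ m : ℝ, ∫⁻ x in A, ENNReal.ofReal ((w x - m) ^ 2) ≤
      C * ((∫⁻ x in Metric.ball z₀ r₀, ENNReal.ofReal ((w x - m) ^ 2)) + ∫⁻ x, g x) with hP
  have hmono : ∀ {A B : Set (Fin 2 → ℝ)}, A ⊆ B → P B → P A := by
    rintro A B hAB ⟨C, hC, H⟩
    exact ⟨C, hC, fun w g h hw hg m => (lintegral_mono_set hAB).trans (H w g h hw hg m)⟩
  have hunion : ∀ {A B : Set (Fin 2 → ℝ)}, P A → P B → P (A ∪ B) := by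
    rintro A B ⟨C, hC, H⟩ ⟨C', hC', H'⟩
    refine ⟨C + C', ENNReal.add_ne_top.2 ⟨hC, hC'⟩, fun w g h hw hg m => ?_⟩
    refine (lintegral_union_le _ _ _).trans ?_
    rw [add_mul]
    exact add_le_add (H w g h hw hg m) (H' w g h hw hg m)
  -- A ball inherits the estimate from a ball of the same radius to which it can be translated
  -- inside `Ω`.
  have hball : ∀ {z z' : Fin 2 → ℝ} {R r : ℝ}, Metric.ball z R ⊆ Ω → dist z' z + r ≤ R → 0 < r →
      P (Metric.ball z' r) → P (Metric.ball z r) := by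
    rintro z z' R r hR hd hr ⟨C, hC, H⟩
    refine ⟨2 * C + 2 * ENNReal.ofReal (‖z' - z‖ ^ 2), ENNReal.add_ne_top.2
      ⟨ENNReal.mul_ne_top (by simp) hC, ENNReal.mul_ne_top (by simp) (by simp)⟩,
      fun w g h hw hg m => ?_⟩
    refine (h.transport hw hg m (z' - z) measurableSet_ball (B := Metric.ball z' r)
      (fun x hx => ?_) (fun x hx t ht => hR ?_)).trans ?_
    · rw [mem_ball, dist_eq_norm] at hx ⊢
      convert hx using 2; abel
    · rw [mem_ball, dist_eq_norm] at hx ⊢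
      rw [dist_eq_norm] at hd
      calc ‖x + t • (z' - z) - z‖ = ‖(x - z) + t • (z' - z)‖ := by congr 1; abel
        _ ≤ ‖x - z‖ + ‖t • (z' - z)‖ := norm_add_le _ _
        _ ≤ ‖x - z‖ + 1 * ‖z' - z‖ := by
          rw [norm_smul, Real.norm_of_nonneg ht.1.le]; gcongr; exact ht.2.le
        _ < R := by linarith
    · have h1 := H w g h hw hg m
      set X := ∫⁻ x in Metric.ball z₀ r₀, ENNReal.ofReal ((w x - m) ^ 2)
      set Y := ∫⁻ x, g x
      calc _ ≤ 2 * (C * (X + Y)) + 2 * ENNReal.ofReal (‖z' - z‖ ^ 2) * (X + Y) := by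
            gcongr; exact le_add_self
        _ = _ := by ring
  -- The points with a good ball around them form an open set that is closed relative to `Ω` by
  -- `hball` and contains `z₀`. As `Ω` is connected, every point of it is good.
  set G : Set (Fin 2 → ℝ) := {z | ∃ r > 0, P (Metric.ball z r)} with hG
  have hGo : IsOpen G := by
    rw [Metric.isOpen_iff]
    rintro z ⟨r, hr, hz⟩
    refine ⟨r / 2, by positivity, fun z' hz' => ⟨r / 2, by positivity, hmono ?_ hz⟩⟩
    apply ball_subset_ball'
    rw [mem_ball] at hz'; linarith
  have hsub : Ω ⊆ G := by
    by_contra hnot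
    obtain ⟨y, hyΩ, hyG⟩ := not_subset.1 hnot
    have hcl : ∀ z ∈ Ω, z ∈ closure G → z ∈ G := by
      intro z hz hzc
      obtain ⟨R, hR, hRΩ⟩ := Metric.isOpen_iff.1 hΩ z hz
      obtain ⟨z', ⟨r, hr, hPr⟩, hdz⟩ := Metric.mem_closure_iff.1 hzc (R / 2) (by positivity)
      refine ⟨min r (R / 2), by positivity, hball hRΩ (z' := z') ?_ (by positivity)
        (hmono (ball_subset_ball (min_le_left _ _)) hPr)⟩
      rw [dist_comm]; linarith [min_le_right r (R / 2)]
    obtain ⟨x, hx, hx1, hx2⟩ := hc G (closure G)ᶜ hGo isClosed_closure.isOpen_compl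
      (fun z hz => by
        by_cases h : z ∈ closure G
        · exact Or.inl (hcl z hz h)
        · exact Or.inr h)
      ⟨z₀, hz₀, r₀, hr₀, 1, by simp, fun w g h hw hg m => by rw [one_mul]; exact le_self_add⟩
      ⟨y, hyΩ, fun h => hyG (hcl y hyΩ h)⟩
    exact hx2 (subset_closure hx1)
  refine hK.induction_on (p := P) ⟨0, by simp, fun w g h hw hg m => by simp⟩
    (fun A B hAB hB => hmono hAB hB) (fun A B hA hB => hunion hA hB) (fun z hz => ?_)
  obtain ⟨r, hr, h⟩ := hsub (hKΩ hz)
  exact ⟨Metric.ball z r, mem_nhdsWithin_of_mem_nhds (ball_mem_nhds z hr), h⟩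

/-- Poincaré's inequality on a connected open set with the uniform cone condition. -/
theorem exists_poincare (hΩ : IsOpen Ω) (hc : IsConnected Ω) (hb : Bornology.IsBounded Ω)
    (hcone : UniformCone Ω) :
    ∃ C : ℝ≥0∞, C ≠ ⊤ ∧ ∀ w g, SqGrad Ω w g → Measurable w → Measurable g → ∃ m : ℝ,
      ∫⁻ x in Ω, ENNReal.ofReal ((w x - m) ^ 2) ≤ C * ∫⁻ x, g x := by
  obtain ⟨z₀, hz₀⟩ := hc.nonempty
  obtain ⟨r₀, hr₀, hball⟩ := Metric.isOpen_iff.1 hΩ z₀ hz₀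
  obtain ⟨D, η, hη, hD⟩ := hcone
  -- The cones end in the compact set `K`: if `e` is the axis of a cone with vertex `x`, the ball of
  -- radius `η` about `x + e` lies in `Ω`.
  set K : Set (Fin 2 → ℝ) := {z | Metric.ball z η ⊆ Ω} with hKdef
  have hKΩ : K ⊆ Ω := fun z hz => hz (mem_ball_self hη)
  have hKc : IsCompact K := by
    refine hb.isCompact_closure.of_isClosed_subset ?_ (hKΩ.trans subset_closure)
    rw [← isOpen_compl_iff, Metric.isOpen_iff]
    intro z hz
    obtain ⟨y, hy, hyΩ⟩ := not_subset.1 hz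
    rw [mem_ball] at hy
    refine ⟨η - dist y z, by linarith, fun z' hz' hsub => hyΩ (hsub ?_)⟩
    rw [mem_ball] at hz' ⊢
    calc dist y z' ≤ dist y z + dist z z' := dist_triangle _ _ _
      _ < η := by rw [dist_comm z]; linarith
  obtain ⟨C₁, hC₁, H₁⟩ := SqGrad.compact hΩ hc.isPreconnected hr₀ hz₀ hKc hKΩ
  set C₀ := ENNReal.ofReal (4 * r₀ ^ 2) * volume (Metric.ball (0 : Fin 2 → ℝ) (2 * r₀)) *
        (volume (Metric.ball z₀ r₀))⁻¹ with hC₀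
  have hC₀t : C₀ ≠ ⊤ := ENNReal.mul_ne_top (ENNReal.mul_ne_top ENNReal.ofReal_ne_top measure_ball_lt_top.ne)
    (ENNReal.inv_ne_top.2 (measure_ball_pos volume z₀ hr₀).ne')
  refine ⟨∑ e ∈ D, (2 * (C₁ * (C₀ + 1)) + 2 * ENNReal.ofReal (‖e‖ ^ 2)), ?_, fun w g h hw hg => ?_⟩
  · refine ENNReal.sum_ne_top.2 fun e _ => ENNReal.add_ne_top.2 ⟨?_, ?_⟩
    · exact ENNReal.mul_ne_top (by simp) (ENNReal.mul_ne_top hC₁ (ENNReal.add_ne_top.2 ⟨hC₀t, by simp⟩))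
    · exact ENNReal.mul_ne_top (by simp) (by simp)
  obtain ⟨m, hm⟩ := h.ball hw hg hr₀ hball
  refine ⟨m, ?_⟩
  -- These are the vertices of cones with axis `e`. Translation by `e` takes them into `K` along
  -- segments in `Ω`.
  set A : (Fin 2 → ℝ) → Set (Fin 2 → ℝ) := fun e =>
    {x | ∀ y, ‖y - e‖ < η → ∀ r ∈ Icc (0 : ℝ) 1, x + r • y ∈ Ω} with hA
  have hcov : Ω ⊆ ⋃ e : D, A e := by
    intro x hx
    obtain ⟨e, he, H⟩ := hD x hx
    exact mem_iUnion.2 ⟨⟨e, he⟩, H⟩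
  calc ∫⁻ x in Ω, ENNReal.ofReal ((w x - m) ^ 2)
      ≤ ∫⁻ x in ⋃ e : D, A e, ENNReal.ofReal ((w x - m) ^ 2) := lintegral_mono_set hcov
    _ ≤ ∑' e : D, ∫⁻ x in A e, ENNReal.ofReal ((w x - m) ^ 2) := lintegral_iUnion_le _ _
    _ = ∑ e ∈ D, ∫⁻ x in A e, ENNReal.ofReal ((w x - m) ^ 2) := by
        rw [tsum_fintype, Finset.sum_coe_sort D (fun e => ∫⁻ x in A e, ENNReal.ofReal ((w x - m) ^ 2))]
    _ ≤ ∑ e ∈ D, (2 * (C₁ * (C₀ + 1)) + 2 * ENNReal.ofReal (‖e‖ ^ 2)) * ∫⁻ x, g x := by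
        apply Finset.sum_le_sum
        intro e _
        have htr := h.transport hw hg m e (A := A e) (B := K) hKc.isClosed.measurableSet
          (fun x hx y hy => ?_) (fun x hx r hr => hx e (by simpa using hη) r ⟨hr.1.le, hr.2.le⟩)
        · refine htr.trans ?_
          rw [add_mul]
          gcongr ?_ + _
          have := H₁ w g h hw hg m
          calc 2 * ∫⁻ x in K, ENNReal.ofReal ((w x - m) ^ 2)
              ≤ 2 * (C₁ * (C₀ * (∫⁻ x, g x) + ∫⁻ x, g x)) := by
                gcongr 2 * ?_
                exact this.trans (by gcongr)
            _ = _ := by ring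
        · rw [mem_ball, dist_eq_norm] at hy
          have := hx (y - x) (by rwa [show y - x - e = y - (x + e) by abel]) 1 (by simp)
          simpa using this
    _ = _ := by rw [Finset.sum_mul]

end

end

section

open Set Metric Filter Topology MeasureTheory ENNReal

/-! ### Curves in the plane -/

lemma det_smulRight_add (v u : Fin 2 → ℝ) :
    ((ContinuousLinearMap.proj (R := ℝ) (φ := fun _ : Fin 2 => ℝ) 0).smulRight v +
      (ContinuousLinearMap.proj (R := ℝ) (φ := fun _ : Fin 2 => ℝ) 1).smulRight u).det = det2 v u := by
  have : ((((ContinuousLinearMap.proj (R := ℝ) (φ := fun _ : Fin 2 => ℝ) 0).smulRight v +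
      (ContinuousLinearMap.proj (R := ℝ) (φ := fun _ : Fin 2 => ℝ) 1).smulRight u) :
      (Fin 2 → ℝ) →L[ℝ] (Fin 2 → ℝ)) : (Fin 2 → ℝ) →ₗ[ℝ] (Fin 2 → ℝ)) =
      Matrix.toLin' !![v 0, u 0; v 1, u 1] := by
    apply LinearMap.ext
    intro y
    ext k
    fin_cases k <;> simp [Matrix.mulVec, dotProduct, Fin.sum_univ_two] <;> ring
  rw [ContinuousLinearMap.det, this, LinearMap.det_toLin', Matrix.det_fin_two_of, det2]
  ring

/-- Integration over a strip along a curve in coordinates adapted to the curve. -/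
lemma lintegral_strip_le {γ : ℝ → Fin 2 → ℝ} (hγ : Differentiable ℝ γ) (hγ' : Measurable γ)
    {u : Fin 2 → ℝ} {κ a b : ℝ} (hκ : 0 < κ) (hdet : ∀ t ∈ Icc a b, κ ≤ det2 (deriv γ t) u)
    {f : (Fin 2 → ℝ) → ℝ≥0∞} (hf : Measurable f) :
    ∫⁻ t in Icc a b, ∫⁻ r in Icc (0 : ℝ) 1, f (γ t + r • u) ≤
      ENNReal.ofReal κ⁻¹ * ∫⁻ x, f x := by
  set Φ : (Fin 2 → ℝ) → Fin 2 → ℝ := fun y => γ (y 0) + y 1 • u with hΦ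
  set s : Set (Fin 2 → ℝ) := MeasurableEquiv.finTwoArrow ⁻¹' (Icc a b ×ˢ Icc (0 : ℝ) 1) with hs
  have hsm : MeasurableSet s :=
    MeasurableEquiv.finTwoArrow.measurable (measurableSet_Icc.prod measurableSet_Icc)
  have hsI : ∀ y ∈ s, y 0 ∈ Icc a b := fun y hy => hy.1
  have hder : ∀ y ∈ s, HasFDerivWithinAt Φ
      ((ContinuousLinearMap.proj (R := ℝ) (φ := fun _ : Fin 2 => ℝ) 0).smulRight (deriv γ (y 0)) +
      (ContinuousLinearMap.proj (R := ℝ) (φ := fun _ : Fin 2 => ℝ) 1).smulRight u) s y := by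
    intro y _
    apply HasFDerivAt.hasFDerivWithinAt
    apply HasFDerivAt.add
    · have h1 : HasFDerivAt (fun y : Fin 2 → ℝ => y 0)
        (ContinuousLinearMap.proj (R := ℝ) (φ := fun _ : Fin 2 => ℝ) 0) y :=
        (ContinuousLinearMap.proj (R := ℝ) (φ := fun _ : Fin 2 => ℝ) 0).hasFDerivAt
      have h2 := (hγ (y 0)).hasDerivAt.hasFDerivAt.comp y h1
      refine h2.congr_fderiv (ContinuousLinearMap.ext fun z => ?_)
      simp
    · have h1 : HasFDerivAt (fun y : Fin 2 → ℝ => y 1)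
        (ContinuousLinearMap.proj (R := ℝ) (φ := fun _ : Fin 2 => ℝ) 1) y :=
        (ContinuousLinearMap.proj (R := ℝ) (φ := fun _ : Fin 2 => ℝ) 1).hasFDerivAt
      exact h1.smul_const u
  -- The determinant with `u` is not changed by adding multiples of `u`. Being strictly monotone
  -- along the curve, it recovers `t` from the point, so the coordinates of the strip are injective.
  have hmono : StrictMonoOn (fun t => det2 (γ t) u) (Icc a b) := by
    have hd : ∀ t, HasDerivAt (fun t => det2 (γ t) u) (det2 (deriv γ t) u) t := by
      intro t
      have h := hasDerivAt_pi.1 (hγ t).hasDerivAt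
      exact ((h 0).mul_const (u 1)).sub ((h 1).mul_const (u 0))
    apply strictMonoOn_of_deriv_pos (convex_Icc a b)
    · exact fun t _ => (hd t).continuousAt.continuousWithinAt
    · intro t ht
      rw [(hd t).deriv]
      exact hκ.trans_le (hdet t (interior_subset ht))
  have hu : u ≠ 0 ∨ s = ∅ := by
    rcases s.eq_empty_or_nonempty with h | ⟨y, hy⟩
    · exact Or.inr h
    · left; rintro rfl
      have := hdet _ (hsI y hy)
      simp [det2] at this; linarith
  have hinj : InjOn Φ s := by
    intro y hy z hz hyz
    have hu : u ≠ 0 := hu.resolve_right (nonempty_iff_ne_empty.1 ⟨y, hy⟩)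
    have hyz' : γ (y 0) + y 1 • u = γ (z 0) + z 1 • u := hyz
    have h0 : y 0 = z 0 := by
      apply hmono.injOn (hsI y hy) (hsI z hz)
      show det2 (γ (y 0)) u = det2 (γ (z 0)) u
      have e1 : det2 u (γ (y 0) + y 1 • u) = det2 u (γ (z 0) + z 1 • u) := by rw [hyz']
      rw [det2_add, det2_add, det2_smul, det2_smul, det2_self] at e1
      rw [det2_swap, det2_swap (γ (z 0))]; linarith
    rw [h0, _root_.add_right_inj] at hyz'
    have h1 : y 1 = z 1 := smul_left_injective ℝ hu hyz'
    ext k; fin_cases k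
    · exact h0
    · exact h1
  have hcv := lintegral_image_eq_lintegral_abs_det_fderiv_mul volume hsm hder hinj f
  have hfub : ∫⁻ y in s, f (Φ y) = ∫⁻ t in Icc a b, ∫⁻ r in Icc (0 : ℝ) 1, f (γ t + r • u) := by
    have hm : Measurable fun q : ℝ × ℝ => f (γ q.1 + q.2 • u) := hf.comp (by fun_prop)
    have h1 := (volume_preserving_finTwoArrow ℝ).setLIntegral_comp_preimage
      (measurableSet_Icc.prod measurableSet_Icc (s := Icc a b) (t := Icc (0 : ℝ) 1)) hm
    rw [Measure.volume_eq_prod, ← Measure.prod_restrict, lintegral_prod _ hm.aemeasurable] at h1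
    exact h1
  rw [← hfub]
  have hκt : ENNReal.ofReal κ ≠ ⊤ := ENNReal.ofReal_ne_top
  have hκ0 : ENNReal.ofReal κ ≠ 0 := by rw [Ne, ENNReal.ofReal_eq_zero, not_le]; exact hκ
  rw [ENNReal.ofReal_inv_of_pos hκ]
  rw [← ENNReal.div_eq_inv_mul, ENNReal.le_div_iff_mul_le (Or.inl hκ0) (Or.inl hκt), mul_comm]
  have hΦm : Measurable Φ := by rw [hΦ]; fun_prop
  calc ENNReal.ofReal κ * ∫⁻ y in s, f (Φ y) = ∫⁻ y in s, ENNReal.ofReal κ * f (Φ y) :=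
        (lintegral_const_mul _ (hf.comp hΦm)).symm
    _ ≤ ∫⁻ y in s, ENNReal.ofReal |((ContinuousLinearMap.proj (R := ℝ)
        (φ := fun _ : Fin 2 => ℝ) 0).smulRight (deriv γ (y 0)) +
        (ContinuousLinearMap.proj (R := ℝ) (φ := fun _ : Fin 2 => ℝ) 1).smulRight u).det| *
        f (Φ y) := by
        apply setLIntegral_mono' hsm
        intro y hy
        rw [det_smulRight_add]
        gcongr
        exact (hdet _ (hsI y hy)).trans (le_abs_self _)
    _ = ∫⁻ x in Φ '' s, f x := hcv.symm
    _ ≤ ∫⁻ x, f x := setLIntegral_le_lintegral _ _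

namespace MultipatchSurface

variable {ι ε : Type*} {d : ℕ} (S : MultipatchSurface ι ε d)

/-- A trace inequality on the middle part of a side. -/
lemma exists_trace_bound [Finite ε] (s : ε × Bool) : ∃ τ > 0, τ < 1 / 2 ∧ ∃ C : ℝ≥0∞, C ≠ ⊤ ∧
    ∀ w g, SqGrad (S.dom (S.patch s)) w g → Measurable w → Measurable g → ∀ m : ℝ,
      ∫⁻ t in Icc (1 / 2 - τ) (1 / 2 + τ), ENNReal.ofReal ((w (S.curve s t) - m) ^ 2) ≤
        C * ((∫⁻ x in S.dom (S.patch s), ENNReal.ofReal ((w x - m) ^ 2)) + ∫⁻ x, g x) := by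
  obtain ⟨u, κ, hκ, τ, hτ, hτ2, hstrip⟩ := S.exists_strip s
  set Ω := S.dom (S.patch s) with hΩ
  set γ := S.curve s with hγ
  have hI : ∀ t, t ∈ Icc (1 / 2 - τ) (1 / 2 + τ) → |t - 1 / 2| ≤ τ := by
    intro t ht; rw [abs_le]; constructor <;> linarith [ht.1, ht.2]
  have hγd : Differentiable ℝ γ := (S.curve_smooth s).differentiable (by simp)
  have hγm : Measurable γ := (S.continuous_curve s).measurable
  have hΩm : MeasurableSet Ω := (S.dom_open _).measurableSet
  refine ⟨τ, hτ, hτ2, 2 * (2 * ENNReal.ofReal κ⁻¹) +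
    2 * (ENNReal.ofReal (‖u‖ ^ 2) * ENNReal.ofReal (κ / 2)⁻¹), ?_, fun w g h hw hg m => ?_⟩
  · refine ENNReal.add_ne_top.2 ⟨?_, ?_⟩
    · exact ENNReal.mul_ne_top (by simp) (ENNReal.mul_ne_top (by simp) ENNReal.ofReal_ne_top)
    · exact ENNReal.mul_ne_top (by simp) (ENNReal.mul_ne_top ENNReal.ofReal_ne_top ENNReal.ofReal_ne_top)
  set F : (Fin 2 → ℝ) → ℝ≥0∞ := Ω.indicator fun x => ENNReal.ofReal ((w x - m) ^ 2) with hF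
  have hFm : Measurable F := (((hw.sub_const m).pow_const 2).ennreal_ofReal).indicator hΩm
  have hFi : ∫⁻ x, F x = ∫⁻ x in Ω, ENNReal.ofReal ((w x - m) ^ 2) := lintegral_indicator hΩm _
  -- `A ρ` is the mean square on the curve shifted by `ρ • u`. Some shift with `ρ ≥ 1 / 2` has at
  -- most the average over the strip, and the increments between it and the curve are controlled by
  -- `g`. The lower bound on `ρ` keeps the Jacobian of the strip in between above `κ / 2`.
  set A : ℝ → ℝ≥0∞ := fun ρ => ∫⁻ t in Icc (1 / 2 - τ) (1 / 2 + τ), F (γ t + ρ • u) with hA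
  have hFm2 : Measurable fun q : ℝ × ℝ => F (γ q.2 + q.1 • u) := hFm.comp (by fun_prop)
  have hAm : Measurable A := Measurable.lintegral_prod_right' hFm2
  have hAi : ∫⁻ ρ in Icc (1 / 2 : ℝ) 1, A ρ ≤ ENNReal.ofReal κ⁻¹ * ∫⁻ x, F x := by
    calc ∫⁻ ρ in Icc (1 / 2 : ℝ) 1, A ρ ≤ ∫⁻ ρ in Icc (0 : ℝ) 1, A ρ :=
          lintegral_mono_set (Icc_subset_Icc (by norm_num) le_rfl)
      _ = ∫⁻ t in Icc (1 / 2 - τ) (1 / 2 + τ), ∫⁻ ρ in Icc (0 : ℝ) 1, F (γ t + ρ • u) := by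
          rw [hA, lintegral_lintegral_swap]; exact hFm2.aemeasurable
      _ ≤ _ := lintegral_strip_le hγd hγm hκ (fun t ht => (hstrip t (hI t ht)).1) hFm
  have hvol : volume (Icc (1 / 2 : ℝ) 1) = ENNReal.ofReal (1 / 2) := by
    rw [Real.volume_Icc]; norm_num
  obtain ⟨ρ, hρ, hle⟩ := exists_le_setLAverage (μ := volume) (s := Icc (1 / 2 : ℝ) 1) (f := A)
    (by rw [hvol]; simp) (by rw [hvol]; simp) hAm.aemeasurable
  have hA2 : A ρ ≤ 2 * ENNReal.ofReal κ⁻¹ * ∫⁻ x in Ω, ENNReal.ofReal ((w x - m) ^ 2) := by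
    refine hle.trans ?_
    rw [setLAverage_eq, hvol, ENNReal.div_eq_inv_mul, ← ENNReal.ofReal_inv_of_pos (by norm_num), mul_assoc]
    have : ENNReal.ofReal (1 / 2)⁻¹ = 2 := by norm_num
    rw [this, ← hFi]
    gcongr
  have hρ0 : (0 : ℝ) < ρ := by linarith [hρ.1]
  have hgm : Measurable fun t => ∫⁻ r in Icc (0 : ℝ) 1, g (γ t + r • ρ • u) :=
    (measurable_segment hg (ρ • u)).comp hγm
  have hFm1 : Measurable fun t => F (γ t + ρ • u) := hFm.comp (by fun_prop)
  calc ∫⁻ t in Icc (1 / 2 - τ) (1 / 2 + τ), ENNReal.ofReal ((w (γ t) - m) ^ 2)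
      ≤ ∫⁻ t in Icc (1 / 2 - τ) (1 / 2 + τ), (2 * F (γ t + ρ • u) +
        2 * (ENNReal.ofReal (‖u‖ ^ 2) * ∫⁻ r in Icc (0 : ℝ) 1, g (γ t + r • ρ • u))) := by
        apply setLIntegral_mono' measurableSet_Icc
        intro t ht
        have hin := (hstrip t (hI t ht)).2
        have hFt : F (γ t + ρ • u) = ENNReal.ofReal ((w (γ t + ρ • u) - m) ^ 2) :=
          indicator_of_mem (hin ρ hρ0 hρ.2) _
        refine (ofReal_sq_sub_le (w (γ t)) (w (γ t + ρ • u)) m).trans ?_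
        rw [hFt]
        gcongr
        refine (h (γ t) (ρ • u) fun r hr => ?_).trans ?_
        · rw [smul_smul]
          exact hin _ (mul_pos hr.1 hρ0) (by nlinarith [hr.1, hr.2, hρ.2])
        · gcongr
          rw [norm_smul, Real.norm_of_nonneg hρ0.le]
          nlinarith [norm_nonneg u, hρ.2]
    _ = 2 * A ρ + 2 * (ENNReal.ofReal (‖u‖ ^ 2) *
        ∫⁻ t in Icc (1 / 2 - τ) (1 / 2 + τ), ∫⁻ r in Icc (0 : ℝ) 1, g (γ t + r • ρ • u)) := by
        rw [lintegral_add_left (hFm1.const_mul _), lintegral_const_mul _ hFm1,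
          lintegral_const_mul _ (hgm.const_mul _), lintegral_const_mul _ hgm]
    _ ≤ 2 * (2 * ENNReal.ofReal κ⁻¹ * ∫⁻ x in Ω, ENNReal.ofReal ((w x - m) ^ 2)) +
        2 * (ENNReal.ofReal (‖u‖ ^ 2) * (ENNReal.ofReal (κ / 2)⁻¹ * ∫⁻ x, g x)) := by
        gcongr
        apply lintegral_strip_le hγd hγm (by positivity) _ hg
        intro t ht
        rw [det2_smul]
        have := (hstrip t (hI t ht)).1
        have : κ / 2 ≤ 1 / 2 * det2 (deriv γ t) u := by linarith
        refine this.trans ?_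
        gcongr
        · linarith
        · exact hρ.1
    _ ≤ _ := by
        set X := ∫⁻ x in Ω, ENNReal.ofReal ((w x - m) ^ 2)
        set Y := ∫⁻ x, g x
        calc _ ≤ 2 * (2 * ENNReal.ofReal κ⁻¹ * (X + Y)) +
            2 * (ENNReal.ofReal (‖u‖ ^ 2) * (ENNReal.ofReal (κ / 2)⁻¹ * (X + Y))) := by
              gcongr
              · exact le_self_add
              · exact le_add_self
          _ = _ := by ring

/-- A side spends a parameter time of order `h` in each element. -/
lemma exists_volume_side_le (s : ε × Bool) : ∃ C : ℝ, 0 ≤ C ∧ ∀ h > 0, ∀ o K,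
    volume (Icc (0 : ℝ) 1 ∩ {t | S.curve s t ∈ gridElement h o K}) ≤ ENNReal.ofReal (C * h) := by
  -- Near each parameter a regular curve expands distances by at least `‖b‖ / 2`, so the parameters
  -- in one element have diameter at most `2 * h / ‖b‖`. By compactness finitely many such
  -- neighbourhoods suffice.
  refine isCompact_Icc.induction_on (p := fun A : Set ℝ => ∃ C : ℝ, 0 ≤ C ∧ ∀ h > 0, ∀ o K,
    volume (A ∩ {t | S.curve s t ∈ gridElement h o K}) ≤ ENNReal.ofReal (C * h))
    ⟨0, le_rfl, by simp⟩ ?_ ?_ ?_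
  · rintro A B hAB ⟨C, hC, H⟩
    exact ⟨C, hC, fun h hh o K => (measure_mono (inter_subset_inter_left _ hAB)).trans (H h hh o K)⟩
  · rintro A B ⟨C, hC, H⟩ ⟨C', hC', H'⟩
    refine ⟨C + C', by positivity, fun h hh o K => ?_⟩
    rw [union_inter_distrib_right, add_mul, ENNReal.ofReal_add (by positivity) (by positivity)]
    exact (measure_union_le _ _).trans (add_le_add (H h hh o K) (H' h hh o K))
  · intro t₀ ht₀
    set b := deriv (S.curve s) t₀ with hb
    have hb0 : 0 < ‖b‖ := norm_pos_iff.2 (S.curve_regular s t₀ ht₀)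
    obtain ⟨η, hη, hflat, -⟩ := S.exists_curve_flat s t₀ (show 0 < ‖b‖ / 2 by positivity)
    refine ⟨Metric.ball t₀ η, mem_nhdsWithin_of_mem_nhds (ball_mem_nhds _ hη), 2 / ‖b‖,
      by positivity, fun h hh o K => ?_⟩
    refine (Real.volume_le_diam _).trans (Metric.ediam_le ?_)
    rintro t ⟨ht, htK⟩ t' ⟨ht', htK'⟩
    rw [mem_ball, Real.dist_eq] at ht ht'
    have htK : S.curve s t ∈ gridElement h o K := htK
    have htK' : S.curve s t' ∈ gridElement h o K := htK'
    rw [mem_gridElement_iff] at htK htK'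
    have h1 := hflat t t' ht ht'
    have h2 : ‖S.curve s t - S.curve s t'‖ ≤ h := by
      rw [pi_norm_le_iff_of_nonneg hh.le]
      intro k
      rw [Real.norm_eq_abs, Pi.sub_apply, abs_le]
      constructor <;> nlinarith [htK k, htK' k]
    have h3 : |t - t'| * ‖b‖ ≤ h + ‖b‖ / 2 * |t - t'| := by
      calc |t - t'| * ‖b‖ = ‖(t - t') • b‖ := by rw [norm_smul, Real.norm_eq_abs]
        _ = ‖(S.curve s t - S.curve s t') - (S.curve s t - S.curve s t' - (t - t') • b)‖ := by
            congr 1; abel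
        _ ≤ _ := norm_sub_le _ _
        _ ≤ _ := by gcongr
    rw [edist_dist, Real.dist_eq]
    apply ENNReal.ofReal_le_ofReal
    rw [div_mul_eq_mul_div, le_div_iff₀ hb0]
    linarith

end MultipatchSurface

end

section

open Set MeasureTheory Polynomial

/-! ### Quadratic forms -/

/-- If the common kernel of finitely many functionals lies in the kernels of others, the sum of
squares of the latter is bounded by that of the former. -/
lemma exists_sum_sq_le {V I J : Type*} [AddCommGroup V] [Module ℝ V] (s : Finset I)
    (t : Finset J) (φ : I → V →ₗ[ℝ] ℝ) (ψ : J → V →ₗ[ℝ] ℝ)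
    (h : ∀ v, (∀ j ∈ t, ψ j v = 0) → ∀ i ∈ s, φ i v = 0) :
    ∃ C > 0, ∀ v, ∑ i ∈ s, φ i v ^ 2 ≤ C * ∑ j ∈ t, ψ j v ^ 2 := by
  -- A functional that vanishes on the common kernel of finitely many others is a linear combination
  -- of them, in any vector space. The constant comes from the Cauchy–Schwarz inequality.
  have hmem : ∀ i ∈ s, ∃ c : t → ℝ, ∀ v, φ i v = ∑ j, c j * ψ j v := by
    intro i hi
    have : φ i ∈ Submodule.span ℝ (Set.range fun j : t => ψ j) := by
      apply mem_span_of_iInf_ker_le_ker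
      intro v hv
      rw [Submodule.mem_iInf] at hv
      exact h v (fun j hj => hv ⟨j, hj⟩) i hi
    obtain ⟨c, hc⟩ := (Submodule.mem_span_range_iff_exists_fun ℝ).1 this
    exact ⟨c, fun v => by rw [← hc]; simp⟩
  choose! c hc using hmem
  refine ⟨∑ i ∈ s, ∑ j, c i j ^ 2 + 1, by positivity, fun v => ?_⟩
  have h0 : 0 ≤ ∑ j ∈ t, ψ j v ^ 2 := Finset.sum_nonneg fun _ _ => sq_nonneg _
  calc ∑ i ∈ s, φ i v ^ 2 ≤ ∑ i ∈ s, (∑ j, c i j ^ 2) * ∑ j ∈ t, ψ j v ^ 2 := by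
        apply Finset.sum_le_sum
        intro i hi
        rw [hc i hi, ← Finset.sum_coe_sort t fun j => ψ j v ^ 2]
        exact Finset.sum_mul_sq_le_sq_mul_sq _ _ _
    _ = (∑ i ∈ s, ∑ j, c i j ^ 2) * ∑ j ∈ t, ψ j v ^ 2 := by rw [Finset.sum_mul]
    _ ≤ _ := by gcongr; linarith

/-! ### Lagrange polynomials -/

/-- The Lagrange basis polynomials of the nodes `j / p`. -/
noncomputable def lag (p j : ℕ) : ℝ[X] :=
  Lagrange.basis (Finset.range (p + 1)) (fun j : ℕ => (j : ℝ) / p) j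

section

variable {p : ℕ}

lemma injOn_nodes (hp : 1 ≤ p) : Set.InjOn (fun j : ℕ => (j : ℝ) / p) (Finset.range (p + 1)) := by
  intro i _ j _ hij
  have : (0 : ℝ) < p := by exact_mod_cast hp
  simp only at hij
  rw [div_left_inj' this.ne'] at hij
  exact_mod_cast hij

lemma eval_lag (hp : 1 ≤ p) {i j : ℕ} (hi : i ∈ Finset.range (p + 1)) (hj : j ∈ Finset.range (p + 1)) :
    (lag p i).eval ((j : ℝ) / p) = if i = j then 1 else 0 := by
  split_ifs with h
  · subst h; exact Lagrange.eval_basis_self (injOn_nodes hp) hi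
  · exact Lagrange.eval_basis_of_ne (v := fun j : ℕ => (j : ℝ) / p) h hj

lemma degree_lag (hp : 1 ≤ p) {i : ℕ} (hi : i ∈ Finset.range (p + 1)) : (lag p i).degree = p := by
  have := Lagrange.degree_basis (injOn_nodes hp) hi
  simpa [lag] using this

lemma sum_lag (hp : 1 ≤ p) : ∑ j ∈ Finset.range (p + 1), lag p j = 1 :=
  Lagrange.sum_basis (injOn_nodes hp) ⟨0, by simp⟩

lemma degree_sum_lag_lt (hp : 1 ≤ p) (b : ℕ → ℝ) :
    (∑ j ∈ Finset.range (p + 1), C (b j) * lag p j).degree < ((p + 1 : ℕ) : WithBot ℕ) := by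
  rw [Polynomial.degree_lt_iff_coeff_zero]
  intro m hm
  rw [Polynomial.finsetSum_coeff]
  apply Finset.sum_eq_zero
  intro j hj
  rw [Polynomial.coeff_C_mul, Polynomial.coeff_eq_zero_of_degree_lt, mul_zero]
  rw [degree_lag hp hj]
  exact_mod_cast hm

lemma eval_sum_lag (hp : 1 ≤ p) (b : ℕ → ℝ) {i : ℕ} (hi : i ∈ Finset.range (p + 1)) :
    (∑ j ∈ Finset.range (p + 1), C (b j) * lag p j).eval ((i : ℝ) / p) = b i := by
  rw [Polynomial.eval_finsetSum, Finset.sum_eq_single i]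
  · rw [eval_mul, eval_C, eval_lag hp hi hi]; simp
  · intro j hj hji
    rw [eval_mul, eval_lag hp hj hi, if_neg hji, mul_zero]
  · exact fun h => absurd hi h

lemma eq_sum_lag (hp : 1 ≤ p) {P : ℝ[X]} (hP : P.degree < ((p + 1 : ℕ) : WithBot ℕ)) :
    P = ∑ j ∈ Finset.range (p + 1), C (P.eval ((j : ℝ) / p)) * lag p j := by
  have := Lagrange.eq_interpolate (injOn_nodes hp) (f := P) (by simpa using hP)
  rw [Lagrange.interpolate_apply] at this
  exact this

lemma eq_zero_of_eval_nodes (hp : 1 ≤ p) {P : ℝ[X]} (hP : P.degree < ((p + 1 : ℕ) : WithBot ℕ))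
    (h : ∀ j ∈ Finset.range (p + 1), P.eval ((j : ℝ) / p) = 0) : P = 0 := by
  rw [eq_sum_lag hp hP]
  exact Finset.sum_eq_zero fun j hj => by rw [h j hj]; simp

/-- The mean square of a polynomial on the unit interval controls its nodal values. -/
lemma exists_mass_le (hp : 1 ≤ p) : ∃ κ > 0, ∀ P : ℝ[X], P.degree < ((p + 1 : ℕ) : WithBot ℕ) →
    κ * ∑ j ∈ Finset.range (p + 1), P.eval ((j : ℝ) / p) ^ 2 ≤ ∫ t in (0 : ℝ)..1, P.eval t ^ 2 := by
  set R : (Fin (p + 1) → ℝ) → ℝ[X] := fun b => ∑ j, C (b j) * lag p j with hR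
  set Q : (Fin (p + 1) → ℝ) → ℝ := fun b => ∫ t in (0 : ℝ)..1, (R b).eval t ^ 2 with hQ
  have hQc : Continuous Q := by
    have : Q = fun b => ∑ i : Fin (p + 1), ∑ j : Fin (p + 1),
        b i * b j * ∫ t in (0 : ℝ)..1, (lag p i).eval t * (lag p j).eval t := by
      funext b
      simp only [hQ, hR]
      simp_rw [Polynomial.eval_finsetSum, pow_two, Finset.sum_mul_sum]
      rw [intervalIntegral.integral_finsetSum]
      · refine Finset.sum_congr rfl fun i _ => ?_
        rw [intervalIntegral.integral_finsetSum]
        · refine Finset.sum_congr rfl fun j _ => ?_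
          rw [← intervalIntegral.integral_const_mul]
          congr 1; funext t; simp; ring
        · intro j _
          exact Continuous.intervalIntegrable (by fun_prop) _ _
      · intro i _
        exact Continuous.intervalIntegrable (by fun_prop) _ _
    rw [this]; fun_prop
  have hQpos : ∀ b, b ≠ 0 → 0 < Q b := by
    intro b hb
    by_contra hneg
    apply hb
    have hcont : Continuous fun t : ℝ => (R b).eval t ^ 2 := by fun_prop
    have hz : ∀ t ∈ Icc (0 : ℝ) 1, (R b).eval t = 0 := by
      by_contra! hne
      obtain ⟨t, ht, hne⟩ := hne
      have := intervalIntegral.integral_pos (a := 0) (b := 1) one_pos hcont.continuousOn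
        (fun _ _ => sq_nonneg _) ⟨t, ht, by positivity⟩
      exact hneg this
    funext i
    have hi : (i : ℕ) ∈ Finset.range (p + 1) := Finset.mem_range.2 i.2
    have h1 := hz ((i : ℕ) / p) ⟨by positivity, by
      rw [div_le_one (by exact_mod_cast hp)]
      exact_mod_cast Nat.lt_succ_iff.1 i.2⟩
    have h2 : R b = ∑ j ∈ Finset.range (p + 1), C ((fun j => if h : j < p + 1 then b ⟨j, h⟩ else 0) j)
        * lag p j := by
      rw [Finset.sum_range]
      exact Finset.sum_congr rfl fun j _ => by simp only [dif_pos j.2]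
    rw [h2, eval_sum_lag hp _ hi] at h1
    rwa [dif_pos i.2] at h1
  have hQs : ∀ (r : ℝ) b, Q (r • b) = r ^ 2 * Q b := by
    intro r b
    simp only [hQ]
    rw [← intervalIntegral.integral_const_mul]
    congr 1; funext t
    have : R (r • b) = C r * R b := by
      simp only [hR, Finset.mul_sum]
      refine Finset.sum_congr rfl fun j _ => ?_
      simp; ring
    rw [this, eval_mul, eval_C]; ring
  -- A positive quadratic form is bounded below by its minimum on the unit sphere. The sphere is
  -- that of the sup norm, hence the factor `p + 1`.
  obtain ⟨b₀, hb₀, hmin⟩ := (isCompact_sphere (0 : Fin (p + 1) → ℝ) 1).exists_isMinOn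
    ⟨fun _ => 1, by simp [pi_norm_const]⟩ hQc.continuousOn
  have hb₀' : b₀ ≠ 0 := by rintro rfl; simp at hb₀
  have hq := hQpos b₀ hb₀'
  refine ⟨Q b₀ / (p + 1), by positivity, fun P hP => ?_⟩
  set b : Fin (p + 1) → ℝ := fun j => P.eval (((j : ℕ) : ℝ) / p) with hb
  have hRb : R b = P := by
    conv_rhs => rw [eq_sum_lag hp hP, Finset.sum_range]
  have hsum : ∑ j ∈ Finset.range (p + 1), P.eval ((j : ℝ) / p) ^ 2 ≤ (p + 1) * ‖b‖ ^ 2 := by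
    rw [Finset.sum_range]
    calc ∑ j : Fin (p + 1), P.eval (((j : ℕ) : ℝ) / p) ^ 2 ≤ ∑ _j : Fin (p + 1), ‖b‖ ^ 2 := by
          apply Finset.sum_le_sum
          intro j _
          rw [← sq_abs]
          have := norm_le_pi_norm b j
          rw [Real.norm_eq_abs] at this
          gcongr
      _ = _ := by simp
  have hlow : Q b₀ * ‖b‖ ^ 2 ≤ Q b := by
    by_cases h0 : b = 0
    · rw [h0]; simp [hQ, hR]
    · have hn : 0 < ‖b‖ := norm_pos_iff.2 h0
      have h1 : Q b₀ ≤ Q (‖b‖⁻¹ • b) := hmin (by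
        rw [mem_sphere_zero_iff_norm, norm_smul, norm_inv, norm_norm, inv_mul_cancel₀ hn.ne'])
      rw [hQs, inv_pow, inv_mul_eq_div, le_div_iff₀ (by positivity)] at h1
      exact h1
  have : Q b = ∫ t in (0 : ℝ)..1, P.eval t ^ 2 := by simp only [hQ, hRb]
  rw [← this]
  calc Q b₀ / (p + 1) * ∑ j ∈ Finset.range (p + 1), P.eval ((j : ℝ) / p) ^ 2
      ≤ Q b₀ / (p + 1) * ((p + 1) * ‖b‖ ^ 2) := by gcongr
    _ = Q b₀ * ‖b‖ ^ 2 := by field_simp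
    _ ≤ Q b := hlow

/-- Two polynomials that join smoothly are translates of each other. -/
lemma taylor_eq_of_derivatives (P P' : ℝ[X]) (hP : P.degree < ((p + 1 : ℕ) : WithBot ℕ))
    (hP' : P'.degree < ((p + 1 : ℕ) : WithBot ℕ))
    (h : ∀ q ≤ p, (derivative^[q] P).eval 1 = (derivative^[q] P').eval 0) : taylor 1 P = P' := by
  ext q
  rcases le_or_gt q p with hq | hq
  · have h1 := h q hq
    -- The coefficient of order `q` of a Taylor expansion is the Hasse derivative at the centre,
    -- that is, the derivative divided by `q!`. Orders above `p` vanish on both sides.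
    rw [← Polynomial.factorial_smul_hasseDeriv] at h1
    rw [show (q.factorial • hasseDeriv q) P = C (q.factorial : ℝ) * hasseDeriv q P by simp,
      show (q.factorial • hasseDeriv q) P' = C (q.factorial : ℝ) * hasseDeriv q P' by simp,
      eval_mul, eval_mul, eval_C, eval_C] at h1
    have h2 := mul_left_cancel₀ (by exact_mod_cast q.factorial_ne_zero) h1
    rw [taylor_coeff, h2, ← taylor_coeff, taylor_zero]
  · rw [Polynomial.coeff_eq_zero_of_degree_lt, Polynomial.coeff_eq_zero_of_degree_lt]
    · exact hP'.trans_le (by exact_mod_cast hq)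
    · rw [degree_taylor]; exact hP.trans_le (by exact_mod_cast hq)

end

end

section

open Set MeasureTheory Polynomial

/-! ### Reference functions -/

/-- The derivative of order `(α, β)` at `(s, t)` of the tensor product polynomial with nodal
values `c`. -/
noncomputable def refVal (p : ℕ) (c : ℕ → ℕ → ℝ) (α β : ℕ) (s t : ℝ) : ℝ :=
  ∑ i ∈ Finset.range (p + 1), ∑ j ∈ Finset.range (p + 1),
    c i j * ((derivative^[α] (lag p i)).eval s * (derivative^[β] (lag p j)).eval t)

/-- The sum of squares of nodal values. -/
def nodalMass (p : ℕ) (c : ℕ → ℕ → ℝ) : ℝ :=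
  ∑ x ∈ Finset.range (p + 1) ×ˢ Finset.range (p + 1), c x.1 x.2 ^ 2

/-- The sum of squares of differences of nodal values. -/
def nodalEnergy (p : ℕ) (c : ℕ → ℕ → ℝ) : ℝ :=
  ∑ x ∈ (Finset.range (p + 1) ×ˢ Finset.range (p + 1)) ×ˢ
    (Finset.range (p + 1) ×ˢ Finset.range (p + 1)), (c x.1.1 x.1.2 - c x.2.1 x.2.2) ^ 2

lemma nodalMass_nonneg (p : ℕ) (c : ℕ → ℕ → ℝ) : 0 ≤ nodalMass p c :=
  Finset.sum_nonneg fun _ _ => sq_nonneg _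

lemma nodalEnergy_nonneg (p : ℕ) (c : ℕ → ℕ → ℝ) : 0 ≤ nodalEnergy p c :=
  Finset.sum_nonneg fun _ _ => sq_nonneg _

/-- `refVal` as a linear map of the nodal values. -/
noncomputable def refLin (p α β : ℕ) (s t : ℝ) : (ℕ → ℕ → ℝ) →ₗ[ℝ] ℝ where
  toFun c := refVal p c α β s t
  map_add' c c' := by simp [refVal, add_mul, Finset.sum_add_distrib]
  map_smul' r c := by simp [refVal, Finset.mul_sum, mul_assoc]

section

variable {p : ℕ}

/-- Carries statements about the first variable over to the second. -/
lemma refVal_swap (c : ℕ → ℕ → ℝ) (α β : ℕ) (s t : ℝ) :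
    refVal p c α β s t = refVal p (fun i j => c j i) β α t s := by
  rw [refVal, refVal, Finset.sum_comm]
  refine Finset.sum_congr rfl fun i _ => Finset.sum_congr rfl fun j _ => by ring

lemma nodalEnergy_swap (c : ℕ → ℕ → ℝ) :
    nodalEnergy p (fun i j => c j i) = nodalEnergy p c := by
  refine Finset.sum_nbij' (fun x => ((x.1.2, x.1.1), (x.2.2, x.2.1)))
    (fun x => ((x.1.2, x.1.1), (x.2.2, x.2.1))) ?_ ?_ ?_ ?_ ?_ <;> simp +contextual

lemma continuous_refVal (c : ℕ → ℕ → ℝ) (α β : ℕ) :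
    Continuous fun q : ℝ × ℝ => refVal p c α β q.1 q.2 := by
  unfold refVal; fun_prop

lemma degree_iterate_derivative_lt (α : ℕ) {P : ℝ[X]} (hP : P.degree < ((p + 1 : ℕ) : WithBot ℕ)) :
    (derivative^[α] P).degree < ((p + 1 : ℕ) : WithBot ℕ) := by
  induction α with
  | zero => exact hP
  | succ n ih =>
    rw [Function.iterate_succ_apply']
    exact (degree_derivative_le).trans_lt ih

lemma degree_lag_lt (hp : 1 ≤ p) {i : ℕ} (hi : i ∈ Finset.range (p + 1)) :
    (lag p i).degree < ((p + 1 : ℕ) : WithBot ℕ) := by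
  rw [degree_lag hp hi]; exact_mod_cast Nat.lt_succ_self p

/-- Derivatives do not raise the degree, so the one-dimensional bounds apply to derivatives of any
order on every line. -/
lemma exists_poly_refVal (hp : 1 ≤ p) (c : ℕ → ℕ → ℝ) (α β : ℕ) (t : ℝ) :
    ∃ P : ℝ[X], P.degree < ((p + 1 : ℕ) : WithBot ℕ) ∧ ∀ s, refVal p c α β s t = P.eval s := by
  refine ⟨∑ i ∈ Finset.range (p + 1), ∑ j ∈ Finset.range (p + 1),
    C (c i j * (derivative^[β] (lag p j)).eval t) * derivative^[α] (lag p i), ?_, fun s => ?_⟩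
  · rw [← Polynomial.mem_degreeLT]
    refine Submodule.sum_mem _ fun i hi => Submodule.sum_mem _ fun j hj => ?_
    rw [← Polynomial.smul_eq_C_mul]
    refine Submodule.smul_mem _ _ ?_
    rw [Polynomial.mem_degreeLT]
    exact degree_iterate_derivative_lt α (degree_lag_lt hp hi)
  · simp only [refVal, Polynomial.eval_finsetSum, eval_mul, eval_C]
    refine Finset.sum_congr rfl fun i _ => Finset.sum_congr rfl fun j _ => by ring

/-- On a line through nodes all but one of the Lagrange polynomials of the other variable vanish,
which leaves a polynomial in one variable. -/
lemma refVal_node_right (hp : 1 ≤ p) (c : ℕ → ℕ → ℝ) (α : ℕ) (s : ℝ) {j : ℕ}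
    (hj : j ∈ Finset.range (p + 1)) : refVal p c α 0 s ((j : ℝ) / p) =
      (derivative^[α] (∑ i ∈ Finset.range (p + 1), C (c i j) * lag p i)).eval s := by
  rw [Polynomial.iterate_derivative_sum, Polynomial.eval_finsetSum, refVal]
  refine Finset.sum_congr rfl fun i hi => ?_
  rw [Polynomial.iterate_derivative_C_mul, eval_mul, eval_C, Finset.sum_eq_single j]
  · rw [Function.iterate_zero_apply, eval_lag hp hj hj]; simp
  · intro k hk hkj
    rw [Function.iterate_zero_apply, eval_lag hp hk hj, if_neg hkj]; simp
  · exact fun h => absurd hj h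

lemma refVal_node (hp : 1 ≤ p) (c : ℕ → ℕ → ℝ) {i j : ℕ} (hi : i ∈ Finset.range (p + 1))
    (hj : j ∈ Finset.range (p + 1)) : refVal p c 0 0 ((i : ℝ) / p) ((j : ℝ) / p) = c i j := by
  rw [refVal_node_right hp c 0 _ hj, Function.iterate_zero_apply]
  exact eval_sum_lag hp (fun i => c i j) hi

/-- The mean square of a reference function controls its nodal values. -/
lemma exists_mass_le_two (hp : 1 ≤ p) : ∃ κ > 0, ∀ c α β,
    κ * ∑ x ∈ Finset.range (p + 1) ×ˢ Finset.range (p + 1),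
      refVal p c α β ((x.1 : ℝ) / p) ((x.2 : ℝ) / p) ^ 2 ≤
    ∫ t in (0 : ℝ)..1, ∫ s in (0 : ℝ)..1, refVal p c α β s t ^ 2 := by
  obtain ⟨κ, hκ, hmass⟩ := exists_mass_le hp
  refine ⟨κ * κ, by positivity, fun c α β => ?_⟩
  have hc := continuous_refVal (p := p) c α β
  have h1 : ∀ t, κ * ∑ i ∈ Finset.range (p + 1), refVal p c α β ((i : ℝ) / p) t ^ 2 ≤
      ∫ s in (0 : ℝ)..1, refVal p c α β s t ^ 2 := by
    intro t
    obtain ⟨P, hP, hPe⟩ := exists_poly_refVal hp c α β t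
    simp only [hPe]; exact hmass P hP
  have h2 : ∀ s, κ * ∑ j ∈ Finset.range (p + 1), refVal p c α β s ((j : ℝ) / p) ^ 2 ≤
      ∫ t in (0 : ℝ)..1, refVal p c α β s t ^ 2 := by
    intro s
    obtain ⟨P, hP, hPe⟩ := exists_poly_refVal hp (fun i j => c j i) β α s
    simp only [refVal_swap c, hPe]; exact hmass P hP
  have hct : ∀ s, Continuous fun t => refVal p c α β s t := fun s =>
    hc.comp (Continuous.prodMk continuous_const continuous_id)
  have hcs : Continuous fun t => ∫ s in (0 : ℝ)..1, refVal p c α β s t ^ 2 := by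
    apply intervalIntegral.continuous_parametric_intervalIntegral_of_continuous'
    exact (hc.comp continuous_swap).pow 2
  calc κ * κ * ∑ x ∈ Finset.range (p + 1) ×ˢ Finset.range (p + 1),
        refVal p c α β ((x.1 : ℝ) / p) ((x.2 : ℝ) / p) ^ 2
      = κ * ∑ i ∈ Finset.range (p + 1), κ * ∑ j ∈ Finset.range (p + 1),
        refVal p c α β ((i : ℝ) / p) ((j : ℝ) / p) ^ 2 := by
        rw [Finset.sum_product, ← Finset.mul_sum]; ring
    _ ≤ κ * ∑ i ∈ Finset.range (p + 1), ∫ t in (0 : ℝ)..1, refVal p c α β ((i : ℝ) / p) t ^ 2 := by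
        gcongr with i _
        exact h2 _
    _ = ∫ t in (0 : ℝ)..1, κ * ∑ i ∈ Finset.range (p + 1), refVal p c α β ((i : ℝ) / p) t ^ 2 := by
        rw [intervalIntegral.integral_const_mul, intervalIntegral.integral_finsetSum]
        intro i _
        exact ((hct _).pow 2).intervalIntegrable _ _
    _ ≤ _ := by
        apply intervalIntegral.integral_mono_on zero_le_one _ (hcs.intervalIntegrable _ _)
        · exact fun t _ => h1 t
        · apply Continuous.intervalIntegrable
          exact continuous_const.mul (continuous_finsetSum _ fun i _ => (hct _).pow 2)

lemma eq_of_derivative_nodes (hp : 1 ≤ p) (b : ℕ → ℝ)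
    (h : derivative (∑ i ∈ Finset.range (p + 1), C (b i) * lag p i) = 0) {i i' : ℕ}
    (hi : i ∈ Finset.range (p + 1)) (hi' : i' ∈ Finset.range (p + 1)) : b i = b i' := by
  obtain ⟨k, hk⟩ : ∃ k, (∑ i ∈ Finset.range (p + 1), C (b i) * lag p i) = C k :=
    ⟨_, Polynomial.eq_C_of_natDegree_eq_zero (Polynomial.derivative_eq_zero.1 h)⟩
  rw [← eval_sum_lag hp b hi, ← eval_sum_lag hp b hi', hk, eval_C, eval_C]

/-- The gradient controls the differences of nodal values. -/
lemma exists_nodalEnergy_le_grad (hp : 1 ≤ p) : ∃ κ > 0, ∀ c,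
    κ * nodalEnergy p c ≤ (∫ t in (0 : ℝ)..1, ∫ s in (0 : ℝ)..1, refVal p c 1 0 s t ^ 2) +
      ∫ t in (0 : ℝ)..1, ∫ s in (0 : ℝ)..1, refVal p c 0 1 s t ^ 2 := by
  obtain ⟨κ, hκ, hmass⟩ := exists_mass_le_two hp
  set r := Finset.range (p + 1) with hr
  -- If both partial derivatives vanish at all nodes, they vanish along all lines of nodes, so the
  -- nodal values agree along rows and columns. By linear algebra the nodal values of the
  -- derivatives control the differences, and they are themselves controlled by the `L²` norms.
  obtain ⟨C', hC', H⟩ := exists_sum_sq_le ((r ×ˢ r) ×ˢ (r ×ˢ r)) (Finset.univ ×ˢ (r ×ˢ r))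
    (fun x => (LinearMap.proj x.1.2 ∘ₗ LinearMap.proj x.1.1 : (ℕ → ℕ → ℝ) →ₗ[ℝ] ℝ) -
      (LinearMap.proj x.2.2 ∘ₗ LinearMap.proj x.2.1 : (ℕ → ℕ → ℝ) →ₗ[ℝ] ℝ))
    (fun x : Bool × (ℕ × ℕ) => refLin p (if x.1 then 1 else 0) (if x.1 then 0 else 1)
      ((x.2.1 : ℝ) / p) ((x.2.2 : ℝ) / p)) (by
    intro c hc x hx
    have h1 : ∀ i ∈ r, ∀ j ∈ r, refVal p c 1 0 ((i : ℝ) / p) ((j : ℝ) / p) = 0 := fun i hi j hj =>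
      hc (true, (i, j)) (by simp [hi, hj])
    have h2 : ∀ i ∈ r, ∀ j ∈ r, refVal p c 0 1 ((i : ℝ) / p) ((j : ℝ) / p) = 0 := fun i hi j hj =>
      hc (false, (i, j)) (by simp [hi, hj])
    have hz : ∀ (c : ℕ → ℕ → ℝ), (∀ i ∈ r, ∀ j ∈ r, refVal p c 1 0 ((i : ℝ) / p) ((j : ℝ) / p) = 0) →
        ∀ i ∈ r, ∀ i' ∈ r, ∀ j ∈ r, c i j = c i' j := by
      intro c hc i hi i' hi' j hj
      refine eq_of_derivative_nodes hp (fun i => c i j) ?_ hi hi'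
      apply eq_zero_of_eval_nodes hp
      · exact degree_iterate_derivative_lt 1 (degree_sum_lag_lt hp _)
      · intro k hk
        have := hc k hk j hj
        rwa [refVal_node_right hp c 1 _ hj] at this
    simp only [Finset.mem_product] at hx
    obtain ⟨⟨hx1, hx2⟩, hx3, hx4⟩ := hx
    have e1 := hz c h1 _ hx1 _ hx3 _ hx2
    have e2 := hz (fun i j => c j i) (fun i hi j hj => by
      have := h2 j hj i hi
      rwa [refVal_swap] at this) _ hx2 _ hx4 _ hx3
    change c x.1.1 x.1.2 - c x.2.1 x.2.2 = 0
    rw [e1, e2, sub_self])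
  refine ⟨κ / C', by positivity, fun c => ?_⟩
  have h := H c
  have hL : ∑ x ∈ (r ×ˢ r) ×ˢ (r ×ˢ r), (((LinearMap.proj x.1.2 ∘ₗ LinearMap.proj x.1.1 :
      (ℕ → ℕ → ℝ) →ₗ[ℝ] ℝ) - (LinearMap.proj x.2.2 ∘ₗ LinearMap.proj x.2.1 : (ℕ → ℕ → ℝ) →ₗ[ℝ] ℝ)) c) ^ 2 =
      nodalEnergy p c := rfl
  rw [hL, Finset.sum_product, Fintype.sum_bool] at h
  have h1 := hmass c 1 0
  have h2 := hmass c 0 1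
  rw [div_mul_eq_mul_div, div_le_iff₀ hC']
  set A := ∑ x ∈ r ×ˢ r, refVal p c 1 0 ((x.1 : ℝ) / p) ((x.2 : ℝ) / p) ^ 2
  set B := ∑ x ∈ r ×ˢ r, refVal p c 0 1 ((x.1 : ℝ) / p) ((x.2 : ℝ) / p) ^ 2
  have h' : nodalEnergy p c ≤ C' * (A + B) := h
  calc κ * nodalEnergy p c ≤ κ * (C' * (A + B)) := by gcongr
    _ = (κ * A + κ * B) * C' := by ring
    _ ≤ _ := by gcongr

/-- The jump of the `q`-th normal derivative over the common edge of two elements that are adjacent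
in the first direction. -/
noncomputable def refJump (p : ℕ) (c c' : ℕ → ℕ → ℝ) (q : ℕ) (t : ℝ) : ℝ :=
  refVal p c' q 0 0 t - refVal p c q 0 1 t

lemma continuous_refJump (c c' : ℕ → ℕ → ℝ) (q : ℕ) : Continuous (refJump p c c' q) := by
  unfold refJump refVal; fun_prop

/-- The nodal energy of an element is controlled by that of a neighbour and the jumps. -/
lemma exists_nodalEnergy_le_neighbour (hp : 1 ≤ p) : ∃ C > 0, ∀ c c',
    (∀ j ∈ Finset.range (p + 1), c' 0 j = c p j) →
    nodalEnergy p c ≤ C * (nodalEnergy p c' +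
      ∑ q ∈ Finset.Icc 1 p, ∫ t in (0 : ℝ)..1, refJump p c c' q t ^ 2) ∧
    nodalEnergy p c' ≤ C * (nodalEnergy p c +
      ∑ q ∈ Finset.Icc 1 p, ∫ t in (0 : ℝ)..1, refJump p c c' q t ^ 2) := by
  obtain ⟨κ, hκ, hmass⟩ := exists_mass_le hp
  set r := Finset.range (p + 1) with hr
  have h0r : 0 ∈ r := by simp [hr]
  have hpr : p ∈ r := by simp [hr]
  -- the functionals
  let V := (ℕ → ℕ → ℝ) × (ℕ → ℕ → ℝ)
  let E : Bool → ((ℕ × ℕ) × (ℕ × ℕ)) → V →ₗ[ℝ] ℝ := fun b x =>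
    ((LinearMap.proj x.1.2 ∘ₗ LinearMap.proj x.1.1 : (ℕ → ℕ → ℝ) →ₗ[ℝ] ℝ) -
      (LinearMap.proj x.2.2 ∘ₗ LinearMap.proj x.2.1 : (ℕ → ℕ → ℝ) →ₗ[ℝ] ℝ)) ∘ₗ
      (if b then LinearMap.fst ℝ (ℕ → ℕ → ℝ) (ℕ → ℕ → ℝ) else LinearMap.snd ℝ _ _)
  let Jm : ℕ × ℕ → V →ₗ[ℝ] ℝ := fun x =>
    refLin p x.1 0 0 ((x.2 : ℝ) / p) ∘ₗ LinearMap.snd ℝ _ _ -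
      refLin p x.1 0 1 ((x.2 : ℝ) / p) ∘ₗ LinearMap.fst ℝ _ _
  have hE1 : ∀ v x, E true x v = v.1 x.1.1 x.1.2 - v.1 x.2.1 x.2.2 := fun v x => rfl
  have hE2 : ∀ v x, E false x v = v.2 x.1.1 x.1.2 - v.2 x.2.1 x.2.2 := fun v x => rfl
  have hJ : ∀ v x, Jm x v = refJump p v.1 v.2 x.1 ((x.2 : ℝ) / p) := fun v x => rfl
  -- matching derivatives
  have hmatch : ∀ v : V, (∀ x ∈ Finset.range (p + 1) ×ˢ r, Jm x v = 0) → ∀ j ∈ r,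
      taylor 1 (∑ i ∈ r, C (v.1 i j) * lag p i) = ∑ i ∈ r, C (v.2 i j) * lag p i := by
    intro v hv j hj
    refine taylor_eq_of_derivatives (p := p) _ _ (degree_sum_lag_lt hp _) (degree_sum_lag_lt hp _) ?_
    intro q hq
    have := hv (q, j) (by simp [hj, hq])
    rw [hJ, refJump, refVal_node_right hp _ _ _ hj, refVal_node_right hp _ _ _ hj, sub_eq_zero] at this
    exact this.symm
  have hzero : ∀ v : V, (∀ j ∈ r, v.2 0 j = v.1 p j) → ∀ j ∈ r, Jm (0, j) v = 0 := by
    intro v hv j hj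
    rw [hJ]
    have h1 := refVal_node hp v.2 h0r hj
    have h2 := refVal_node hp v.1 hpr hj
    have hp0 : (p : ℝ) ≠ 0 := by positivity
    simp only [Nat.cast_zero, zero_div] at h1
    rw [div_self hp0] at h2
    simp only [refJump, h1, h2, hv j hj, sub_self]
  -- Suppose that one element is constant and all jumps vanish at the nodes of the edge. On each
  -- line of nodes normal to the edge, the two polynomials are then translates of each other, so
  -- both are constant, with the same constant on all lines.
  have hker : ∀ b : Bool, ∀ v : V, (∀ y ∈ (((r ×ˢ r) ×ˢ (r ×ˢ r)).disjSum (Finset.range (p + 1) ×ˢ r)),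
      Sum.elim (E b) Jm y v = 0) → ∀ x ∈ (r ×ˢ r) ×ˢ (r ×ˢ r), E (!b) x v = 0 := by
    intro b v hv
    have hvJ : ∀ x ∈ Finset.range (p + 1) ×ˢ r, Jm x v = 0 := fun x hx =>
      hv (Sum.inr x) (by simpa using hx)
    have hvE : ∀ x ∈ (r ×ˢ r) ×ˢ (r ×ˢ r), E b x v = 0 := fun x hx =>
      hv (Sum.inl x) (by simpa using hx)
    have hm := hmatch v hvJ
    have hp0 : (p : ℝ) ≠ 0 := by positivity
    have hedge : ∀ j ∈ r, v.2 0 j = v.1 p j := by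
      intro j hj
      have h1 := hvJ (0, j) (by simp [hj])
      have h2 := refVal_node hp v.2 h0r hj
      have h3 := refVal_node hp v.1 hpr hj
      simp only [Nat.cast_zero, zero_div] at h2
      rw [div_self hp0] at h3
      simp only [hJ, refJump, h2, h3] at h1
      linarith
    have hconst : ∀ (w : ℕ → ℕ → ℝ), (∀ i ∈ r, ∀ j ∈ r, w i j = w 0 0) → ∀ j ∈ r,
        ∑ i ∈ r, C (w i j) * lag p i = C (w 0 0) := by
      intro w hw j hj
      rw [Finset.sum_congr rfl fun i hi => by rw [hw i hi j hj], ← Finset.mul_sum, sum_lag hp, mul_one]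
    rintro x hx
    simp only [Finset.mem_product] at hx
    obtain ⟨⟨hx1, hx2⟩, hx3, hx4⟩ := hx
    cases b
    · have hw : ∀ i ∈ r, ∀ j ∈ r, v.2 i j = v.2 0 0 := fun i hi j hj => by
        have := hvE ((i, j), (0, 0)) (by simp [hi, hj, h0r])
        rw [hE2] at this; exact sub_eq_zero.1 this
      have hall : ∀ i ∈ r, ∀ j ∈ r, v.1 i j = v.2 0 0 := by
        intro i hi j hj
        have h1 := hm j hj
        rw [hconst v.2 hw j hj] at h1
        have h2 : ∑ i ∈ r, C (v.1 i j) * lag p i = C (v.2 0 0) := by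
          have h3 := congrArg (taylor (-1)) h1
          rwa [taylor_taylor, neg_add_cancel, taylor_zero, taylor_C] at h3
        have h4 := eval_sum_lag hp (fun i => v.1 i j) hi
        rw [h2, eval_C] at h4
        exact h4.symm
      rw [Bool.not_false, hE1, hall _ hx1 _ hx2, hall _ hx3 _ hx4, sub_self]
    · have hw : ∀ i ∈ r, ∀ j ∈ r, v.1 i j = v.1 0 0 := fun i hi j hj => by
        have := hvE ((i, j), (0, 0)) (by simp [hi, hj, h0r])
        rw [hE1] at this; exact sub_eq_zero.1 this
      have hall : ∀ i ∈ r, ∀ j ∈ r, v.2 i j = v.1 0 0 := by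
        intro i hi j hj
        have h1 := hm j hj
        rw [hconst v.1 hw j hj, taylor_C] at h1
        have h4 := eval_sum_lag hp (fun i => v.2 i j) hi
        rw [← h1, eval_C] at h4
        exact h4.symm
      rw [Bool.not_true, hE2, hall _ hx1 _ hx2, hall _ hx3 _ hx4, sub_self]
  -- the jumps control their nodal values
  have hjump : ∀ c c' q, κ * ∑ j ∈ r, refJump p c c' q ((j : ℝ) / p) ^ 2 ≤
      ∫ t in (0 : ℝ)..1, refJump p c c' q t ^ 2 := by
    intro c c' q
    obtain ⟨P, hP, hPe⟩ := exists_poly_refVal hp (fun i j => c' j i) 0 q 0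
    obtain ⟨P', hP', hPe'⟩ := exists_poly_refVal hp (fun i j => c j i) 0 q 1
    have := hmass (P - P') ((degree_sub_le _ _).trans_lt (max_lt hP hP'))
    simp only [refJump, refVal_swap c, refVal_swap c', hPe, hPe']
    simpa using this
  have key : ∀ b : Bool, ∃ C > 0, ∀ c c', (∀ j ∈ r, c' 0 j = c p j) →
      ∑ x ∈ (r ×ˢ r) ×ˢ (r ×ˢ r), E (!b) x (c, c') ^ 2 ≤
        C * (∑ x ∈ (r ×ˢ r) ×ˢ (r ×ˢ r), E b x (c, c') ^ 2 +
          ∑ q ∈ Finset.Icc 1 p, ∫ t in (0 : ℝ)..1, refJump p c c' q t ^ 2) := by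
    intro b
    obtain ⟨C', hC', H⟩ := exists_sum_sq_le ((r ×ˢ r) ×ˢ (r ×ˢ r))
      (((r ×ˢ r) ×ˢ (r ×ˢ r)).disjSum (Finset.range (p + 1) ×ˢ r)) (E (!b)) (Sum.elim (E b) Jm)
      (hker b)
    refine ⟨C' * (1 + κ⁻¹), by positivity, fun c c' hcc => ?_⟩
    have h := H (c, c')
    rw [Finset.sum_disjSum] at h
    simp only [Sum.elim_inl, Sum.elim_inr] at h
    set X := ∑ x ∈ (r ×ˢ r) ×ˢ (r ×ˢ r), E b x (c, c') ^ 2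
    set Y := ∑ q ∈ Finset.Icc 1 p, ∫ t in (0 : ℝ)..1, refJump p c c' q t ^ 2 with hY
    have hX0 : 0 ≤ X := Finset.sum_nonneg fun _ _ => sq_nonneg _
    have hY' : ∑ x ∈ Finset.range (p + 1) ×ˢ r, Jm x (c, c') ^ 2 ≤ κ⁻¹ * Y := by
      -- The stabilization contains no term of order zero. None is needed, for the jump of order
      -- zero vanishes by continuity.
      have hset : Finset.range (p + 1) = insert 0 (Finset.Icc 1 p) := by ext; simp; omega
      rw [Finset.sum_product, hset, Finset.sum_insert (by simp)]
      have hz : ∑ y ∈ r, Jm (0, y) (c, c') ^ 2 = 0 :=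
        Finset.sum_eq_zero fun j hj => by rw [hzero (c, c') hcc j hj]; ring
      rw [hz, zero_add, hY, Finset.mul_sum]
      apply Finset.sum_le_sum
      intro q _
      rw [inv_mul_eq_div, le_div_iff₀ hκ, mul_comm]
      exact hjump c c' q
    have hY0 : 0 ≤ Y := Finset.sum_nonneg fun q _ =>
      intervalIntegral.integral_nonneg zero_le_one fun _ _ => sq_nonneg _
    calc _ ≤ C' * (X + κ⁻¹ * Y) := h.trans (by gcongr)
      _ ≤ C' * ((1 + κ⁻¹) * (X + Y)) := by
        gcongr
        have : 0 ≤ κ⁻¹ * X := by positivity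
        nlinarith
      _ = _ := by ring
  obtain ⟨C₁, hC₁, H₁⟩ := key false
  obtain ⟨C₂, hC₂, H₂⟩ := key true
  refine ⟨C₁ + C₂, by positivity, fun c c' hcc => ?_⟩
  have hnn : 0 ≤ ∑ q ∈ Finset.Icc 1 p, ∫ t in (0 : ℝ)..1, refJump p c c' q t ^ 2 :=
    Finset.sum_nonneg fun q _ => intervalIntegral.integral_nonneg zero_le_one fun t _ => sq_nonneg _
  constructor
  · have h := H₁ c c' hcc
    have h0 := mul_nonneg hC₂.le (add_nonneg (nodalEnergy_nonneg p c') hnn)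
    rw [add_mul]
    exact h.trans (le_add_of_nonneg_right h0)
  · have h := H₂ c c' hcc
    have h0 := mul_nonneg hC₁.le (add_nonneg (nodalEnergy_nonneg p c) hnn)
    rw [add_mul]
    exact h.trans (le_add_of_nonneg_left h0)

/-- Upper bounds for reference functions. -/
lemma exists_refVal_le (p : ℕ) : ∃ C > 0, ∀ c, ∀ α ≤ p, ∀ β ≤ p, ∀ s ∈ Icc (0 : ℝ) 1,
    ∀ t ∈ Icc (0 : ℝ) 1, refVal p c α β s t ^ 2 ≤ C * nodalMass p c := by
  have hb : ∀ x ∈ Finset.range (p + 1) ×ˢ Finset.range (p + 1), ∃ M : ℝ, 0 ≤ M ∧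
      ∀ s ∈ Icc (0 : ℝ) 1, (derivative^[x.1] (lag p x.2)).eval s ^ 2 ≤ M := by
    intro x _
    have hc : Continuous fun s => (derivative^[x.1] (lag p x.2)).eval s ^ 2 := by fun_prop
    obtain ⟨M, hM⟩ := (isCompact_Icc (a := (0 : ℝ)) (b := 1)).bddAbove_image hc.continuousOn
    have hM' : ∀ s ∈ Icc (0 : ℝ) 1, (derivative^[x.1] (lag p x.2)).eval s ^ 2 ≤ M :=
      fun s hs => hM (mem_image_of_mem _ hs)
    exact ⟨M, (sq_nonneg _).trans (hM' 0 (by simp)), hM'⟩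
  choose! M hM0 hM using hb
  set B := ∑ x ∈ Finset.range (p + 1) ×ˢ Finset.range (p + 1), M x with hB
  have hB0 : 0 ≤ B := Finset.sum_nonneg hM0
  have hMB : ∀ x ∈ Finset.range (p + 1) ×ˢ Finset.range (p + 1), M x ≤ B := fun x hx =>
    Finset.single_le_sum hM0 hx
  refine ⟨(p + 1) ^ 2 * (B * B) + 1, by positivity, fun c α hα β hβ s hs t ht => ?_⟩
  have hm := nodalMass_nonneg p c
  rw [refVal, ← Finset.sum_product (s := Finset.range (p + 1)) (t := Finset.range (p + 1))
    (f := fun x => c x.1 x.2 * ((derivative^[α] (lag p x.1)).eval s *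
      (derivative^[β] (lag p x.2)).eval t))]
  refine (Finset.sum_mul_sq_le_sq_mul_sq _ _ _).trans ?_
  rw [mul_comm]
  have h2 : ∑ x ∈ Finset.range (p + 1) ×ˢ Finset.range (p + 1),
      ((derivative^[α] (lag p x.1)).eval s * (derivative^[β] (lag p x.2)).eval t) ^ 2 ≤
      (p + 1) ^ 2 * (B * B) := by
    calc _ ≤ ∑ x ∈ Finset.range (p + 1) ×ˢ Finset.range (p + 1), B * B := by
          apply Finset.sum_le_sum
          intro x hx
          rw [Finset.mem_product] at hx
          rw [mul_pow]
          have e1 : (α, x.1) ∈ Finset.range (p + 1) ×ˢ Finset.range (p + 1) := by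
            rw [Finset.mem_product]; exact ⟨Finset.mem_range.2 (by omega), hx.1⟩
          have e2 : (β, x.2) ∈ Finset.range (p + 1) ×ˢ Finset.range (p + 1) := by
            rw [Finset.mem_product]; exact ⟨Finset.mem_range.2 (by omega), hx.2⟩
          have := (hM _ e1 s hs).trans (hMB _ e1)
          have := (hM _ e2 t ht).trans (hMB _ e2)
          gcongr
      _ = _ := by
        rw [Finset.sum_const, Finset.card_product, Finset.card_range, nsmul_eq_mul]; push_cast; ring
  calc _ ≤ (p + 1) ^ 2 * (B * B) * nodalMass p c := by
        exact mul_le_mul_of_nonneg_right h2 hm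
    _ ≤ _ := by gcongr; linarith

lemma nodalMass_sub_le (c : ℕ → ℕ → ℝ) {i j : ℕ} (hi : i ∈ Finset.range (p + 1))
    (hj : j ∈ Finset.range (p + 1)) :
    nodalMass p (fun k l => c k l - c i j) ≤ nodalEnergy p c := by
  rw [nodalEnergy, Finset.sum_product_right]
  exact Finset.single_le_sum (f := fun y : ℕ × ℕ => ∑ x ∈ Finset.range (p + 1) ×ˢ Finset.range (p + 1),
    (c x.1 x.2 - c y.1 y.2) ^ 2) (fun _ _ => Finset.sum_nonneg fun _ _ => sq_nonneg _)
    (Finset.mk_mem_product hi hj)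

/-- One nodal value and the differences determine all nodal values. This carries the mass across a
shared node. -/
lemma nodalMass_le (c : ℕ → ℕ → ℝ) {i j : ℕ} (hi : i ∈ Finset.range (p + 1))
    (hj : j ∈ Finset.range (p + 1)) :
    nodalMass p c ≤ 2 * nodalEnergy p c + 2 * (p + 1) ^ 2 * c i j ^ 2 := by
  calc nodalMass p c ≤ ∑ x ∈ Finset.range (p + 1) ×ˢ Finset.range (p + 1),
        (2 * (c x.1 x.2 - c i j) ^ 2 + 2 * c i j ^ 2) := by
        apply Finset.sum_le_sum
        intro x _
        nlinarith [sq_nonneg (c x.1 x.2 - c i j - c i j)]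
    _ = 2 * nodalMass p (fun k l => c k l - c i j) + 2 * (p + 1) ^ 2 * c i j ^ 2 := by
        rw [Finset.sum_add_distrib, ← Finset.mul_sum, nodalMass]; simp; ring
    _ ≤ _ := by linarith [nodalMass_sub_le c hi hj]

lemma nodalEnergy_le (c : ℕ → ℕ → ℝ) : nodalEnergy p c ≤ 4 * (p + 1) ^ 2 * nodalMass p c := by
  calc nodalEnergy p c ≤ ∑ x ∈ (Finset.range (p + 1) ×ˢ Finset.range (p + 1)) ×ˢ
        (Finset.range (p + 1) ×ˢ Finset.range (p + 1)),
        (2 * c x.1.1 x.1.2 ^ 2 + 2 * c x.2.1 x.2.2 ^ 2) := by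
        apply Finset.sum_le_sum
        intro x _
        nlinarith [sq_nonneg (c x.1.1 x.1.2 + c x.2.1 x.2.2)]
    _ = _ := by
        have e1 := Finset.sum_product (Finset.range (p + 1) ×ˢ Finset.range (p + 1))
          (Finset.range (p + 1) ×ˢ Finset.range (p + 1)) fun x => 2 * c x.1.1 x.1.2 ^ 2
        have e2 := Finset.sum_product_right (Finset.range (p + 1) ×ˢ Finset.range (p + 1))
          (Finset.range (p + 1) ×ˢ Finset.range (p + 1)) fun x => 2 * c x.2.1 x.2.2 ^ 2
        rw [Finset.sum_add_distrib, e1, e2]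
        simp only [Finset.sum_const, Finset.card_product, Finset.card_range, nsmul_eq_mul,
          ← Finset.mul_sum, nodalMass]
        push_cast; ring

/-- The first derivatives of reference functions are bounded by the nodal energy. -/
lemma exists_refGrad_le (hp : 1 ≤ p) : ∃ C > 0, ∀ c, ∀ s ∈ Icc (0 : ℝ) 1, ∀ t ∈ Icc (0 : ℝ) 1,
    refVal p c 1 0 s t ^ 2 ≤ C * nodalEnergy p c ∧ refVal p c 0 1 s t ^ 2 ≤ C * nodalEnergy p c := by
  obtain ⟨C', hC', H⟩ := exists_refVal_le p
  -- Subtracting a constant does not affect first derivatives, because the Lagrange polynomials sum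
  -- to `1`. The general bound by the mass thus becomes a bound by the energy.
  have hshift : ∀ c α β s t, α + β = 1 →
      refVal p c α β s t = refVal p (fun k l => c k l - c 0 0) α β s t := by
    intro c α β s t hαβ
    have h1 : refVal p (fun k l => c k l - c 0 0) α β s t = refVal p c α β s t -
        c 0 0 * ((derivative^[α] (∑ i ∈ Finset.range (p + 1), lag p i)).eval s *
          (derivative^[β] (∑ i ∈ Finset.range (p + 1), lag p i)).eval t) := by
      rw [Polynomial.iterate_derivative_sum, Polynomial.iterate_derivative_sum,
        Polynomial.eval_finsetSum, Polynomial.eval_finsetSum, Finset.sum_mul_sum, Finset.mul_sum]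
      simp only [refVal, Finset.mul_sum, sub_mul, Finset.sum_sub_distrib]
    rw [h1, sum_lag hp]
    rcases Nat.add_eq_one_iff.1 hαβ with ⟨rfl, rfl⟩ | ⟨rfl, rfl⟩ <;> simp
  have h0 : 0 ∈ Finset.range (p + 1) := by simp
  refine ⟨C', hC', fun c s hs t ht => ⟨?_, ?_⟩⟩
  · rw [hshift c 1 0 s t rfl]
    refine (H _ 1 hp 0 (by omega) s hs t ht).trans ?_
    gcongr; exact nodalMass_sub_le c h0 h0
  · rw [hshift c 0 1 s t rfl]
    refine (H _ 0 (by omega) 1 hp s hs t ht).trans ?_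
    gcongr; exact nodalMass_sub_le c h0 h0

end

end

section

open Set MeasureTheory

/-! ### Piecewise polynomials on the grid -/

/-- The nodal values on the element `K`. -/
def localCoef (p : ℕ) (a : (Fin 2 → ℤ) → ℝ) (K : Fin 2 → ℤ) : ℕ → ℕ → ℝ :=
  fun i j => a ![p * K 0 + i, p * K 1 + j]

/-- The piecewise polynomial with nodal values `a` at the nodes in `N`. -/
noncomputable def gridPoly (p : ℕ) (h : ℝ) (o : Fin 2 → ℝ) (N : Finset (Fin 2 → ℤ))
    (a : (Fin 2 → ℤ) → ℝ) (K : Fin 2 → ℤ) : MvPolynomial (Fin 2) ℝ :=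
  ∑ m ∈ N, a m • localLagrange p h o m K

/-- The local coordinate on the element `K`. -/
noncomputable def elemCoord (h : ℝ) (o : Fin 2 → ℝ) (K : Fin 2 → ℤ) (k : Fin 2) :
    MvPolynomial (Fin 2) ℝ :=
  MvPolynomial.C h⁻¹ * (MvPolynomial.X k - MvPolynomial.C (o k)) - MvPolynomial.C (K k : ℝ)

/-- The value of the local coordinate. -/
noncomputable def locPt (h : ℝ) (o : Fin 2 → ℝ) (K : Fin 2 → ℤ) (x : Fin 2 → ℝ) (k : Fin 2) : ℝ :=
  h⁻¹ * (x k - o k) - K k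

section

variable {p : ℕ} {h : ℝ} {o : Fin 2 → ℝ} {K K' m : Fin 2 → ℤ} {N : Finset (Fin 2 → ℤ)}
  {a : (Fin 2 → ℤ) → ℝ} {x : Fin 2 → ℝ}

lemma eval_aeval_elemCoord (k : Fin 2) (P : Polynomial ℝ) :
    MvPolynomial.eval x (Polynomial.aeval (elemCoord h o K k) P) =
      P.eval (locPt h o K x k) := by
  rw [← MvPolynomial.coe_aeval_eq_eval, RingHom.coe_coe, ← Polynomial.aeval_algHom_apply,
    Polynomial.coe_aeval_eq_eval]
  congr 1
  simp [elemCoord, locPt]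

lemma pderiv_elemCoord (k k' : Fin 2) :
    MvPolynomial.pderiv k (elemCoord h o K k') = if k = k' then MvPolynomial.C h⁻¹ else 0 := by
  simp only [elemCoord, map_sub, Derivation.leibniz, MvPolynomial.pderiv_C, MvPolynomial.pderiv_X,
    smul_eq_mul, sub_zero, mul_zero, add_zero]
  split_ifs with hk
  · subst hk; simp
  · rw [Pi.single_eq_of_ne (Ne.symm hk), mul_zero]

lemma pderiv_aeval_elemCoord_of_ne {k k' : Fin 2} (hk : k ≠ k') (P : Polynomial ℝ) :
    MvPolynomial.pderiv k (Polynomial.aeval (elemCoord h o K k') P) = 0 := by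
  rw [Derivation.map_aeval, pderiv_elemCoord, if_neg hk, smul_zero]

/-- Each derivative of the local coordinate gives a factor `h⁻¹`, and the other coordinate acts as a
constant. -/
lemma iterate_pderiv_aeval {k k' : Fin 2} (hk : k ≠ k') (P P' : Polynomial ℝ) (q : ℕ) :
    (MvPolynomial.pderiv k)^[q] (Polynomial.aeval (elemCoord h o K k) P *
        Polynomial.aeval (elemCoord h o K k') P') =
      (MvPolynomial.C h⁻¹) ^ q * (Polynomial.aeval (elemCoord h o K k) (Polynomial.derivative^[q] P) *
        Polynomial.aeval (elemCoord h o K k') P') := by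
  induction q with
  | zero => simp
  | succ q ih =>
    rw [Function.iterate_succ_apply', ih, ← map_pow, Derivation.leibniz, Derivation.leibniz,
      MvPolynomial.pderiv_C, pderiv_aeval_elemCoord_of_ne hk, Derivation.map_aeval,
      pderiv_elemCoord, if_pos rfl, Function.iterate_succ_apply', map_pow]
    simp only [smul_eq_mul]
    ring

lemma localLagrange_of_mem {i j : ℕ} (hi : i ∈ Finset.range (p + 1)) (hj : j ∈ Finset.range (p + 1)) :
    localLagrange p h o ![p * K 0 + i, p * K 1 + j] K =
      Polynomial.aeval (elemCoord h o K 0) (lag p i) *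
        Polynomial.aeval (elemCoord h o K 1) (lag p j) := by
  rw [Finset.mem_range] at hi hj
  rw [localLagrange, if_pos, Fin.prod_univ_two]
  · simp [elemCoord, lag]
  · intro k
    fin_cases k <;> constructor <;> simp <;> nlinarith

/-- The nodes of an element. -/
noncomputable def elemNodes (p : ℕ) (K : Fin 2 → ℤ) : Finset (Fin 2 → ℤ) :=
  Fintype.piFinset fun k => Finset.Icc ((p : ℤ) * K k) (p * (K k + 1))

lemma localLagrange_of_notMem (hm : m ∉ elemNodes p K) : localLagrange p h o m K = 0 := by
  rw [localLagrange, if_neg]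
  simpa [elemNodes] using hm

lemma sum_elemNodes {M : Type*} [AddCommMonoid M] (f : (Fin 2 → ℤ) → M) :
    ∑ m ∈ elemNodes p K, f m = ∑ i ∈ Finset.range (p + 1), ∑ j ∈ Finset.range (p + 1),
      f ![p * K 0 + i, p * K 1 + j] := by
  rw [← Finset.sum_product']
  symm
  refine Finset.sum_bij (fun x _ => ![(p : ℤ) * K 0 + x.1, (p : ℤ) * K 1 + x.2]) ?_ ?_ ?_ ?_
  · intro x hx
    simp only [Finset.mem_product, Finset.mem_range] at hx
    simp only [elemNodes, Fintype.mem_piFinset, Fin.forall_fin_two, Finset.mem_Icc]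
    simp; constructor <;> nlinarith
  · intro x _ y _ hxy
    have h0 := congrFun hxy 0
    have h1 := congrFun hxy 1
    simp at h0 h1
    exact Prod.ext h0 h1
  · intro m hm
    simp only [elemNodes, Fintype.mem_piFinset, Fin.forall_fin_two, Finset.mem_Icc, mul_add,
      mul_one] at hm
    refine ⟨((m 0 - p * K 0).toNat, (m 1 - p * K 1).toNat), ?_, ?_⟩
    · simp only [Finset.mem_product, Finset.mem_range]; omega
    · ext k
      fin_cases k <;> simp <;> omega
  · intro _ _; rfl

/-- Since `a` vanishes outside `N`, summing over `N` amounts to summing over the nodes of `K`, also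
for elements with nodes outside `N`. -/
lemma gridPoly_eq (ha : ∀ m ∉ N, a m = 0) : gridPoly p h o N a K =
    ∑ i ∈ Finset.range (p + 1), ∑ j ∈ Finset.range (p + 1), localCoef p a K i j •
      (Polynomial.aeval (elemCoord h o K 0) (lag p i) *
        Polynomial.aeval (elemCoord h o K 1) (lag p j)) := by
  have h1 : gridPoly p h o N a K = ∑ m ∈ elemNodes p K, a m • localLagrange p h o m K := by
    rw [gridPoly, ← Finset.sum_subset (Finset.inter_subset_left (s₁ := N) (s₂ := elemNodes p K)),
      ← Finset.sum_subset (Finset.inter_subset_right (s₁ := N) (s₂ := elemNodes p K))]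
    · intro m hm hm'
      have : m ∉ N := fun hN => hm' (Finset.mem_inter.2 ⟨hN, hm⟩)
      rw [ha m this, zero_smul]
    · intro m hm hm'
      have : m ∉ elemNodes p K := fun hN => hm' (Finset.mem_inter.2 ⟨hm, hN⟩)
      rw [localLagrange_of_notMem this, smul_zero]
  rw [h1, sum_elemNodes]
  refine Finset.sum_congr rfl fun i hi => Finset.sum_congr rfl fun j hj => ?_
  rw [localLagrange_of_mem hi hj]; rfl

lemma iterate_pderiv_sum {α : Type*} (k : Fin 2) (q : ℕ) (s : Finset α) (b : α → ℝ)
    (f : α → MvPolynomial (Fin 2) ℝ) :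
    (MvPolynomial.pderiv k)^[q] (∑ i ∈ s, b i • f i) =
      ∑ i ∈ s, b i • (MvPolynomial.pderiv k)^[q] (f i) := by
  have : (⇑(MvPolynomial.pderiv (R := ℝ) k))^[q] =
      ⇑(((MvPolynomial.pderiv (R := ℝ) k).toLinearMap : Module.End ℝ (MvPolynomial (Fin 2) ℝ)) ^ q) := by
    rw [Module.End.coe_pow]; rfl
  rw [this, map_sum]
  simp

lemma eval_iterate_pderiv_zero (ha : ∀ m ∉ N, a m = 0) (q : ℕ) :
    MvPolynomial.eval x ((MvPolynomial.pderiv 0)^[q] (gridPoly p h o N a K)) =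
      h⁻¹ ^ q * refVal p (localCoef p a K) q 0 (locPt h o K x 0) (locPt h o K x 1) := by
  rw [gridPoly_eq ha, ← Finset.sum_product', iterate_pderiv_sum, map_sum, refVal,
    ← Finset.sum_product', Finset.mul_sum]
  refine Finset.sum_congr rfl fun y _ => ?_
  rw [iterate_pderiv_aeval (by decide), MvPolynomial.smul_eval, map_mul, map_mul, map_pow,
    MvPolynomial.eval_C, eval_aeval_elemCoord, eval_aeval_elemCoord, Function.iterate_zero_apply]
  ring

lemma eval_iterate_pderiv_one (ha : ∀ m ∉ N, a m = 0) (q : ℕ) :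
    MvPolynomial.eval x ((MvPolynomial.pderiv 1)^[q] (gridPoly p h o N a K)) =
      h⁻¹ ^ q * refVal p (localCoef p a K) 0 q (locPt h o K x 0) (locPt h o K x 1) := by
  rw [gridPoly_eq ha, ← Finset.sum_product', iterate_pderiv_sum, map_sum, refVal,
    ← Finset.sum_product', Finset.mul_sum]
  refine Finset.sum_congr rfl fun y _ => ?_
  rw [mul_comm (Polynomial.aeval _ _), iterate_pderiv_aeval (by decide), MvPolynomial.smul_eval,
    map_mul, map_mul, map_pow,
    MvPolynomial.eval_C, eval_aeval_elemCoord, eval_aeval_elemCoord, Function.iterate_zero_apply]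
  ring

lemma eval_gridPoly (ha : ∀ m ∉ N, a m = 0) :
    MvPolynomial.eval x (gridPoly p h o N a K) =
      refVal p (localCoef p a K) 0 0 (locPt h o K x 0) (locPt h o K x 1) := by
  simpa using eval_iterate_pderiv_zero (p := p) (h := h) (o := o) (K := K) (x := x) ha 0

lemma locPt_mem_Icc (hh : 0 < h) (hx : x ∈ gridElement h o K) (k : Fin 2) :
    locPt h o K x k ∈ Icc (0 : ℝ) 1 := by
  have := mem_gridElement_iff.1 hx k
  rw [locPt, inv_mul_eq_div]
  constructor
  · rw [sub_nonneg, le_div_iff₀ hh]; linarith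
  · rw [sub_le_iff_le_add, div_le_iff₀ hh]; linarith

/-- Elementwise bounds. -/
lemma exists_eval_gridPoly_le (hp : 1 ≤ p) : ∃ C > 0, ∀ (h : ℝ) (o : Fin 2 → ℝ)
    (N : Finset (Fin 2 → ℤ)) (a : (Fin 2 → ℤ) → ℝ) (K : Fin 2 → ℤ) (x : Fin 2 → ℝ), 0 < h →
    (∀ m ∉ N, a m = 0) → x ∈ gridElement h o K →
    MvPolynomial.eval x (gridPoly p h o N a K) ^ 2 ≤ C * nodalMass p (localCoef p a K) ∧
    ∀ k, MvPolynomial.eval x (MvPolynomial.pderiv k (gridPoly p h o N a K)) ^ 2 ≤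
      C * (h ^ 2)⁻¹ * nodalEnergy p (localCoef p a K) := by
  obtain ⟨C₁, hC₁, H₁⟩ := exists_refVal_le p
  obtain ⟨C₂, hC₂, H₂⟩ := exists_refGrad_le hp
  refine ⟨C₁ + C₂, by positivity, fun h o N a K x hh ha hx => ⟨?_, fun k => ?_⟩⟩
  · rw [eval_gridPoly ha]
    refine (H₁ _ 0 (by omega) 0 (by omega) _ (locPt_mem_Icc hh hx 0) _ (locPt_mem_Icc hh hx 1)).trans ?_
    have := nodalMass_nonneg p (localCoef p a K)
    gcongr; linarith
  · have hE := nodalEnergy_nonneg p (localCoef p a K)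
    have h1 := H₂ (localCoef p a K) _ (locPt_mem_Icc hh hx 0) _ (locPt_mem_Icc hh hx 1)
    have e0 := eval_iterate_pderiv_zero (p := p) (h := h) (o := o) (K := K) (x := x) ha 1
    have e1 := eval_iterate_pderiv_one (p := p) (h := h) (o := o) (K := K) (x := x) ha 1
    simp only [Function.iterate_one, pow_one] at e0 e1
    fin_cases k
    · simp only [Fin.zero_eta]
      rw [e0, mul_pow, inv_pow]
      calc _ ≤ (h ^ 2)⁻¹ * (C₂ * nodalEnergy p (localCoef p a K)) := by gcongr; exact h1.1
        _ ≤ (h ^ 2)⁻¹ * ((C₁ + C₂) * nodalEnergy p (localCoef p a K)) := by gcongr; linarith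
        _ = _ := by ring
    · simp only [Fin.mk_one]
      rw [e1, mul_pow, inv_pow]
      calc _ ≤ (h ^ 2)⁻¹ * (C₂ * nodalEnergy p (localCoef p a K)) := by gcongr; exact h1.2
        _ ≤ (h ^ 2)⁻¹ * ((C₁ + C₂) * nodalEnergy p (localCoef p a K)) := by gcongr; linarith
        _ = _ := by ring

end

/-! ### Continuity across elements -/

/-- A one-dimensional piecewise Lagrange basis polynomial. -/
noncomputable def lagFun (p : ℕ) (m k : ℤ) (s : ℝ) : ℝ :=
  if (p : ℤ) * k ≤ m ∧ m ≤ p * (k + 1) then (lag p (m - p * k).toNat).eval (s - k) else 0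

section

variable {p : ℕ} {h : ℝ} {o : Fin 2 → ℝ} {K K' m : Fin 2 → ℤ} {N : Finset (Fin 2 → ℤ)}
  {a : (Fin 2 → ℤ) → ℝ} {x : Fin 2 → ℝ}

lemma lagFun_add_one (hp : 1 ≤ p) (m k : ℤ) : lagFun p m k (k + 1) = if m = p * (k + 1) then 1 else 0 := by
  rw [lagFun, add_sub_cancel_left]
  have hp0 : (p : ℝ) ≠ 0 := by positivity
  split_ifs with h1 h2 h2
  · have : (m - p * k).toNat = p := by rw [h2]; ring_nf; simp
    rw [this]
    have := eval_lag hp (i := p) (j := p) (by simp) (by simp)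
    rwa [div_self hp0, if_pos rfl] at this
  · have h3 : (m - p * k).toNat ≠ p := by
      intro h4; apply h2; rw [mul_add, mul_one]; omega
    have := eval_lag hp (i := (m - p * k).toNat) (j := p)
      (by rw [Finset.mem_range]; rw [mul_add, mul_one] at h1; omega) (by simp)
    rwa [div_self hp0, if_neg h3] at this
  · exfalso; apply h1; rw [h2, mul_add]; constructor <;> omega
  · rfl

lemma lagFun_self (hp : 1 ≤ p) (m k : ℤ) : lagFun p m k k = if m = p * k then 1 else 0 := by
  rw [lagFun, sub_self]
  have hp0 : (p : ℝ) ≠ 0 := by positivity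
  split_ifs with h1 h2 h2
  · have : (m - p * k).toNat = 0 := by rw [h2]; simp
    rw [this]
    have := eval_lag hp (i := 0) (j := 0) (by simp) (by simp)
    simpa using this
  · have h3 : (m - p * k).toNat ≠ 0 := by omega
    have := eval_lag hp (i := (m - p * k).toNat) (j := 0)
      (by rw [Finset.mem_range]; rw [mul_add, mul_one] at h1; omega) (by simp)
    rw [if_neg h3] at this
    simpa using this
  · exfalso; apply h1; rw [h2, mul_add]; constructor <;> omega
  · rfl

/-- Distinct unit intervals with a common point are adjacent and the point is an integer. It is a
node of both intervals, where both functions are `1` or `0` according to whether `m` is that node.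
-/
lemma lagFun_eq (hp : 1 ≤ p) (m : ℤ) {k k' : ℤ} {s : ℝ} (hs : s ∈ Icc (k : ℝ) (k + 1))
    (hs' : s ∈ Icc (k' : ℝ) (k' + 1)) : lagFun p m k s = lagFun p m k' s := by
  have key : ∀ k k' : ℤ, k < k' → s ∈ Icc (k : ℝ) (k + 1) → s ∈ Icc (k' : ℝ) (k' + 1) →
      lagFun p m k s = lagFun p m k' s := by
    intro k k' hk hs hs'
    have h1 : (k : ℝ) + 1 ≤ k' := by exact_mod_cast hk
    have h2 : s = k' := le_antisymm (hs.2.trans h1) hs'.1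
    have h3 : k' = k + 1 := by
      have : (k' : ℝ) ≤ k + 1 := hs'.1.trans hs.2
      have : k' ≤ k + 1 := by exact_mod_cast this
      omega
    rw [h2, lagFun_self hp, h3]
    push_cast
    exact lagFun_add_one hp m k
  rcases lt_trichotomy k k' with hk | hk | hk
  · exact key k k' hk hs hs'
  · rw [hk]
  · exact (key k' k hk hs' hs).symm

lemma eval_localLagrange : MvPolynomial.eval x (localLagrange p h o m K) =
    lagFun p (m 0) (K 0) (h⁻¹ * (x 0 - o 0)) * lagFun p (m 1) (K 1) (h⁻¹ * (x 1 - o 1)) := by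
  rw [localLagrange]
  simp only [lagFun, Fin.forall_fin_two]
  by_cases h0 : (p : ℤ) * K 0 ≤ m 0 ∧ m 0 ≤ p * (K 0 + 1)
  · by_cases h1 : (p : ℤ) * K 1 ≤ m 1 ∧ m 1 ≤ p * (K 1 + 1)
    · rw [if_pos ⟨h0, h1⟩, if_pos h0, if_pos h1, Fin.prod_univ_two, map_mul]
      exact congrArg₂ _ (eval_aeval_elemCoord 0 _) (eval_aeval_elemCoord 1 _)
    · rw [if_neg (fun h => h1 h.2), if_neg h1, map_zero, mul_zero]
  · rw [if_neg (fun h => h0 h.1), if_neg h0, map_zero, zero_mul]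

lemma mem_Icc_of_mem_gridElement (hh : 0 < h) (hx : x ∈ gridElement h o K) (k : Fin 2) :
    h⁻¹ * (x k - o k) ∈ Icc (K k : ℝ) (K k + 1) := by
  have := locPt_mem_Icc hh hx k
  rw [locPt] at this
  exact ⟨by linarith [this.1], by linarith [this.2]⟩

lemma eval_localLagrange_eq (hp : 1 ≤ p) (hh : 0 < h) (hx : x ∈ gridElement h o K)
    (hx' : x ∈ gridElement h o K') : MvPolynomial.eval x (localLagrange p h o m K) =
      MvPolynomial.eval x (localLagrange p h o m K') := by
  rw [eval_localLagrange, eval_localLagrange,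
    lagFun_eq hp _ (mem_Icc_of_mem_gridElement hh hx 0) (mem_Icc_of_mem_gridElement hh hx' 0),
    lagFun_eq hp _ (mem_Icc_of_mem_gridElement hh hx 1) (mem_Icc_of_mem_gridElement hh hx' 1)]

lemma eval_gridPoly_eq (hp : 1 ≤ p) (hh : 0 < h) (hx : x ∈ gridElement h o K)
    (hx' : x ∈ gridElement h o K') : MvPolynomial.eval x (gridPoly p h o N a K) =
      MvPolynomial.eval x (gridPoly p h o N a K') := by
  simp only [gridPoly, map_sum, MvPolynomial.smul_eval]
  exact Finset.sum_congr rfl fun m _ => by rw [eval_localLagrange_eq hp hh hx hx']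

lemma continuous_lagFun_floor (hp : 1 ≤ p) (m : ℤ) : Continuous fun s : ℝ => lagFun p m ⌊s⌋ s := by
  have hk : ∀ k : ℤ, ContinuousOn (fun s : ℝ => lagFun p m ⌊s⌋ s) (Icc (k : ℝ) (k + 1)) := by
    intro k
    have h1 : Continuous fun s : ℝ => lagFun p m k s := by
      unfold lagFun; split_ifs <;> fun_prop
    refine h1.continuousOn.congr fun s hs => ?_
    exact lagFun_eq hp m ⟨Int.floor_le s, (Int.lt_floor_add_one s).le⟩ hs
  rw [continuous_iff_continuousAt]
  intro s
  -- The two closed intervals to the left and to the right of `⌊s⌋` together form a neighbourhood of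
  -- `s`.
  have h2 := (hk (⌊s⌋ - 1)).union_of_isClosed (hk ⌊s⌋) isClosed_Icc isClosed_Icc
  apply h2.continuousAt
  have h3 : Ioo ((⌊s⌋ : ℝ) - 1) (⌊s⌋ + 1) ∈ nhds s :=
    Ioo_mem_nhds (by linarith [Int.floor_le s]) (Int.lt_floor_add_one s)
  filter_upwards [h3] with y hy
  rcases le_total y ⌊s⌋ with hy' | hy'
  · left; push_cast; exact ⟨hy.1.le, by linarith⟩
  · right; exact ⟨hy', hy.2.le⟩

lemma elementTowards_zero (x : Fin 2 → ℝ) (k : Fin 2) :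
    elementTowards h o 0 x k = ⌊h⁻¹ * (x k - o k)⌋ := by
  simp [elementTowards, inv_mul_eq_div]

lemma mem_gridElement_elementTowards_zero (hh : 0 < h) (o x : Fin 2 → ℝ) :
    x ∈ gridElement h o (elementTowards h o 0 x) := by
  have := mem_gridElement_floor hh o x
  convert this using 2
  ext k; simp [elementTowards]

lemma continuous_gridFun (hp : 1 ≤ p) :
    Continuous fun x => MvPolynomial.eval x (gridPoly p h o N a (elementTowards h o 0 x)) := by
  simp only [gridPoly, map_sum, MvPolynomial.smul_eval, eval_localLagrange, elementTowards_zero]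
  refine continuous_finsetSum _ fun m _ => continuous_const.mul ?_
  have h0 := (continuous_lagFun_floor hp (m 0)).comp
    (show Continuous fun x : Fin 2 → ℝ => h⁻¹ * (x 0 - o 0) by fun_prop)
  have h1 := (continuous_lagFun_floor hp (m 1)).comp
    (show Continuous fun x : Fin 2 → ℝ => h⁻¹ * (x 1 - o 1) by fun_prop)
  exact h0.mul h1

end

end

/-! ### Increments and elementwise integrals of piecewise polynomials. -/

section

open Set MeasureTheory

section

variable {p : ℕ} {h : ℝ} {o : Fin 2 → ℝ} {K K' m : Fin 2 → ℤ} {N : Finset (Fin 2 → ℤ)}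
  {a : (Fin 2 → ℤ) → ℝ} {x u : Fin 2 → ℝ}

/-- The closed element selected by the direction `u` contains the initial piece of the ray. The
value `s = 0` is included, so it contains `x` too. -/
lemma eventually_mem_elementTowards (hh : 0 < h) (o u x : Fin 2 → ℝ) :
    ∀ᶠ s in nhdsWithin (0 : ℝ) (Ici 0), x + s • u ∈ gridElement h o (elementTowards h o u x) := by
  simp only [mem_gridElement_iff, Filter.eventually_all]
  intro k
  have hc : Filter.Tendsto (fun s : ℝ => (x + s • u) k) (nhdsWithin 0 (Ici 0)) (nhds (x k)) := by
    have : Continuous fun s : ℝ => (x + s • u) k := by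
      simp only [Pi.add_apply, Pi.smul_apply, smul_eq_mul]; fun_prop
    simpa using (this.tendsto 0).mono_left nhdsWithin_le_nhds
  have hx : x k = o k + h * ((x k - o k) / h) := by field_simp; ring
  simp only [elementTowards]
  split_ifs with hu
  · have h1 := Int.ceil_lt_add_one ((x k - o k) / h)
    have h2 := Int.le_ceil ((x k - o k) / h)
    have h3 : o k + h * (((⌈(x k - o k) / h⌉ - 1 : ℤ) : ℝ)) < x k := by
      push_cast; nlinarith
    filter_upwards [hc.eventually_const_lt h3, self_mem_nhdsWithin] with s hs hs0
    refine ⟨hs.le, ?_⟩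
    simp only [Pi.add_apply, Pi.smul_apply, smul_eq_mul]
    push_cast
    have : s * u k ≤ 0 := mul_nonpos_of_nonneg_of_nonpos hs0 hu.le
    nlinarith
  · have h1 := Int.floor_le ((x k - o k) / h)
    have h2 := Int.lt_floor_add_one ((x k - o k) / h)
    have h3 : x k < o k + h * (⌊(x k - o k) / h⌋ + 1) := by nlinarith
    filter_upwards [hc.eventually_lt_const h3, self_mem_nhdsWithin] with s hs hs0
    refine ⟨?_, hs.le⟩
    simp only [Pi.add_apply, Pi.smul_apply, smul_eq_mul]
    have : 0 ≤ s * u k := mul_nonneg hs0 (not_lt.1 hu)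
    nlinarith

lemma mem_gridElement_elementTowards (hh : 0 < h) (o u x : Fin 2 → ℝ) :
    x ∈ gridElement h o (elementTowards h o u x) := by
  have := (eventually_mem_elementTowards hh o u x).self_of_nhdsWithin (mem_Ici.2 le_rfl)
  simpa using this

lemma hasDerivAt_eval_line (P : MvPolynomial (Fin 2) ℝ) (x u : Fin 2 → ℝ) (r : ℝ) :
    HasDerivAt (fun r => MvPolynomial.eval (x + r • u) P)
      (∑ k, u k * MvPolynomial.eval (x + r • u) (MvPolynomial.pderiv k P)) r := by
  induction P using MvPolynomial.induction_on with
  | C b => simpa using hasDerivAt_const r b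
  | add P Q hP hQ =>
    simp only [map_add, mul_add, Finset.sum_add_distrib]
    exact hP.add hQ
  | mul_X P k hP =>
    have hX : HasDerivAt (fun r : ℝ => x k + r * u k) (u k) r := by
      simpa using ((hasDerivAt_id r).mul_const (u k)).const_add (x k)
    refine (hP.mul hX).congr_deriv ?_ |>.congr_of_eventuallyEq ?_
    rotate_left
    · exact Filter.Eventually.of_forall fun r => by simp
    · simp only [Derivation.leibniz, smul_eq_mul, map_add, map_mul, MvPolynomial.eval_X,
        MvPolynomial.pderiv_X, mul_add, Finset.sum_add_distrib, Finset.sum_mul]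
      refine (add_comm _ _).trans (congrArg₂ _ ?_ ?_)
      · rw [Finset.sum_eq_single k]
        · simp [mul_comm]
        · intro j _ hj
          rw [Pi.single_eq_of_ne (Ne.symm hj), map_zero, mul_zero, mul_zero]
        · simp
      · rw [← Finset.sum_add_distrib]
        exact Finset.sum_congr rfl fun j _ => by simp; ring

/-- Across faces the function has no derivative, and a line may even run inside a face. A right
derivative exists at every point, and it can be computed in the element that lies ahead. -/
lemma hasDerivWithinAt_gridFun (hp : 1 ≤ p) (hh : 0 < h) (x u : Fin 2 → ℝ) (r : ℝ) :
    HasDerivWithinAt (fun r : ℝ => MvPolynomial.eval (x + r • u)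
        (gridPoly p h o N a (elementTowards h o 0 (x + r • u))))
      (∑ k, u k * MvPolynomial.eval (x + r • u) (MvPolynomial.pderiv k
        (gridPoly p h o N a (elementTowards h o u (x + r • u))))) (Ioi r) r := by
  refine ((hasDerivAt_eval_line (gridPoly p h o N a (elementTowards h o u (x + r • u))) x u
    r).hasDerivWithinAt).congr_of_eventuallyEq ?_ ?_
  · have h1 := eventually_mem_elementTowards hh o u (x + r • u)
    have h2 : Filter.Tendsto (fun r' => r' - r) (nhdsWithin r (Ioi r)) (nhdsWithin 0 (Ici 0)) := by
      refine tendsto_nhdsWithin_iff.2 ⟨?_, ?_⟩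
      · have : Continuous fun r' => r' - r := by fun_prop
        simpa using (this.tendsto r).mono_left nhdsWithin_le_nhds
      · filter_upwards [self_mem_nhdsWithin] with r' hr'
        exact sub_nonneg.2 (le_of_lt (mem_Ioi.1 hr'))
    filter_upwards [h2.eventually h1] with r' hr'
    have e : x + r • u + (r' - r) • u = x + r' • u := by rw [sub_smul]; abel
    rw [e] at hr'
    exact eval_gridPoly_eq hp hh (mem_gridElement_elementTowards hh o 0 _) hr'
  · exact eval_gridPoly_eq hp hh (mem_gridElement_elementTowards hh o 0 _)
      (mem_gridElement_elementTowards hh o u _)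

/-- The energy of the piecewise polynomial, spread over the elements in `T`. -/
noncomputable def energyDensity (p : ℕ) (h : ℝ) (o : Fin 2 → ℝ) (a : (Fin 2 → ℤ) → ℝ)
    (T : Finset (Fin 2 → ℤ)) (x : Fin 2 → ℝ) : ℝ :=
  ∑ K ∈ T, (gridElement h o K).indicator
    (fun _ => (h ^ 2)⁻¹ * nodalEnergy p (localCoef p a K)) x

lemma measurableSet_gridElement (h : ℝ) (o : Fin 2 → ℝ) (K : Fin 2 → ℤ) :
    MeasurableSet (gridElement h o K) := (isClosed_gridElement h o K).measurableSet

lemma indicator_energy_nonneg (K : Fin 2 → ℤ) (x : Fin 2 → ℝ) : 0 ≤ (gridElement h o K).indicator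
    (fun _ => (h ^ 2)⁻¹ * nodalEnergy p (localCoef p a K)) x :=
  indicator_nonneg (fun _ _ => mul_nonneg (by positivity) (nodalEnergy_nonneg _ _)) _

lemma energyDensity_nonneg (T : Finset (Fin 2 → ℤ)) (x : Fin 2 → ℝ) :
    0 ≤ energyDensity p h o a T x :=
  Finset.sum_nonneg fun K _ => indicator_energy_nonneg K x

lemma measurable_energyDensity (T : Finset (Fin 2 → ℤ)) : Measurable (energyDensity p h o a T) :=
  Finset.measurable_sum _ fun K _ => measurable_const.indicator (measurableSet_gridElement h o K)

lemma energyDensity_ge {T : Finset (Fin 2 → ℤ)} (hK : K ∈ T) (hx : x ∈ gridElement h o K) :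
    (h ^ 2)⁻¹ * nodalEnergy p (localCoef p a K) ≤ energyDensity p h o a T x := by
  have := Finset.single_le_sum (fun K _ => indicator_energy_nonneg (p := p) (a := a) (h := h) (o := o) K x) hK
  rwa [indicator_of_mem hx] at this

lemma energyDensity_le (T : Finset (Fin 2 → ℤ)) (x : Fin 2 → ℝ) : energyDensity p h o a T x ≤
    ∑ K ∈ T, (h ^ 2)⁻¹ * nodalEnergy p (localCoef p a K) :=
  Finset.sum_le_sum fun K _ => indicator_le_self' (fun _ _ =>
    mul_nonneg (by positivity) (nodalEnergy_nonneg _ _)) _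

lemma volume_gridElement (hh : 0 < h) (o : Fin 2 → ℝ) (K : Fin 2 → ℤ) :
    volume (gridElement h o K) = ENNReal.ofReal (h ^ 2) := by
  rw [gridElement, Real.volume_Icc_pi, Fin.prod_univ_two, ← ENNReal.ofReal_mul]
  · congr 1; ring
  · nlinarith

/-- The integral extends over whole elements, including their parts outside the patch; the area `h ^
2` cancels the weight of the density. -/
lemma lintegral_energyDensity (hh : 0 < h) {C : ℝ} (hC : 0 ≤ C) (T : Finset (Fin 2 → ℤ)) :
    ∫⁻ x, ENNReal.ofReal (C * energyDensity p h o a T x) =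
      ENNReal.ofReal (C * ∑ K ∈ T, nodalEnergy p (localCoef p a K)) := by
  have hE := fun K => nodalEnergy_nonneg p (localCoef p a K)
  have e : ∀ x, ENNReal.ofReal (C * energyDensity p h o a T x) = ∑ K ∈ T,
      (gridElement h o K).indicator (fun _ => ENNReal.ofReal
        (C * ((h ^ 2)⁻¹ * nodalEnergy p (localCoef p a K)))) x := by
    intro x
    rw [energyDensity, Finset.mul_sum, ENNReal.ofReal_sum_of_nonneg fun K _ =>
      mul_nonneg hC (indicator_energy_nonneg K x)]
    refine Finset.sum_congr rfl fun K _ => ?_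
    by_cases hx : x ∈ gridElement h o K
    · rw [indicator_of_mem hx, indicator_of_mem hx]
    · rw [indicator_of_notMem hx, indicator_of_notMem hx, mul_zero, ENNReal.ofReal_zero]
  simp only [e]
  rw [lintegral_finsetSum _ fun K _ => measurable_const.indicator (measurableSet_gridElement h o K),
    Finset.mul_sum, ENNReal.ofReal_sum_of_nonneg fun K _ => mul_nonneg hC (hE K)]
  refine Finset.sum_congr rfl fun K _ => ?_
  rw [lintegral_indicator_const (measurableSet_gridElement h o K), volume_gridElement hh,
    ← ENNReal.ofReal_mul (mul_nonneg hC (mul_nonneg (by positivity) (hE K)))]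
  congr 1
  field_simp

lemma sq_integral_le {f : ℝ → ℝ} (hf : IntervalIntegrable f volume 0 1)
    (hf2 : IntervalIntegrable (fun t => f t ^ 2) volume 0 1) :
    (∫ t in (0 : ℝ)..1, f t) ^ 2 ≤ ∫ t in (0 : ℝ)..1, f t ^ 2 := by
  set m := ∫ t in (0 : ℝ)..1, f t with hm
  have h0 : 0 ≤ ∫ t in (0 : ℝ)..1, (f t - m) ^ 2 :=
    intervalIntegral.integral_nonneg zero_le_one fun _ _ => sq_nonneg _
  have e : ∀ t, (f t - m) ^ 2 = f t ^ 2 - (2 * m) * f t + m ^ 2 := fun t => by ring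
  simp only [e] at h0
  rw [intervalIntegral.integral_add (hf2.sub (hf.const_mul _)) intervalIntegrable_const,
    intervalIntegral.integral_sub hf2 (hf.const_mul _), intervalIntegral.integral_const_mul, ← hm,
    intervalIntegral.integral_const] at h0
  simp at h0
  nlinarith

/-- The energy density bounds the increments of the piecewise polynomial. -/
lemma exists_sqGrad (hp : 1 ≤ p) : ∃ C > 0, ∀ (h : ℝ) (o : Fin 2 → ℝ)
    (N : Finset (Fin 2 → ℤ)) (a : (Fin 2 → ℤ) → ℝ) (T : Finset (Fin 2 → ℤ)) (Ω : Set (Fin 2 → ℝ)),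
    0 < h → (∀ m ∉ N, a m = 0) → (∀ K, (gridElement h o K ∩ Ω).Nonempty → K ∈ T) →
    SqGrad Ω (fun x => MvPolynomial.eval x (gridPoly p h o N a (elementTowards h o 0 x)))
      (fun x => ENNReal.ofReal (C * energyDensity p h o a T x)) := by
  obtain ⟨C, hC, H⟩ := exists_eval_gridPoly_le hp
  refine ⟨4 * C, by positivity, fun h o N a T Ω hh ha hT x u hu => ?_⟩
  set φ : ℝ → ℝ := fun r => MvPolynomial.eval (x + r • u)
    (gridPoly p h o N a (elementTowards h o 0 (x + r • u))) with hφ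
  have hd : ∀ r, HasDerivWithinAt φ (derivWithin φ (Ioi r) r) (Ioi r) r := fun r =>
    (hasDerivWithinAt_gridFun hp hh x u r).differentiableWithinAt.hasDerivWithinAt
  have hline : Continuous fun r : ℝ => x + r • u := by fun_prop
  have hcont : Continuous φ := (continuous_gridFun (N := N) (a := a) (h := h) (o := o) hp).comp hline
  set D : ℝ → ℝ := fun r => derivWithin φ (Ioi r) r with hD
  have hDm : Measurable D := measurable_derivWithin_Ioi φ
  have hDG : ∀ r ∈ Ioo (0 : ℝ) 1, D r ^ 2 ≤ ‖u‖ ^ 2 * (4 * C * energyDensity p h o a T (x + r • u)) := by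
    intro r hr
    have e : D r = _ := (hasDerivWithinAt_gridFun hp hh x u r).derivWithin
      (uniqueDiffWithinAt_Ioi r)
    rw [e, Fin.sum_univ_two]
    set K := elementTowards h o u (x + r • u)
    have hK := mem_gridElement_elementTowards hh o u (x + r • u)
    have hKT : K ∈ T := hT K ⟨_, hK, hu r hr⟩
    obtain ⟨-, hk⟩ := H h o N a K _ hh ha hK
    set A := MvPolynomial.eval (x + r • u) (MvPolynomial.pderiv 0 (gridPoly p h o N a K))
    set B := MvPolynomial.eval (x + r • u) (MvPolynomial.pderiv 1 (gridPoly p h o N a K))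
    have h0 : A ^ 2 ≤ _ := hk 0
    have h1 : B ^ 2 ≤ _ := hk 1
    have hu0 : u 0 ^ 2 ≤ ‖u‖ ^ 2 := by
      rw [← sq_abs]; exact pow_le_pow_left₀ (abs_nonneg _) (norm_le_pi_norm u 0) 2
    have hu1 : u 1 ^ 2 ≤ ‖u‖ ^ 2 := by
      rw [← sq_abs]; exact pow_le_pow_left₀ (abs_nonneg _) (norm_le_pi_norm u 1) 2
    calc (u 0 * A + u 1 * B) ^ 2 ≤ 2 * (u 0 ^ 2 * A ^ 2 + u 1 ^ 2 * B ^ 2) := by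
          nlinarith [sq_nonneg (u 0 * A - u 1 * B)]
      _ ≤ 2 * (‖u‖ ^ 2 * (C * (h ^ 2)⁻¹ * nodalEnergy p (localCoef p a K)) +
          ‖u‖ ^ 2 * (C * (h ^ 2)⁻¹ * nodalEnergy p (localCoef p a K))) := by gcongr
      _ = ‖u‖ ^ 2 * (4 * C * ((h ^ 2)⁻¹ * nodalEnergy p (localCoef p a K))) := by ring
      _ ≤ _ := by gcongr; exact energyDensity_ge hKT hK
  set M : ℝ := ‖u‖ ^ 2 * (4 * C * ∑ K ∈ T, (h ^ 2)⁻¹ * nodalEnergy p (localCoef p a K)) with hM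
  have hM0 : 0 ≤ M := by
    have : 0 ≤ ∑ K ∈ T, (h ^ 2)⁻¹ * nodalEnergy p (localCoef p a K) :=
      Finset.sum_nonneg fun K _ => mul_nonneg (by positivity) (nodalEnergy_nonneg _ _)
    positivity
  have hDM : ∀ r ∈ Ioo (0 : ℝ) 1, D r ^ 2 ≤ M := fun r hr => (hDG r hr).trans (by
    rw [hM]; gcongr; exact energyDensity_le T _)
  have hint : ∀ f : ℝ → ℝ, Measurable f → (∃ B, ∀ r ∈ Ioo (0 : ℝ) 1, |f r| ≤ B) →
      IntervalIntegrable f volume 0 1 := by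
    rintro f hf ⟨B, hB⟩
    rw [intervalIntegrable_iff, uIoc_of_le zero_le_one, integrableOn_Ioc_iff_integrableOn_Ioo]
    refine Measure.integrableOn_of_bounded (M := B) (by simp) hf.aestronglyMeasurable ?_
    exact (ae_restrict_iff' measurableSet_Ioo).2 (Filter.Eventually.of_forall hB)
  have hDi : IntervalIntegrable D volume 0 1 := hint D hDm ⟨M + 1, fun r hr => by
    have := hDM r hr
    rw [← sq_abs] at this
    nlinarith [sq_nonneg (|D r| - 1), abs_nonneg (D r)]⟩
  have hDi2 : IntervalIntegrable (fun r => D r ^ 2) volume 0 1 := hint _ (hDm.pow_const 2)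
    ⟨M, fun r hr => by rw [abs_of_nonneg (sq_nonneg _)]; exact hDM r hr⟩
  -- The fundamental theorem of calculus needs only continuity and an integrable right derivative.
  -- The increment is then bounded by the Cauchy–Schwarz inequality on the unit interval.
  have hftc := intervalIntegral.integral_eq_sub_of_hasDeriv_right_of_le zero_le_one
    hcont.continuousOn (fun r _ => hd r) hDi
  have e1 : φ 1 = MvPolynomial.eval (x + u) (gridPoly p h o N a (elementTowards h o 0 (x + u))) := by
    rw [hφ]; simp
  have e0 : φ 0 = MvPolynomial.eval x (gridPoly p h o N a (elementTowards h o 0 x)) := by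
    rw [hφ]; simp
  simp only
  rw [← e1, ← e0, ← hftc]
  calc ENNReal.ofReal ((∫ y in (0 : ℝ)..1, derivWithin φ (Ioi y) y) ^ 2)
      ≤ ENNReal.ofReal (∫ r in (0 : ℝ)..1, D r ^ 2) :=
        ENNReal.ofReal_le_ofReal (sq_integral_le hDi hDi2)
    _ = ∫⁻ r in Ioo (0 : ℝ) 1, ENNReal.ofReal (D r ^ 2) := by
        rw [intervalIntegral.integral_of_le zero_le_one, integral_Ioc_eq_integral_Ioo,
          ofReal_integral_eq_lintegral_ofReal]
        · exact (integrableOn_Ioc_iff_integrableOn_Ioo (by simp)).1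
            ((intervalIntegrable_iff_integrableOn_Ioc_of_le zero_le_one).1 hDi2)
        · exact Filter.Eventually.of_forall fun _ => sq_nonneg _
    _ ≤ ∫⁻ r in Ioo (0 : ℝ) 1, ENNReal.ofReal (‖u‖ ^ 2) *
          ENNReal.ofReal (4 * C * energyDensity p h o a T (x + r • u)) := by
        apply setLIntegral_mono' measurableSet_Ioo
        intro r hr
        rw [← ENNReal.ofReal_mul (by positivity)]
        exact ENNReal.ofReal_le_ofReal (hDG r hr)
    _ ≤ ∫⁻ r in Icc (0 : ℝ) 1, ENNReal.ofReal (‖u‖ ^ 2) *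
          ENNReal.ofReal (4 * C * energyDensity p h o a T (x + r • u)) :=
        lintegral_mono_set Ioo_subset_Icc_self
    _ = _ := by
        rw [lintegral_const_mul]
        exact (((measurable_energyDensity T).comp hline.measurable).const_mul _).ennreal_ofReal

/-! ### Integrals over elements -/

/-- The half-open element. -/
def gridCell (h : ℝ) (o : Fin 2 → ℝ) (K : Fin 2 → ℤ) : Set (Fin 2 → ℝ) :=
  Set.pi univ fun k => Ico (o k + h * K k) (o k + h * (K k + 1))

lemma measurableSet_gridCell (h : ℝ) (o : Fin 2 → ℝ) (K : Fin 2 → ℤ) :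
    MeasurableSet (gridCell h o K) := MeasurableSet.univ_pi fun _ => measurableSet_Ico

lemma mem_gridCell_iff (hh : 0 < h) : x ∈ gridCell h o K ↔ elementTowards h o 0 x = K := by
  simp only [gridCell, mem_univ_pi, mem_Ico, funext_iff, elementTowards_zero, Int.floor_eq_iff,
    inv_mul_eq_div, le_div_iff₀ hh, div_lt_iff₀ hh]
  refine forall_congr' fun k => and_congr ?_ ?_ <;> constructor <;> intro h1 <;> linarith

lemma gridCell_subset (h : ℝ) (o : Fin 2 → ℝ) (K : Fin 2 → ℤ) :
    gridCell h o K ⊆ gridElement h o K := fun _ hx => mem_gridElement_iff.2 fun k =>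
  ⟨(hx k (mem_univ k)).1, (hx k (mem_univ k)).2.le⟩

lemma setIntegral_gridCell (hh : 0 < h) {f : (Fin 2 → ℝ) → ℝ} (hf : Continuous f) :
    ∫ x in gridCell h o K, f x = h ^ 2 * ∫ t in (0 : ℝ)..1, ∫ s in (0 : ℝ)..1,
      f ![o 0 + h * (K 0 + s), o 1 + h * (K 1 + t)] := by
  have hmp := (volume_preserving_finTwoArrow ℝ).symm
  have e1 := hmp.setIntegral_preimage_emb (MeasurableEquiv.finTwoArrow.symm.measurableEmbedding) f
    (gridCell h o K)
  have e2 : (MeasurableEquiv.finTwoArrow.symm : ℝ × ℝ → Fin 2 → ℝ) ⁻¹' gridCell h o K =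
      Ico (o 0 + h * K 0) (o 0 + h * (K 0 + 1)) ×ˢ Ico (o 1 + h * K 1) (o 1 + h * (K 1 + 1)) := by
    ext z
    simp [gridCell, Fin.forall_fin_two, MeasurableEquiv.finTwoArrow]
  have hg : Continuous fun z : ℝ × ℝ => f ![z.1, z.2] := hf.comp (by fun_prop)
  have e3 : ∀ z : ℝ × ℝ, f (MeasurableEquiv.finTwoArrow.symm z) = f ![z.1, z.2] := fun z => rfl
  simp only [e3] at e1
  rw [e2] at e1
  rw [← e1]
  have h01 : o 0 + h * K 0 ≤ o 0 + h * (K 0 + 1) := by nlinarith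
  have h11 : o 1 + h * K 1 ≤ o 1 + h * (K 1 + 1) := by nlinarith
  have hi : Integrable (fun z : ℝ × ℝ => f ![z.1, z.2])
      ((volume.restrict (Ico (o 0 + h * K 0) (o 0 + h * (K 0 + 1)))).prod
        (volume.restrict (Ico (o 1 + h * K 1) (o 1 + h * (K 1 + 1))))) := by
    rw [Measure.prod_restrict]
    exact (hg.continuousOn.integrableOn_compact (isCompact_Icc.prod isCompact_Icc)).mono_set
      (prod_mono Ico_subset_Icc_self Ico_subset_Icc_self)
  have e4 : ∫ z in Ico (o 0 + h * K 0) (o 0 + h * (K 0 + 1)) ×ˢ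
      Ico (o 1 + h * K 1) (o 1 + h * (K 1 + 1)), f ![z.1, z.2] =
      ∫ t in Ico (o 1 + h * K 1) (o 1 + h * (K 1 + 1)),
        ∫ s in Ico (o 0 + h * K 0) (o 0 + h * (K 0 + 1)), f ![s, t] := by
    rw [Measure.volume_eq_prod, ← Measure.prod_restrict]
    exact integral_prod_symm _ hi
  rw [e4]
  have conv : ∀ (b c : ℝ) (g : ℝ → ℝ), ∫ s in Ico (b + h * c) (b + h * (c + 1)), g s =
      h * ∫ s in (0 : ℝ)..1, g (b + h * (c + s)) := by
    intro b c g
    rw [integral_Ico_eq_integral_Ioo, ← integral_Ioc_eq_integral_Ioo,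
      ← intervalIntegral.integral_of_le (by nlinarith)]
    have := intervalIntegral.integral_comp_add_mul g (a := 0) (b := 1) hh.ne' (b + h * c)
    have e : ∀ s : ℝ, b + h * (c + s) = b + h * c + h * s := fun s => by ring
    simp only [e, this, smul_eq_mul]
    rw [mul_inv_cancel_left₀ hh.ne']
    simp
  rw [conv]
  simp only [conv]
  rw [intervalIntegral.integral_const_mul]
  ring

lemma locPt_param (hh : 0 < h) (s t : ℝ) :
    locPt h o K ![o 0 + h * (K 0 + s), o 1 + h * (K 1 + t)] 0 = s ∧
    locPt h o K ![o 0 + h * (K 0 + s), o 1 + h * (K 1 + t)] 1 = t := by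
  constructor <;> simp [locPt] <;> field_simp <;> ring

lemma sum_refVal_node (hp : 1 ≤ p) (c : ℕ → ℕ → ℝ) :
    ∑ x ∈ Finset.range (p + 1) ×ˢ Finset.range (p + 1),
      refVal p c 0 0 ((x.1 : ℝ) / p) ((x.2 : ℝ) / p) ^ 2 = nodalMass p c := by
  refine Finset.sum_congr rfl fun x hx => ?_
  rw [Finset.mem_product] at hx
  rw [refVal_node hp c hx.1 hx.2]

/-- The elementwise integrals control the nodal mass and the nodal energy. -/
lemma exists_le_setIntegral_gridCell (hp : 1 ≤ p) : ∃ κ > 0, ∀ (h : ℝ) (o : Fin 2 → ℝ)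
    (N : Finset (Fin 2 → ℤ)) (a : (Fin 2 → ℤ) → ℝ) (K : Fin 2 → ℤ), 0 < h → (∀ m ∉ N, a m = 0) →
    κ * h ^ 2 * nodalMass p (localCoef p a K) ≤
      ∫ x in gridCell h o K, MvPolynomial.eval x (gridPoly p h o N a K) ^ 2 ∧
    κ * nodalEnergy p (localCoef p a K) ≤ ∫ x in gridCell h o K,
      ∑ k, MvPolynomial.eval x (MvPolynomial.pderiv k (gridPoly p h o N a K)) ^ 2 := by
  obtain ⟨κ₁, hκ₁, H₁⟩ := exists_mass_le_two hp
  obtain ⟨κ₂, hκ₂, H₂⟩ := exists_nodalEnergy_le_grad hp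
  refine ⟨min κ₁ κ₂, by positivity, fun h o N a K hh ha => ⟨?_, ?_⟩⟩
  · have hf : Continuous fun x => MvPolynomial.eval x (gridPoly p h o N a K) ^ 2 :=
      (MvPolynomial.continuous_eval _).pow 2
    rw [setIntegral_gridCell hh hf]
    simp only [eval_gridPoly ha, (locPt_param hh _ _).1, (locPt_param hh _ _).2]
    have h1 := H₁ (localCoef p a K) 0 0
    rw [sum_refVal_node hp] at h1
    have h2 := nodalMass_nonneg p (localCoef p a K)
    calc min κ₁ κ₂ * h ^ 2 * nodalMass p (localCoef p a K)
        ≤ κ₁ * h ^ 2 * nodalMass p (localCoef p a K) := by gcongr; exact min_le_left _ _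
      _ = h ^ 2 * (κ₁ * nodalMass p (localCoef p a K)) := by ring
      _ ≤ _ := by gcongr
  · have hf : ∀ k, Continuous fun x =>
        MvPolynomial.eval x (MvPolynomial.pderiv k (gridPoly p h o N a K)) ^ 2 :=
      fun k => (MvPolynomial.continuous_eval _).pow 2
    have hi : ∀ k, IntegrableOn (fun x =>
        MvPolynomial.eval x (MvPolynomial.pderiv k (gridPoly p h o N a K)) ^ 2) (gridCell h o K) :=
      fun k => ((hf k).continuousOn.integrableOn_compact isCompact_Icc).mono_set
        (gridCell_subset h o K)
    have e0 := fun x => eval_iterate_pderiv_zero (p := p) (h := h) (o := o) (K := K) (x := x) ha 1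
    have e1 := fun x => eval_iterate_pderiv_one (p := p) (h := h) (o := o) (K := K) (x := x) ha 1
    simp only [Function.iterate_one, pow_one] at e0 e1
    simp only [Fin.sum_univ_two]
    rw [integral_add (hi 0) (hi 1), setIntegral_gridCell hh (hf 0), setIntegral_gridCell hh (hf 1)]
    simp only [e0, e1, (locPt_param hh _ _).1, (locPt_param hh _ _).2, mul_pow,
      intervalIntegral.integral_const_mul]
    have h1 := H₂ (localCoef p a K)
    have h2 := nodalEnergy_nonneg p (localCoef p a K)
    -- In two dimensions the area of the element cancels the scaling of the squared gradient, so the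
    -- energy carries no power of `h`.
    have e : h ^ 2 * (h⁻¹ ^ 2) = 1 := by field_simp
    rw [← mul_assoc, ← mul_assoc, e, one_mul, one_mul]
    refine le_trans ?_ h1
    gcongr; exact min_le_right _ _

end

end

section

open Set

/-! ### Chains of elements -/

/-- The grid distance of two elements. -/
def gridDist (K K' : Fin 2 → ℤ) : ℕ := (K 0 - K' 0).natAbs + (K 1 - K' 1).natAbs

/-- Elements that share a face. -/
def Adjacent (K K' : Fin 2 → ℤ) : Prop := ∃ k, K' = K + Pi.single k 1 ∨ K = K' + Pi.single k 1

section

variable {h : ℝ} {o : Fin 2 → ℝ} {Ω : Set (Fin 2 → ℝ)}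

/-- The segment leaves its first interval through the end that faces the target; there it is already
in the adjacent interval, and until then it has stayed in the first one. -/
lemma exists_crossing {y y' : ℝ} {n n' : ℤ} (hy : y ∈ Icc (n : ℝ) (n + 1))
    (hy' : y' ∈ Icc (n' : ℝ) (n' + 1)) (hne : n ≠ n') :
    ∃ r ∈ Icc (0 : ℝ) 1, ∃ n₁ : ℤ, (n₁ - n').natAbs + 1 = (n - n').natAbs ∧
      (n₁ = n + 1 ∨ n = n₁ + 1) ∧ y + r * (y' - y) ∈ Icc (n₁ : ℝ) (n₁ + 1) ∧
      ∀ r' ∈ Icc 0 r, y + r' * (y' - y) ∈ Icc (n : ℝ) (n + 1) := by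
  have hex : ∀ b, (y ≤ b ∧ b ≤ y') ∨ (y' ≤ b ∧ b ≤ y) → ∃ r ∈ Icc (0 : ℝ) 1, y + r * (y' - y) = b := by
    intro b hb
    by_cases he : y' = y
    · exact ⟨0, by simp, by rcases hb with hb | hb <;> linarith⟩
    · have h0 : y' - y ≠ 0 := sub_ne_zero.2 he
      refine ⟨(b - y) / (y' - y), ?_, by field_simp; ring⟩
      rcases hb with hb | hb
      · have : 0 < y' - y := lt_of_le_of_ne (by linarith) (Ne.symm h0)
        exact ⟨div_nonneg (by linarith) this.le, by rw [div_le_one this]; linarith⟩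
      · have : y' - y < 0 := lt_of_le_of_ne (by linarith) h0
        exact ⟨div_nonneg_of_nonpos (by linarith) this.le, by rw [div_le_one_of_neg this]; linarith⟩
  rcases lt_or_gt_of_ne hne with hlt | hlt
  · have h1 : (n : ℝ) + 1 ≤ n' := by exact_mod_cast hlt
    obtain ⟨r, hr, he⟩ := hex (n + 1) (Or.inl ⟨hy.2, h1.trans hy'.1⟩)
    have hyy : 0 ≤ y' - y := by linarith [hy.2, hy'.1]
    refine ⟨r, hr, n + 1, by omega, Or.inl rfl, ?_, fun r' hr' => ⟨?_, ?_⟩⟩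
    · rw [he]; push_cast; constructor <;> linarith
    · linarith [mul_nonneg hr'.1 hyy, hy.1]
    · linarith [mul_le_mul_of_nonneg_right hr'.2 hyy]
  · have h1 : (n' : ℝ) + 1 ≤ n := by exact_mod_cast hlt
    obtain ⟨r, hr, he⟩ := hex n (Or.inr ⟨hy'.2.trans h1, hy.1⟩)
    have hyy : y' - y ≤ 0 := by linarith [hy.1, hy'.2]
    refine ⟨r, hr, n - 1, by omega, Or.inr (by ring), ?_, fun r' hr' => ⟨?_, ?_⟩⟩
    · rw [he]; push_cast; constructor <;> linarith
    · linarith [mul_le_mul_of_nonpos_right hr'.2 hyy]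
    · linarith [mul_nonpos_of_nonneg_of_nonpos hr'.1 hyy, hy.2]

lemma mem_gridElement_iff_coord (hh : 0 < h) {K : Fin 2 → ℤ} {x : Fin 2 → ℝ} :
    x ∈ gridElement h o K ↔ ∀ k, h⁻¹ * (x k - o k) ∈ Icc (K k : ℝ) (K k + 1) := by
  refine ⟨fun hx k => mem_Icc_of_mem_gridElement hh hx k, fun hx => mem_gridElement_iff.2 fun k => ?_⟩
  have := hx k
  rw [inv_mul_eq_div, mem_Icc, le_div_iff₀ hh, div_le_iff₀ hh] at this
  constructor <;> linarith

/-- Of the two coordinates that have to change, the one whose crossing comes first is moved, so the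
other is still in its interval. This also covers segments through a vertex, where a diagonal step is
split into two steps over faces. -/
lemma exists_adjacent (hh : 0 < h) {K Kz : Fin 2 → ℤ} {x z : Fin 2 → ℝ} (hx : x ∈ gridElement h o K)
    (hz : z ∈ gridElement h o Kz) (hne : K ≠ Kz) : ∃ r ∈ Icc (0 : ℝ) 1, ∃ K', Adjacent K K' ∧
      gridDist K' Kz + 1 = gridDist K Kz ∧ x + r • (z - x) ∈ gridElement h o K' := by
  rw [mem_gridElement_iff_coord hh] at hx hz
  have hcoord : ∀ (r : ℝ) k, h⁻¹ * ((x + r • (z - x)) k - o k) =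
      h⁻¹ * (x k - o k) + r * (h⁻¹ * (z k - o k) - h⁻¹ * (x k - o k)) := by
    intro r k; simp only [Pi.add_apply, Pi.smul_apply, Pi.sub_apply, smul_eq_mul]; ring
  simp only [mem_gridElement_iff_coord hh, hcoord]
  have hsame : ∀ k, K k = Kz k → ∀ r ∈ Icc (0 : ℝ) 1,
      h⁻¹ * (x k - o k) + r * (h⁻¹ * (z k - o k) - h⁻¹ * (x k - o k)) ∈ Icc (K k : ℝ) (K k + 1) := by
    intro k hk r hr
    have h1 := hx k
    have h2 := hz k
    rw [← hk] at h2
    constructor <;> nlinarith [h1.1, h1.2, h2.1, h2.2, hr.1, hr.2]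
  -- it suffices to move in one coordinate while the other one stays in its interval
  have hmove : ∀ k k' : Fin 2, k ≠ k' → ∀ r ∈ Icc (0 : ℝ) 1, ∀ n₁ : ℤ,
      (n₁ - Kz k).natAbs + 1 = (K k - Kz k).natAbs → (n₁ = K k + 1 ∨ K k = n₁ + 1) →
      h⁻¹ * (x k - o k) + r * (h⁻¹ * (z k - o k) - h⁻¹ * (x k - o k)) ∈ Icc (n₁ : ℝ) (n₁ + 1) →
      h⁻¹ * (x k' - o k') + r * (h⁻¹ * (z k' - o k') - h⁻¹ * (x k' - o k')) ∈
        Icc (K k' : ℝ) (K k' + 1) →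
      ∃ r ∈ Icc (0 : ℝ) 1, ∃ K', Adjacent K K' ∧ gridDist K' Kz + 1 = gridDist K Kz ∧
        ∀ k, h⁻¹ * (x k - o k) + r * (h⁻¹ * (z k - o k) - h⁻¹ * (x k - o k)) ∈
          Icc (K' k : ℝ) (K' k + 1) := by
    intro k k' hkk r hr n₁ hd hn hm hm'
    refine ⟨r, hr, Function.update K k n₁, ⟨k, ?_⟩, ?_, ?_⟩
    · rcases hn with hn | hn
      · left; ext j; by_cases hj : j = k
        · subst hj; simp [hn]
        · simp [hj]
      · right; ext j; by_cases hj : j = k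
        · subst hj; simp [hn]
        · simp [hj]
    · unfold gridDist
      fin_cases k <;> simp at hd ⊢ <;> omega
    · intro j
      by_cases hj : j = k
      · subst hj; simpa using hm
      · have : j = k' := by omega
        subst this; simpa [hj] using hm'
  by_cases h0 : K 0 = Kz 0
  · have h1 : K 1 ≠ Kz 1 := fun h1 => hne (by ext k; fin_cases k <;> assumption)
    obtain ⟨r, hr, n₁, hd, hn, hm, -⟩ := exists_crossing (hx 1) (hz 1) h1
    exact hmove 1 0 (by decide) r hr n₁ hd hn hm (hsame 0 h0 r hr)
  · obtain ⟨r, hr, n₁, hd, hn, hm, hs⟩ := exists_crossing (hx 0) (hz 0) h0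
    by_cases h1 : K 1 = Kz 1
    · exact hmove 0 1 (by decide) r hr n₁ hd hn hm (hsame 1 h1 r hr)
    · obtain ⟨r', hr', n₁', hd', hn', hm', hs'⟩ := exists_crossing (hx 1) (hz 1) h1
      rcases le_total r r' with hrr | hrr
      · exact hmove 0 1 (by decide) r hr n₁ hd hn hm (hs' r ⟨hr.1, hrr⟩)
      · exact hmove 1 0 (by decide) r' hr' n₁' hd' hn' hm' (hs r' ⟨hr'.1, hrr⟩)

lemma gridDist_eq_zero {K K' : Fin 2 → ℤ} (hd : gridDist K K' = 0) : K = K' := by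
  unfold gridDist at hd
  ext k; fin_cases k <;> simp <;> omega

lemma gridDist_triangle (K K' K'' : Fin 2 → ℤ) : gridDist K K'' ≤ gridDist K K' + gridDist K' K'' := by
  unfold gridDist; omega

lemma gridDist_comm (K K' : Fin 2 → ℤ) : gridDist K K' = gridDist K' K := by
  unfold gridDist; omega

/-- Propagation along the elements that meet a segment. -/
lemma exists_uncut_le {Q P : (Fin 2 → ℤ) → ℝ} {T : Finset (Fin 2 → ℤ)} {cut : (Fin 2 → ℤ) → Prop}
    {C : ℝ} (hh : 0 < h) (hC : 1 ≤ C) (hQ : ∀ K, 0 ≤ Q K) (hP : ∀ K, 0 ≤ P K)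
    (hT : ∀ K, (gridElement h o K ∩ Ω).Nonempty → K ∈ T)
    (hstep : ∀ K ∈ T, ∀ K' ∈ T, cut K → Adjacent K K' → Q K ≤ C * (Q K' + P K))
    {z : Fin 2 → ℝ} {Kz : Fin 2 → ℤ} (hz : z ∈ gridElement h o Kz) (hKz : ¬ cut Kz) :
    ∀ (n : ℕ) (K : Fin 2 → ℤ) (x : Fin 2 → ℝ), x ∈ gridElement h o K →
      (∀ r ∈ Icc (0 : ℝ) 1, x + r • (z - x) ∈ Ω) → gridDist K Kz = n →
      ∃ K₀ ∈ T, ¬ cut K₀ ∧ gridDist K₀ Kz ≤ n ∧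
        Q K ≤ C ^ n * (Q K₀ + ∑ K' ∈ T with gridDist K' Kz ≤ n, P K') := by
  intro n
  induction n with
  | zero =>
    intro K x hx hseg hd
    have hKT : K ∈ T := hT K ⟨x, hx, by simpa using hseg 0 (by simp)⟩
    obtain rfl := gridDist_eq_zero hd
    refine ⟨K, hKT, hKz, by rw [hd], ?_⟩
    have := Finset.sum_nonneg fun K' (_ : K' ∈ T.filter fun K' => gridDist K' K ≤ 0) => hP K'
    simpa using this
  | succ n ih =>
    intro K x hx hseg hd
    have hKT : K ∈ T := hT K ⟨x, hx, by simpa using hseg 0 (by simp)⟩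
    -- The walk stops at the first element that is not cut, because the step inequality is available
    -- only at cut elements.
    by_cases hcut : cut K
    swap
    · refine ⟨K, hKT, hcut, hd.le, ?_⟩
      have := Finset.sum_nonneg fun K' (_ : K' ∈ T.filter fun K' => gridDist K' Kz ≤ n + 1) => hP K'
      have h1 : 1 ≤ C ^ (n + 1) := one_le_pow₀ hC
      nlinarith [hQ K]
    · have hne : K ≠ Kz := by rintro rfl; exact hKz hcut
      obtain ⟨r, hr, K', hadj, hdist, hw⟩ := exists_adjacent hh hx hz hne
      have hK'T : K' ∈ T := hT K' ⟨_, hw, hseg r hr⟩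
      obtain ⟨K₀, hK₀, hcut₀, hd₀, hle⟩ := ih K' _ hw (fun r' hr' => by
        have := hseg (r + r' * (1 - r)) ⟨by nlinarith [hr.1, hr.2, hr'.1], by nlinarith [hr.1, hr.2, hr'.2]⟩
        convert this using 1
        ext k; simp only [Pi.add_apply, Pi.smul_apply, Pi.sub_apply, smul_eq_mul]; ring) (by omega)
      refine ⟨K₀, hK₀, hcut₀, by omega, (hstep K hKT K' hK'T hcut hadj).trans ?_⟩
      have hsum : ∑ K' ∈ T with gridDist K' Kz ≤ n, P K' + P K ≤
          ∑ K' ∈ T with gridDist K' Kz ≤ n + 1, P K' := by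
        rw [add_comm, ← Finset.sum_insert (by simp [hd])]
        apply Finset.sum_le_sum_of_subset_of_nonneg
        · intro J hJ
          rw [Finset.mem_insert, Finset.mem_filter] at hJ
          rcases hJ with rfl | hJ
          · exact Finset.mem_filter.2 ⟨hKT, hd.le⟩
          · exact Finset.mem_filter.2 ⟨hJ.1, by omega⟩
        · exact fun _ _ _ => hP _
      have h1 : 1 ≤ C ^ n := one_le_pow₀ hC
      have h2 : P K ≤ C ^ n * P K := le_mul_of_one_le_left (hP K) h1
      calc C * (Q K' + P K) ≤ C * (C ^ n * (Q K₀ + ∑ K' ∈ T with gridDist K' Kz ≤ n, P K') +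
            C ^ n * P K) := by gcongr
        _ = C ^ (n + 1) * (Q K₀ + (∑ K' ∈ T with gridDist K' Kz ≤ n, P K' + P K)) := by ring
        _ ≤ _ := by gcongr

/-- Each `K'` is counted at most once for every element in the square of side `2 * n + 1` around it.
-/
lemma sum_sum_gridDist_le (T U : Finset (Fin 2 → ℤ)) (n : ℕ) {f : (Fin 2 → ℤ) → ℝ}
    (hf : ∀ K, 0 ≤ f K) :
    ∑ K ∈ T, ∑ K' ∈ U with gridDist K' K ≤ n, f K' ≤ (2 * n + 1) ^ 2 * ∑ K' ∈ U, f K' := by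
  simp only [Finset.sum_filter]
  rw [Finset.sum_comm, Finset.mul_sum]
  apply Finset.sum_le_sum
  intro K' _
  rw [← Finset.sum_filter, Finset.sum_const, nsmul_eq_mul]
  refine mul_le_mul_of_nonneg_right ?_ (hf K')
  have hsub : (T.filter fun K => gridDist K' K ≤ n) ⊆
      Fintype.piFinset fun k => Finset.Icc (K' k - n) (K' k + n) := by
    intro K hK
    rw [Finset.mem_filter] at hK
    have := hK.2
    unfold gridDist at this
    rw [Fintype.mem_piFinset, Fin.forall_fin_two, Finset.mem_Icc, Finset.mem_Icc]
    omega
  have hcard := Finset.card_le_card hsub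
  rw [Fintype.card_piFinset, Fin.prod_univ_two, Int.card_Icc, Int.card_Icc] at hcard
  have e : ∀ b : ℤ, (b + n + 1 - (b - n)).toNat = 2 * n + 1 := fun b => by omega
  rw [e, e] at hcard
  calc _ ≤ (((2 * n + 1) * (2 * n + 1) : ℕ) : ℝ) := by exact_mod_cast hcard
    _ = _ := by push_cast; ring

open Classical in
/-- On a domain with the uniform cone property, the elements that are not cut control all active
elements. -/
lemma UniformCone.exists_sum_le (hΩ : IsOpen Ω) (hcone : UniformCone Ω) {C : ℝ} (hC : 1 ≤ C) :
    ∃ C' > 0, ∃ h₀ > 0, ∀ (h : ℝ) (o : Fin 2 → ℝ) (T : Finset (Fin 2 → ℤ)) (Q P : (Fin 2 → ℤ) → ℝ),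
      0 < h → h ≤ h₀ → (∀ K, K ∈ T ↔ (gridElement h o K ∩ Ω).Nonempty) →
      (∀ K, 0 ≤ Q K) → (∀ K, 0 ≤ P K) →
      (∀ K ∈ T, ∀ K' ∈ T, (gridElement h o K ∩ frontier Ω).Nonempty → Adjacent K K' →
        Q K ≤ C * (Q K' + P K)) →
      ∑ K ∈ T, Q K ≤ C' * (∑ K ∈ T with ¬ (gridElement h o K ∩ frontier Ω).Nonempty, Q K +
        ∑ K ∈ T, P K) := by
  obtain ⟨D, η, hη, hD⟩ := hcone
  -- At the distance `M * h` along its axis the cone contains a ball of radius `2 * h`, hence the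
  -- whole element at its centre. The bound `h ≤ M⁻¹` keeps this point within the truncated cone,
  -- and `R` bounds the number of elements to be crossed in each coordinate.
  set M : ℝ := 2 / η with hM
  have hM0 : 0 < M := by positivity
  obtain ⟨B, hB⟩ := (D.finite_toSet.image fun e => ‖e‖).bddAbove
  have hB' : ∀ e ∈ D, ‖e‖ ≤ B := fun e he => hB (mem_image_of_mem _ he)
  obtain ⟨R, hR⟩ := exists_nat_ge (M * B + 1)
  refine ⟨C ^ (2 * R) * (2 * (4 * R : ℕ) + 1) ^ 2, by positivity, M⁻¹, by positivity,
    fun h o T Q P hh hh₀ hT hQ hP hstep => ?_⟩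
  have hMh : M * h ≤ 1 := by
    calc M * h ≤ M * M⁻¹ := by gcongr
      _ = 1 := mul_inv_cancel₀ hM0.ne'
  have hMh0 : 0 < M * h := by positivity
  -- each active element is linked to an element that is not cut
  have hlink : ∀ K ∈ T, ∃ K₀ ∈ T, ¬ (gridElement h o K₀ ∩ frontier Ω).Nonempty ∧
      gridDist K₀ K ≤ 4 * R ∧
      Q K ≤ C ^ (2 * R) * (Q K₀ + ∑ K' ∈ T with gridDist K' K ≤ 4 * R, P K') := by
    intro K hK
    obtain ⟨x, hxK, hxΩ⟩ := (hT K).1 hK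
    obtain ⟨e, he, hex⟩ := hD x hxΩ
    set z := x + (M * h) • e with hz
    set Kz := elementTowards h o 0 z
    have hzK : z ∈ gridElement h o Kz := mem_gridElement_elementTowards_zero hh o z
    have hsub : gridElement h o Kz ⊆ Ω := by
      intro w hw
      have hwz : ‖w - z‖ ≤ h := by
        rw [pi_norm_le_iff_of_nonneg hh.le]
        intro k
        have h1 := mem_gridElement_iff.1 hw k
        have h2 := mem_gridElement_iff.1 hzK k
        rw [Pi.sub_apply, Real.norm_eq_abs, abs_le]
        constructor <;> linarith
      have := hex (e + (M * h)⁻¹ • (w - z)) (by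
        rw [add_sub_cancel_left, norm_smul, norm_inv, Real.norm_of_nonneg hMh0.le]
        calc (M * h)⁻¹ * ‖w - z‖ ≤ (M * h)⁻¹ * h := by gcongr
          _ = η / 2 := by rw [hM]; field_simp
          _ < η := by linarith) (M * h) ⟨hMh0.le, hMh⟩
      rwa [smul_add, smul_smul, mul_inv_cancel₀ hMh0.ne', one_smul, ← add_assoc, ← hz,
        add_sub_cancel] at this
    have hKz : ¬ (gridElement h o Kz ∩ frontier Ω).Nonempty := by
      rintro ⟨w, hw, hw'⟩
      rw [hΩ.frontier_eq] at hw'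
      exact hw'.2 (hsub hw)
    have hdist : gridDist K Kz ≤ 2 * R := by
      have hk : ∀ k, (K k - Kz k).natAbs ≤ R := by
        intro k
        have h1 := mem_gridElement_iff.1 hxK k
        have h2 := mem_gridElement_iff.1 hzK k
        have h3 : z k = x k + M * h * e k := by simp [hz]
        have h4 : |e k| ≤ B := (norm_le_pi_norm e k).trans (hB' e he)
        have h5 := abs_le.1 h4
        have h6 : |((K k - Kz k : ℤ) : ℝ)| ≤ M * B + 1 := by
          push_cast
          rw [abs_le]
          have h7 : M * h * e k ≤ M * h * B := by gcongr; exact h5.2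
          have h8 : M * h * (-B) ≤ M * h * e k := by gcongr; exact h5.1
          constructor
          · refine le_of_mul_le_mul_left ?_ hh
            nlinarith
          · refine le_of_mul_le_mul_left ?_ hh
            nlinarith
        have h9 := h6.trans hR
        rw [← Int.cast_abs, Int.abs_eq_natAbs] at h9
        exact_mod_cast h9
      have := hk 0
      have := hk 1
      unfold gridDist; omega
    obtain ⟨K₀, hK₀, hcut₀, hd₀, hle⟩ := exists_uncut_le
      (cut := fun K => (gridElement h o K ∩ frontier Ω).Nonempty) hh hC hQ hP
      (fun K => (hT K).2) hstep hzK hKz _ K x hxK (fun r hr => by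
        have := hex e (by simpa using hη) (r * (M * h)) ⟨mul_nonneg hr.1 hMh0.le,
          mul_le_one₀ hr.2 hMh0.le hMh⟩
        rwa [hz, add_sub_cancel_left, smul_smul]) rfl
    -- Distances are now measured from `K` instead of `Kz`, which turns `2 * R` into `4 * R`.
    have ht := gridDist_triangle K₀ Kz K
    rw [gridDist_comm Kz K] at ht
    refine ⟨K₀, hK₀, hcut₀, by omega, hle.trans ?_⟩
    have hsum : ∑ K' ∈ T with gridDist K' Kz ≤ gridDist K Kz, P K' ≤
        ∑ K' ∈ T with gridDist K' K ≤ 4 * R, P K' := by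
      apply Finset.sum_le_sum_of_subset_of_nonneg
      · intro J hJ
        rw [Finset.mem_filter] at hJ ⊢
        have ht := gridDist_triangle J Kz K
        rw [gridDist_comm Kz K] at ht
        exact ⟨hJ.1, by omega⟩
      · exact fun _ _ _ => hP _
    have h0 := hQ K₀
    have h1 := Finset.sum_nonneg fun K' (_ : K' ∈ T.filter fun K' => gridDist K' K ≤ 4 * R) => hP K'
    have h2 := Finset.sum_nonneg fun K' (_ : K' ∈ T.filter fun K' => gridDist K' Kz ≤ gridDist K Kz) =>
      hP K'
    gcongr
  have hQsum : ∀ K ∈ T, Q K ≤ C ^ (2 * R) *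
      (∑ K' ∈ T.filter (fun K => ¬ (gridElement h o K ∩ frontier Ω).Nonempty)
        with gridDist K' K ≤ 4 * R, Q K' + ∑ K' ∈ T with gridDist K' K ≤ 4 * R, P K') := by
    intro K hK
    obtain ⟨K₀, hK₀, hcut₀, hd₀, hle⟩ := hlink K hK
    refine hle.trans ?_
    gcongr
    exact Finset.single_le_sum (f := Q) (fun _ _ => hQ _)
      (Finset.mem_filter.2 ⟨Finset.mem_filter.2 ⟨hK₀, hcut₀⟩, hd₀⟩)
  calc ∑ K ∈ T, Q K ≤ _ := Finset.sum_le_sum hQsum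
    _ = C ^ (2 * R) * (∑ K ∈ T, ∑ K' ∈ T.filter
        (fun K => ¬ (gridElement h o K ∩ frontier Ω).Nonempty) with gridDist K' K ≤ 4 * R, Q K' +
          ∑ K ∈ T, ∑ K' ∈ T with gridDist K' K ≤ 4 * R, P K') := by
        rw [← Finset.mul_sum, Finset.sum_add_distrib]
    _ ≤ C ^ (2 * R) * ((2 * (4 * R : ℕ) + 1) ^ 2 *
          ∑ K ∈ T with ¬ (gridElement h o K ∩ frontier Ω).Nonempty, Q K +
          (2 * (4 * R : ℕ) + 1) ^ 2 * ∑ K ∈ T, P K) := by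
        gcongr
        · exact sum_sum_gridDist_le T _ (4 * R) hQ
        · exact sum_sum_gridDist_le T T (4 * R) hP
    _ = _ := by ring

end

end

section

open Set MeasureTheory

/-! ### Bounded measurable functions -/

/-- The function is bounded and measurable on a set. -/
def BddMeas {α : Type*} [MeasurableSpace α] (μ : Measure α) (s : Set α) (f : α → ℝ) : Prop :=
  AEStronglyMeasurable f (μ.restrict s) ∧ ∃ M, ∀ x ∈ s, |f x| ≤ M

namespace BddMeas

variable {α : Type*} [MeasurableSpace α] {μ : Measure α} {s : Set α} {f g : α → ℝ}

lemma add (hf : BddMeas μ s f) (hg : BddMeas μ s g) : BddMeas μ s (fun x => f x + g x) := by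
  obtain ⟨M, hM⟩ := hf.2
  obtain ⟨M', hM'⟩ := hg.2
  exact ⟨hf.1.add hg.1, M + M', fun x hx => (abs_add_le _ _).trans (add_le_add (hM x hx) (hM' x hx))⟩

lemma mul (hf : BddMeas μ s f) (hg : BddMeas μ s g) : BddMeas μ s (fun x => f x * g x) := by
  obtain ⟨M, hM⟩ := hf.2
  obtain ⟨M', hM'⟩ := hg.2
  refine ⟨hf.1.mul hg.1, M * M', fun x hx => ?_⟩
  rw [abs_mul]
  exact mul_le_mul (hM x hx) (hM' x hx) (abs_nonneg _) ((abs_nonneg _).trans (hM x hx))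

lemma const (c : ℝ) : BddMeas μ s (fun _ => c) :=
  ⟨aestronglyMeasurable_const, |c|, fun _ _ => le_rfl⟩

lemma sub (hf : BddMeas μ s f) (hg : BddMeas μ s g) : BddMeas μ s (fun x => f x - g x) := by
  have := hf.add ((const (-1)).mul hg)
  simpa [sub_eq_add_neg] using this

lemma sum {β : Type*} (t : Finset β) {F : β → α → ℝ} (hF : ∀ b ∈ t, BddMeas μ s (F b)) :
    BddMeas μ s (fun x => ∑ b ∈ t, F b x) := by
  classical
  induction t using Finset.induction_on with
  | empty => simpa using const 0
  | insert b t hb ih =>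
    simp only [Finset.sum_insert hb]
    exact (hF b (Finset.mem_insert_self _ _)).add
      (ih fun b' hb' => hF b' (Finset.mem_insert_of_mem hb'))

lemma integrableOn (hf : BddMeas μ s f) (hs : MeasurableSet s) (hμ : μ s ≠ ⊤) :
    IntegrableOn f s μ := by
  obtain ⟨M, hM⟩ := hf.2
  have : IsFiniteMeasure (μ.restrict s) := ⟨by simpa using hμ.lt_top⟩
  exact Integrable.of_bound hf.1 M ((ae_restrict_iff' hs).2 (Filter.Eventually.of_forall hM))

lemma intervalIntegrable {f : ℝ → ℝ} (hf : BddMeas volume (Icc 0 1) f) :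
    IntervalIntegrable f volume 0 1 := by
  rw [intervalIntegrable_iff, uIoc_of_le zero_le_one]
  exact (hf.integrableOn measurableSet_Icc (by simp)).mono_set Ioc_subset_Icc_self

lemma of_continuousOn_subset [TopologicalSpace α] [OpensMeasurableSpace α] {t : Set α}
    (hf : ContinuousOn f t) (ht : IsCompact t) (hst : s ⊆ t) (hs : MeasurableSet s) :
    BddMeas μ s f := by
  obtain ⟨M, hM⟩ := ht.exists_bound_of_continuousOn hf
  exact ⟨(hf.mono hst).aestronglyMeasurable hs, M, fun x hx => hM x (hst hx)⟩

lemma comp_one_sub {f : ℝ → ℝ} (hf : BddMeas volume (Icc 0 1) f) :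
    BddMeas volume (Icc 0 1) (fun t => f (1 - t)) := by
  obtain ⟨M, hM⟩ := hf.2
  have hpre : (fun t : ℝ => 1 - t) ⁻¹' Icc 0 1 = Icc 0 1 := by
    ext t; simp only [mem_preimage, mem_Icc]; constructor <;> intro h <;> constructor <;> linarith [h.1, h.2]
  have hmp := (Measure.measurePreserving_sub_left (volume : Measure ℝ) 1).restrict_preimage
    (measurableSet_Icc (a := (0 : ℝ)) (b := 1))
  rw [hpre] at hmp
  exact ⟨hf.1.comp_measurePreserving hmp, M, fun t ht => hM _ ⟨by linarith [ht.2], by linarith [ht.1]⟩⟩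

end BddMeas

/-! ### Elementwise polynomials are bounded and measurable -/

lemma measurable_elementTowards {α : Type*} [MeasurableSpace α] (h : ℝ) (o : Fin 2 → ℝ)
    {u x : α → Fin 2 → ℝ} (hu : Measurable u) (hx : Measurable x) :
    Measurable fun a => elementTowards h o (u a) (x a) := by
  refine measurable_pi_lambda _ fun k => ?_
  unfold elementTowards
  have h1 : Measurable fun a => (x a k - o k) / h := by fun_prop
  exact Measurable.ite (measurableSet_lt (by fun_prop) measurable_const)
    ((Int.measurable_ceil.comp h1).sub_const 1) (Int.measurable_floor.comp h1)

lemma measurable_comp_family {α β γ δ : Type*} [MeasurableSpace α] [MeasurableSpace β]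
    [MeasurableSpace γ] [MeasurableSpace δ] [Countable γ] [MeasurableSingletonClass γ] {g : β → γ → δ}
    (hg : ∀ K, Measurable fun y => g y K) {x : α → β} {K : α → γ} (hx : Measurable x)
    (hK : Measurable K) : Measurable fun a => g (x a) (K a) := by
  have : Measurable fun z : β × γ => g z.1 z.2 := measurable_from_prod_countable_left hg
  exact this.comp (hx.prodMk hK)

lemma measurable_eval_family {α : Type*} [MeasurableSpace α]
    (P : (Fin 2 → ℤ) → MvPolynomial (Fin 2) ℝ) {x : α → Fin 2 → ℝ} {K : α → Fin 2 → ℤ}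
    (hx : Measurable x) (hK : Measurable K) :
    Measurable fun a => MvPolynomial.eval (x a) (P (K a)) :=
  measurable_comp_family (g := fun y K => MvPolynomial.eval y (P K))
    (fun K => (MvPolynomial.continuous_eval (P K)).measurable) hx hK

/-- Only finitely many elements contain points of the unit square, whichever direction selects among
them. So the bound is uniform in `u`. -/
lemma exists_bound_eval_family {h : ℝ} (hh : 0 < h) (o : Fin 2 → ℝ)
    (P : (Fin 2 → ℤ) → MvPolynomial (Fin 2) ℝ) :
    ∃ M, ∀ u, ∀ x ∈ Icc (0 : Fin 2 → ℝ) 1, |MvPolynomial.eval x (P (elementTowards h o u x))| ≤ M := by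
  have hK : ∀ K, ∃ M, ∀ x ∈ Icc (0 : Fin 2 → ℝ) 1, |MvPolynomial.eval x (P K)| ≤ M := fun K =>
    isCompact_Icc.exists_bound_of_continuousOn (MvPolynomial.continuous_eval _).continuousOn
  choose M hM using hK
  set T : Finset (Fin 2 → ℤ) := Fintype.piFinset fun k =>
    Finset.Icc (⌊(0 - o k) / h⌋ - 1) ⌈(1 - o k) / h⌉ with hT
  have hM0 : ∀ K, 0 ≤ M K := fun K => (abs_nonneg _).trans (hM K 0 (by simp))
  refine ⟨∑ K ∈ T, M K, fun u x hx => (hM _ x hx).trans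
    (Finset.single_le_sum (fun K _ => hM0 K) ?_)⟩
  rw [hT, Fintype.mem_piFinset]
  intro k
  have h0 : (0 - o k) / h ≤ (x k - o k) / h := by
    have := hx.1 k; simp only [Pi.zero_apply] at this; gcongr
  have h1 : (x k - o k) / h ≤ (1 - o k) / h := by
    have := hx.2 k; simp only [Pi.one_apply] at this; gcongr
  have f0 := Int.floor_le_floor h0
  have c1 := Int.ceil_le_ceil h1
  have fc := Int.floor_le_ceil ((x k - o k) / h)
  rw [Finset.mem_Icc, elementTowards]
  split_ifs <;> omega

namespace MultipatchSurface

variable {ι ε : Type*} {d : ℕ} (S : MultipatchSurface ι ε d)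

/-! ### The metric -/

lemma closure_dom_subset (i : ι) : closure (S.dom i) ⊆ Icc 0 1 :=
  closure_minimal (S.dom_subset i) isClosed_Icc

lemma isCompact_closure_dom (i : ι) : IsCompact (closure (S.dom i)) :=
  isCompact_Icc.of_isClosed_subset isClosed_closure (S.closure_dom_subset i)

lemma curve_mem_closure (s : ε × Bool) {t : ℝ} (ht : t ∈ Icc (0 : ℝ) 1) :
    S.curve s t ∈ closure (S.dom (S.patch s)) := frontier_subset_closure (S.curve_mem_frontier s ht)

lemma continuous_metric (i : ι) (k l : Fin 2) : Continuous fun x => S.metric i x k l := by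
  have h1 : Continuous (fderiv ℝ (S.F i)) := (S.F_smooth i).continuous_fderiv (by simp)
  have h2 : ∀ v, Continuous fun x => fderiv ℝ (S.F i) x v := fun v => h1.clm_apply continuous_const
  exact (h2 _).inner (h2 _)

lemma metric_symm (i : ι) (x : Fin 2 → ℝ) (k l : Fin 2) : S.metric i x k l = S.metric i x l k := by
  simp only [metric, Matrix.of_apply]; exact real_inner_comm _ _

lemma dotProduct_metric (i : ι) (x ξ : Fin 2 → ℝ) :
    ξ ⬝ᵥ (S.metric i x).mulVec ξ = ‖fderiv ℝ (S.F i) x ξ‖ ^ 2 := by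
  have e : ξ = ξ 0 • (Pi.single 0 1 : Fin 2 → ℝ) + ξ 1 • (Pi.single 1 1 : Fin 2 → ℝ) := by
    ext k; fin_cases k <;> simp
  rw [← real_inner_self_eq_norm_sq]
  conv_rhs => rw [e]
  simp only [map_add, map_smul, inner_add_left, inner_add_right, real_inner_smul_left,
    real_inner_smul_right]
  simp only [Matrix.mulVec, dotProduct, Fin.sum_univ_two, metric, Matrix.of_apply]
  ring

lemma dotProduct_metric_pos {i : ι} {x : Fin 2 → ℝ} (hx : x ∈ closure (S.dom i)) {ξ : Fin 2 → ℝ}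
    (hξ : ξ ≠ 0) : 0 < ξ ⬝ᵥ (S.metric i x).mulVec ξ := by
  rw [dotProduct_metric]
  have : fderiv ℝ (S.F i) x ξ ≠ 0 := fun h0 => hξ (S.F_immersion i x hx (by rw [h0, map_zero]))
  positivity

lemma metric_diag_pos {i : ι} {x : Fin 2 → ℝ} (hx : x ∈ closure (S.dom i)) (k : Fin 2) :
    0 < S.metric i x k k := by
  have := S.dotProduct_metric_pos hx (ξ := Pi.single k 1) (by simp)
  simpa using this

lemma metric_det (i : ι) (x : Fin 2 → ℝ) :
    (S.metric i x).det = S.metric i x 0 0 * S.metric i x 1 1 - S.metric i x 0 1 ^ 2 := by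
  rw [Matrix.det_fin_two, S.metric_symm i x 1 0]; ring

lemma metric_det_pos {i : ι} {x : Fin 2 → ℝ} (hx : x ∈ closure (S.dom i)) :
    0 < (S.metric i x).det := by
  have h0 := S.metric_diag_pos hx 0
  have h1 := S.dotProduct_metric_pos hx (ξ := ![-S.metric i x 0 1, S.metric i x 0 0]) (by
    intro h2
    have := congrFun h2 1
    simp at this
    exact h0.ne' this)
  rw [metric_det]
  simp only [Matrix.mulVec, dotProduct, Fin.sum_univ_two, S.metric_symm i x 1 0] at h1
  simp at h1
  have h2 : 0 < S.metric i x 0 0 *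
      (S.metric i x 0 0 * S.metric i x 1 1 - S.metric i x 0 1 ^ 2) := by nlinarith
  exact (pos_iff_pos_of_mul_pos h2).1 h0

lemma continuous_metric_det (i : ι) : Continuous fun x => (S.metric i x).det := by
  simp only [metric_det]
  have := S.continuous_metric i
  exact ((this 0 0).mul (this 1 1)).sub ((this 0 1).pow 2)

lemma metric_inv_apply (i : ι) (x : Fin 2 → ℝ) :
    (S.metric i x)⁻¹ 0 0 = ((S.metric i x).det)⁻¹ * S.metric i x 1 1 ∧
    (S.metric i x)⁻¹ 0 1 = -(((S.metric i x).det)⁻¹ * S.metric i x 0 1) ∧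
    (S.metric i x)⁻¹ 1 0 = -(((S.metric i x).det)⁻¹ * S.metric i x 0 1) ∧
    (S.metric i x)⁻¹ 1 1 = ((S.metric i x).det)⁻¹ * S.metric i x 0 0 := by
  rw [Matrix.inv_def, Ring.inverse_eq_inv', Matrix.adjugate_fin_two]
  simp [S.metric_symm i x 1 0]

lemma metric_inv_symm (i : ι) (x : Fin 2 → ℝ) (k l : Fin 2) :
    (S.metric i x)⁻¹ k l = (S.metric i x)⁻¹ l k := by
  obtain ⟨-, h01, h10, -⟩ := S.metric_inv_apply i x
  fin_cases k <;> fin_cases l <;> first | rfl | (simp only [Fin.zero_eta, Fin.mk_one]; rw [h01, h10])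

lemma continuousOn_metric_inv (i : ι) (k l : Fin 2) :
    ContinuousOn (fun x => (S.metric i x)⁻¹ k l) (closure (S.dom i)) := by
  have hd : ContinuousOn (fun x => ((S.metric i x).det)⁻¹) (closure (S.dom i)) :=
    (S.continuous_metric_det i).continuousOn.inv₀ fun x hx => (S.metric_det_pos hx).ne'
  have hm := fun k l => (S.continuous_metric i k l).continuousOn (s := closure (S.dom i))
  have h := fun x => S.metric_inv_apply i x
  fin_cases k <;> fin_cases l <;> simp only [Fin.zero_eta, Fin.mk_one]
  · exact (hd.mul (hm 1 1)).congr fun x _ => (h x).1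
  · exact (hd.mul (hm 0 1)).neg.congr fun x _ => (h x).2.1
  · exact (hd.mul (hm 0 1)).neg.congr fun x _ => (h x).2.2.1
  · exact (hd.mul (hm 0 0)).congr fun x _ => (h x).2.2.2

/-- Bounds for the metric. -/
lemma exists_metric_bounds (i : ι) : ∃ c > 0, ∃ C > 0, ∀ x ∈ closure (S.dom i),
    (c ≤ √(S.metric i x).det ∧ √(S.metric i x).det ≤ C) ∧ ∀ ξ : Fin 2 → ℝ,
      c * ∑ k, ξ k ^ 2 ≤ ξ ⬝ᵥ (S.metric i x)⁻¹.mulVec ξ ∧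
      ξ ⬝ᵥ (S.metric i x)⁻¹.mulVec ξ ≤ C * ∑ k, ξ k ^ 2 := by
  have hcpt := S.isCompact_closure_dom i
  have hne : (closure (S.dom i)).Nonempty := (S.dom_connected i).nonempty.closure
  obtain ⟨x₁, hx₁, h₁⟩ := hcpt.exists_isMinOn hne (S.continuous_metric_det i).continuousOn
  obtain ⟨D, hD⟩ := hcpt.bddAbove_image (S.continuous_metric_det i).continuousOn
  have htr : Continuous fun x => S.metric i x 0 0 + S.metric i x 1 1 :=
    (S.continuous_metric i 0 0).add (S.continuous_metric i 1 1)
  obtain ⟨B, hB⟩ := hcpt.bddAbove_image htr.continuousOn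
  set b := (S.metric i x₁).det with hb
  have hb0 : 0 < b := S.metric_det_pos hx₁
  have hB0 : 0 < B := by
    have := hB (mem_image_of_mem _ hx₁)
    have h0 := S.metric_diag_pos hx₁ 0
    have h1 := S.metric_diag_pos hx₁ 1
    linarith
  have hD0 : 0 < D := hb0.trans_le (hD (mem_image_of_mem _ hx₁))
  refine ⟨min (√b) B⁻¹, lt_min (Real.sqrt_pos.2 hb0) (by positivity), max (√D) (B / b),
    lt_max_of_lt_right (by positivity), fun x hx => ⟨⟨?_, ?_⟩, fun ξ => ?_⟩⟩
  · exact (min_le_left _ _).trans (Real.sqrt_le_sqrt (h₁ hx))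
  · exact (Real.sqrt_le_sqrt (hD (mem_image_of_mem _ hx))).trans (le_max_left _ _)
  · obtain ⟨e00, e01, e10, e11⟩ := S.metric_inv_apply i x
    have hdet := S.metric_det_pos hx
    have hdet' := S.metric_det i x
    have hbx : b ≤ (S.metric i x).det := h₁ hx
    have hBx : S.metric i x 0 0 + S.metric i x 1 1 ≤ B := hB (mem_image_of_mem _ hx)
    have h0 := S.metric_diag_pos hx 0
    have h1 := S.metric_diag_pos hx 1
    set δ := (S.metric i x).det
    set g00 := S.metric i x 0 0
    set g01 := S.metric i x 0 1
    set g11 := S.metric i x 1 1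
    have eq : ξ ⬝ᵥ (S.metric i x)⁻¹.mulVec ξ =
        δ⁻¹ * (g11 * ξ 0 ^ 2 - 2 * g01 * ξ 0 * ξ 1 + g00 * ξ 1 ^ 2) := by
      simp only [Matrix.mulVec, dotProduct, Fin.sum_univ_two, e00, e01, e10, e11]; ring
    rw [eq, Fin.sum_univ_two]
    -- This is the form of the adjugate. The adjugate of a positive `2 × 2` matrix has the same
    -- trace and determinant, so its eigenvalues lie between the determinant divided by the trace
    -- and the trace.
    set q := g11 * ξ 0 ^ 2 - 2 * g01 * ξ 0 * ξ 1 + g00 * ξ 1 ^ 2 with hq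
    have hn : 0 ≤ ξ 0 ^ 2 + ξ 1 ^ 2 := by positivity
    have hlow : δ * (ξ 0 ^ 2 + ξ 1 ^ 2) ≤ (g00 + g11) * q := by
      rw [hdet', hq]
      nlinarith [sq_nonneg (g11 * ξ 0 - g01 * ξ 1), sq_nonneg (g00 * ξ 1 - g01 * ξ 0)]
    have hq0 : 0 ≤ q := by
      have : 0 ≤ (g00 + g11) * q := le_trans (by positivity) hlow
      exact (mul_nonneg_iff_of_pos_left (by linarith)).1 this
    have hup : q ≤ (g00 + g11) * (ξ 0 ^ 2 + ξ 1 ^ 2) := by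
      have : 0 ≤ g00 * ξ 0 ^ 2 + 2 * g01 * ξ 0 * ξ 1 + g11 * ξ 1 ^ 2 := by
        have h2 : 0 ≤ g00 * (g00 * ξ 0 ^ 2 + 2 * g01 * ξ 0 * ξ 1 + g11 * ξ 1 ^ 2) := by
          have : g00 * (g00 * ξ 0 ^ 2 + 2 * g01 * ξ 0 * ξ 1 + g11 * ξ 1 ^ 2) =
            (g00 * ξ 0 + g01 * ξ 1) ^ 2 + δ * ξ 1 ^ 2 := by rw [hdet']; ring
          rw [this]; positivity
        exact (mul_nonneg_iff_of_pos_left h0).1 h2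
      rw [hq]; nlinarith
    constructor
    · calc min (√b) B⁻¹ * (ξ 0 ^ 2 + ξ 1 ^ 2) ≤ B⁻¹ * (ξ 0 ^ 2 + ξ 1 ^ 2) := by
            gcongr; exact min_le_right _ _
        _ ≤ δ⁻¹ * q := by
            rw [inv_mul_eq_div, inv_mul_eq_div, div_le_div_iff₀ hB0 hdet]
            calc _ = δ * (ξ 0 ^ 2 + ξ 1 ^ 2) := by ring
              _ ≤ _ := hlow
              _ ≤ B * q := by gcongr
              _ = _ := by ring
    · calc δ⁻¹ * q ≤ b⁻¹ * (B * (ξ 0 ^ 2 + ξ 1 ^ 2)) := by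
            gcongr
            exact hup.trans (by gcongr)
        _ = B / b * (ξ 0 ^ 2 + ξ 1 ^ 2) := by rw [div_eq_mul_inv]; ring
        _ ≤ _ := by gcongr; exact le_max_right _ _

lemma inward_ne_zero (s : ε × Bool) {t : ℝ} (ht : t ∈ Icc (0 : ℝ) 1) : S.inward s t ≠ 0 := by
  intro h0
  apply S.curve_regular s t ht
  have h1 := congrFun h0 0
  have h2 := congrFun h0 1
  simp [inward] at h1 h2
  ext k; fin_cases k <;> simp [h1, h2]

lemma continuous_inward (s : ε × Bool) (k : Fin 2) : Continuous fun t => S.inward s t k := by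
  have h1 := S.continuous_deriv_curve s
  fin_cases k <;> simp [inward] <;> fun_prop

lemma continuousOn_conormal (s : ε × Bool) (k : Fin 2) :
    ContinuousOn (fun t => S.conormal s t k) (Icc 0 1) := by
  have hG : ∀ k l, ContinuousOn (fun t => (S.metric (S.patch s) (S.curve s t))⁻¹ k l) (Icc 0 1) :=
    fun k l => (S.continuousOn_metric_inv (S.patch s) k l).comp (S.continuous_curve s).continuousOn
      fun t ht => S.curve_mem_closure s ht
  have hM : ∀ k l, ContinuousOn (fun t => S.metric (S.patch s) (S.curve s t) k l) (Icc 0 1) :=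
    fun k l => ((S.continuous_metric (S.patch s) k l).comp (S.continuous_curve s)).continuousOn
  have hn : ∀ k, ContinuousOn (fun t => S.inward s t k) (Icc 0 1) :=
    fun k => (S.continuous_inward s k).continuousOn
  have ha : ∀ k, ContinuousOn (fun t =>
      ((S.metric (S.patch s) (S.curve s t))⁻¹.mulVec (-(S.inward s t))) k) (Icc 0 1) := by
    intro k
    simp only [Matrix.mulVec, dotProduct, Fin.sum_univ_two, Pi.neg_apply]
    exact ((hG k 0).mul (hn 0).neg).add ((hG k 1).mul (hn 1).neg)
  simp only [conormal, Pi.smul_apply, smul_eq_mul]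
  refine ContinuousOn.mul (ContinuousOn.inv₀ ?_ ?_) (ha k)
  · apply ContinuousOn.sqrt
    simp only [dotProduct]
    refine continuousOn_finsetSum _ fun k _ => (ha k).mul ?_
    simp only [Matrix.mulVec, dotProduct]
    exact continuousOn_finsetSum _ fun l _ => (hM k l).mul (ha l)
  · intro t ht
    refine (Real.sqrt_pos.2 (S.dotProduct_metric_pos (S.curve_mem_closure s ht) ?_)).ne'
    intro h0
    have h1 := congrArg (S.metric (S.patch s) (S.curve s t)).mulVec h0
    have hu : IsUnit (S.metric (S.patch s) (S.curve s t)).det :=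
      (S.metric_det_pos (S.curve_mem_closure s ht)).ne'.isUnit
    rw [Matrix.mulVec_mulVec, Matrix.mul_nonsing_inv _ hu, Matrix.one_mulVec, Matrix.mulVec_zero,
      neg_eq_zero] at h1
    exact S.inward_ne_zero s ht h1

/-- The length element of an interface. -/
noncomputable def speed (e : ε) (t : ℝ) : ℝ :=
  ‖fderiv ℝ (S.F (S.patch (e, false))) (S.curve (e, false) t) (deriv (S.curve (e, false)) t)‖

lemma continuous_speed (e : ε) : Continuous (S.speed e) := by
  have h1 : Continuous (fderiv ℝ (S.F (S.patch (e, false)))) :=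
    (S.F_smooth _).continuous_fderiv (by simp)
  exact ((h1.comp (S.continuous_curve _)).clm_apply (S.continuous_deriv_curve _)).norm

lemma exists_speed_bounds (e : ε) : ∃ c > 0, ∃ C > 0, ∀ t ∈ Icc (0 : ℝ) 1,
    c ≤ S.speed e t ∧ S.speed e t ≤ C := by
  obtain ⟨t₁, ht₁, h₁⟩ := isCompact_Icc.exists_isMinOn (nonempty_Icc.2 (zero_le_one (α := ℝ)))
    (S.continuous_speed e).continuousOn
  obtain ⟨C, hC⟩ := (isCompact_Icc (a := (0 : ℝ)) (b := 1)).bddAbove_image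
    (S.continuous_speed e).continuousOn
  have hpos : 0 < S.speed e t₁ := by
    have h0 : fderiv ℝ (S.F (S.patch (e, false))) (S.curve (e, false) t₁)
        (deriv (S.curve (e, false)) t₁) ≠ 0 := fun h0 =>
      S.curve_regular (e, false) t₁ ht₁
        (S.F_immersion _ _ (S.curve_mem_closure (e, false) ht₁) (by rw [h0, map_zero]))
    exact norm_pos_iff.2 h0
  exact ⟨_, hpos, C, hpos.trans_le (hC (mem_image_of_mem _ ht₁)), fun t ht =>
    ⟨h₁ ht, hC (mem_image_of_mem _ ht)⟩⟩

end MultipatchSurface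

end

section

open Set MeasureTheory

namespace MultipatchSurface

variable {ι ε : Type*} {d : ℕ} (S : MultipatchSurface ι ε d)
variable {h : ℝ} {o : ι → Fin 2 → ℝ}

/-! ### Integrability -/

/-- An integral is zero by convention if the integrand is not integrable. The additivity of the
forms therefore rests on the boundedness and measurability of everything that is integrated. -/
lemma bddMeas_dom (hh : 0 < h) (i : ι) (P : (Fin 2 → ℤ) → MvPolynomial (Fin 2) ℝ) :
    BddMeas volume (S.dom i) fun x => MvPolynomial.eval x (P (elementTowards h (o i) 0 x)) := by
  obtain ⟨M, hM⟩ := exists_bound_eval_family hh (o i) P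
  exact ⟨(measurable_eval_family P measurable_id (measurable_elementTowards h (o i)
    measurable_const measurable_id)).aestronglyMeasurable, M, fun x hx => hM 0 x (S.dom_subset i hx)⟩

lemma bddMeas_curve (hh : 0 < h) (s : ε × Bool) (P : (Fin 2 → ℤ) → MvPolynomial (Fin 2) ℝ) :
    BddMeas volume (Icc 0 1) fun t => MvPolynomial.eval (S.curve s t)
      (P (elementTowards h (o (S.patch s)) (S.inward s t) (S.curve s t))) := by
  obtain ⟨M, hM⟩ := exists_bound_eval_family hh (o (S.patch s)) P
  have hc : Measurable (S.curve s) := (S.continuous_curve s).measurable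
  have hi : Measurable (S.inward s) := measurable_pi_lambda _ fun k =>
    (S.continuous_inward s k).measurable
  exact ⟨(measurable_eval_family P hc (measurable_elementTowards h (o _) hi hc)).aestronglyMeasurable,
    M, fun t ht => hM _ _ (S.closure_dom_subset _ (S.curve_mem_closure s ht))⟩

lemma bddMeas_val (hh : 0 < h) (v : BrokenPoly ι) (i : ι) : BddMeas volume (S.dom i) (val h o v i) :=
  S.bddMeas_dom hh i (v i)

lemma bddMeas_grad (hh : 0 < h) (v : BrokenPoly ι) (i : ι) (k : Fin 2) :
    BddMeas volume (S.dom i) fun x => grad h o v i x k :=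
  S.bddMeas_dom hh i fun K => MvPolynomial.pderiv k (v i K)

lemma bddMeas_of_continuousOn_closure (i : ι) {f : (Fin 2 → ℝ) → ℝ}
    (hf : ContinuousOn f (closure (S.dom i))) : BddMeas volume (S.dom i) f :=
  .of_continuousOn_subset hf (S.isCompact_closure_dom i) subset_closure (S.dom_open i).measurableSet

lemma bddMeas_gradTerm (hh : 0 < h) (v w : BrokenPoly ι) (i : ι) :
    BddMeas volume (S.dom i) fun x =>
      grad h o v i x ⬝ᵥ (S.metric i x)⁻¹.mulVec (grad h o w i x) := by
  simp only [dotProduct, Matrix.mulVec]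
  exact .sum _ fun k _ => (S.bddMeas_grad hh v i k).mul (.sum _ fun l _ =>
    (S.bddMeas_of_continuousOn_closure i (S.continuousOn_metric_inv i k l)).mul
      (S.bddMeas_grad hh w i l))

lemma bddMeas_trace (hh : 0 < h) (v : BrokenPoly ι) (s : ε × Bool) :
    BddMeas volume (Icc 0 1) (S.trace h o v s) := S.bddMeas_curve hh s (v (S.patch s))

lemma bddMeas_flux (hh : 0 < h) (v : BrokenPoly ι) (s : ε × Bool) :
    BddMeas volume (Icc 0 1) (S.flux h o v s) :=
  .sum _ fun k _ => (BddMeas.of_continuousOn_subset (S.continuousOn_conormal s k) isCompact_Icc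
    subset_rfl measurableSet_Icc).mul
    (S.bddMeas_curve hh s fun K => MvPolynomial.pderiv k (v (S.patch s) K))

lemma _root_.BddMeas.comp_opposite {f : ℝ → ℝ} (hf : BddMeas volume (Icc 0 1) f) (e : ε) :
    BddMeas volume (Icc 0 1) fun t => f (S.opposite e t) := by
  unfold opposite
  cases S.reversed e
  · simpa using hf
  · simpa using hf.comp_one_sub

lemma bddMeas_jump (hh : 0 < h) (v : BrokenPoly ι) (e : ε) :
    BddMeas volume (Icc 0 1) (S.jump h o v e) :=
  (S.bddMeas_trace hh v _).sub ((S.bddMeas_trace hh v _).comp_opposite S e)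

lemma bddMeas_avgFlux (hh : 0 < h) (v : BrokenPoly ι) (e : ε) :
    BddMeas volume (Icc 0 1) (S.avgFlux h o v e) := by
  have := ((S.bddMeas_flux (o := o) hh v (e, false)).sub
    ((S.bddMeas_flux (o := o) hh v (e, true)).comp_opposite S e)).mul (.const 2⁻¹)
  simp only [← div_eq_mul_inv] at this
  exact this

lemma integrableOn_patch (i : ι) {f : (Fin 2 → ℝ) → ℝ} (hf : BddMeas volume (S.dom i) f) :
    IntegrableOn (fun x => f x * √(S.metric i x).det) (S.dom i) := by
  refine (hf.mul (S.bddMeas_of_continuousOn_closure i ?_)).integrableOn (S.dom_open i).measurableSet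
    (S.isBounded_dom i).measure_lt_top.ne
  exact (S.continuous_metric_det i).sqrt.continuousOn

lemma intervalIntegrable_interface (e : ε) {f : ℝ → ℝ} (hf : BddMeas volume (Icc 0 1) f) :
    IntervalIntegrable (fun t => f t * S.speed e t) volume 0 1 :=
  (hf.mul (.of_continuousOn_subset (S.continuous_speed e).continuousOn isCompact_Icc subset_rfl
    measurableSet_Icc)).intervalIntegrable

lemma patchIntegral_add (i : ι) {f g : (Fin 2 → ℝ) → ℝ} (hf : BddMeas volume (S.dom i) f)
    (hg : BddMeas volume (S.dom i) g) :
    S.patchIntegral i (fun x => f x + g x) = S.patchIntegral i f + S.patchIntegral i g := by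
  simp only [patchIntegral, add_mul]
  exact integral_add (S.integrableOn_patch i hf) (S.integrableOn_patch i hg)

lemma patchIntegral_const_mul (i : ι) (r : ℝ) (f : (Fin 2 → ℝ) → ℝ) :
    S.patchIntegral i (fun x => r * f x) = r * S.patchIntegral i f := by
  simp only [patchIntegral, mul_assoc]
  exact integral_const_mul _ _

lemma interfaceIntegral_add (e : ε) {f g : ℝ → ℝ} (hf : BddMeas volume (Icc 0 1) f)
    (hg : BddMeas volume (Icc 0 1) g) :
    S.interfaceIntegral e (fun x => f x + g x) = S.interfaceIntegral e f + S.interfaceIntegral e g := by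
  simp only [interfaceIntegral, add_mul]
  exact intervalIntegral.integral_add (S.intervalIntegrable_interface e hf)
    (S.intervalIntegrable_interface e hg)

lemma interfaceIntegral_const_mul (e : ε) (r : ℝ) (f : ℝ → ℝ) :
    S.interfaceIntegral e (fun x => r * f x) = r * S.interfaceIntegral e f := by
  simp only [interfaceIntegral, mul_assoc]
  exact intervalIntegral.integral_const_mul _ _

/-! ### Bilinearity -/

lemma val_add (v w : BrokenPoly ι) (i : ι) (x : Fin 2 → ℝ) :
    val h o (v + w) i x = val h o v i x + val h o w i x := by simp [val]

lemma val_smul (r : ℝ) (v : BrokenPoly ι) (i : ι) (x : Fin 2 → ℝ) :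
    val h o (r • v) i x = r * val h o v i x := by simp [val, MvPolynomial.smul_eval]

lemma grad_add (v w : BrokenPoly ι) (i : ι) (x : Fin 2 → ℝ) :
    grad h o (v + w) i x = grad h o v i x + grad h o w i x := by ext k; simp [grad]

lemma grad_smul (r : ℝ) (v : BrokenPoly ι) (i : ι) (x : Fin 2 → ℝ) :
    grad h o (r • v) i x = r • grad h o v i x := by ext k; simp [grad, MvPolynomial.smul_eval]

lemma trace_add (v w : BrokenPoly ι) (s : ε × Bool) (t : ℝ) :
    S.trace h o (v + w) s t = S.trace h o v s t + S.trace h o w s t := by simp [trace]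

lemma trace_smul (r : ℝ) (v : BrokenPoly ι) (s : ε × Bool) (t : ℝ) :
    S.trace h o (r • v) s t = r * S.trace h o v s t := by simp [trace, MvPolynomial.smul_eval]

lemma flux_add (v w : BrokenPoly ι) (s : ε × Bool) (t : ℝ) :
    S.flux h o (v + w) s t = S.flux h o v s t + S.flux h o w s t := by
  simp [flux]; ring

lemma flux_smul (r : ℝ) (v : BrokenPoly ι) (s : ε × Bool) (t : ℝ) :
    S.flux h o (r • v) s t = r * S.flux h o v s t := by
  simp [flux, MvPolynomial.smul_eval]; ring

lemma jump_add (v w : BrokenPoly ι) (e : ε) (t : ℝ) :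
    S.jump h o (v + w) e t = S.jump h o v e t + S.jump h o w e t := by
  simp only [jump, trace_add]; ring

lemma jump_smul (r : ℝ) (v : BrokenPoly ι) (e : ε) (t : ℝ) :
    S.jump h o (r • v) e t = r * S.jump h o v e t := by
  simp only [jump, trace_smul]; ring

lemma avgFlux_add (v w : BrokenPoly ι) (e : ε) (t : ℝ) :
    S.avgFlux h o (v + w) e t = S.avgFlux h o v e t + S.avgFlux h o w e t := by
  simp only [avgFlux, flux_add]; ring

lemma avgFlux_smul (r : ℝ) (v : BrokenPoly ι) (e : ε) (t : ℝ) :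
    S.avgFlux h o (r • v) e t = r * S.avgFlux h o v e t := by
  simp only [avgFlux, flux_smul]; ring

lemma iterate_pderiv_add (k : Fin 2) (q : ℕ) (P Q : MvPolynomial (Fin 2) ℝ) :
    (MvPolynomial.pderiv k)^[q] (P + Q) =
      (MvPolynomial.pderiv k)^[q] P + (MvPolynomial.pderiv k)^[q] Q :=
  iterate_map_add (MvPolynomial.pderiv (R := ℝ) k) q P Q

lemma iterate_pderiv_smul (k : Fin 2) (q : ℕ) (r : ℝ) (P : MvPolynomial (Fin 2) ℝ) :
    (MvPolynomial.pderiv k)^[q] (r • P) = r • (MvPolynomial.pderiv k)^[q] P := by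
  simpa using iterate_pderiv_sum k q {()} (fun _ => r) (fun _ => P)

lemma faceJump_add (v w : BrokenPoly ι) (i : ι) (f : (Fin 2 → ℤ) × Fin 2) (q : ℕ) (t : ℝ) :
    faceJump h o (v + w) i f q t = faceJump h o v i f q t + faceJump h o w i f q t := by
  simp only [faceJump, Pi.add_apply]
  rw [add_sub_add_comm, iterate_pderiv_add, map_add]

lemma faceJump_smul (r : ℝ) (v : BrokenPoly ι) (i : ι) (f : (Fin 2 → ℤ) × Fin 2) (q : ℕ) (t : ℝ) :
    faceJump h o (r • v) i f q t = r * faceJump h o v i f q t := by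
  simp only [faceJump, Pi.smul_apply]
  rw [← smul_sub, iterate_pderiv_smul, MvPolynomial.smul_eval]

lemma continuous_faceJump (v : BrokenPoly ι) (i : ι) (f : (Fin 2 → ℤ) × Fin 2) (q : ℕ) :
    Continuous (faceJump h o v i f q) := by
  unfold faceJump
  refine (MvPolynomial.continuous_eval _).comp (continuous_pi fun k => ?_)
  by_cases hk : k = f.2
  · subst hk; simp only [Function.update_self]; fun_prop
  · simp only [Function.update_of_ne hk]; fun_prop

variable [Fintype ι] (p : ℕ)

/-- The finite element function with given coefficients. -/
noncomputable def interp (V : S.Dof p h o → ℝ) : BrokenPoly ι :=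
  ∑ n, V n • S.basisFun p h o n

lemma integral_interp (hh : 0 < h) (V : S.Dof p h o → ℝ) :
    S.integral h o (S.interp p V) = ∑ n, V n * S.integral h o (S.basisFun p h o n) := by
  classical
  have hsum : ∀ s : Finset (S.Dof p h o), S.integral h o (∑ n ∈ s, V n • S.basisFun p h o n) =
      ∑ n ∈ s, V n * S.integral h o (S.basisFun p h o n) := by
    intro s
    induction s using Finset.induction_on with
    | empty =>
      have : ∀ i, val h o (0 : BrokenPoly ι) i = fun _ => 0 := fun i => by ext x; simp [val]
      simp [integral, patchIntegral, this]
    | insert b s hb ih =>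
      rw [Finset.sum_insert hb, Finset.sum_insert hb, ← ih]
      simp only [integral, Finset.mul_sum, ← Finset.sum_add_distrib]
      refine Finset.sum_congr rfl fun i _ => ?_
      rw [← S.patchIntegral_const_mul i, ← S.patchIntegral_add i
        ((BddMeas.const _).mul (S.bddMeas_val hh _ i)) (S.bddMeas_val hh _ i)]
      congr 1
      ext x; rw [val_add, val_smul]
  exact hsum Finset.univ

variable [Fintype ε] (β : ℝ) (γ : ℕ → ℝ)

lemma discreteForm_add (hh : 0 < h) (v v' w : BrokenPoly ι) :
    S.discreteForm p β γ h o (v + v') w =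
      S.discreteForm p β γ h o v w + S.discreteForm p β γ h o v' w := by
  have h1 : ∀ i, S.patchIntegral i (fun x => grad h o (v + v') i x ⬝ᵥ
      (S.metric i x)⁻¹.mulVec (grad h o w i x)) = S.patchIntegral i (fun x => grad h o v i x ⬝ᵥ
      (S.metric i x)⁻¹.mulVec (grad h o w i x)) + S.patchIntegral i (fun x => grad h o v' i x ⬝ᵥ
      (S.metric i x)⁻¹.mulVec (grad h o w i x)) := fun i => by
    simp only [grad_add, add_dotProduct]
    exact S.patchIntegral_add i (S.bddMeas_gradTerm hh v w i) (S.bddMeas_gradTerm hh v' w i)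
  have h2 : ∀ e, S.interfaceIntegral e (fun t => S.avgFlux h o (v + v') e t * S.jump h o w e t) =
      S.interfaceIntegral e (fun t => S.avgFlux h o v e t * S.jump h o w e t) +
      S.interfaceIntegral e (fun t => S.avgFlux h o v' e t * S.jump h o w e t) := fun e => by
    simp only [avgFlux_add, add_mul]
    exact S.interfaceIntegral_add e ((S.bddMeas_avgFlux hh _ e).mul (S.bddMeas_jump hh _ e))
      ((S.bddMeas_avgFlux hh _ e).mul (S.bddMeas_jump hh _ e))
  have h3 : ∀ e, S.interfaceIntegral e (fun t => S.jump h o (v + v') e t * S.avgFlux h o w e t) =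
      S.interfaceIntegral e (fun t => S.jump h o v e t * S.avgFlux h o w e t) +
      S.interfaceIntegral e (fun t => S.jump h o v' e t * S.avgFlux h o w e t) := fun e => by
    simp only [jump_add, add_mul]
    exact S.interfaceIntegral_add e ((S.bddMeas_jump hh _ e).mul (S.bddMeas_avgFlux hh _ e))
      ((S.bddMeas_jump hh _ e).mul (S.bddMeas_avgFlux hh _ e))
  have h4 : ∀ e, S.interfaceIntegral e (fun t => S.jump h o (v + v') e t * S.jump h o w e t) =
      S.interfaceIntegral e (fun t => S.jump h o v e t * S.jump h o w e t) +
      S.interfaceIntegral e (fun t => S.jump h o v' e t * S.jump h o w e t) := fun e => by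
    simp only [jump_add, add_mul]
    exact S.interfaceIntegral_add e ((S.bddMeas_jump hh _ e).mul (S.bddMeas_jump hh _ e))
      ((S.bddMeas_jump hh _ e).mul (S.bddMeas_jump hh _ e))
  have h5 : ∀ i f q, ∀ a b : ℝ, ∫ t in a..b, faceJump h o (v + v') i f q t * faceJump h o w i f q t =
      (∫ t in a..b, faceJump h o v i f q t * faceJump h o w i f q t) +
      ∫ t in a..b, faceJump h o v' i f q t * faceJump h o w i f q t := fun i f q a b => by
    simp only [faceJump_add, add_mul]
    exact intervalIntegral.integral_add
      (((continuous_faceJump v i f q).mul (continuous_faceJump w i f q)).intervalIntegrable _ _)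
      (((continuous_faceJump v' i f q).mul (continuous_faceJump w i f q)).intervalIntegrable _ _)
  simp only [discreteForm, nitscheForm, stabForm, h1, h2, h3, h4, h5, mul_add,
    Finset.sum_add_distrib]
  ring

lemma discreteForm_smul (r : ℝ) (v w : BrokenPoly ι) :
    S.discreteForm p β γ h o (r • v) w = r * S.discreteForm p β γ h o v w := by
  simp only [discreteForm, nitscheForm, stabForm, grad_smul, smul_dotProduct, smul_eq_mul,
    avgFlux_smul, jump_smul, faceJump_smul, mul_assoc, patchIntegral_const_mul,
    interfaceIntegral_const_mul, intervalIntegral.integral_const_mul, mul_add, Finset.mul_sum, mul_sub]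
  congr 1
  · congr 1
    exact Finset.sum_congr rfl fun e _ => by ring
  · exact Finset.sum_congr rfl fun i _ => Finset.sum_congr rfl fun f _ =>
      Finset.sum_congr rfl fun q _ => by ring

lemma discreteForm_comm (v w : BrokenPoly ι) :
    S.discreteForm p β γ h o v w = S.discreteForm p β γ h o w v := by
  have h1 : ∀ i x, grad h o v i x ⬝ᵥ (S.metric i x)⁻¹.mulVec (grad h o w i x) =
      grad h o w i x ⬝ᵥ (S.metric i x)⁻¹.mulVec (grad h o v i x) := fun i x => by
    simp only [dotProduct, Matrix.mulVec, Fin.sum_univ_two, S.metric_inv_symm i x 1 0]; ring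
  simp only [discreteForm, nitscheForm, stabForm, h1, mul_comm (S.jump h o w _ _),
    mul_comm (faceJump h o w _ _ _ _), mul_comm (S.jump h o v _ _) (S.avgFlux h o w _ _)]
  congr 2
  congr 1
  exact Finset.sum_congr rfl fun e _ => add_comm _ _

lemma discreteForm_sum {α : Type*} (hh : 0 < h) (s : Finset α) (V : α → ℝ) (v : α → BrokenPoly ι)
    (w : BrokenPoly ι) : S.discreteForm p β γ h o (∑ n ∈ s, V n • v n) w =
      ∑ n ∈ s, V n * S.discreteForm p β γ h o (v n) w := by
  classical
  induction s using Finset.induction_on with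
  | empty =>
    have := S.discreteForm_smul (h := h) (o := o) p β γ 0 0 w
    simpa using this
  | insert b s hb ih =>
    rw [Finset.sum_insert hb, Finset.sum_insert hb, S.discreteForm_add p β γ hh, ih,
      S.discreteForm_smul]

/-- Translates estimates of the form on finite element functions into estimates of the matrix. -/
lemma discreteForm_interp (hh : 0 < h) (V W : S.Dof p h o → ℝ) :
    S.discreteForm p β γ h o (S.interp p V) (S.interp p W) =
      W ⬝ᵥ (S.stiffness p β γ h o).mulVec V := by
  rw [interp, S.discreteForm_sum p β γ hh]
  have : ∀ n, S.discreteForm p β γ h o (S.basisFun p h o n) (S.interp p W) =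
      ∑ m, W m * S.discreteForm p β γ h o (S.basisFun p h o n) (S.basisFun p h o m) := fun n => by
    rw [discreteForm_comm, interp, S.discreteForm_sum p β γ hh]
    exact Finset.sum_congr rfl fun m _ => by rw [discreteForm_comm]
  simp only [this, dotProduct, Matrix.mulVec, stiffness, Matrix.of_apply, Finset.mul_sum]
  rw [Finset.sum_comm]
  exact Finset.sum_congr rfl fun m _ => Finset.sum_congr rfl fun n _ => by ring

end MultipatchSurface

end

section

open Set MeasureTheory

/-- The nodal values on an element, with the coordinate `k` put first. -/
def orient (k : Fin 2) (c : ℕ → ℕ → ℝ) : ℕ → ℕ → ℝ := if k = 0 then c else fun i j => c j i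

lemma nodalEnergy_orient (p : ℕ) (k : Fin 2) (c : ℕ → ℕ → ℝ) :
    nodalEnergy p (orient k c) = nodalEnergy p c := by
  unfold orient
  split_ifs
  · rfl
  · exact nodalEnergy_swap c

lemma nodalMass_orient (p : ℕ) (k : Fin 2) (c : ℕ → ℕ → ℝ) :
    nodalMass p (orient k c) = nodalMass p c := by
  unfold orient
  split_ifs
  · rfl
  · exact Finset.sum_equiv (Equiv.prodComm ℕ ℕ) (by simp [and_comm]) (fun x _ => rfl)

lemma nodalMass_eq_sum (p : ℕ) (a : (Fin 2 → ℤ) → ℝ) (K : Fin 2 → ℤ) :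
    nodalMass p (localCoef p a K) = ∑ m ∈ elemNodes p K, a m ^ 2 := by
  rw [sum_elemNodes, nodalMass, Finset.sum_product]; rfl

/-- This is how continuity enters: the nodes on the common face are the last row of one element and
the first row of the other. -/
lemma orient_shared (p : ℕ) (a : (Fin 2 → ℤ) → ℝ) (K : Fin 2 → ℤ) (k : Fin 2) (j : ℕ) :
    orient k (localCoef p a (K + Pi.single k 1)) 0 j = orient k (localCoef p a K) p j := by
  unfold orient localCoef
  fin_cases k <;> simp <;> congr 1 <;> ext l <;> fin_cases l <;> simp <;> ring

/-- The squared jumps of all normal derivatives over the face `f`, on the reference scale. -/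
noncomputable def jumpEnergy (p : ℕ) (a : (Fin 2 → ℤ) → ℝ) (f : (Fin 2 → ℤ) × Fin 2) : ℝ :=
  ∑ q ∈ Finset.Icc 1 p, ∫ t in (0 : ℝ)..1, refJump p (orient f.2 (localCoef p a f.1))
    (orient f.2 (localCoef p a (f.1 + Pi.single f.2 1))) q t ^ 2

lemma integral_refJump_sq_nonneg (p : ℕ) (c c' : ℕ → ℕ → ℝ) (q : ℕ) :
    0 ≤ ∫ t in (0 : ℝ)..1, refJump p c c' q t ^ 2 :=
  intervalIntegral.integral_nonneg zero_le_one fun _ _ => sq_nonneg _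

lemma jumpEnergy_nonneg (p : ℕ) (a : (Fin 2 → ℤ) → ℝ) (f : (Fin 2 → ℤ) × Fin 2) :
    0 ≤ jumpEnergy p a f := Finset.sum_nonneg fun _ _ => integral_refJump_sq_nonneg _ _ _ _

/-- The constant is made at least `1` since its powers accumulate along chains of elements. -/
lemma exists_nodalEnergy_le_adjacent {p : ℕ} (hp : 1 ≤ p) : ∃ C, 1 ≤ C ∧
    ∀ (a : (Fin 2 → ℤ) → ℝ) (K : Fin 2 → ℤ) (k : Fin 2),
    nodalEnergy p (localCoef p a K) ≤
      C * (nodalEnergy p (localCoef p a (K + Pi.single k 1)) + jumpEnergy p a (K, k)) ∧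
    nodalEnergy p (localCoef p a (K + Pi.single k 1)) ≤
      C * (nodalEnergy p (localCoef p a K) + jumpEnergy p a (K, k)) := by
  obtain ⟨C, hC, H⟩ := exists_nodalEnergy_le_neighbour hp
  refine ⟨max C 1, le_max_right _ _, fun a K k => ?_⟩
  have h := H (orient k (localCoef p a K)) (orient k (localCoef p a (K + Pi.single k 1)))
    fun j _ => orient_shared p a K k j
  rw [nodalEnergy_orient, nodalEnergy_orient] at h
  have h1 := nodalEnergy_nonneg p (localCoef p a K)
  have h2 := nodalEnergy_nonneg p (localCoef p a (K + Pi.single k 1))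
  have h3 := jumpEnergy_nonneg p a (K, k)
  refine ⟨h.1.trans ?_, h.2.trans ?_⟩
  · exact mul_le_mul_of_nonneg_right (le_max_left _ _) (add_nonneg h2 h3)
  · exact mul_le_mul_of_nonneg_right (le_max_left _ _) (add_nonneg h1 h3)

/-- Neighbours share a node, whose value fixes the mass up to the energy. No jump is needed, as the
energy of `K` itself is already under control. -/
lemma nodalMass_le_adjacent (p : ℕ) (a : (Fin 2 → ℤ) → ℝ) {K K' : Fin 2 → ℤ} (hadj : Adjacent K K') :
    nodalMass p (localCoef p a K) ≤ 2 * (p + 1) ^ 2 *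
      (nodalMass p (localCoef p a K') + nodalEnergy p (localCoef p a K)) := by
  have key : ∀ c c' : ℕ → ℕ → ℝ, ∀ i ∈ Finset.range (p + 1), ∀ i' ∈ Finset.range (p + 1),
      c i 0 = c' i' 0 → nodalMass p c ≤ 2 * (p + 1) ^ 2 * (nodalMass p c' + nodalEnergy p c) := by
    intro c c' i hi i' hi' he
    have h0 : 0 ∈ Finset.range (p + 1) := by simp
    have h1 := nodalMass_le c hi h0
    have h2 : c' i' 0 ^ 2 ≤ nodalMass p c' :=
      Finset.single_le_sum (f := fun x : ℕ × ℕ => c' x.1 x.2 ^ 2) (fun _ _ => sq_nonneg _)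
        (Finset.mk_mem_product hi' h0)
    have h3 := nodalEnergy_nonneg p c
    have h4 : (1 : ℝ) ≤ (p + 1) ^ 2 := one_le_pow₀ (by linarith [(Nat.cast_nonneg p : (0 : ℝ) ≤ p)])
    rw [he] at h1
    nlinarith
  obtain ⟨k, rfl | rfl⟩ := hadj
  · have h := key (orient k (localCoef p a K)) (orient k (localCoef p a (K + Pi.single k 1))) p
      (by simp) 0 (by simp) (orient_shared p a K k 0).symm
    rwa [nodalMass_orient, nodalMass_orient, nodalEnergy_orient] at h
  · have h := key (orient k (localCoef p a (K' + Pi.single k 1))) (orient k (localCoef p a K')) 0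
      (by simp) p (by simp) (orient_shared p a K' k 0)
    rwa [nodalMass_orient, nodalMass_orient, nodalEnergy_orient] at h

lemma sum_mul_le_sum_mul_sum {α : Type*} (s : Finset α) {f g : α → ℝ} (hf : ∀ q ∈ s, 0 ≤ f q)
    (hg : ∀ q ∈ s, 0 ≤ g q) : ∑ q ∈ s, f q * g q ≤ (∑ q ∈ s, f q) * ∑ q ∈ s, g q := by
  rw [Finset.sum_mul]
  exact Finset.sum_le_sum fun q hq => mul_le_mul_of_nonneg_left (Finset.single_le_sum hg hq) (hf q hq)

lemma exists_jumpEnergy_le (p : ℕ) : ∃ C > 0, ∀ (a : (Fin 2 → ℤ) → ℝ) (f : (Fin 2 → ℤ) × Fin 2),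
    jumpEnergy p a f ≤ C * (nodalMass p (localCoef p a f.1) +
      nodalMass p (localCoef p a (f.1 + Pi.single f.2 1))) := by
  obtain ⟨C, hC, H⟩ := exists_refVal_le p
  refine ⟨p * (2 * C) + 1, by positivity, fun a f => ?_⟩
  set c := orient f.2 (localCoef p a f.1) with hc
  set c' := orient f.2 (localCoef p a (f.1 + Pi.single f.2 1)) with hc'
  have hm : nodalMass p (localCoef p a f.1) = nodalMass p c := (nodalMass_orient _ _ _).symm
  have hm' : nodalMass p (localCoef p a (f.1 + Pi.single f.2 1)) = nodalMass p c' :=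
    (nodalMass_orient _ _ _).symm
  rw [hm, hm']
  have h0 := nodalMass_nonneg p c
  have h0' := nodalMass_nonneg p c'
  calc jumpEnergy p a f ≤ ∑ q ∈ Finset.Icc 1 p, 2 * C * (nodalMass p c + nodalMass p c') := by
        apply Finset.sum_le_sum
        intro q hq
        rw [Finset.mem_Icc] at hq
        have hb : ∀ t ∈ Icc (0 : ℝ) 1, refJump p c c' q t ^ 2 ≤
            2 * C * (nodalMass p c + nodalMass p c') := by
          intro t ht
          have h1 := H c q hq.2 0 (by omega) 1 (by simp) t ht
          have h2 := H c' q hq.2 0 (by omega) 0 (by simp) t ht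
          rw [refJump]
          nlinarith [sq_nonneg (refVal p c' q 0 0 t + refVal p c q 0 1 t)]
        calc _ ≤ ∫ t in (0 : ℝ)..1, 2 * C * (nodalMass p c + nodalMass p c') :=
              intervalIntegral.integral_mono_on zero_le_one
                (((continuous_refJump c c' q).pow 2).intervalIntegrable _ _)
                intervalIntegrable_const hb
          _ = _ := by simp
    _ = p * (2 * C) * (nodalMass p c + nodalMass p c') := by simp; ring
    _ ≤ _ := by nlinarith

/-- In each coordinate a node belongs to at most two intervals of the grid. -/
lemma card_elemNodes_le {p : ℕ} (hp : 1 ≤ p) (T : Finset (Fin 2 → ℤ)) (m : Fin 2 → ℤ) :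
    (T.filter fun K => m ∈ elemNodes p K).card ≤ 4 := by
  have hsub : (T.filter fun K => m ∈ elemNodes p K) ⊆
      Fintype.piFinset fun k => Finset.Icc (m k / p - 1) (m k / p) := by
    intro K hK
    rw [Finset.mem_filter, elemNodes, Fintype.mem_piFinset] at hK
    rw [Fintype.mem_piFinset]
    intro k
    have := Finset.mem_Icc.1 (hK.2 k)
    have hp' : (0 : ℤ) < p := by exact_mod_cast hp
    rw [Finset.mem_Icc]
    constructor
    · have : m k / p ≤ K k + 1 := by
        apply Int.le_of_lt_add_one
        apply Int.ediv_lt_of_lt_mul hp'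
        nlinarith
      omega
    · exact (Int.le_ediv_iff_mul_le hp').2 (by linarith)
  refine (Finset.card_le_card hsub).trans ?_
  rw [Fintype.card_piFinset, Fin.prod_univ_two, Int.card_Icc, Int.card_Icc]
  have e : ∀ b : ℤ, (b + 1 - (b - 1)).toNat = 2 := fun b => by omega
  rw [e, e]
  norm_num

namespace MultipatchSurface

variable {ι ε : Type*} {d : ℕ} (S : MultipatchSurface ι ε d)
variable {h : ℝ} {o : ι → Fin 2 → ℝ} {p : ℕ}

/-! ### Nodal values of finite element functions -/

open Classical in
/-- The nodal values on the patch `i`, extended by zero. -/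
noncomputable def coef (V : S.Dof p h o → ℝ) (i : ι) (m : Fin 2 → ℤ) : ℝ :=
  if hm : m ∈ S.activeNodes p h o i then V ⟨i, m, hm⟩ else 0

lemma coef_of_notMem (V : S.Dof p h o → ℝ) (i : ι) :
    ∀ m ∉ S.activeNodes p h o i, S.coef V i m = 0 := fun m hm => by
  rw [coef, dif_neg hm]

lemma interp_apply [Fintype ι] (V : S.Dof p h o → ℝ) (i : ι) (K : Fin 2 → ℤ) :
    S.interp p V i K = gridPoly p h (o i) (S.activeNodes p h o i) (S.coef V i) K := by
  classical
  have h1 : S.interp p V i K = ∑ n, V n • S.basisFun p h o n i K := by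
    simp [interp, Finset.sum_apply]
  rw [h1, Fintype.sum_sigma, Finset.sum_eq_single i]
  · rw [gridPoly, ← Finset.sum_coe_sort (S.activeNodes p h o i)]
    refine Finset.sum_congr rfl fun m _ => ?_
    rw [coef, dif_pos m.2, basisFun, if_pos rfl]
  · intro j _ hj
    refine Finset.sum_eq_zero fun m _ => ?_
    rw [basisFun, if_neg (Ne.symm hj), smul_zero]
  · simp

lemma elemNodes_subset_activeNodes {i : ι} {K : Fin 2 → ℤ} (hK : K ∈ S.activeElements h o i) :
    elemNodes p K ⊆ S.activeNodes p h o i :=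
  Finset.subset_biUnion_of_mem (fun K => elemNodes p K) hK

/-- The nodal energy of an element. -/
noncomputable def elemEnergy (V : S.Dof p h o → ℝ) (i : ι) (K : Fin 2 → ℤ) : ℝ :=
  nodalEnergy p (localCoef p (S.coef V i) K)

/-- The nodal mass of an element. -/
noncomputable def elemMass (V : S.Dof p h o → ℝ) (i : ι) (K : Fin 2 → ℤ) : ℝ :=
  nodalMass p (localCoef p (S.coef V i) K)

lemma elemEnergy_nonneg (V : S.Dof p h o → ℝ) (i : ι) (K : Fin 2 → ℤ) : 0 ≤ S.elemEnergy V i K :=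
  nodalEnergy_nonneg _ _

lemma elemMass_nonneg (V : S.Dof p h o → ℝ) (i : ι) (K : Fin 2 → ℤ) : 0 ≤ S.elemMass V i K :=
  nodalMass_nonneg _ _

lemma sum_sq_coef [Fintype ι] (V : S.Dof p h o → ℝ) :
    ∑ n, V n ^ 2 = ∑ i, ∑ m ∈ S.activeNodes p h o i, S.coef V i m ^ 2 := by
  rw [Fintype.sum_sigma]
  refine Finset.sum_congr rfl fun i _ => ?_
  rw [← Finset.sum_coe_sort (S.activeNodes p h o i)]
  refine Finset.sum_congr rfl fun m _ => ?_
  rw [coef, dif_pos m.2]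

/-- Every active node belongs to at least one active element. -/
lemma sum_sq_le_sum_elemMass [Fintype ι] (V : S.Dof p h o → ℝ) :
    ∑ n, V n ^ 2 ≤ ∑ i, ∑ K ∈ S.activeElements h o i, S.elemMass V i K := by
  rw [sum_sq_coef]
  refine Finset.sum_le_sum fun i _ => ?_
  simp only [elemMass, nodalMass_eq_sum]
  have h1 : ∀ m ∈ S.activeNodes p h o i, S.coef V i m ^ 2 ≤ ∑ K ∈ S.activeElements h o i,
      if m ∈ elemNodes p K then S.coef V i m ^ 2 else 0 := by
    intro m hm
    obtain ⟨K, hK, hmK⟩ := Finset.mem_biUnion.1 hm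
    have h2 : m ∈ elemNodes p K := hmK
    refine le_trans ?_ (Finset.single_le_sum (fun K _ => ?_) hK)
    · rw [if_pos h2]
    · split_ifs
      · exact sq_nonneg _
      · exact le_rfl
  refine (Finset.sum_le_sum h1).trans ?_
  rw [Finset.sum_comm]
  refine Finset.sum_le_sum fun K _ => ?_
  rw [← Finset.sum_filter]
  refine Finset.sum_le_sum_of_subset_of_nonneg ?_ fun _ _ _ => sq_nonneg _
  intro m hm
  exact (Finset.mem_filter.1 hm).2

/-- A node belongs to at most four elements, so the total mass and the squared norm of the
coefficients are equivalent. -/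
lemma sum_elemMass_le [Fintype ι] (hp : 1 ≤ p) (V : S.Dof p h o → ℝ) :
    ∑ i, ∑ K ∈ S.activeElements h o i, S.elemMass V i K ≤ 4 * ∑ n, V n ^ 2 := by
  rw [sum_sq_coef, Finset.mul_sum]
  refine Finset.sum_le_sum fun i _ => ?_
  simp only [elemMass, nodalMass_eq_sum]
  have h1 : ∀ K ∈ S.activeElements h o i, ∑ m ∈ elemNodes p K, S.coef V i m ^ 2 =
      ∑ m ∈ S.activeNodes p h o i, if m ∈ elemNodes p K then S.coef V i m ^ 2 else 0 := by
    intro K hK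
    rw [← Finset.sum_filter]
    congr 1
    ext m
    rw [Finset.mem_filter]
    exact ⟨fun hm => ⟨S.elemNodes_subset_activeNodes hK hm, hm⟩, fun hm => hm.2⟩
  rw [Finset.sum_congr rfl h1, Finset.sum_comm, Finset.mul_sum]
  refine Finset.sum_le_sum fun m _ => ?_
  rw [← Finset.sum_filter, Finset.sum_const, nsmul_eq_mul]
  refine mul_le_mul_of_nonneg_right ?_ (sq_nonneg _)
  exact_mod_cast card_elemNodes_le hp _ m

/-! ### Stabilization -/

lemma faceJump_interp [Fintype ι] (hh : 0 < h) (V : S.Dof p h o → ℝ) (i : ι)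
    (f : (Fin 2 → ℤ) × Fin 2) (q : ℕ) (t : ℝ) :
    faceJump h o (S.interp p V) i f q (o i f.2.rev + h * (f.1 f.2.rev + t)) =
      h⁻¹ ^ q * refJump p (orient f.2 (localCoef p (S.coef V i) f.1))
        (orient f.2 (localCoef p (S.coef V i) (f.1 + Pi.single f.2 1))) q t := by
  obtain ⟨K, k⟩ := f
  have ha := S.coef_of_notMem V i
  have hsub : ∀ P Q : MvPolynomial (Fin 2) ℝ, (MvPolynomial.pderiv k)^[q] (P - Q) =
      (MvPolynomial.pderiv k)^[q] P - (MvPolynomial.pderiv k)^[q] Q :=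
    iterate_map_sub (MvPolynomial.pderiv (R := ℝ) k) q
  simp only [faceJump, hsub, map_sub, interp_apply, refJump, mul_sub]
  fin_cases k
  · simp only [Fin.zero_eta, eval_iterate_pderiv_zero ha, orient, if_true]
    congr 3 <;> simp [locPt] <;> field_simp <;> ring
  · simp only [Fin.mk_one, eval_iterate_pderiv_one ha, orient, if_neg one_ne_zero]
    rw [refVal_swap, refVal_swap (localCoef p (S.coef V i) K)]
    congr 3 <;> simp [locPt] <;> field_simp <;> ring

/-- The two derivatives of order `q` contribute `h⁻¹ ^ (2 * q)` and the length of the face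
contributes `h`. The weight of the stabilization cancels both. -/
lemma integral_faceJump_sq [Fintype ι] (hh : 0 < h) (V : S.Dof p h o → ℝ) (i : ι)
    (f : (Fin 2 → ℤ) × Fin 2) {q : ℕ} (hq : 1 ≤ q) :
    h ^ (2 * q - 1) * ∫ t in (o i f.2.rev + h * f.1 f.2.rev)..(o i f.2.rev + h * (f.1 f.2.rev + 1)),
      faceJump h o (S.interp p V) i f q t * faceJump h o (S.interp p V) i f q t =
    ∫ t in (0 : ℝ)..1, refJump p (orient f.2 (localCoef p (S.coef V i) f.1))
        (orient f.2 (localCoef p (S.coef V i) (f.1 + Pi.single f.2 1))) q t ^ 2 := by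
  have h1 := intervalIntegral.integral_comp_add_mul (fun t => faceJump h o (S.interp p V) i f q t *
    faceJump h o (S.interp p V) i f q t) (a := 0) (b := 1) hh.ne' (o i f.2.rev + h * f.1 f.2.rev)
  have e : ∀ t : ℝ, o i f.2.rev + h * f.1 f.2.rev + h * t = o i f.2.rev + h * (f.1 f.2.rev + t) :=
    fun t => by ring
  simp only [e, S.faceJump_interp hh, smul_eq_mul, add_zero] at h1
  have h2 : ∀ (r y : ℝ), r * y * (r * y) = r ^ 2 * y ^ 2 := fun r y => by ring
  simp only [h2, intervalIntegral.integral_const_mul] at h1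
  rw [eq_comm, inv_mul_eq_iff_eq_mul₀ hh.ne'] at h1
  rw [h1]
  obtain ⟨n, rfl⟩ : ∃ n, q = n + 1 := ⟨q - 1, by omega⟩
  have e3 : 2 * (n + 1) - 1 = 2 * n + 1 := by omega
  rw [e3, ← mul_assoc, ← mul_assoc]
  have e4 : h ^ (2 * n + 1) * h * (h⁻¹ ^ (n + 1)) ^ 2 = 1 := by
    rw [← pow_succ, ← pow_mul, inv_pow, show (n + 1) * 2 = 2 * n + 1 + 1 by ring]
    exact mul_inv_cancel₀ (by positivity)
  rw [e4, one_mul]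

lemma stabForm_interp [Fintype ι] (hh : 0 < h) (γ : ℕ → ℝ) (V : S.Dof p h o → ℝ) :
    S.stabForm p γ h o (S.interp p V) (S.interp p V) = ∑ i, ∑ f ∈ S.stabFaces h o i,
      ∑ q ∈ Finset.Icc 1 p, γ q * ∫ t in (0 : ℝ)..1,
        refJump p (orient f.2 (localCoef p (S.coef V i) f.1))
          (orient f.2 (localCoef p (S.coef V i) (f.1 + Pi.single f.2 1))) q t ^ 2 := by
  refine Finset.sum_congr rfl fun i _ => Finset.sum_congr rfl fun f _ =>
    Finset.sum_congr rfl fun q hq => ?_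
  rw [mul_assoc, S.integral_faceJump_sq hh V i f (Finset.mem_Icc.1 hq).1]

/-- The jump energy over all stabilized faces of a patch. -/
noncomputable def faceEnergy (V : S.Dof p h o → ℝ) (i : ι) : ℝ :=
  ∑ f ∈ S.stabFaces h o i, jumpEnergy p (S.coef V i) f

lemma faceEnergy_nonneg (V : S.Dof p h o → ℝ) (i : ι) : 0 ≤ S.faceEnergy V i :=
  Finset.sum_nonneg fun _ _ => jumpEnergy_nonneg _ _ _

lemma exists_stabForm_ge [Fintype ι] (p : ℕ) (γ : ℕ → ℝ) (hγ : ∀ k ∈ Finset.Icc 1 p, 0 < γ k) :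
    ∃ c > 0, ∀ (h : ℝ) (o : ι → Fin 2 → ℝ) (V : S.Dof p h o → ℝ), 0 < h →
      c * ∑ i, S.faceEnergy V i ≤ S.stabForm p γ h o (S.interp p V) (S.interp p V) := by
  obtain ⟨c, hc, H⟩ := Finset.exists_pos_le (Finset.Icc 1 p) γ hγ
  refine ⟨c, hc, fun h o V hh => ?_⟩
  rw [S.stabForm_interp hh]
  simp only [faceEnergy, jumpEnergy, Finset.mul_sum]
  refine Finset.sum_le_sum fun i _ => Finset.sum_le_sum fun f _ => Finset.sum_le_sum fun q hq => ?_
  exact mul_le_mul_of_nonneg_right (H q hq) (integral_refJump_sq_nonneg _ _ _ _)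

/-- An element is the lower element of at most two faces and the upper element of at most two. -/
lemma sum_stabFaces_le (i : ι) {m : (Fin 2 → ℤ) → ℝ} (hm : ∀ K, 0 ≤ m K) :
    ∑ f ∈ S.stabFaces h o i, (m f.1 + m (f.1 + Pi.single f.2 1)) ≤
      4 * ∑ K ∈ S.activeElements h o i, m K := by
  classical
  have h0 : ∑ f ∈ S.activeElements h o i ×ˢ (Finset.univ : Finset (Fin 2)), m f.1 =
      2 * ∑ K ∈ S.activeElements h o i, m K := by
    rw [Finset.sum_product_right]; simp
  have h1 : ∑ f ∈ S.stabFaces h o i, m f.1 ≤ 2 * ∑ K ∈ S.activeElements h o i, m K := by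
    rw [← h0]
    refine Finset.sum_le_sum_of_subset_of_nonneg ?_ fun _ _ _ => hm _
    exact Finset.filter_subset _ _
  have h2 : ∑ f ∈ S.stabFaces h o i, m (f.1 + Pi.single f.2 1) ≤
      2 * ∑ K ∈ S.activeElements h o i, m K := by
    have hinj : Set.InjOn (fun f : (Fin 2 → ℤ) × Fin 2 => (f.1 + Pi.single f.2 1, f.2))
        (S.stabFaces h o i) := by
      intro f _ g _ hfg
      simp only [Prod.mk.injEq] at hfg
      obtain ⟨h3, h4⟩ := hfg
      rw [h4] at h3
      exact Prod.ext (add_right_cancel h3) h4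
    have h3 := Finset.sum_image (f := fun f : (Fin 2 → ℤ) × Fin 2 => m f.1) hinj
    simp only at h3
    rw [← h0, ← h3]
    refine Finset.sum_le_sum_of_subset_of_nonneg ?_ fun _ _ _ => hm _
    intro g hg
    obtain ⟨f, hf, rfl⟩ := Finset.mem_image.1 hg
    rw [stabFaces, Finset.mem_filter] at hf
    exact Finset.mk_mem_product hf.2.1 (Finset.mem_univ _)
  rw [Finset.sum_add_distrib]
  linarith

lemma exists_stabForm_le [Fintype ι] (p : ℕ) (γ : ℕ → ℝ) (hγ : ∀ k ∈ Finset.Icc 1 p, 0 < γ k) :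
    ∃ C > 0, ∀ (h : ℝ) (o : ι → Fin 2 → ℝ) (V : S.Dof p h o → ℝ), 0 < h →
      S.stabForm p γ h o (S.interp p V) (S.interp p V) ≤
        C * ∑ i, ∑ K ∈ S.activeElements h o i, S.elemMass V i K := by
  obtain ⟨C, hC, H⟩ := exists_jumpEnergy_le p
  set G := ∑ q ∈ Finset.Icc 1 p, γ q with hG
  have hG0 : 0 ≤ G := Finset.sum_nonneg fun q hq => (hγ q hq).le
  refine ⟨G * (4 * C) + 1, by positivity, fun h o V hh => ?_⟩
  rw [S.stabForm_interp hh, Finset.mul_sum]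
  refine Finset.sum_le_sum fun i _ => ?_
  have hm := fun K => S.elemMass_nonneg V i K
  have hsum := S.sum_stabFaces_le (h := h) (o := o) i hm
  calc _ ≤ ∑ f ∈ S.stabFaces h o i, G * (C * (S.elemMass V i f.1 +
          S.elemMass V i (f.1 + Pi.single f.2 1))) := by
        refine Finset.sum_le_sum fun f _ => (sum_mul_le_sum_mul_sum _ (fun q hq => (hγ q hq).le)
          fun q _ => integral_refJump_sq_nonneg _ _ _ _).trans ?_
        exact mul_le_mul_of_nonneg_left (H (S.coef V i) f) hG0
    _ = G * C * ∑ f ∈ S.stabFaces h o i, (S.elemMass V i f.1 +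
          S.elemMass V i (f.1 + Pi.single f.2 1)) := by
        rw [Finset.mul_sum]; exact Finset.sum_congr rfl fun _ _ => by ring
    _ ≤ G * C * (4 * ∑ K ∈ S.activeElements h o i, S.elemMass V i K) := by gcongr
    _ ≤ _ := by
        have := Finset.sum_nonneg fun K (_ : K ∈ S.activeElements h o i) => hm K
        nlinarith

end MultipatchSurface

end

/-! ### Uncut elements, traces and fluxes. -/

section

open Set MeasureTheory

namespace MultipatchSurface

variable {ι ε : Type*} {d : ℕ} (S : MultipatchSurface ι ε d)
variable {h : ℝ} {o : ι → Fin 2 → ℝ} {p : ℕ}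

open Classical in
/-- The active elements that are not cut. -/
noncomputable def uncutElements (h : ℝ) (o : ι → Fin 2 → ℝ) (i : ι) : Finset (Fin 2 → ℤ) :=
  (S.activeElements h o i).filter fun K => ¬ (gridElement h (o i) K ∩ frontier (S.dom i)).Nonempty

/-- Elements are connected, and so cannot leave the patch without meeting its frontier. -/
lemma gridElement_subset_dom (hh : 0 < h) {i : ι} {K : Fin 2 → ℤ} (hK : K ∈ S.uncutElements h o i) :
    gridElement h (o i) K ⊆ S.dom i := by
  classical
  rw [uncutElements, Finset.mem_filter, S.mem_activeElements hh] at hK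
  exact (convex_Icc _ _).isPreconnected.subset_of_disjoint_frontier' (S.dom_open i)
    (fun x hx hx' => hK.2 ⟨x, hx, hx'⟩) hK.1

/-- Half-open cells are disjoint, so the integrals over them add up to at most the integral over the
patch. -/
lemma sum_uncut_integral_le (hh : 0 < h) (i : ι) {f : (Fin 2 → ℝ) → ℝ} (hf : ∀ x, 0 ≤ f x)
    (hfi : IntegrableOn f (S.dom i)) :
    ∑ K ∈ S.uncutElements h o i, ∫ x in gridCell h (o i) K, f x ≤ ∫ x in S.dom i, f x := by
  have hsub : ∀ K ∈ S.uncutElements h o i, gridCell h (o i) K ⊆ S.dom i := fun K hK =>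
    (gridCell_subset h (o i) K).trans (S.gridElement_subset_dom hh hK)
  rw [← integral_biUnion_finset _ (fun K _ => measurableSet_gridCell h (o i) K)]
  · exact setIntegral_mono_set hfi (Filter.Eventually.of_forall hf)
      (LE.le.eventuallyLE (iUnion₂_subset hsub))
  · intro K _ K' _ hne
    rw [Function.onFun, Set.disjoint_left]
    intro x hx hx'
    rw [mem_gridCell_iff hh] at hx hx'
    exact hne (hx.symm.trans hx')
  · exact fun K hK => hfi.mono_set (hsub K hK)

lemma val_interp [Fintype ι] (V : S.Dof p h o → ℝ) (i : ι) (x : Fin 2 → ℝ) : val h o (S.interp p V) i x =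
    MvPolynomial.eval x (gridPoly p h (o i) (S.activeNodes p h o i) (S.coef V i)
      (elementTowards h (o i) 0 x)) := by
  rw [val, interp_apply]

lemma continuous_val_interp [Fintype ι] (hp : 1 ≤ p) (V : S.Dof p h o → ℝ) (i : ι) :
    Continuous (val h o (S.interp p V) i) := by
  have := continuous_gridFun (h := h) (o := o i) (N := S.activeNodes p h o i) (a := S.coef V i) hp
  exact this.congr fun x => (S.val_interp V i x).symm

/-- The sum of the nodal energies of a patch. -/
noncomputable def patchEnergy (V : S.Dof p h o → ℝ) (i : ι) : ℝ :=
  ∑ K ∈ S.activeElements h o i, S.elemEnergy V i K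

/-- The sum of the nodal masses of a patch. -/
noncomputable def patchMass (V : S.Dof p h o → ℝ) (i : ι) : ℝ :=
  ∑ K ∈ S.activeElements h o i, S.elemMass V i K

lemma patchEnergy_nonneg (V : S.Dof p h o → ℝ) (i : ι) : 0 ≤ S.patchEnergy V i :=
  Finset.sum_nonneg fun _ _ => S.elemEnergy_nonneg V i _

lemma patchMass_nonneg (V : S.Dof p h o → ℝ) (i : ι) : 0 ≤ S.patchMass V i :=
  Finset.sum_nonneg fun _ _ => S.elemMass_nonneg V i _

lemma patchEnergy_le (V : S.Dof p h o → ℝ) (i : ι) :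
    S.patchEnergy V i ≤ 4 * (p + 1) ^ 2 * S.patchMass V i := by
  rw [patchEnergy, patchMass, Finset.mul_sum]
  exact Finset.sum_le_sum fun K _ => nodalEnergy_le _

lemma exists_sqGrad_val [Fintype ι] (hp : 1 ≤ p) : ∃ C > 0, ∀ (h : ℝ) (o : ι → Fin 2 → ℝ)
    (V : S.Dof p h o → ℝ) (i : ι), 0 < h → SqGrad (S.dom i) (val h o (S.interp p V) i)
      (fun x => ENNReal.ofReal (C * energyDensity p h (o i) (S.coef V i) (S.activeElements h o i) x)) := by
  obtain ⟨C, hC, H⟩ := exists_sqGrad hp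
  refine ⟨C, hC, fun h o V i hh => ?_⟩
  have h1 := H h (o i) (S.activeNodes p h o i) (S.coef V i) (S.activeElements h o i) (S.dom i) hh
    (S.coef_of_notMem V i) (fun K hK => (S.mem_activeElements hh).2 hK)
  have h2 : val h o (S.interp p V) i = _ := funext (S.val_interp V i)
  rwa [← h2] at h1

/-- By continuity the trace does not depend on the element from which it is taken. Fluxes do, as
gradients jump over faces. -/
lemma trace_interp [Fintype ι] (hp : 1 ≤ p) (hh : 0 < h) (V : S.Dof p h o → ℝ) (s : ε × Bool) (t : ℝ) :
    S.trace h o (S.interp p V) s t = val h o (S.interp p V) (S.patch s) (S.curve s t) := by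
  rw [val_interp, trace, interp_apply]
  exact eval_gridPoly_eq hp hh (mem_gridElement_elementTowards hh _ _ _)
    (mem_gridElement_elementTowards hh _ _ _)

/-- The element on the inward side contains points of the patch, so traces and fluxes use active
elements only. The ends of a side are excluded, which does not matter for integrals. -/
lemma elementTowards_inward_mem (hh : 0 < h) (s : ε × Bool) {t : ℝ} (ht : t ∈ Ioo (0 : ℝ) 1) :
    elementTowards h (o (S.patch s)) (S.inward s t) (S.curve s t) ∈
      S.activeElements h o (S.patch s) := by
  rw [S.mem_activeElements hh]
  obtain ⟨δ, hδ, H⟩ := S.curve_left s t ht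
  have h1 := (eventually_mem_elementTowards hh (o (S.patch s)) (S.inward s t) (S.curve s t)).filter_mono
    (nhdsWithin_mono 0 Ioi_subset_Ici_self)
  obtain ⟨r, hr1, hr2⟩ := (h1.and (Ioo_mem_nhdsGT hδ)).exists
  exact ⟨_, hr1, (H r hr2).1⟩

lemma exists_conormal_bound [Finite ε] : ∃ B > 0, ∀ s : ε × Bool, ∀ t ∈ Icc (0 : ℝ) 1, ∀ k,
    S.conormal s t k ^ 2 ≤ B := by
  have h1 : ∀ z : (ε × Bool) × Fin 2, ∃ B, ∀ t ∈ Icc (0 : ℝ) 1, ‖S.conormal z.1 t z.2‖ ≤ B := fun z =>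
    isCompact_Icc.exists_bound_of_continuousOn (S.continuousOn_conormal z.1 z.2)
  choose B hB using h1
  obtain ⟨M, hM⟩ := (Set.finite_range fun z => B z ^ 2).bddAbove
  refine ⟨max M 1, by positivity, fun s t ht k => ?_⟩
  have h2 := hB (s, k) t ht
  have h3 : B (s, k) ^ 2 ≤ M := hM (mem_range_self (s, k))
  rw [Real.norm_eq_abs] at h2
  rw [← sq_abs]
  exact (pow_le_pow_left₀ (abs_nonneg _) h2 2).trans (h3.trans (le_max_left _ _))

/-- Pointwise bounds for traces and fluxes. -/
lemma exists_trace_flux_le [Fintype ι] [Finite ε] (hp : 1 ≤ p) : ∃ C > 0, ∀ (h : ℝ) (o : ι → Fin 2 → ℝ)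
    (V : S.Dof p h o → ℝ) (s : ε × Bool), 0 < h → ∀ t ∈ Ioo (0 : ℝ) 1,
    S.trace h o (S.interp p V) s t ^ 2 ≤ ∑ K ∈ S.activeElements h o (S.patch s),
      (gridElement h (o (S.patch s)) K).indicator (fun _ => C * S.elemMass V (S.patch s) K)
        (S.curve s t) ∧
    S.flux h o (S.interp p V) s t ^ 2 ≤ ∑ K ∈ S.activeElements h o (S.patch s),
      (gridElement h (o (S.patch s)) K).indicator
        (fun _ => C * (h ^ 2)⁻¹ * S.elemEnergy V (S.patch s) K) (S.curve s t) := by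
  obtain ⟨B, hB, hBn⟩ := S.exists_conormal_bound
  obtain ⟨C, hC, H⟩ := exists_eval_gridPoly_le hp
  refine ⟨C + 4 * B * C, by positivity, fun h o V s hh t ht => ?_⟩
  set K₀ := elementTowards h (o (S.patch s)) (S.inward s t) (S.curve s t) with hK₀
  have hact := S.elementTowards_inward_mem (o := o) hh s ht
  have hmem := mem_gridElement_elementTowards hh (o (S.patch s)) (S.inward s t) (S.curve s t)
  obtain ⟨h1, h2⟩ := H h (o (S.patch s)) (S.activeNodes p h o (S.patch s)) (S.coef V (S.patch s)) K₀
    (S.curve s t) hh (S.coef_of_notMem V _) hmem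
  -- The element that carries the trace varies with `t`. The sum over all active elements that
  -- contain the point dominates its contribution.
  have key : ∀ f : (Fin 2 → ℤ) → ℝ, (∀ K, 0 ≤ f K) → f K₀ ≤ ∑ K ∈ S.activeElements h o (S.patch s),
      (gridElement h (o (S.patch s)) K).indicator (fun _ => f K) (S.curve s t) := by
    intro f hf
    have := Finset.single_le_sum (f := fun K => (gridElement h (o (S.patch s)) K).indicator
      (fun _ => f K) (S.curve s t)) (fun K _ => indicator_nonneg (fun _ _ => hf K) _) hact
    rwa [indicator_of_mem hmem] at this
  constructor
  · refine le_trans ?_ (key (fun K => (C + 4 * B * C) * S.elemMass V (S.patch s) K)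
      fun K => mul_nonneg (by positivity) (S.elemMass_nonneg V _ K))
    rw [trace, interp_apply]
    refine h1.trans ?_
    have : 0 ≤ 4 * B * C * S.elemMass V (S.patch s) K₀ :=
      mul_nonneg (by positivity) (S.elemMass_nonneg V _ K₀)
    rw [add_mul]
    exact le_add_of_nonneg_right this
  · refine le_trans ?_ (key (fun K => (C + 4 * B * C) * (h ^ 2)⁻¹ * S.elemEnergy V (S.patch s) K)
      fun K => mul_nonneg (by positivity) (S.elemEnergy_nonneg V _ K))
    rw [flux]
    simp only [interp_apply, Fin.sum_univ_two]
    have n0 := hBn s t (Ioo_subset_Icc_self ht) 0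
    have n1 := hBn s t (Ioo_subset_Icc_self ht) 1
    have g0 := h2 0
    have g1 := h2 1
    have hE : 0 ≤ C * (h ^ 2)⁻¹ * S.elemEnergy V (S.patch s) K₀ :=
      mul_nonneg (by positivity) (S.elemEnergy_nonneg V _ K₀)
    change _ ≤ C * (h ^ 2)⁻¹ * S.elemEnergy V (S.patch s) K₀ at g0
    change _ ≤ C * (h ^ 2)⁻¹ * S.elemEnergy V (S.patch s) K₀ at g1
    set a := S.conormal s t 0
    set b := S.conormal s t 1
    set x := MvPolynomial.eval (S.curve s t) (MvPolynomial.pderiv 0 (gridPoly p h (o (S.patch s))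
      (S.activeNodes p h o (S.patch s)) (S.coef V (S.patch s)) K₀))
    set y := MvPolynomial.eval (S.curve s t) (MvPolynomial.pderiv 1 (gridPoly p h (o (S.patch s))
      (S.activeNodes p h o (S.patch s)) (S.coef V (S.patch s)) K₀))
    calc (a * x + b * y) ^ 2 ≤ 2 * (a ^ 2 * x ^ 2 + b ^ 2 * y ^ 2) := by
          nlinarith [sq_nonneg (a * x - b * y)]
      _ ≤ 2 * (B * (C * (h ^ 2)⁻¹ * S.elemEnergy V (S.patch s) K₀) +
          B * (C * (h ^ 2)⁻¹ * S.elemEnergy V (S.patch s) K₀)) := by gcongr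
      _ = 4 * B * (C * (h ^ 2)⁻¹ * S.elemEnergy V (S.patch s) K₀) := by ring
      _ ≤ 4 * B * (C * (h ^ 2)⁻¹ * S.elemEnergy V (S.patch s) K₀) +
          C * (h ^ 2)⁻¹ * S.elemEnergy V (S.patch s) K₀ := le_add_of_nonneg_right hE
      _ = _ := by ring

/-- Integrals along a side of functions that are bounded elementwise. -/
lemma exists_integral_side_le [Finite ε] : ∃ C > 0, ∀ (h : ℝ) (o : ι → Fin 2 → ℝ) (s : ε × Bool)
    (T : Finset (Fin 2 → ℤ)) (b : (Fin 2 → ℤ) → ℝ) (f : ℝ → ℝ), 0 < h → (∀ K, 0 ≤ b K) →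
    BddMeas volume (Icc 0 1) f → (∀ t ∈ Ioo (0 : ℝ) 1, f t ≤ ∑ K ∈ T,
      (gridElement h (o (S.patch s)) K).indicator (fun _ => b K) (S.curve s t)) →
    ∫ t in (0 : ℝ)..1, f t ≤ C * h * ∑ K ∈ T, b K := by
  choose C hC H using S.exists_volume_side_le
  obtain ⟨M, hM⟩ := (Set.finite_range C).bddAbove
  refine ⟨max M 1, by positivity, fun h o s T b f hh hb hf hle => ?_⟩
  have hmeas : ∀ K, MeasurableSet {t | S.curve s t ∈ gridElement h (o (S.patch s)) K} := fun K =>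
    (S.continuous_curve s).measurable (measurableSet_gridElement _ _ _)
  have hmI : ∀ K, MeasurableSet (Icc (0 : ℝ) 1 ∩ {t | S.curve s t ∈ gridElement h (o (S.patch s)) K}) :=
    fun K => measurableSet_Icc.inter (hmeas K)
  have hint : ∀ K ∈ T, IntegrableOn (fun t => (gridElement h (o (S.patch s)) K).indicator
      (fun _ => b K) (S.curve s t)) (Icc 0 1) := by
    intro K _
    have : (fun t => (gridElement h (o (S.patch s)) K).indicator (fun _ => b K) (S.curve s t)) =
        {t | S.curve s t ∈ gridElement h (o (S.patch s)) K}.indicator fun _ => b K := by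
      ext t; rfl
    rw [this]
    exact (integrableOn_const (by simp)).indicator (hmeas K)
  rw [intervalIntegral.integral_of_le zero_le_one, integral_Ioc_eq_integral_Ioo]
  calc ∫ t in Ioo (0 : ℝ) 1, f t ≤ ∫ t in Ioo (0 : ℝ) 1, ∑ K ∈ T,
        (gridElement h (o (S.patch s)) K).indicator (fun _ => b K) (S.curve s t) :=
        setIntegral_mono_on ((hf.integrableOn measurableSet_Icc (by simp)).mono_set Ioo_subset_Icc_self)
          (IntegrableOn.mono_set (integrable_finsetSum T hint) Ioo_subset_Icc_self)
          measurableSet_Ioo hle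
    _ = ∫ t in Icc (0 : ℝ) 1, ∑ K ∈ T,
        (gridElement h (o (S.patch s)) K).indicator (fun _ => b K) (S.curve s t) := by
        rw [integral_Icc_eq_integral_Ioo]
    _ = ∑ K ∈ T, ∫ t in Icc (0 : ℝ) 1,
        (gridElement h (o (S.patch s)) K).indicator (fun _ => b K) (S.curve s t) :=
        integral_finsetSum T hint
    _ ≤ ∑ K ∈ T, max M 1 * h * b K := by
        refine Finset.sum_le_sum fun K _ => ?_
        have e : ∫ t in Icc (0 : ℝ) 1,
            (gridElement h (o (S.patch s)) K).indicator (fun _ => b K) (S.curve s t) =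
            volume.real (Icc (0 : ℝ) 1 ∩ {t | S.curve s t ∈ gridElement h (o (S.patch s)) K}) * b K := by
          rw [← smul_eq_mul, ← setIntegral_const, ← setIntegral_indicator (hmeas K)]
          rfl
        rw [e]
        refine mul_le_mul_of_nonneg_right ?_ (hb K)
        have h1 := H s h hh (o (S.patch s)) K
        have h2 : C s ≤ max M 1 := (hM (mem_range_self s)).trans (le_max_left _ _)
        refine (ENNReal.toReal_mono ENNReal.ofReal_ne_top h1).trans ?_
        rw [ENNReal.toReal_ofReal (mul_nonneg (hC s) hh.le)]
        gcongr
    _ = _ := by rw [Finset.mul_sum]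

/-- Integral bounds for traces and fluxes. -/
lemma exists_integral_trace_flux_le [Fintype ι] [Finite ε] (hp : 1 ≤ p) : ∃ C > 0, ∀ (h : ℝ)
    (o : ι → Fin 2 → ℝ) (V : S.Dof p h o → ℝ) (s : ε × Bool), 0 < h →
    ∫ t in (0 : ℝ)..1, S.trace h o (S.interp p V) s t ^ 2 ≤ C * h * S.patchMass V (S.patch s) ∧
    ∫ t in (0 : ℝ)..1, S.flux h o (S.interp p V) s t ^ 2 ≤ C * h⁻¹ * S.patchEnergy V (S.patch s) := by
  obtain ⟨C₁, hC₁, H₁⟩ := S.exists_trace_flux_le hp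
  obtain ⟨C₂, hC₂, H₂⟩ := S.exists_integral_side_le
  refine ⟨C₁ * C₂, by positivity, fun h o V s hh => ⟨?_, ?_⟩⟩
  · have hb := (S.bddMeas_trace (o := o) hh (S.interp p V) s).mul (S.bddMeas_trace (o := o) hh (S.interp p V) s)
    simp only [← pow_two] at hb
    refine (H₂ h o s _ _ _ hh (fun K => mul_nonneg hC₁.le (S.elemMass_nonneg V _ K)) hb
      fun t ht => (H₁ h o V s hh t ht).1).trans (le_of_eq ?_)
    rw [← Finset.mul_sum, patchMass]; ring
  · have hb := (S.bddMeas_flux (o := o) hh (S.interp p V) s).mul (S.bddMeas_flux (o := o) hh (S.interp p V) s)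
    simp only [← pow_two] at hb
    refine (H₂ h o s _ _ _ hh (fun K => mul_nonneg (by positivity) (S.elemEnergy_nonneg V _ K)) hb
      fun t ht => (H₁ h o V s hh t ht).2).trans (le_of_eq ?_)
    rw [← Finset.mul_sum, patchEnergy]
    field_simp

lemma integral_comp_opposite (e : ε) (f : ℝ → ℝ) :
    ∫ t in (0 : ℝ)..1, f (S.opposite e t) = ∫ t in (0 : ℝ)..1, f t := by
  unfold opposite
  cases S.reversed e
  · simp
  · simp [intervalIntegral.integral_comp_sub_left f 1]

/-- Integral bounds for jumps and average fluxes. -/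
lemma exists_integral_jump_avgFlux_le [Fintype ι] [Finite ε] (hp : 1 ≤ p) : ∃ C > 0, ∀ (h : ℝ)
    (o : ι → Fin 2 → ℝ) (V : S.Dof p h o → ℝ) (e : ε), 0 < h →
    ∫ t in (0 : ℝ)..1, S.jump h o (S.interp p V) e t ^ 2 ≤
      C * h * (S.patchMass V (S.patch (e, false)) + S.patchMass V (S.patch (e, true))) ∧
    ∫ t in (0 : ℝ)..1, S.avgFlux h o (S.interp p V) e t ^ 2 ≤
      C * h⁻¹ * (S.patchEnergy V (S.patch (e, false)) + S.patchEnergy V (S.patch (e, true))) := by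
  obtain ⟨C, hC, H⟩ := S.exists_integral_trace_flux_le hp
  have key : ∀ (e : ε) (f g : ℝ → ℝ), BddMeas volume (Icc 0 1) f → BddMeas volume (Icc 0 1) g →
      ∫ t in (0 : ℝ)..1, (f t - g (S.opposite e t)) ^ 2 ≤
        2 * ((∫ t in (0 : ℝ)..1, f t ^ 2) + ∫ t in (0 : ℝ)..1, g t ^ 2) := by
    intro e f g hf hg
    have hf2 := hf.mul hf
    have hg2 := (hg.comp_opposite S e).mul (hg.comp_opposite S e)
    have hd := hf.sub (hg.comp_opposite S e)
    have hd2 := hd.mul hd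
    simp only [← pow_two] at hf2 hg2 hd2
    have e2 := S.integral_comp_opposite e fun t => g t ^ 2
    rw [← e2, ← intervalIntegral.integral_add hf2.intervalIntegrable hg2.intervalIntegrable,
      ← intervalIntegral.integral_const_mul]
    refine intervalIntegral.integral_mono_on zero_le_one hd2.intervalIntegrable
      ((hf2.add hg2).intervalIntegrable.const_mul 2) fun t _ => ?_
    nlinarith [sq_nonneg (f t + g (S.opposite e t))]
  refine ⟨2 * C, by positivity, fun h o V e hh => ⟨?_, ?_⟩⟩
  · have h1 := key e _ _ (S.bddMeas_trace (o := o) hh (S.interp p V) (e, false))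
      (S.bddMeas_trace (o := o) hh (S.interp p V) (e, true))
    have h2 := (H h o V (e, false) hh).1
    have h3 := (H h o V (e, true) hh).1
    refine h1.trans ?_
    linarith
  · have h1 := key e _ _ (S.bddMeas_flux (o := o) hh (S.interp p V) (e, false))
      (S.bddMeas_flux (o := o) hh (S.interp p V) (e, true))
    have h2 := (H h o V (e, false) hh).2
    have h3 := (H h o V (e, true) hh).2
    have h4 : ∀ t, S.avgFlux h o (S.interp p V) e t ^ 2 = 4⁻¹ * (S.flux h o (S.interp p V) (e, false) t -
        S.flux h o (S.interp p V) (e, true) (S.opposite e t)) ^ 2 := fun t => by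
      rw [avgFlux]; ring
    simp only [h4, intervalIntegral.integral_const_mul]
    have h5 : 0 ≤ C * h⁻¹ * S.patchEnergy V (S.patch (e, false)) :=
      mul_nonneg (by positivity) (S.patchEnergy_nonneg V _)
    have h6 : 0 ≤ C * h⁻¹ * S.patchEnergy V (S.patch (e, true)) :=
      mul_nonneg (by positivity) (S.patchEnergy_nonneg V _)
    linarith

end MultipatchSurface

end

/-! ### Energy and mass of a patch. -/

section

open Set MeasureTheory

namespace MultipatchSurface

variable {ι ε : Type*} {d : ℕ} (S : MultipatchSurface ι ε d)
variable {h : ℝ} {o : ι → Fin 2 → ℝ} {p : ℕ}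

/-- The energy of a function on a patch. -/
noncomputable def gradEnergy (h : ℝ) (o : ι → Fin 2 → ℝ) (v : BrokenPoly ι) (i : ι) : ℝ :=
  S.patchIntegral i fun x => grad h o v i x ⬝ᵥ (S.metric i x)⁻¹.mulVec (grad h o v i x)

lemma bddMeas_grad_sq (hh : 0 < h) (v : BrokenPoly ι) (i : ι) :
    BddMeas volume (S.dom i) fun x => ∑ k, grad h o v i x k ^ 2 := by
  simp only [pow_two]
  exact .sum _ fun k _ => (S.bddMeas_grad hh v i k).mul (S.bddMeas_grad hh v i k)

lemma integrableOn_dom (i : ι) {f : (Fin 2 → ℝ) → ℝ} (hf : BddMeas volume (S.dom i) f) :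
    IntegrableOn f (S.dom i) :=
  hf.integrableOn (S.dom_open i).measurableSet (S.isBounded_dom i).measure_lt_top.ne

/-- The energy is equivalent to the integral of the squared reference gradient. -/
lemma exists_gradEnergy_bounds (i : ι) : ∃ c > 0, ∃ C > 0, ∀ (h : ℝ) (o : ι → Fin 2 → ℝ)
    (v : BrokenPoly ι), 0 < h →
    c * (∫ x in S.dom i, ∑ k, grad h o v i x k ^ 2) ≤ S.gradEnergy h o v i ∧
    S.gradEnergy h o v i ≤ C * ∫ x in S.dom i, ∑ k, grad h o v i x k ^ 2 := by
  obtain ⟨c, hc, C, hC, H⟩ := S.exists_metric_bounds i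
  refine ⟨c * c, by positivity, C * C, by positivity, fun h o v hh => ?_⟩
  have hg := S.integrableOn_dom i (S.bddMeas_grad_sq (o := o) hh v i)
  have hG := S.integrableOn_patch i (S.bddMeas_gradTerm (o := o) hh v v i)
  have hms := (S.dom_open i).measurableSet
  have hn : ∀ x, 0 ≤ ∑ k, grad h o v i x k ^ 2 := fun x => Finset.sum_nonneg fun _ _ => sq_nonneg _
  constructor
  · rw [← integral_const_mul]
    refine setIntegral_mono_on (hg.const_mul _) hG hms fun x hx => ?_
    obtain ⟨⟨h1, -⟩, h2⟩ := H x (subset_closure hx)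
    obtain ⟨h3, -⟩ := h2 (grad h o v i x)
    calc c * c * ∑ k, grad h o v i x k ^ 2 = c * ∑ k, grad h o v i x k ^ 2 * c := by
          rw [← Finset.sum_mul]; ring
      _ = (c * ∑ k, grad h o v i x k ^ 2) * c := by rw [← Finset.sum_mul]; ring
      _ ≤ _ := mul_le_mul h3 h1 hc.le ((mul_nonneg hc.le (hn x)).trans h3)
  · rw [← integral_const_mul]
    refine setIntegral_mono_on hG (hg.const_mul _) hms fun x hx => ?_
    obtain ⟨⟨-, h1⟩, h2⟩ := H x (subset_closure hx)
    obtain ⟨-, h3⟩ := h2 (grad h o v i x)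
    calc _ ≤ (C * ∑ k, grad h o v i x k ^ 2) * C :=
          mul_le_mul h3 h1 (Real.sqrt_nonneg _) (mul_nonneg hC.le (hn x))
      _ = _ := by ring

lemma grad_interp [Fintype ι] (V : S.Dof p h o → ℝ) (i : ι) (x : Fin 2 → ℝ) (k : Fin 2) :
    grad h o (S.interp p V) i x k = MvPolynomial.eval x (MvPolynomial.pderiv k
      (gridPoly p h (o i) (S.activeNodes p h o i) (S.coef V i) (elementTowards h (o i) 0 x))) := by
  rw [grad, interp_apply]

/-- Lower bounds by the elements that are not cut. -/
lemma exists_uncut_le_integral [Fintype ι] (hp : 1 ≤ p) : ∃ κ > 0, ∀ (h : ℝ) (o : ι → Fin 2 → ℝ)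
    (V : S.Dof p h o → ℝ) (i : ι), 0 < h →
    κ * h ^ 2 * ∑ K ∈ S.uncutElements h o i, S.elemMass V i K ≤
      ∫ x in S.dom i, val h o (S.interp p V) i x ^ 2 ∧
    κ * ∑ K ∈ S.uncutElements h o i, S.elemEnergy V i K ≤
      ∫ x in S.dom i, ∑ k, grad h o (S.interp p V) i x k ^ 2 := by
  obtain ⟨κ, hκ, H⟩ := exists_le_setIntegral_gridCell hp
  refine ⟨κ, hκ, fun h o V i hh => ⟨?_, ?_⟩⟩
  · have hv := (S.bddMeas_val (o := o) hh (S.interp p V) i).mul (S.bddMeas_val (o := o) hh (S.interp p V) i)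
    simp only [← pow_two] at hv
    refine le_trans ?_ (S.sum_uncut_integral_le (o := o) hh i (fun x => sq_nonneg _)
      (S.integrableOn_dom i hv))
    rw [Finset.mul_sum]
    refine Finset.sum_le_sum fun K _ => ?_
    refine (H h (o i) _ _ K hh (S.coef_of_notMem V i)).1.trans (le_of_eq ?_)
    refine setIntegral_congr_fun (measurableSet_gridCell _ _ _) fun x hx => ?_
    simp only [val_interp, (mem_gridCell_iff hh).1 hx]
  · refine le_trans ?_ (S.sum_uncut_integral_le (o := o) hh i
      (fun x => Finset.sum_nonneg fun _ _ => sq_nonneg _)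
      (S.integrableOn_dom i (S.bddMeas_grad_sq hh (S.interp p V) i)))
    rw [Finset.mul_sum]
    refine Finset.sum_le_sum fun K _ => ?_
    refine (H h (o i) _ _ K hh (S.coef_of_notMem V i)).2.trans (le_of_eq ?_)
    refine setIntegral_congr_fun (measurableSet_gridCell _ _ _) fun x hx => ?_
    simp only [grad_interp, (mem_gridCell_iff hh).1 hx]

lemma integral_energyDensity_le (hh : 0 < h) (V : S.Dof p h o → ℝ) (i : ι) :
    IntegrableOn (energyDensity p h (o i) (S.coef V i) (S.activeElements h o i)) (S.dom i) ∧
    ∫ x in S.dom i, energyDensity p h (o i) (S.coef V i) (S.activeElements h o i) x ≤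
      S.patchEnergy V i := by
  have hint : IntegrableOn (energyDensity p h (o i) (S.coef V i) (S.activeElements h o i))
      (S.dom i) := by
    refine S.integrableOn_dom i ⟨(measurable_energyDensity _).aestronglyMeasurable,
      ∑ K ∈ S.activeElements h o i, (h ^ 2)⁻¹ * nodalEnergy p (localCoef p (S.coef V i) K),
      fun x _ => ?_⟩
    rw [abs_of_nonneg (energyDensity_nonneg _ _)]
    exact energyDensity_le _ _
  refine ⟨hint, ?_⟩
  rw [integral_eq_lintegral_of_nonneg_ae (Filter.Eventually.of_forall fun x =>
    energyDensity_nonneg _ _) hint.1]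
  have h1 := lintegral_energyDensity (p := p) (o := o i) (a := S.coef V i) hh zero_le_one
    (S.activeElements h o i)
  simp only [one_mul] at h1
  refine (ENNReal.toReal_mono (by rw [h1]; exact ENNReal.ofReal_ne_top)
    (setLIntegral_le_lintegral _ _)).trans ?_
  rw [h1, ENNReal.toReal_ofReal (Finset.sum_nonneg fun _ _ => nodalEnergy_nonneg _ _)]
  rfl

lemma exists_integral_grad_le [Fintype ι] (hp : 1 ≤ p) : ∃ C > 0, ∀ (h : ℝ) (o : ι → Fin 2 → ℝ)
    (V : S.Dof p h o → ℝ) (i : ι), 0 < h →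
    ∫ x in S.dom i, ∑ k, grad h o (S.interp p V) i x k ^ 2 ≤ C * S.patchEnergy V i := by
  obtain ⟨C, hC, H⟩ := exists_eval_gridPoly_le hp
  refine ⟨2 * C, by positivity, fun h o V i hh => ?_⟩
  obtain ⟨hint, hle⟩ := S.integral_energyDensity_le hh V i
  calc _ ≤ ∫ x in S.dom i, 2 * C * energyDensity p h (o i) (S.coef V i) (S.activeElements h o i) x := by
        refine setIntegral_mono_on (S.integrableOn_dom i (S.bddMeas_grad_sq hh _ i))
          (hint.const_mul _) (S.dom_open i).measurableSet fun x hx => ?_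
        have hmem := mem_gridElement_elementTowards_zero hh (o i) x
        have hact : elementTowards h (o i) 0 x ∈ S.activeElements h o i :=
          (S.mem_activeElements hh).2 ⟨x, hmem, hx⟩
        obtain ⟨-, h2⟩ := H h (o i) (S.activeNodes p h o i) (S.coef V i) _ x hh
          (S.coef_of_notMem V i) hmem
        have h3 := energyDensity_ge (p := p) (a := S.coef V i) hact hmem
        simp only [grad_interp, Fin.sum_univ_two]
        have h0 := h2 0
        have h1 := h2 1
        rw [mul_assoc] at h0 h1
        have h4 := mul_le_mul_of_nonneg_left h3 hC.le
        linarith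
    _ ≤ _ := by rw [integral_const_mul]; gcongr

/-- Control of all active elements by the uncut ones. -/
lemma exists_patchEnergy_le (hp : 1 ≤ p) {i : ι} (hcone : UniformCone (S.dom i)) :
    ∃ C > 0, ∃ h₀ > 0, ∀ (h : ℝ) (o : ι → Fin 2 → ℝ) (V : S.Dof p h o → ℝ), 0 < h → h ≤ h₀ →
      S.patchEnergy V i ≤ C * (∑ K ∈ S.uncutElements h o i, S.elemEnergy V i K + S.faceEnergy V i) ∧
      S.patchMass V i ≤ C * (∑ K ∈ S.uncutElements h o i, S.elemMass V i K + S.patchEnergy V i) := by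
  classical
  obtain ⟨C₀, hC₀, H₀⟩ := exists_nodalEnergy_le_adjacent hp
  obtain ⟨C₁, hC₁, h₁, hh₁, H₁⟩ := hcone.exists_sum_le (S.dom_open i) hC₀
  have hp1 : (1 : ℝ) ≤ 2 * (p + 1) ^ 2 := by
    have : (1 : ℝ) ≤ (p + 1) ^ 2 := one_le_pow₀ (by linarith [(Nat.cast_nonneg p : (0 : ℝ) ≤ p)])
    linarith
  obtain ⟨C₂, hC₂, h₂, hh₂, H₂⟩ := hcone.exists_sum_le (S.dom_open i) hp1
  refine ⟨2 * C₁ + C₂, by positivity, min h₁ h₂, by positivity, fun h o V hh hh₀ => ⟨?_, ?_⟩⟩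
  -- `P K` collects the jumps over all stabilized faces of `K`. A face belongs to two elements,
  -- whence the factor `2` below.
  · set P : (Fin 2 → ℤ) → ℝ := fun K => ∑ f ∈ S.stabFaces h o i,
      ((if f.1 = K then jumpEnergy p (S.coef V i) f else 0) +
        if f.1 + Pi.single f.2 1 = K then jumpEnergy p (S.coef V i) f else 0) with hP
    have hterm : ∀ K f, 0 ≤ ((if f.1 = K then jumpEnergy p (S.coef V i) f else 0) +
        if f.1 + Pi.single f.2 1 = K then jumpEnergy p (S.coef V i) f else 0) := fun K f => by
      have := jumpEnergy_nonneg p (S.coef V i) f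
      split_ifs <;> linarith
    have hP0 : ∀ K, 0 ≤ P K := fun K => Finset.sum_nonneg fun f _ => hterm K f
    have hPsum : ∑ K ∈ S.activeElements h o i, P K ≤ 2 * S.faceEnergy V i := by
      rw [hP, Finset.sum_comm, faceEnergy, Finset.mul_sum]
      refine Finset.sum_le_sum fun f _ => ?_
      have h0 := jumpEnergy_nonneg p (S.coef V i) f
      rw [Finset.sum_add_distrib, Finset.sum_ite_eq, Finset.sum_ite_eq]
      split_ifs <;> linarith
    have h1 := H₁ h (o i) (S.activeElements h o i) (S.elemEnergy V i) P hh
      (hh₀.trans (min_le_left _ _)) (fun K => S.mem_activeElements hh) (S.elemEnergy_nonneg V i) hP0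
      (by
        rintro K hK K' hK' hcut ⟨k, rfl | rfl⟩
        -- A face between two active elements is stabilized as soon as one of them is cut, so each
        -- step from a cut element has its jump in the form.
        · have hf : (K, k) ∈ S.stabFaces h o i := by
            rw [stabFaces, Finset.mem_filter]
            exact ⟨Finset.mk_mem_product hK (Finset.mem_univ _), hK', Or.inl hcut⟩
          have h2 := (H₀ (S.coef V i) K k).1
          have h3 : jumpEnergy p (S.coef V i) (K, k) ≤ P K := by
            refine le_trans ?_ (Finset.single_le_sum (fun f _ => hterm K f) hf)
            rw [if_pos rfl]
            have := jumpEnergy_nonneg p (S.coef V i) (K, k)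
            split_ifs <;> linarith
          refine h2.trans ?_
          have : (0 : ℝ) ≤ C₀ := by linarith
          exact mul_le_mul_of_nonneg_left (add_le_add le_rfl h3) this
        · have hf : (K', k) ∈ S.stabFaces h o i := by
            rw [stabFaces, Finset.mem_filter]
            exact ⟨Finset.mk_mem_product hK' (Finset.mem_univ _), hK, Or.inr hcut⟩
          have h2 := (H₀ (S.coef V i) K' k).2
          have h3 : jumpEnergy p (S.coef V i) (K', k) ≤ P (K' + Pi.single k 1) := by
            refine le_trans ?_ (Finset.single_le_sum (fun f _ => hterm _ f) hf)
            simp only [if_true]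
            have := jumpEnergy_nonneg p (S.coef V i) (K', k)
            split_ifs <;> linarith
          refine h2.trans ?_
          have : (0 : ℝ) ≤ C₀ := by linarith
          exact mul_le_mul_of_nonneg_left (add_le_add le_rfl h3) this)
    have h2 : 0 ≤ ∑ K ∈ S.uncutElements h o i, S.elemEnergy V i K :=
      Finset.sum_nonneg fun _ _ => S.elemEnergy_nonneg V i _
    have h3 := S.faceEnergy_nonneg V i
    change S.patchEnergy V i ≤ C₁ * (∑ K ∈ S.uncutElements h o i, S.elemEnergy V i K +
      ∑ K ∈ S.activeElements h o i, P K) at h1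
    calc _ ≤ C₁ * (2 * (∑ K ∈ S.uncutElements h o i, S.elemEnergy V i K + S.faceEnergy V i)) :=
          h1.trans (mul_le_mul_of_nonneg_left (by linarith) hC₁.le)
      _ = 2 * C₁ * (∑ K ∈ S.uncutElements h o i, S.elemEnergy V i K + S.faceEnergy V i) := by ring
      _ ≤ _ := mul_le_mul_of_nonneg_right (by linarith) (by linarith)
  · have h1 := H₂ h (o i) (S.activeElements h o i) (S.elemMass V i) (S.elemEnergy V i) hh
      (hh₀.trans (min_le_right _ _)) (fun K => S.mem_activeElements hh) (S.elemMass_nonneg V i)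
      (S.elemEnergy_nonneg V i) (fun K _ K' _ _ hadj => nodalMass_le_adjacent p (S.coef V i) hadj)
    have h2 : 0 ≤ ∑ K ∈ S.uncutElements h o i, S.elemMass V i K :=
      Finset.sum_nonneg fun _ _ => S.elemMass_nonneg V i _
    have h3 := S.patchEnergy_nonneg V i
    change S.patchMass V i ≤ C₂ * (∑ K ∈ S.uncutElements h o i, S.elemMass V i K +
      S.patchEnergy V i) at h1
    exact h1.trans (mul_le_mul_of_nonneg_right (by linarith) (by linarith))

end MultipatchSurface

end

/-! ### Coercivity and boundedness of the discrete form. -/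

section

open Set MeasureTheory

namespace MultipatchSurface

variable {ι ε : Type*} {d : ℕ} (S : MultipatchSurface ι ε d)
variable {h : ℝ} {o : ι → Fin 2 → ℝ} {p : ℕ}

lemma gradEnergy_nonneg (hh : 0 < h) (v : BrokenPoly ι) (i : ι) : 0 ≤ S.gradEnergy h o v i := by
  obtain ⟨c, hc, C, hC, H⟩ := S.exists_gradEnergy_bounds i
  refine le_trans ?_ (H h o v hh).1
  exact mul_nonneg hc.le (integral_nonneg fun x => Finset.sum_nonneg fun _ _ => sq_nonneg _)

/-- The gradient and the stabilization control the nodal energy. -/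
lemma exists_patchEnergy_le_gradEnergy [Fintype ι] (hp : 1 ≤ p) (hcone : ∀ i, UniformCone (S.dom i)) :
    ∃ C > 0, ∃ h₀ > 0, ∀ (h : ℝ) (o : ι → Fin 2 → ℝ) (V : S.Dof p h o → ℝ), 0 < h → h ≤ h₀ → ∀ i,
      S.patchEnergy V i ≤ C * (S.gradEnergy h o (S.interp p V) i + S.faceEnergy V i) := by
  obtain ⟨κ, hκ, Hκ⟩ := S.exists_uncut_le_integral hp
  choose c hc C' hC' H using S.exists_gradEnergy_bounds
  choose C hC h₀ hh₀ H' using fun i => S.exists_patchEnergy_le hp (hcone i)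
  obtain ⟨M, hM⟩ := (Set.finite_range fun i => C i * ((c i * κ)⁻¹ + 1)).bddAbove
  obtain ⟨h₁, hh₁, hle⟩ := Finset.exists_pos_le Finset.univ h₀ fun i _ => hh₀ i
  refine ⟨max M 1, by positivity, h₁, hh₁, fun h o V hh hhh i => ?_⟩
  have h1 := (H' i h o V hh (hhh.trans (hle i (Finset.mem_univ i)))).1
  have h2 := (Hκ h o V i hh).2
  have h3 := (H i h o (S.interp p V) hh).1
  have hci := hc i
  have hCi := hC i
  have hG := S.gradEnergy_nonneg (o := o) hh (S.interp p V) i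
  have hF := S.faceEnergy_nonneg V i
  set U := ∑ K ∈ S.uncutElements h o i, S.elemEnergy V i K
  have h4 : U ≤ (c i * κ)⁻¹ * S.gradEnergy h o (S.interp p V) i := by
    rw [inv_mul_eq_div, le_div_iff₀ (by positivity)]
    calc U * (c i * κ) = c i * (κ * U) := by ring
      _ ≤ _ := (mul_le_mul_of_nonneg_left h2 hci.le).trans h3
  have h5 : C i * ((c i * κ)⁻¹ + 1) ≤ max M 1 := (hM (mem_range_self i)).trans (le_max_left _ _)
  have h6 : 0 ≤ (c i * κ)⁻¹ := by positivity
  calc _ ≤ C i * ((c i * κ)⁻¹ * S.gradEnergy h o (S.interp p V) i + S.faceEnergy V i) :=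
        h1.trans (mul_le_mul_of_nonneg_left (by linarith) hCi.le)
    _ ≤ C i * (((c i * κ)⁻¹ + 1) * (S.gradEnergy h o (S.interp p V) i + S.faceEnergy V i)) := by
        refine mul_le_mul_of_nonneg_left ?_ hCi.le
        nlinarith [mul_nonneg h6 hF]
    _ = C i * ((c i * κ)⁻¹ + 1) * (S.gradEnergy h o (S.interp p V) i + S.faceEnergy V i) := by ring
    _ ≤ _ := mul_le_mul_of_nonneg_right h5 (add_nonneg hG hF)

/-- The squared jump over an interface. -/
noncomputable def jumpSq (h : ℝ) (o : ι → Fin 2 → ℝ) (v : BrokenPoly ι) (e : ε) : ℝ :=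
  ∫ t in (0 : ℝ)..1, S.jump h o v e t ^ 2

lemma jumpSq_nonneg (v : BrokenPoly ι) (e : ε) : 0 ≤ S.jumpSq h o v e :=
  intervalIntegral.integral_nonneg zero_le_one fun _ _ => sq_nonneg _

lemma bddMeas_jump_sq (hh : 0 < h) (v : BrokenPoly ι) (e : ε) :
    BddMeas volume (Icc 0 1) fun t => S.jump h o v e t ^ 2 := by
  simp only [pow_two]; exact (S.bddMeas_jump hh v e).mul (S.bddMeas_jump hh v e)

lemma bddMeas_avgFlux_sq (hh : 0 < h) (v : BrokenPoly ι) (e : ε) :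
    BddMeas volume (Icc 0 1) fun t => S.avgFlux h o v e t ^ 2 := by
  simp only [pow_two]; exact (S.bddMeas_avgFlux hh v e).mul (S.bddMeas_avgFlux hh v e)

/-- Interface integrals of nonnegative functions are equivalent to parameter integrals. -/
lemma exists_interfaceIntegral_bounds [Finite ε] : ∃ c > 0, ∃ C > 0, ∀ (e : ε) (f : ℝ → ℝ),
    BddMeas volume (Icc 0 1) f → (∀ t, 0 ≤ f t) →
    c * (∫ t in (0 : ℝ)..1, f t) ≤ S.interfaceIntegral e f ∧
    S.interfaceIntegral e f ≤ C * ∫ t in (0 : ℝ)..1, f t := by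
  have := Fintype.ofFinite ε
  choose c hc C hC H using S.exists_speed_bounds
  obtain ⟨c₁, hc₁, hle⟩ := Finset.exists_pos_le Finset.univ c fun e _ => hc e
  obtain ⟨M, hM⟩ := (Set.finite_range C).bddAbove
  refine ⟨c₁, hc₁, max M 1, by positivity, fun e f hf hf0 => ?_⟩
  have hi := S.intervalIntegrable_interface e hf
  rw [← intervalIntegral.integral_const_mul, ← intervalIntegral.integral_const_mul]
  constructor
  · refine intervalIntegral.integral_mono_on zero_le_one (hf.intervalIntegrable.const_mul _) hi
      fun t ht => ?_
    change _ ≤ f t * S.speed e t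
    rw [mul_comm]
    exact mul_le_mul_of_nonneg_left ((hle e (Finset.mem_univ e)).trans (H e t ht).1) (hf0 t)
  · refine intervalIntegral.integral_mono_on zero_le_one hi (hf.intervalIntegrable.const_mul _)
      fun t ht => ?_
    change f t * S.speed e t ≤ _
    rw [mul_comm]
    exact mul_le_mul_of_nonneg_right ((H e t ht).2.trans
      ((hM (mem_range_self e)).trans (le_max_left _ _))) (hf0 t)

lemma sum_sides_le [Fintype ι] [Fintype ε] {f : ι → ℝ} (hf : ∀ i, 0 ≤ f i) :
    ∑ e : ε, (f (S.patch (e, false)) + f (S.patch (e, true))) ≤ 2 * Fintype.card ε * ∑ i, f i := by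
  have h1 : ∀ s, f (S.patch s) ≤ ∑ i, f i := fun s =>
    Finset.single_le_sum (fun i _ => hf i) (Finset.mem_univ _)
  calc _ ≤ ∑ e : ε, 2 * ∑ i, f i := Finset.sum_le_sum fun e _ => by
        linarith [h1 (e, false), h1 (e, true)]
    _ = _ := by simp; ring

/-- The consistency terms are bounded by the nodal energy and the penalty. -/
lemma exists_consistency_le [Fintype ι] [Fintype ε] (hp : 1 ≤ p) : ∃ C > 0, ∀ (h : ℝ)
    (o : ι → Fin 2 → ℝ) (V : S.Dof p h o → ℝ) (δ : ℝ), 0 < h → 0 < δ →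
    |∑ e, (S.interfaceIntegral e (fun t => S.avgFlux h o (S.interp p V) e t * S.jump h o (S.interp p V) e t)
      + S.interfaceIntegral e (fun t => S.jump h o (S.interp p V) e t * S.avgFlux h o (S.interp p V) e t))|
      ≤ δ * C * ∑ i, S.patchEnergy V i + ∑ e, δ⁻¹ * h⁻¹ *
        S.interfaceIntegral e (fun t => S.jump h o (S.interp p V) e t * S.jump h o (S.interp p V) e t) := by
  obtain ⟨c, hc, W, hW, HW⟩ := S.exists_interfaceIntegral_bounds
  obtain ⟨C, hC, H⟩ := S.exists_integral_jump_avgFlux_le hp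
  refine ⟨W * C * (2 * Fintype.card ε) + 1, by positivity, fun h o V δ hh hδ => ?_⟩
  set v := S.interp p V with hv
  have hterm : ∀ e, |S.interfaceIntegral e (fun t => S.avgFlux h o v e t * S.jump h o v e t)
      + S.interfaceIntegral e (fun t => S.jump h o v e t * S.avgFlux h o v e t)| ≤
      δ * (W * C) * (S.patchEnergy V (S.patch (e, false)) + S.patchEnergy V (S.patch (e, true))) +
      δ⁻¹ * h⁻¹ * S.interfaceIntegral e (fun t => S.jump h o v e t * S.jump h o v e t) := by
    intro e
    have bF := S.bddMeas_avgFlux (o := o) hh v e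
    have bJ := S.bddMeas_jump (o := o) hh v e
    have bFF := S.bddMeas_avgFlux_sq (o := o) hh v e
    have h1 := (HW e _ bFF fun t => sq_nonneg _).2
    have h2 := (H h o V e hh).2
    rw [← hv] at h2
    have hE : 0 ≤ S.patchEnergy V (S.patch (e, false)) + S.patchEnergy V (S.patch (e, true)) :=
      add_nonneg (S.patchEnergy_nonneg V _) (S.patchEnergy_nonneg V _)
    -- The squared flux along an interface is of order `h⁻¹` times the energy, which the weight `h`
    -- compensates.
    have h3 : δ * h * S.interfaceIntegral e (fun t => S.avgFlux h o v e t ^ 2) ≤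
        δ * (W * C) * (S.patchEnergy V (S.patch (e, false)) + S.patchEnergy V (S.patch (e, true))) := by
      calc _ ≤ δ * h * (W * (C * h⁻¹ * (S.patchEnergy V (S.patch (e, false)) +
            S.patchEnergy V (S.patch (e, true))))) := by
            refine mul_le_mul_of_nonneg_left (h1.trans ?_) (by positivity)
            exact mul_le_mul_of_nonneg_left h2 hW.le
        _ = _ := by field_simp
    have hadd : ∀ r r' : ℝ, r * S.interfaceIntegral e (fun t => S.avgFlux h o v e t ^ 2) +
        r' * S.interfaceIntegral e (fun t => S.jump h o v e t * S.jump h o v e t) =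
        S.interfaceIntegral e (fun t => r * S.avgFlux h o v e t ^ 2 +
          r' * (S.jump h o v e t * S.jump h o v e t)) := fun r r' => by
      rw [S.interfaceIntegral_add e ((BddMeas.const r).mul bFF) ((BddMeas.const r').mul (bJ.mul bJ)),
        S.interfaceIntegral_const_mul, S.interfaceIntegral_const_mul]
    have hsum : S.interfaceIntegral e (fun t => S.avgFlux h o v e t * S.jump h o v e t)
      + S.interfaceIntegral e (fun t => S.jump h o v e t * S.avgFlux h o v e t) =
      S.interfaceIntegral e (fun t => S.avgFlux h o v e t * S.jump h o v e t +
        S.jump h o v e t * S.avgFlux h o v e t) :=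
      (S.interfaceIntegral_add e (bF.mul bJ) (bJ.mul bF)).symm
    -- Young's inequality with the parameter `δ * h`. It leaves the jump with the weight `h⁻¹` of
    -- the penalty.
    have habs : |S.interfaceIntegral e (fun t => S.avgFlux h o v e t * S.jump h o v e t +
        S.jump h o v e t * S.avgFlux h o v e t)| ≤
        S.interfaceIntegral e (fun t => δ * h * S.avgFlux h o v e t ^ 2 +
          δ⁻¹ * h⁻¹ * (S.jump h o v e t * S.jump h o v e t)) := by
      refine (intervalIntegral.abs_integral_le_integral_abs zero_le_one).trans ?_
      refine intervalIntegral.integral_mono_on zero_le_one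
        (S.intervalIntegrable_interface e ((bF.mul bJ).add (bJ.mul bF))).abs
        (S.intervalIntegrable_interface e (((BddMeas.const _).mul bFF).add
          ((BddMeas.const _).mul (bJ.mul bJ)))) fun t _ => ?_
      rw [abs_mul, abs_of_nonneg (norm_nonneg _)]
      refine mul_le_mul_of_nonneg_right ?_ (norm_nonneg _)
      set x := S.avgFlux h o v e t
      set y := S.jump h o v e t
      have hk : 0 < δ * h := by positivity
      have e1 : δ * h * x ^ 2 + δ⁻¹ * h⁻¹ * (y * y) - 2 * (x * y) = (δ * h)⁻¹ * (δ * h * x - y) ^ 2 := by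
        field_simp; ring
      have e2 : δ * h * x ^ 2 + δ⁻¹ * h⁻¹ * (y * y) + 2 * (x * y) = (δ * h)⁻¹ * (δ * h * x + y) ^ 2 := by
        field_simp; ring
      have p1 : 0 ≤ (δ * h)⁻¹ * (δ * h * x - y) ^ 2 := by positivity
      have p2 : 0 ≤ (δ * h)⁻¹ * (δ * h * x + y) ^ 2 := by positivity
      rw [abs_le]
      constructor <;> linarith
    rw [hsum]
    refine habs.trans ?_
    rw [← hadd]
    linarith
  refine (Finset.abs_sum_le_sum_abs _ _).trans ((Finset.sum_le_sum fun e _ => hterm e).trans ?_)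
  rw [Finset.sum_add_distrib, ← Finset.mul_sum]
  have h4 := S.sum_sides_le fun i => S.patchEnergy_nonneg V i
  have h5 : 0 ≤ ∑ i, S.patchEnergy V i := Finset.sum_nonneg fun i _ => S.patchEnergy_nonneg V i
  have h6 : 0 ≤ δ * (W * C) := by positivity
  have h7 := mul_le_mul_of_nonneg_left h4 h6
  have h8 : 0 ≤ δ * ∑ i, S.patchEnergy V i := mul_nonneg hδ.le h5
  nlinarith

/-- Coercivity of the discrete form. -/
lemma exists_coercive [Fintype ι] [Fintype ε] (hp : 1 ≤ p) (hcone : ∀ i, UniformCone (S.dom i))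
    (γ : ℕ → ℝ) (hγ : ∀ k ∈ Finset.Icc 1 p, 0 < γ k) :
    ∃ β₀ > 0, ∃ h₀ > 0, ∃ c > 0, ∀ β ≥ β₀, ∀ (h : ℝ) (o : ι → Fin 2 → ℝ) (V : S.Dof p h o → ℝ),
      0 < h → h ≤ h₀ →
      c * (∑ i, S.patchEnergy V i + h⁻¹ * ∑ e, S.jumpSq h o (S.interp p V) e) ≤
        S.discreteForm p β γ h o (S.interp p V) (S.interp p V) := by
  obtain ⟨C₁, hC₁, h₀, hh₀, H₁⟩ := S.exists_patchEnergy_le_gradEnergy hp hcone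
  obtain ⟨c₂, hc₂, H₂⟩ := S.exists_stabForm_ge p γ hγ
  obtain ⟨C₃, hC₃, H₃⟩ := S.exists_consistency_le hp
  obtain ⟨w, hw, W, hW, HW⟩ := S.exists_interfaceIntegral_bounds
  set m := min c₂ 1 with hm
  have hm0 : 0 < m := by positivity
  -- With this `δ` the consistency terms consume half of the energy that gradient and stabilization
  -- provide. They also consume `δ⁻¹` of the penalty parameter, so that `β₀ = δ⁻¹ + 1` leaves the
  -- jumps with weight `h⁻¹`.
  set δ := m / (2 * C₁ * C₃) with hδ
  have hδ0 : 0 < δ := by positivity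
  refine ⟨δ⁻¹ + 1, by positivity, h₀, hh₀, min (m / (2 * C₁)) w, by positivity,
    fun β hβ h o V hh hhh => ?_⟩
  set v := S.interp p V with hv
  set E := ∑ i, S.patchEnergy V i with hE
  have hE0 : 0 ≤ E := Finset.sum_nonneg fun i _ => S.patchEnergy_nonneg V i
  set G := ∑ i, S.gradEnergy h o v i with hG
  have hG0 : 0 ≤ G := Finset.sum_nonneg fun i _ => S.gradEnergy_nonneg hh v i
  set F := ∑ i, S.faceEnergy V i with hF
  have hF0 : 0 ≤ F := Finset.sum_nonneg fun i _ => S.faceEnergy_nonneg V i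
  have h1 : E ≤ C₁ * (G + F) := by
    rw [hE, hG, hF, ← Finset.sum_add_distrib, Finset.mul_sum]
    exact Finset.sum_le_sum fun i _ => H₁ h o V hh hhh i
  have h2 := H₂ h o V hh
  have h3 := H₃ h o V δ hh hδ0
  rw [← hv] at h2 h3
  have h4' := le_of_abs_le h3
  set I := ∑ e, S.interfaceIntegral e (fun t => S.jump h o v e t * S.jump h o v e t) with hI
  have h5 : w * ∑ e, S.jumpSq h o v e ≤ I := by
    rw [hI, Finset.mul_sum]
    refine Finset.sum_le_sum fun e _ => ?_
    have := (HW e _ (S.bddMeas_jump_sq (o := o) hh v e) fun t => sq_nonneg _).1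
    simp only [pow_two] at this
    simpa only [jumpSq, pow_two] using this
  have hJ0 : 0 ≤ ∑ e, S.jumpSq h o v e := Finset.sum_nonneg fun e _ => S.jumpSq_nonneg v e
  have hI0 : 0 ≤ I := (mul_nonneg hw.le hJ0).trans h5
  have hform : S.discreteForm p β γ h o v v = G - (∑ e, (S.interfaceIntegral e (fun t =>
      S.avgFlux h o v e t * S.jump h o v e t) + S.interfaceIntegral e (fun t =>
        S.jump h o v e t * S.avgFlux h o v e t))) + β * h⁻¹ * I + S.stabForm p γ h o v v := by
    rw [hI, Finset.mul_sum]; rfl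
  rw [← Finset.mul_sum, ← hI] at h4'
  rw [hform]
  have h6 : m * (G + F) ≤ G + c₂ * F := by
    have := min_le_left c₂ 1
    have := min_le_right c₂ 1
    nlinarith
  have h7 : m / C₁ * E ≤ m * (G + F) := by
    calc m / C₁ * E ≤ m / C₁ * (C₁ * (G + F)) := by gcongr
      _ = _ := by field_simp
  have h8 : δ * C₃ * E = m / (2 * C₁) * E := by rw [hδ]; field_simp
  have h9 : m / C₁ * E = m / (2 * C₁) * E + m / (2 * C₁) * E := by field_simp; ring
  have hhi : 0 < h⁻¹ := by positivity
  have h10 : h⁻¹ * I ≤ (β - δ⁻¹) * h⁻¹ * I := by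
    have : (1 : ℝ) ≤ β - δ⁻¹ := by linarith
    have h' : 0 ≤ h⁻¹ * I := by positivity
    nlinarith
  have h11 : min (m / (2 * C₁)) w * (E + h⁻¹ * ∑ e, S.jumpSq h o v e) ≤
      m / (2 * C₁) * E + h⁻¹ * I := by
    rw [mul_add]
    refine add_le_add (mul_le_mul_of_nonneg_right (min_le_left _ _) hE0) ?_
    calc _ ≤ w * (h⁻¹ * ∑ e, S.jumpSq h o v e) :=
          mul_le_mul_of_nonneg_right (min_le_right _ _) (by positivity)
      _ = h⁻¹ * (w * ∑ e, S.jumpSq h o v e) := by ring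
      _ ≤ _ := by gcongr
  linarith

/-- Boundedness of the discrete form. -/
lemma exists_discreteForm_le [Fintype ι] [Fintype ε] (hp : 1 ≤ p) (γ : ℕ → ℝ)
    (hγ : ∀ k ∈ Finset.Icc 1 p, 0 < γ k) {β : ℝ} (hβ : 0 < β) :
    ∃ C > 0, ∀ (h : ℝ) (o : ι → Fin 2 → ℝ) (V : S.Dof p h o → ℝ), 0 < h →
      S.discreteForm p β γ h o (S.interp p V) (S.interp p V) ≤ C * ∑ n, V n ^ 2 := by
  choose c hc C' hC' H using S.exists_gradEnergy_bounds
  obtain ⟨M, hM⟩ := (Set.finite_range C').bddAbove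
  obtain ⟨C₁, hC₁, H₁⟩ := S.exists_integral_grad_le hp
  obtain ⟨C₂, hC₂, H₂⟩ := S.exists_stabForm_le p γ hγ
  obtain ⟨C₃, hC₃, H₃⟩ := S.exists_consistency_le hp
  obtain ⟨w, hw, W, hW, HW⟩ := S.exists_interfaceIntegral_bounds
  obtain ⟨C₄, hC₄, H₄⟩ := S.exists_integral_jump_avgFlux_le hp
  set D := (max M 1 * C₁ + C₃) * (4 * (p + 1) ^ 2) + (1 + β) * (W * C₄ * (2 * Fintype.card ε)) + C₂
    with hD
  have hM1 : 0 < max M 1 := by positivity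
  refine ⟨D * 4, by positivity, fun h o V hh => ?_⟩
  set v := S.interp p V with hv
  set E := ∑ i, S.patchEnergy V i with hE
  set L := ∑ i, S.patchMass V i with hL
  have hL0 : 0 ≤ L := Finset.sum_nonneg fun i _ => S.patchMass_nonneg V i
  have hEL : E ≤ 4 * (p + 1) ^ 2 * L := by
    rw [hE, hL, Finset.mul_sum]; exact Finset.sum_le_sum fun i _ => S.patchEnergy_le V i
  have h1 : ∑ i, S.gradEnergy h o v i ≤ max M 1 * C₁ * E := by
    rw [hE, Finset.mul_sum]
    refine Finset.sum_le_sum fun i _ => ((H i h o v hh).2).trans ?_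
    have h2 := H₁ h o V i hh
    have h3 : C' i ≤ max M 1 := (hM (mem_range_self i)).trans (le_max_left _ _)
    rw [mul_assoc]
    exact mul_le_mul h3 h2 (integral_nonneg fun x => Finset.sum_nonneg fun _ _ => sq_nonneg _) hM1.le
  have h2 := H₂ h o V hh
  change _ ≤ C₂ * L at h2
  -- Any `δ` will do for the upper bound. The choice `δ = 1` adds `1` to the penalty parameter.
  have h3 := neg_le_of_abs_le (H₃ h o V 1 hh one_pos)
  rw [← hv] at h2 h3
  set I := ∑ e, S.interfaceIntegral e (fun t => S.jump h o v e t * S.jump h o v e t) with hI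
  -- Squared traces on a side are of order `h` times the mass, so the penalty is bounded by the mass
  -- uniformly in `h`.
  have h5 : h⁻¹ * I ≤ W * C₄ * (2 * Fintype.card ε) * L := by
    have h6 : I ≤ ∑ e, W * C₄ * h * (S.patchMass V (S.patch (e, false)) +
        S.patchMass V (S.patch (e, true))) := by
      refine Finset.sum_le_sum fun e _ => ?_
      have h7 := (HW e _ (S.bddMeas_jump_sq (o := o) hh v e) fun t => sq_nonneg _).2
      simp only [pow_two] at h7
      refine h7.trans ?_
      have h8 := (H₄ h o V e hh).1
      rw [← hv] at h8
      simp only [pow_two] at h8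
      calc _ ≤ W * (C₄ * h * (S.patchMass V (S.patch (e, false)) +
            S.patchMass V (S.patch (e, true)))) := mul_le_mul_of_nonneg_left h8 hW.le
        _ = _ := by ring
    have h9 := S.sum_sides_le fun i => S.patchMass_nonneg V i
    rw [← Finset.mul_sum] at h6
    calc h⁻¹ * I ≤ h⁻¹ * (W * C₄ * h * (2 * Fintype.card ε * L)) := by
          refine mul_le_mul_of_nonneg_left (h6.trans ?_) (by positivity)
          exact mul_le_mul_of_nonneg_left h9 (by positivity)
      _ = _ := by field_simp
  have hform : S.discreteForm p β γ h o v v = ∑ i, S.gradEnergy h o v i - (∑ e, (S.interfaceIntegral e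
      (fun t => S.avgFlux h o v e t * S.jump h o v e t) + S.interfaceIntegral e (fun t =>
        S.jump h o v e t * S.avgFlux h o v e t))) + β * h⁻¹ * I + S.stabForm p γ h o v v := by
    rw [hI, Finset.mul_sum]; rfl
  rw [← Finset.mul_sum, ← hI] at h3
  simp only [inv_one, one_mul] at h3
  rw [hform]
  have h10 : D * L ≤ D * 4 * ∑ n, V n ^ 2 := by
    have := S.sum_elemMass_le hp V
    change L ≤ _ at this
    have hD0 : 0 ≤ D := by positivity
    nlinarith
  refine le_trans ?_ h10
  have h11 : (max M 1 * C₁ + C₃) * E ≤ (max M 1 * C₁ + C₃) * (4 * (p + 1) ^ 2 * L) := by gcongr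
  have h12 : (1 + β) * (h⁻¹ * I) ≤ (1 + β) * (W * C₄ * (2 * Fintype.card ε) * L) := by gcongr
  rw [hD]
  linarith

end MultipatchSurface

end

/-! ### Poincaré inequality for functions that jump over interfaces. -/

section

open Set MeasureTheory

lemma setIntegral_le_of_lintegral_ofReal_le {α : Type*} [MeasurableSpace α] {μ : Measure α} {s : Set α}
    {f : α → ℝ} (hf : IntegrableOn f s μ) (h0 : ∀ x, 0 ≤ f x) {R : ℝ} (hR : 0 ≤ R)
    (h : ∫⁻ x in s, ENNReal.ofReal (f x) ∂μ ≤ ENNReal.ofReal R) : ∫ x in s, f x ∂μ ≤ R := by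
  rwa [← ofReal_integral_eq_lintegral_ofReal hf (Filter.Eventually.of_forall h0),
    ENNReal.ofReal_le_ofReal_iff hR] at h

lemma exists_le_ofReal_of_finite {α : Type*} [Finite α] {C : α → ENNReal} (hC : ∀ a, C a ≠ ⊤) :
    ∃ M > 0, ∀ a, C a ≤ ENNReal.ofReal M := by
  obtain ⟨M, hM⟩ := (Set.finite_range fun a => (C a).toReal).bddAbove
  refine ⟨max M 1, by positivity, fun a => ?_⟩
  rw [← ENNReal.ofReal_toReal (hC a)]
  exact ENNReal.ofReal_le_ofReal ((hM (mem_range_self a)).trans (le_max_left _ _))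

/-- Integrates `a - b = (a - A) + (A - B) + (B - b)` over the middle of the parameter interval, to
compare the constants of two patches through the traces on their interface. -/
lemma sq_sub_mul_le_integral {A B : ℝ → ℝ} (hA : BddMeas volume (Icc 0 1) A)
    (hB : BddMeas volume (Icc 0 1) B) {τ : ℝ} (hτ : 0 < τ) (hτ2 : τ < 1 / 2) (a b : ℝ) :
    (a - b) ^ 2 * (2 * τ) ≤ 3 * ((∫ t in (1 / 2 - τ)..(1 / 2 + τ), (A t - a) ^ 2) +
      (∫ t in (1 / 2 - τ)..(1 / 2 + τ), (B t - b) ^ 2) + ∫ t in (0 : ℝ)..1, (A t - B t) ^ 2) := by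
  have hsub : Icc (1 / 2 - τ) (1 / 2 + τ) ⊆ Icc 0 1 := Icc_subset_Icc (by linarith) (by linarith)
  have hint : ∀ f : ℝ → ℝ, BddMeas volume (Icc 0 1) f →
      IntervalIntegrable f volume (1 / 2 - τ) (1 / 2 + τ) := fun f hf => by
    rw [intervalIntegrable_iff, uIoc_of_le (by linarith)]
    exact (hf.integrableOn measurableSet_Icc (by simp)).mono_set (Ioc_subset_Icc_self.trans hsub)
  have hsq : ∀ f : ℝ → ℝ, BddMeas volume (Icc 0 1) f → BddMeas volume (Icc 0 1) fun t => f t ^ 2 :=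
    fun f hf => by simp only [pow_two]; exact hf.mul hf
  have bA := hsq _ (hA.sub (.const a))
  have bB := hsq _ (hB.sub (.const b))
  have bJ := hsq _ (hA.sub hB)
  have h3 : ∫ t in (1 / 2 - τ)..(1 / 2 + τ), (A t - B t) ^ 2 ≤ ∫ t in (0 : ℝ)..1, (A t - B t) ^ 2 :=
    intervalIntegral.integral_mono_interval (by linarith) (by linarith) (by linarith)
      (Filter.Eventually.of_forall fun t => sq_nonneg _) bJ.intervalIntegrable
  have h4 : ∫ _t in (1 / 2 - τ)..(1 / 2 + τ), (a - b) ^ 2 ≤ ∫ t in (1 / 2 - τ)..(1 / 2 + τ),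
      3 * ((A t - a) ^ 2 + (B t - b) ^ 2 + (A t - B t) ^ 2) := by
    refine intervalIntegral.integral_mono_on (by linarith) (hint _ (.const _))
      (hint _ ((BddMeas.const 3).mul ((bA.add bB).add bJ))) fun t _ => ?_
    nlinarith [sq_nonneg ((A t - a) + (B t - b)), sq_nonneg ((A t - a) + (A t - B t)),
      sq_nonneg ((B t - b) - (A t - B t))]
  rw [intervalIntegral.integral_const, intervalIntegral.integral_const_mul,
    intervalIntegral.integral_add ((hint _ bA).add (hint _ bB)) (hint _ bJ),
    intervalIntegral.integral_add (hint _ bA) (hint _ bB), smul_eq_mul] at h4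
  nlinarith

namespace MultipatchSurface

variable {ι ε : Type*} {d : ℕ} (S : MultipatchSurface ι ε d)
variable {h : ℝ} {o : ι → Fin 2 → ℝ} {p : ℕ}

/-- One constant per patch approximates the function both in the patch and on the middle of all of
its sides. Away from the corners each side borders a strip in the patch, and a single interface
portion is enough to compare constants. The minimum over the sides makes `τ` common to all of them.
-/
lemma exists_patch_means [Fintype ι] [Finite ε] (hp : 1 ≤ p) (hcone : ∀ i, UniformCone (S.dom i)) :
    ∃ C > 0, ∃ τ > 0, τ < 1 / 2 ∧ ∀ (h : ℝ) (o : ι → Fin 2 → ℝ) (V : S.Dof p h o → ℝ), 0 < h →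
      ∃ m : ι → ℝ, (∀ i, ∫ x in S.dom i, (val h o (S.interp p V) i x - m i) ^ 2 ≤
        C * S.patchEnergy V i) ∧
      ∀ s, ∫ t in (1 / 2 - τ)..(1 / 2 + τ), (S.trace h o (S.interp p V) s t - m (S.patch s)) ^ 2 ≤
        C * S.patchEnergy V (S.patch s) := by
  obtain ⟨C₀, hC₀, H₀⟩ := S.exists_sqGrad_val hp
  choose P hP HP using fun i =>
    exists_poincare (S.dom_open i) (S.dom_connected i) (S.isBounded_dom i) (hcone i)
  choose τ hτ hτ2 T hT HT using S.exists_trace_bound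
  obtain ⟨M, hM, hPM⟩ := exists_le_ofReal_of_finite hP
  obtain ⟨N, hN, hTN⟩ := exists_le_ofReal_of_finite hT
  have := Fintype.ofFinite ε
  obtain ⟨τ₀, hτ₀, hle⟩ := Finset.exists_pos_le Finset.univ τ fun s _ => hτ s
  have hτ₁ : 0 < min τ₀ (1 / 4) := by positivity
  refine ⟨M * C₀ + N * (M * C₀ + C₀), by positivity, min τ₀ (1 / 4), hτ₁,
    (min_le_right _ _).trans_lt (by norm_num), fun h o V hh => ?_⟩
  set v := S.interp p V with hv
  have hgm : ∀ i, Measurable fun x => ENNReal.ofReal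
      (C₀ * energyDensity p h (o i) (S.coef V i) (S.activeElements h o i) x) := fun i =>
    ((measurable_energyDensity _).const_mul _).ennreal_ofReal
  have hvm : ∀ i, Measurable (val h o v i) := fun i => (S.continuous_val_interp hp V i).measurable
  have hg : ∀ i, ∫⁻ x, ENNReal.ofReal
      (C₀ * energyDensity p h (o i) (S.coef V i) (S.activeElements h o i) x) =
      ENNReal.ofReal (C₀ * S.patchEnergy V i) := fun i => lintegral_energyDensity hh hC₀.le _
  choose m hm using fun i => HP i _ _ (H₀ h o V i hh) (hvm i) (hgm i)
  have hE := fun i => S.patchEnergy_nonneg V i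
  have hm' : ∀ i, ∫⁻ x in S.dom i, ENNReal.ofReal ((val h o v i x - m i) ^ 2) ≤
      ENNReal.ofReal (M * C₀ * S.patchEnergy V i) := fun i => by
    refine (hm i).trans ?_
    rw [hg, mul_assoc, ENNReal.ofReal_mul hM.le]
    exact mul_le_mul_left (hPM i) _
  refine ⟨m, fun i => ?_, fun s => ?_⟩
  · have hb := (S.bddMeas_val (o := o) hh v i).sub (.const (m i))
    have hi := S.integrableOn_dom i (hb.mul hb)
    simp only [← pow_two] at hi
    refine (setIntegral_le_of_lintegral_ofReal_le hi (fun x => sq_nonneg _)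
      (mul_nonneg (by positivity) (hE i)) (hm' i)).trans ?_
    exact mul_le_mul_of_nonneg_right (by nlinarith [mul_pos hN (add_pos (mul_pos hM hC₀) hC₀)]) (hE i)
  · have hb := (S.bddMeas_trace (o := o) hh v s).sub (.const (m (S.patch s)))
    have hi := (hb.mul hb).integrableOn measurableSet_Icc (by simp)
    simp only [← pow_two] at hi
    set τ₁ := min τ₀ (1 / 4) with hτ₁'
    have h1 : τ₁ ≤ τ s := (min_le_left _ _).trans (hle s (Finset.mem_univ s))
    have h2 : τ₁ ≤ 1 / 4 := min_le_right _ _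
    rw [intervalIntegral.integral_of_le (by linarith), ← integral_Icc_eq_integral_Ioc]
    refine setIntegral_le_of_lintegral_ofReal_le (hi.mono_set (Icc_subset_Icc (by linarith) (by linarith)))
      (fun x => sq_nonneg _) (mul_nonneg (by positivity) (hE _)) ?_
    have h3 := HT s _ _ (H₀ h o V (S.patch s) hh) (hvm _) (hgm _) (m (S.patch s))
    calc _ ≤ ∫⁻ t in Icc (1 / 2 - τ s) (1 / 2 + τ s),
          ENNReal.ofReal ((S.trace h o v s t - m (S.patch s)) ^ 2) :=
          lintegral_mono_set (Icc_subset_Icc (by linarith) (by linarith))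
      _ = ∫⁻ t in Icc (1 / 2 - τ s) (1 / 2 + τ s),
          ENNReal.ofReal ((val h o v (S.patch s) (S.curve s t) - m (S.patch s)) ^ 2) := by
          simp only [hv, S.trace_interp hp hh V s]
      _ ≤ _ := h3
      _ ≤ ENNReal.ofReal N * (ENNReal.ofReal (M * C₀ * S.patchEnergy V (S.patch s)) +
          ENNReal.ofReal (C₀ * S.patchEnergy V (S.patch s))) := by
          rw [hg]
          exact mul_le_mul' (hTN s) (add_le_add_left (hm' _) _)
      _ = ENNReal.ofReal (N * (M * C₀ + C₀) * S.patchEnergy V (S.patch s)) := by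
          rw [← ENNReal.ofReal_add (mul_nonneg (by positivity) (hE _)) (mul_nonneg hC₀.le (hE _)),
            ← ENNReal.ofReal_mul hN.le]
          congr 1; ring
      _ ≤ _ := ENNReal.ofReal_le_ofReal (mul_le_mul_of_nonneg_right (by nlinarith [mul_pos hM hC₀]) (hE _))

/-- Differences add up along a chain of patches joined by interfaces. There are finitely many pairs
of patches, so one constant suffices. -/
lemma exists_connected_le [Finite ι] : ∃ C > 0, ∀ (m : ι → ℝ) (X : ℝ), 0 ≤ X →
    (∀ e, (m (S.patch (e, false)) - m (S.patch (e, true))) ^ 2 ≤ X) →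
    ∀ i j, (m i - m j) ^ 2 ≤ C * X := by
  have h1 : ∀ z : ι × ι, ∃ C : ℝ, ∀ (m : ι → ℝ) (X : ℝ), 0 ≤ X →
      (∀ e, (m (S.patch (e, false)) - m (S.patch (e, true))) ^ 2 ≤ X) →
      (m z.1 - m z.2) ^ 2 ≤ C * X := by
    rintro ⟨i, j⟩
    induction S.connected i j with
    | refl => exact ⟨0, fun m X _ _ => by simp⟩
    | @tail a b _ hab ih =>
      obtain ⟨C, hC⟩ := ih
      obtain ⟨e, r, rfl, rfl⟩ := hab
      refine ⟨2 * C + 2, fun m X hX H => ?_⟩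
      have h2 := hC m X hX H
      have h3 : (m (S.patch (e, r)) - m (S.patch (e, !r))) ^ 2 ≤ X := by
        cases r
        · exact H e
        · rw [← neg_sq, neg_sub]; exact H e
      simp only at h2 ⊢
      nlinarith [sq_nonneg ((m i - m (S.patch (e, r))) - (m (S.patch (e, r)) - m (S.patch (e, !r))))]
  choose C hC using h1
  obtain ⟨M, hM⟩ := (Set.finite_range C).bddAbove
  refine ⟨max M 1, by positivity, fun m X hX H i j => (hC (i, j) m X hX H).trans ?_⟩
  exact mul_le_mul_of_nonneg_right ((hM (mem_range_self _)).trans (le_max_left _ _)) hX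

/-- The interval is symmetric about `1 / 2`, and so is invariant under the reversal of the
parameter. -/
lemma integral_symm_comp_opposite (e : ε) (τ : ℝ) (f : ℝ → ℝ) :
    ∫ t in (1 / 2 - τ)..(1 / 2 + τ), f (S.opposite e t) = ∫ t in (1 / 2 - τ)..(1 / 2 + τ), f t := by
  unfold opposite
  cases S.reversed e
  · simp
  · simp only [if_true]
    rw [intervalIntegral.integral_comp_sub_left]
    congr 1 <;> ring

/-- Poincaré inequality for broken functions, with a mean independent of the patch. -/
lemma exists_broken_poincare [Fintype ι] [Fintype ε] (hp : 1 ≤ p) (hcone : ∀ i, UniformCone (S.dom i)) :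
    ∃ C > 0, ∀ (h : ℝ) (o : ι → Fin 2 → ℝ) (V : S.Dof p h o → ℝ), 0 < h →
      ∃ m : ℝ, ∀ i, ∫ x in S.dom i, (val h o (S.interp p V) i x - m) ^ 2 ≤
        C * (∑ i, S.patchEnergy V i + ∑ e, S.jumpSq h o (S.interp p V) e) := by
  obtain ⟨C₁, hC₁, τ, hτ, hτ2, H₁⟩ := S.exists_patch_means hp hcone
  obtain ⟨C₂, hC₂, H₂⟩ := S.exists_connected_le
  refine ⟨2 * C₁ + 2 * (C₂ * (3 * (2 * C₁ + 1) / (2 * τ))), by positivity, fun h o V hh => ?_⟩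
  rcases isEmpty_or_nonempty ι with hι | ⟨⟨i₀⟩⟩
  · exact ⟨0, fun i => (hι.false i).elim⟩
  obtain ⟨m, hm, hm'⟩ := H₁ h o V hh
  set v := S.interp p V with hv
  set E := ∑ i, S.patchEnergy V i with hE
  set J := ∑ e, S.jumpSq h o v e with hJ
  have hEi : ∀ i, S.patchEnergy V i ≤ E := fun i =>
    Finset.single_le_sum (fun i _ => S.patchEnergy_nonneg V i) (Finset.mem_univ i)
  have hJe : ∀ e, S.jumpSq h o v e ≤ J := fun e =>
    Finset.single_le_sum (fun e _ => S.jumpSq_nonneg v e) (Finset.mem_univ e)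
  have hE0 : 0 ≤ E := (S.patchEnergy_nonneg V i₀).trans (hEi i₀)
  have hJ0 : 0 ≤ J := Finset.sum_nonneg fun e _ => S.jumpSq_nonneg v e
  have hX : ∀ e, (m (S.patch (e, false)) - m (S.patch (e, true))) ^ 2 ≤
      3 * (2 * C₁ + 1) / (2 * τ) * (E + J) := by
    intro e
    have bA := S.bddMeas_trace (o := o) hh v (e, false)
    have bB := (S.bddMeas_trace (o := o) hh v (e, true)).comp_opposite S e
    have h1 := hm' (e, false)
    have h2 := hm' (e, true)
    -- Both traces are now functions of the parameter of the first side, as in the jump.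
    rw [← S.integral_symm_comp_opposite e τ fun t => (S.trace h o v (e, true) t - _) ^ 2] at h2
    have h4 : _ ≤ 3 * (_ + _ + S.jumpSq h o v e) :=
      sq_sub_mul_le_integral bA bB hτ hτ2 (m (S.patch (e, false))) (m (S.patch (e, true)))
    have h5 := hEi (S.patch (e, false))
    have h6 := hEi (S.patch (e, true))
    have h7 := hJe e
    rw [div_mul_eq_mul_div, le_div_iff₀ (by positivity)]
    have h8 : C₁ * S.patchEnergy V (S.patch (e, false)) ≤ C₁ * E := by gcongr
    have h9 : C₁ * S.patchEnergy V (S.patch (e, true)) ≤ C₁ * E := by gcongr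
    have h10 : 0 ≤ C₁ * J := by positivity
    nlinarith
  have hconn := H₂ m _ (by positivity) hX
  refine ⟨m i₀, fun i => ?_⟩
  have bi := (S.bddMeas_val (o := o) hh v i).sub (.const (m i))
  have b0 := (S.bddMeas_val (o := o) hh v i).sub (.const (m i₀))
  have h1 : ∫ x in S.dom i, (val h o v i x - m i₀) ^ 2 ≤
      ∫ x in S.dom i, (2 * (val h o v i x - m i) ^ 2 + 2 * (m i - m i₀) ^ 2) := by
    simp only [pow_two]
    refine integral_mono (S.integrableOn_dom i (b0.mul b0)) (S.integrableOn_dom i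
      (((BddMeas.const 2).mul (bi.mul bi)).add (.const _))) fun x => ?_
    dsimp only
    nlinarith [sq_nonneg ((val h o v i x - m i) - (m i - m i₀))]
  have hvol : volume.real (S.dom i) ≤ 1 := by
    have : volume (S.dom i) ≤ 1 := by
      refine (measure_mono (S.dom_subset i)).trans ?_
      rw [Real.volume_Icc_pi]; simp
    exact ENNReal.toReal_le_of_le_ofReal zero_le_one (by simpa using this)
  have bii := bi.mul bi
  simp only [← pow_two] at bii
  rw [integral_add (S.integrableOn_dom i ((BddMeas.const 2).mul bii)) (S.integrableOn_dom i (.const _)),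
    integral_const_mul, setIntegral_const, smul_eq_mul] at h1
  have h2 := hm i
  have h3 := hconn i i₀
  have h4 : C₁ * S.patchEnergy V i ≤ C₁ * (E + J) := by gcongr; linarith [hEi i]
  have h5 : volume.real (S.dom i) * (2 * (m i - m i₀) ^ 2) ≤ 1 * (2 * (m i - m i₀) ^ 2) :=
    mul_le_mul_of_nonneg_right hvol (by positivity)
  nlinarith

end MultipatchSurface

end

/-! ### Bounds for the coefficients of functions of mean zero, and the condition number. -/

section

open Set MeasureTheory

namespace MultipatchSurface

variable {ι ε : Type*} {d : ℕ} (S : MultipatchSurface ι ε d)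
variable {h : ℝ} {o : ι → Fin 2 → ℝ} {p : ℕ}

lemma exists_patchIntegral_bounds [Finite ι] : ∃ c > 0, ∃ C > 0, ∀ (i : ι) (f : (Fin 2 → ℝ) → ℝ),
    BddMeas volume (S.dom i) f → (∀ x, 0 ≤ f x) →
    c * (∫ x in S.dom i, f x) ≤ S.patchIntegral i f ∧
    S.patchIntegral i f ≤ C * ∫ x in S.dom i, f x := by
  have := Fintype.ofFinite ι
  choose c hc C hC H using S.exists_metric_bounds
  obtain ⟨c₀, hc₀, hle⟩ := Finset.exists_pos_le Finset.univ c fun i _ => hc i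
  obtain ⟨M, hM⟩ := (Set.finite_range C).bddAbove
  refine ⟨c₀, hc₀, max M 1, by positivity, fun i f hf h0 => ?_⟩
  have hfi := S.integrableOn_dom i hf
  have hG := S.integrableOn_patch i hf
  have hms := (S.dom_open i).measurableSet
  constructor
  · rw [← integral_const_mul]
    refine setIntegral_mono_on (hfi.const_mul _) hG hms fun x hx => ?_
    rw [mul_comm]
    exact mul_le_mul_of_nonneg_left ((hle i (Finset.mem_univ i)).trans
      (H i x (subset_closure hx)).1.1) (h0 x)
  · rw [← integral_const_mul]
    refine setIntegral_mono_on hG (hfi.const_mul _) hms fun x hx => ?_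
    rw [mul_comm _ (f x)]
    exact mul_le_mul_of_nonneg_left ((H i x (subset_closure hx)).1.2.trans
      ((hM (mem_range_self i)).trans (le_max_left _ _))) (h0 x)

/-- Functions of mean zero minimize the distance to constants. -/
lemma sum_patchIntegral_sq_le [Fintype ι] (hh : 0 < h) {v : BrokenPoly ι} (hv : S.integral h o v = 0)
    (m : ℝ) : ∑ i, S.patchIntegral i (fun x => val h o v i x ^ 2) ≤
      ∑ i, S.patchIntegral i fun x => (val h o v i x - m) ^ 2 := by
  have hb := fun i => S.bddMeas_val (o := o) hh v i
  have h1 : ∀ i, S.patchIntegral i (fun x => (val h o v i x - m) ^ 2) =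
      S.patchIntegral i (fun x => val h o v i x ^ 2) + -2 * m * S.patchIntegral i (val h o v i) +
        S.patchIntegral i fun _ => m ^ 2 := fun i => by
    have hsq := (hb i).mul (hb i)
    simp only [← pow_two] at hsq
    rw [← S.patchIntegral_const_mul, ← S.patchIntegral_add i hsq ((BddMeas.const _).mul (hb i)),
      ← S.patchIntegral_add i (hsq.add ((BddMeas.const _).mul (hb i))) (.const _)]
    congr 1; ext x; ring
  simp only [h1, Finset.sum_add_distrib, ← Finset.mul_sum]
  rw [integral] at hv
  -- The mixed term of the expanded square is a multiple of the integral over the whole surface; it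
  -- vanishes in the sum over the patches only, because `m` is the same on all of them.
  rw [hv]
  have h2 : 0 ≤ ∑ i, S.patchIntegral i fun _ => m ^ 2 := Finset.sum_nonneg fun i _ =>
    integral_nonneg fun x => mul_nonneg (sq_nonneg _) (Real.sqrt_nonneg _)
  linarith

/-- Discrete Poincaré inequality for the coefficients of functions of mean zero. -/
lemma exists_sum_sq_le [Fintype ι] [Fintype ε] (hp : 1 ≤ p) (hcone : ∀ i, UniformCone (S.dom i)) :
    ∃ C > 0, ∃ h₀ > 0, ∀ (h : ℝ) (o : ι → Fin 2 → ℝ) (V : S.Dof p h o → ℝ), 0 < h → h ≤ h₀ →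
      S.integral h o (S.interp p V) = 0 →
      h ^ 2 * ∑ n, V n ^ 2 ≤
        C * (∑ i, S.patchEnergy V i + ∑ e, S.jumpSq h o (S.interp p V) e) := by
  obtain ⟨P, hP, HP⟩ := S.exists_broken_poincare hp hcone
  obtain ⟨c, hc, D, hD, HD⟩ := S.exists_patchIntegral_bounds
  obtain ⟨κ, hκ, Hκ⟩ := S.exists_uncut_le_integral hp
  choose B hB b hb HB using fun i => S.exists_patchEnergy_le hp (hcone i)
  obtain ⟨M, hM⟩ := (Set.finite_range B).bddAbove
  obtain ⟨h₁, hh₁, hle⟩ := Finset.exists_pos_le Finset.univ b fun i _ => hb i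
  set N := (Fintype.card ι : ℝ) with hN
  have hN0 : 0 ≤ N := Nat.cast_nonneg _
  set Q := (c * κ)⁻¹ * (N * (D * P)) with hQ
  have hQ0 : 0 ≤ Q := by positivity
  refine ⟨max M 1 * (Q * N + 1), by positivity, min h₁ 1, by positivity, fun h o V hh hhh hv => ?_⟩
  have hh1 : h ^ 2 ≤ 1 := pow_le_one₀ hh.le (hhh.trans (min_le_right _ _))
  set v := S.interp p V with hvdef
  set E := ∑ i, S.patchEnergy V i with hE
  set J := ∑ e, S.jumpSq h o v e with hJ
  have hE0 : 0 ≤ E := Finset.sum_nonneg fun i _ => S.patchEnergy_nonneg V i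
  have hJ0 : 0 ≤ J := Finset.sum_nonneg fun e _ => S.jumpSq_nonneg v e
  obtain ⟨m, hm⟩ := HP h o V hh
  have hsq : ∀ i r, BddMeas volume (S.dom i) fun x => (val h o v i x - r) ^ 2 := fun i r => by
    have := (S.bddMeas_val (o := o) hh v i).sub (.const r)
    simp only [pow_two]; exact this.mul this
  have h1 : ∑ i, S.patchIntegral i (fun x => (val h o v i x - m) ^ 2) ≤ N * (D * (P * (E + J))) := by
    rw [hN, ← Finset.card_univ, ← nsmul_eq_mul]
    refine Finset.sum_le_card_nsmul _ _ _ fun i _ => ?_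
    exact (HD i _ (hsq i m) fun x => sq_nonneg _).2.trans (mul_le_mul_of_nonneg_left (hm i) hD.le)
  have h2 := (S.sum_patchIntegral_sq_le hh hv m).trans h1
  have h3 : ∀ i, ∫ x in S.dom i, val h o v i x ^ 2 ≤ c⁻¹ * (N * (D * (P * (E + J)))) := fun i => by
    rw [inv_mul_eq_div, le_div_iff₀ hc, mul_comm]
    have hsq0 := hsq i 0
    simp only [sub_zero] at hsq0
    refine (HD i _ hsq0 fun x => sq_nonneg _).1.trans (le_trans ?_ h2)
    exact Finset.single_le_sum (f := fun i => S.patchIntegral i fun x => val h o v i x ^ 2)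
      (fun i _ => integral_nonneg fun x => mul_nonneg (sq_nonneg _) (Real.sqrt_nonneg _))
      (Finset.mem_univ i)
  -- On uncut elements `h ^ 2` times the mass is bounded by the `L²` norm. The energy needed to
  -- reach the cut elements also comes with `h ^ 2`, which is estimated by `1`.
  have h4 : ∀ i, h ^ 2 * S.patchMass V i ≤ max M 1 * (Q * (E + J) + S.patchEnergy V i) := fun i => by
    have h5 := (HB i h o V hh ((hhh.trans (min_le_left _ _)).trans (hle i (Finset.mem_univ i)))).2
    have h6 := (Hκ h o V i hh).1
    have h7 : h ^ 2 * ∑ K ∈ S.uncutElements h o i, S.elemMass V i K ≤ Q * (E + J) := by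
      have := h6.trans (h3 i)
      rw [mul_assoc] at this
      calc _ = κ⁻¹ * (κ * (h ^ 2 * ∑ K ∈ S.uncutElements h o i, S.elemMass V i K)) := by field_simp
        _ ≤ κ⁻¹ * (c⁻¹ * (N * (D * (P * (E + J))))) := by gcongr
        _ = _ := by rw [hQ, mul_inv]; ring
    have hEi := S.patchEnergy_nonneg V i
    have hBM : B i ≤ max M 1 := (hM (mem_range_self i)).trans (le_max_left _ _)
    have hB0 := hB i
    calc _ ≤ h ^ 2 * (B i * (∑ K ∈ S.uncutElements h o i, S.elemMass V i K + S.patchEnergy V i)) := by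
          gcongr
      _ = B i * (h ^ 2 * ∑ K ∈ S.uncutElements h o i, S.elemMass V i K + h ^ 2 * S.patchEnergy V i) := by
          ring
      _ ≤ B i * (Q * (E + J) + 1 * S.patchEnergy V i) := by gcongr
      _ ≤ max M 1 * (Q * (E + J) + 1 * S.patchEnergy V i) := by
          refine mul_le_mul_of_nonneg_right hBM ?_
          have := mul_nonneg hQ0 (add_nonneg hE0 hJ0)
          linarith
      _ = _ := by ring
  calc h ^ 2 * ∑ n, V n ^ 2 ≤ h ^ 2 * ∑ i, S.patchMass V i :=
        mul_le_mul_of_nonneg_left (S.sum_sq_le_sum_elemMass V) (by positivity)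
    _ ≤ ∑ i, max M 1 * (Q * (E + J) + S.patchEnergy V i) := by
        rw [Finset.mul_sum]; exact Finset.sum_le_sum fun i _ => h4 i
    _ = max M 1 * (N * (Q * (E + J)) + E) := by
        rw [← Finset.mul_sum, Finset.sum_add_distrib, Finset.sum_const, Finset.card_univ, nsmul_eq_mul]
    _ ≤ max M 1 * ((Q * N + 1) * (E + J)) := by
        refine mul_le_mul_of_nonneg_left ?_ (by positivity)
        linarith
    _ = _ := by ring

end MultipatchSurface

/-! ### Condition numbers of symmetric matrices -/

section Operator

variable {n : Type*} [Fintype n] [DecidableEq n]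

/-- A symmetric matrix with quadratic form between `0` and `C |x|²` has norm at most `C`. -/
lemma Matrix.norm_toEuclideanCLM_apply_le {A : Matrix n n ℝ} (hA : ∀ x y, x ⬝ᵥ A.mulVec y = y ⬝ᵥ A.mulVec x)
    {C : ℝ} (h0 : ∀ x, 0 ≤ x ⬝ᵥ A.mulVec x) (hC : ∀ x, x ⬝ᵥ A.mulVec x ≤ C * x ⬝ᵥ x)
    (hC0 : 0 ≤ C) (x : EuclideanSpace ℝ n) :
    ‖Matrix.toEuclideanCLM (𝕜 := ℝ) A x‖ ≤ C * ‖x‖ := by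
  have hn : ∀ z : n → ℝ, z ⬝ᵥ z = ‖WithLp.toLp 2 z‖ ^ 2 := fun z => by
    rw [EuclideanSpace.real_norm_sq_eq]; simp [dotProduct, pow_two]
  set x' : n → ℝ := x.ofLp with hx'
  set y := A.mulVec x' with hy
  have hAx : Matrix.toEuclideanCLM (𝕜 := ℝ) A x = WithLp.toLp 2 y := by
    rw [hy, hx']; exact Matrix.toEuclideanCLM_toLp A x.ofLp
  have hnx : x' ⬝ᵥ x' = ‖x‖ ^ 2 := hn x'
  rw [hAx]
  set Y := ‖WithLp.toLp 2 y‖ with hY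
  set X := ‖x‖ with hX
  have hny : y ⬝ᵥ y = Y ^ 2 := hn y
  have hY0 : 0 ≤ Y := norm_nonneg _
  have hX0 : 0 ≤ X := norm_nonneg _
  rcases hY0.eq_or_lt with h | hYpos
  · rw [← h]; positivity
  -- By polarization `4 * r * Y ^ 2` is the difference of the quadratic form at `x' + r • y` and at
  -- `x' - r • y`. The form is nonnegative and bounded, so the parallelogram law gives the right
  -- side; the best choice is `r = X / Y`.
  have key : ∀ r : ℝ, 4 * r * Y ^ 2 ≤ 2 * C * (X ^ 2 + r ^ 2 * Y ^ 2) := fun r => by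
    have e1 := hC (x' + r • y)
    have e2 := h0 (x' - r • y)
    have e3 := hC (x' - r • y)
    have hs : y ⬝ᵥ A.mulVec x' = Y ^ 2 := hny
    have hs' : x' ⬝ᵥ A.mulVec y = Y ^ 2 := (hA _ _).trans hs
    simp only [Matrix.mulVec_add, Matrix.mulVec_sub, Matrix.mulVec_smul, add_dotProduct, sub_dotProduct,
      dotProduct_add, dotProduct_sub, smul_dotProduct, dotProduct_smul, smul_eq_mul, hs, hs', hnx, hny]
      at e1 e2 e3
    have hc := dotProduct_comm x' y
    nlinarith
  rcases hX0.eq_or_lt with hX00 | hXpos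
  · have hx0 : x = 0 := norm_eq_zero.1 hX00.symm
    have hy0 : y = 0 := by rw [hy, hx', hx0]; simp
    rw [hY, hy0]; simpa using mul_nonneg hC0 hX0
  · have h1 := key (X / Y)
    have e1 : 4 * (X / Y) * Y ^ 2 = 4 * X * Y := by field_simp
    have e2 : 2 * C * (X ^ 2 + (X / Y) ^ 2 * Y ^ 2) = 4 * X * (C * X) := by field_simp; ring
    rw [e1, e2] at h1
    exact le_of_mul_le_mul_left h1 (by positivity)

/-- The Cauchy–Schwarz inequality for `x` and its image. The form bound is needed at `x` only, and
the image may be any vector; it need not have mean zero. -/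
lemma Matrix.le_norm_toEuclideanCLM_apply {A : Matrix n n ℝ} {c : ℝ} (x : EuclideanSpace ℝ n)
    (hc : c * x.ofLp ⬝ᵥ x.ofLp ≤ x.ofLp ⬝ᵥ A.mulVec x.ofLp) :
    c * ‖x‖ ≤ ‖Matrix.toEuclideanCLM (𝕜 := ℝ) A x‖ := by
  have h1 : x.ofLp ⬝ᵥ x.ofLp = ‖x‖ ^ 2 := by
    rw [EuclideanSpace.real_norm_sq_eq]; simp [dotProduct, pow_two]
  have h2 : x.ofLp ⬝ᵥ A.mulVec x.ofLp = inner ℝ x (Matrix.toEuclideanCLM (𝕜 := ℝ) A x) := by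
    rw [EuclideanSpace.inner_eq_star_dotProduct, dotProduct_comm]; simp
  have h3 := real_inner_le_norm x (Matrix.toEuclideanCLM (𝕜 := ℝ) A x)
  rw [h1, h2] at hc
  rcases (norm_nonneg x).eq_or_lt with h | h
  · rw [← h]; simp
  · exact le_of_mul_le_mul_left (by nlinarith) h

end Operator

/-- By convention `inverse` is zero for a map that is not invertible. The bound on the norms says
something only together with the invertibility. -/
lemma ContinuousLinearMap.isInvertible_and_norm_mul_norm_inverse_le {E F : Type*}
    [NormedAddCommGroup E] [NormedSpace ℝ E] [FiniteDimensional ℝ E] [NormedAddCommGroup F]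
    [NormedSpace ℝ F] {T : E →L[ℝ] F} (hT : Function.Surjective T) {c C : ℝ} (hc : 0 < c) (hC0 : 0 ≤ C)
    (hC : ∀ x, ‖T x‖ ≤ C * ‖x‖) (hcT : ∀ x, c * ‖x‖ ≤ ‖T x‖) :
    T.IsInvertible ∧ ‖T‖ * ‖T.inverse‖ ≤ C * c⁻¹ := by
  have hinj : Function.Injective T := by
    refine (injective_iff_map_eq_zero T).2 fun x hx => ?_
    have := hcT x
    rw [hx, norm_zero] at this
    exact norm_eq_zero.1 (le_antisymm (by nlinarith [norm_nonneg x]) (norm_nonneg x))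
  set e := (LinearEquiv.ofBijective (T : E →ₗ[ℝ] F) ⟨hinj, hT⟩).toContinuousLinearEquiv with he
  have heT : (e : E →L[ℝ] F) = T := by ext x; rfl
  refine ⟨⟨e, heT⟩, ?_⟩
  refine mul_le_mul (T.opNorm_le_bound hC0 hC) ?_ (norm_nonneg _) hC0
  rw [← heT, ContinuousLinearMap.inverse_equiv]
  refine ContinuousLinearMap.opNorm_le_bound _ (by positivity) fun y => ?_
  have h1 := hcT (e.symm y)
  have h2 : T (e.symm y) = y := by
    rw [← heT]; exact e.apply_symm_apply y
  rw [h2] at h1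
  rw [inv_mul_eq_div, le_div_iff₀ hc, mul_comm]
  exact h1

namespace MultipatchSurface

variable {ι ε : Type*} {d : ℕ} (S : MultipatchSurface ι ε d)

lemma integral_interp_eq_zero [Fintype ι] {p : ℕ} {h : ℝ} {o : ι → Fin 2 → ℝ} (hh : 0 < h)
    {x : EuclideanSpace ℝ (S.Dof p h o)} (hx : x ∈ S.meanZero p h o) :
    S.integral h o (S.interp p x.ofLp) = 0 := by
  rw [S.integral_interp p hh]
  rw [meanZero, Submodule.mem_orthogonal_singleton_iff_inner_right] at hx
  rw [← hx, EuclideanSpace.inner_eq_star_dotProduct]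
  simp [dotProduct]

lemma isInvertible_stiffnessOp [Fintype ι] [Fintype ε] {p : ℕ} {β : ℝ} {γ : ℕ → ℝ} {h : ℝ}
    {o : ι → Fin 2 → ℝ} (hh : 0 < h) {c C : ℝ} (hc : 0 < c) (hC : 0 ≤ C)
    (h0 : ∀ V : S.Dof p h o → ℝ, 0 ≤ S.discreteForm p β γ h o (S.interp p V) (S.interp p V))
    (hle : ∀ V : S.Dof p h o → ℝ, S.discreteForm p β γ h o (S.interp p V) (S.interp p V) ≤ C * ∑ n, V n ^ 2)
    (hge : ∀ V : S.Dof p h o → ℝ, S.integral h o (S.interp p V) = 0 →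
      c * ∑ n, V n ^ 2 ≤ S.discreteForm p β γ h o (S.interp p V) (S.interp p V)) :
    (S.stiffnessOp p β γ h o).IsInvertible ∧ S.condNumber p β γ h o ≤ C * c⁻¹ := by
  classical
  have hq : ∀ V : S.Dof p h o → ℝ, S.discreteForm p β γ h o (S.interp p V) (S.interp p V) =
      V ⬝ᵥ (S.stiffness p β γ h o).mulVec V := fun V => S.discreteForm_interp p β γ hh V V
  have hsq : ∀ V : S.Dof p h o → ℝ, ∑ n, V n ^ 2 = V ⬝ᵥ V := fun V => by simp [dotProduct, pow_two]
  simp only [hq, hsq] at h0 hle hge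
  have hsymm : ∀ V W : S.Dof p h o → ℝ, V ⬝ᵥ (S.stiffness p β γ h o).mulVec W =
      W ⬝ᵥ (S.stiffness p β γ h o).mulVec V := fun V W => by
    rw [← S.discreteForm_interp p β γ hh, ← S.discreteForm_interp p β γ hh, S.discreteForm_comm]
  unfold condNumber stiffnessOp
  refine ContinuousLinearMap.isInvertible_and_norm_mul_norm_inverse_le ?_ hc hC (fun x => ?_) fun x => ?_
  · rintro ⟨_, x, rfl⟩
    exact ⟨x, rfl⟩
  -- The upper bound of the form is used on all vectors, since the image of a mean-zero vector need
  -- not be one.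
  · exact Matrix.norm_toEuclideanCLM_apply_le hsymm h0 hle hC x.1
  · exact Matrix.le_norm_toEuclideanCLM_apply x.1 (hge _ (S.integral_interp_eq_zero hh x.2))

end MultipatchSurface

end

theorem theorem4p3 {ι ε : Type*} [Fintype ι] [Fintype ε] {d : ℕ} (S : MultipatchSurface ι ε d)
    (p : ℕ) (hp : 1 ≤ p) (γ : ℕ → ℝ) (hγ : ∀ k ∈ Finset.Icc 1 p, 0 < γ k)
    (l : ℕ) (c : ℝ) (hc : 0 < c) :
    ∃ β₀ > 0, ∃ h₀ > 0, ∀ β ≥ β₀, ∃ C > 0, ∀ h : ℝ, 0 < h → h ≤ h₀ → ∀ o : ι → Fin 2 → ℝ,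
      S.PatchGeometry l c h o →
        (S.stiffnessOp p β γ h o).IsInvertible ∧ S.condNumber p β γ h o ≤ C * h ^ (-2 : ℤ) := by
  rcases S.uniformCone_or_not_patchGeometry l hc with hcone | ⟨h₀, hh₀, H⟩
  · obtain ⟨β₀, hβ₀, h₁, hh₁, a, ha, Ha⟩ := S.exists_coercive hp hcone γ hγ
    obtain ⟨P, hP, h₂, hh₂, HP⟩ := S.exists_sum_sq_le hp hcone
    -- The bound `h ≤ 1` makes the weight `h⁻¹` of the jumps in the coercivity estimate at least the
    -- weight `1` that the Poincaré inequality requires.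
    refine ⟨β₀, hβ₀, min (min h₁ h₂) 1, by positivity, fun β hβ => ?_⟩
    obtain ⟨C, hC, HC⟩ := S.exists_discreteForm_le hp γ hγ (β := β) (hβ₀.trans_le hβ)
    refine ⟨C * (P / a), by positivity, fun h hh hhh o _ => ?_⟩
    have hle₁ : h ≤ h₁ := hhh.trans ((min_le_left _ _).trans (min_le_left _ _))
    have hle₂ : h ≤ h₂ := hhh.trans ((min_le_left _ _).trans (min_le_right _ _))
    have hle₃ : h ≤ 1 := hhh.trans (min_le_right _ _)
    have hE0 : ∀ V : S.Dof p h o → ℝ, 0 ≤ ∑ i, S.patchEnergy V i := fun V =>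
      Finset.sum_nonneg fun i _ => S.patchEnergy_nonneg V i
    have hJ0 : ∀ V : S.Dof p h o → ℝ, 0 ≤ ∑ e, S.jumpSq h o (S.interp p V) e := fun V =>
      Finset.sum_nonneg fun e _ => S.jumpSq_nonneg _ e
    obtain ⟨h1, h2⟩ := S.isInvertible_stiffnessOp hh (c := a / P * h ^ 2) (by positivity) hC.le
      (fun V => (mul_nonneg ha.le (add_nonneg (hE0 V) (mul_nonneg (by positivity) (hJ0 V)))).trans
        (Ha β hβ h o V hh hle₁))
      (fun V => HC h o V hh) fun V hV => by
        refine le_trans ?_ (Ha β hβ h o V hh hle₁)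
        have h3 := HP h o V hh hle₂ hV
        have h4 := hJ0 V
        have h5 : (1 : ℝ) ≤ h⁻¹ := (one_le_inv₀ hh).2 hle₃
        calc a / P * h ^ 2 * ∑ n, V n ^ 2 = a / P * (h ^ 2 * ∑ n, V n ^ 2) := by ring
          _ ≤ a / P * (P * (∑ i, S.patchEnergy V i + ∑ e, S.jumpSq h o (S.interp p V) e)) := by gcongr
          _ = a * (∑ i, S.patchEnergy V i + 1 * ∑ e, S.jumpSq h o (S.interp p V) e) := by field_simp
          _ ≤ _ := by gcongr
    refine ⟨h1, h2.trans (le_of_eq ?_)⟩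
    rw [zpow_neg, mul_inv, inv_div, ← mul_assoc]
    rfl
  -- Some patch has a cusp: no mesh with `h ≤ h₀` satisfies the patch geometry condition, so any
  -- constants serve.
  · exact ⟨1, one_pos, h₀, hh₀, fun β _ => ⟨1, one_pos, fun h hh hle o hg => (H h hh hle o hg).elim⟩⟩
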